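/- Let $A_i\to\infty$ be real numbers and let $\eta\in C^\infty(\mathbb R)$ satisfy $0\le\eta\le1$, $\eta=0$ on $(-\infty,0]$, $\eta=1$ on $[1,\infty)$. Put $$\rho_i=\tfrac1{10}e^{-A_i^3},\qquad \psi_i(r)=\eta\Big(\frac{\ln(r/\rho_i)}{\ln 2}\Big)\,\eta\Big(\frac{\ln(1/(10r))}{\ln 2}\Big),\qquad \lambda_i=\frac{A_i}{\int_0^{1/10}\psi_i(s)\,\frac{ds}{s}},$$ $$f_i(r)=-A_i+\lambda_i\int_0^r\psi_i(s)\,\frac{ds}{s},\qquad \varphi_i=e^{f_i}.$$ Call $u\in C^\infty([0,2])$ an admissible base function for $i$ if $u$ is concave, $u(0)=u(2)=0$, $\sup u\ge\frac1{10}$, $u'(0)=1$, $u'(2)=-1$, $u>0$ on $(0,2)$, $u'>0$ on $(0,\frac15)$, $u(r)=r$ on $[0,\rho_i)$, $u(r)=2-r$ on $(\frac95,2]$, and $-u''/u\ge|f_i'|^2$ on $(0,2)$. Then there is $N$ such that for every $i\ge N$ an admissible base function exists, and for every choice of admissible base functions $u_i$ $(i\ge N)$ the following hold for the tensors $$g_i=\varphi_i(r)^{-2}\big(dr^2+u_i(r)^2d\theta^2\big)+\varphi_i(r)^2d\xi^2,\qquad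 r\in[0,2],\ \theta,\xi\in[0,2\pi],$$ on $\mathbb S^2\times\mathbb S^1$, where $(r,\theta)$ are polar coordinates on $\mathbb S^2$ with poles $r=0$ and $r=2$, and where $\mathring M=\{0<r<2\}\subset\mathbb S^2\times\mathbb S^1$. 1. Each $g_i$, $i\ge N$, is a smooth Riemannian metric on $\mathbb S^2\times\mathbb S^1$ with nonnegative scalar curvature. 2. There is $V_0<\infty$ with $\mathrm{Vol}_{g_i}(\mathbb S^2\times\mathbb S^1)\le V_0$ for all $i\ge N$. 3. There is $A_0>0$ such that for all $i\ge N$ every (nonempty) closed embedded minimal surface in $(\mathbb S^2\times\mathbb S^1,g_i)$ has area at least $A_0$, i.e. $\mathrm{MinA}(\mathbb S^2\times\mathbb S^1,g_i)\ge A_0$. 4. After passing to a subsequence, $u_i\to u_\infty$ uniformly on $[0,2]$, $\varphi_i\to\varphi_\infty$ locally uniformly on $(0,2)$, and the Riemannian distances $d_{g_i}$ converge, uniformly on $K\times K$ for every compact $K\subset\mathring M$, to a metric $d_*$ on $\mathring M$. 5. For every subsequence and limits $u_\infty,\varphi_\infty,d_*$ as in 4, let $d_{g_\infty}$ be the intrinsic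 length distance on $\mathring M$ (the infimum of lengths of piecewise $C^1$ curves in $\mathring M$) of $g_\infty=\varphi_\infty^{-2}(dr^2+u_\infty^2d\theta^2)+\varphi_\infty^2d\xi^2$. Then for all $0<r_*<\frac1{40}$ and all $\theta_0$, the points $p=(r_*,\theta_0,0)$ and $q=(r_*,\theta_0,\pi)$ of $\mathring M$ (in the coordinates $(r,\theta,\xi)$) satisfy $$d_*(p,q)\le 2r_*<\pi=d_{g_\infty}(p,q).$$ In particular there are $p,q\in\mathring M$ with $d_*(p,q)<d_{g_\infty}(p,q)$. -/

import Mathlib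

open Set Filter Topology MeasureTheory Matrix
open scoped ContDiff

noncomputable section

namespace Drawstring

/-! ### Riemannian geometry of a 3-dimensional space described by local parametrizations -/

/-- A local parametrization of a 3-dimensional space `X` by (an open subset `dom` of) coordinate
space, together with the coefficient matrix of a Riemannian metric in these coordinates.
`map` is a local diffeomorphism in all uses below; it need not be injective (angles). -/
structure Chart (X : Type*) where
  dom : Set (Fin 3 → ℝ)
  map : (Fin 3 → ℝ) → X
  metric : (Fin 3 → ℝ) → Matrix (Fin 3) (Fin 3) ℝ

/-- The partial derivative of `F` at `x` with respect to the `i`-th coordinate. -/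
def pd {n : ℕ} (i : Fin n) (F : (Fin n → ℝ) → ℝ) (x : Fin n → ℝ) : ℝ :=
  deriv (fun t => F (Function.update x i t)) (x i)

/-- Christoffel symbols `Γ^k_{ij}` of the metric with coefficient matrix `G`. -/
def christoffel (G : (Fin 3 → ℝ) → Matrix (Fin 3) (Fin 3) ℝ) (k i j : Fin 3)
    (x : Fin 3 → ℝ) : ℝ :=
  (1 / 2) * ∑ l, (G x)⁻¹ k l *
    (pd i (fun y => G y j l) x + pd j (fun y => G y i l) x - pd l (fun y => G y i j) x)

/-- Ricci curvature `R_{jk}` in coordinates. -/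
def ricci (G : (Fin 3 → ℝ) → Matrix (Fin 3) (Fin 3) ℝ) (j k : Fin 3) (x : Fin 3 → ℝ) : ℝ :=
  ∑ i, (pd i (christoffel G i j k) x - pd j (christoffel G i i k) x
    + ∑ l, (christoffel G i i l x * christoffel G l j k x
      - christoffel G i j l x * christoffel G l i k x))

/-- Scalar curvature `G^{jk} R_{jk}` in coordinates. -/
def scalarCurvature (G : (Fin 3 → ℝ) → Matrix (Fin 3) (Fin 3) ℝ) (x : Fin 3 → ℝ) : ℝ :=
  ∑ j, ∑ k, (G x)⁻¹ j k * ricci G j k x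

/-- The coefficients are those of a smooth Riemannian metric in every chart. -/
def IsSmoothMetric {X : Type*} (𝒜 : Set (Chart X)) : Prop :=
  ∀ c ∈ 𝒜, (∀ i j, ContDiffOn ℝ ∞ (fun x => c.metric x i j) c.dom) ∧
    ∀ x ∈ c.dom, (c.metric x).PosDef

/-- Nonnegative scalar curvature, at every point in every chart. -/
def NonnegScalar {X : Type*} (𝒜 : Set (Chart X)) : Prop :=
  ∀ c ∈ 𝒜, ∀ x ∈ c.dom, 0 ≤ scalarCurvature c.metric x

/-- `HasCurve 𝒜 p q ℓ`: there is a piecewise `C¹` curve of length `ℓ` from `p` to `q`, each of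
whose finitely many pieces is a `C¹` curve lying in one chart. -/
inductive HasCurve {X : Type*} (𝒜 : Set (Chart X)) : X → X → ℝ → Prop
  | piece (c : Chart X) (hc : c ∈ 𝒜) (γ : ℝ → Fin 3 → ℝ) (hγ : ContDiff ℝ 1 γ)
      (hdom : ∀ t ∈ Icc (0 : ℝ) 1, γ t ∈ c.dom) :
      HasCurve 𝒜 (c.map (γ 0)) (c.map (γ 1))
        (∫ t in (0 : ℝ)..1, √(deriv γ t ⬝ᵥ (c.metric (γ t) *ᵥ deriv γ t)))
  | trans {p q s : X} {ℓ ℓ' : ℝ} (h : HasCurve 𝒜 p q ℓ) (h' : HasCurve 𝒜 q s ℓ') :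
      HasCurve 𝒜 p s (ℓ + ℓ')

/-- The Riemannian (length) distance: infimum of the lengths of piecewise `C¹` curves. -/
def riemDist {X : Type*} (𝒜 : Set (Chart X)) (p q : X) : ℝ :=
  sInf {ℓ | HasCurve 𝒜 p q ℓ}

/-! ### Surfaces, area, minimal surfaces -/

/-- The coordinate tangent vector `∂_a ψ`. -/
def tangentVec (ψ : (Fin 2 → ℝ) → Fin 3 → ℝ) (a : Fin 2) (y : Fin 2 → ℝ) : Fin 3 → ℝ :=
  fun k => pd a (fun z => ψ z k) y

/-- The first fundamental form of `ψ` with respect to the metric `G`. -/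
def firstForm (G : (Fin 3 → ℝ) → Matrix (Fin 3) (Fin 3) ℝ) (ψ : (Fin 2 → ℝ) → Fin 3 → ℝ)
    (y : Fin 2 → ℝ) : Matrix (Fin 2) (Fin 2) ℝ :=
  Matrix.of fun a b => tangentVec ψ a y ⬝ᵥ (G (ψ y) *ᵥ tangentVec ψ b y)

/-- The covariant derivative `∇_a ∂_b ψ` along `ψ`. -/
def covDeriv (G : (Fin 3 → ℝ) → Matrix (Fin 3) (Fin 3) ℝ) (ψ : (Fin 2 → ℝ) → Fin 3 → ℝ)
    (a b : Fin 2) (y : Fin 2 → ℝ) : Fin 3 → ℝ :=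
  fun k => pd a (fun z => tangentVec ψ b z k) y
    + ∑ i, ∑ j, christoffel G k i j (ψ y) * tangentVec ψ a y i * tangentVec ψ b y j

/-- The mean curvature of `ψ` vanishes at `y`: for each normal vector `ν`, the trace of the second
fundamental form in the direction `ν` is zero. -/
def MeanCurvatureZeroAt (G : (Fin 3 → ℝ) → Matrix (Fin 3) (Fin 3) ℝ)
    (ψ : (Fin 2 → ℝ) → Fin 3 → ℝ) (y : Fin 2 → ℝ) : Prop :=
  ∀ ν : Fin 3 → ℝ, (∀ a, ν ⬝ᵥ (G (ψ y) *ᵥ tangentVec ψ a y) = 0) →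
    ∑ a, ∑ b, (firstForm G ψ y)⁻¹ a b * (ν ⬝ᵥ (G (ψ y) *ᵥ covDeriv G ψ a b y)) = 0

/-- A regular patch of the subset `S`: a smooth immersion `ψ` of an open `U ⊆ ℝ²` into a chart such
that `c.map ∘ ψ` is a homeomorphism of `U` onto a relatively open subset of `S`. -/
structure Patch {X : Type*} [TopologicalSpace X] (𝒜 : Set (Chart X)) (S : Set X) where
  c : Chart X
  mem : c ∈ 𝒜
  U : Set (Fin 2 → ℝ)
  isOpen_U : IsOpen U
  ψ : (Fin 2 → ℝ) → Fin 3 → ℝ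
  smooth : ContDiffOn ℝ ∞ ψ U
  mapsTo_dom : MapsTo ψ U c.dom
  immersion : ∀ y ∈ U, LinearIndependent ℝ (fun a => tangentVec ψ a y)
  mapsTo : MapsTo (c.map ∘ ψ) U S
  isOpenEmbedding : IsOpenEmbedding (mapsTo.restrict (c.map ∘ ψ) U S)

/-- A closed (compact, without boundary) nonempty smooth embedded surface. -/
def IsClosedSurface {X : Type*} [TopologicalSpace X] (𝒜 : Set (Chart X)) (S : Set X) : Prop :=
  S.Nonempty ∧ IsCompact S ∧ ∀ p ∈ S, ∃ P : Patch 𝒜 S, p ∈ (P.c.map ∘ P.ψ) '' P.U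

/-- A closed embedded minimal surface: the mean curvature vanishes identically. -/
def IsClosedMinimalSurface {X : Type*} [TopologicalSpace X] (𝒜 : Set (Chart X))
    (S : Set X) : Prop :=
  IsClosedSurface 𝒜 S ∧ ∀ P : Patch 𝒜 S, ∀ y ∈ P.U, MeanCurvatureZeroAt P.c.metric P.ψ y

/-- The area of the part of a patch with parameters in `B`. -/
def Patch.areaOn {X : Type*} [TopologicalSpace X] {𝒜 : Set (Chart X)} {S : Set X}
    (P : Patch 𝒜 S) (B : Set (Fin 2 → ℝ)) : ENNReal :=
  ∫⁻ y in B, ENNReal.ofReal (√(firstForm P.c.metric P.ψ y).det)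

/-- The area of a surface `S`: the supremum of the total areas of finite families of pairwise
disjoint measurable pieces of patches.  (On a closed surface the supremum is attained, by a
decomposition of `S` into finitely many such pieces.) -/
def area {X : Type*} [TopologicalSpace X] (𝒜 : Set (Chart X)) (S : Set X) : ENNReal :=
  ⨆ (n : ℕ) (P : Fin n → Patch 𝒜 S) (B : Fin n → Set (Fin 2 → ℝ))
    (_ : ∀ k, MeasurableSet (B k) ∧ B k ⊆ (P k).U)
    (_ : Pairwise fun k l =>
      Disjoint (((P k).c.map ∘ (P k).ψ) '' B k) (((P l).c.map ∘ (P l).ψ) '' B l)),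
    ∑ k, (P k).areaOn (B k)

/-- `MinA`: the infimum of the areas of closed embedded minimal surfaces. -/
def minA {X : Type*} [TopologicalSpace X] (𝒜 : Set (Chart X)) : ENNReal :=
  ⨅ (S : Set X) (_ : IsClosedMinimalSurface 𝒜 S), area 𝒜 S

/-! ### The manifold `S² × S¹` and its doubly rotationally symmetric metrics -/

/-- The manifold `S² × S¹`. -/
abbrev M : Type := Metric.sphere (0 : EuclideanSpace ℝ (Fin 3)) 1 × Circle

/-- The point of the unit sphere with polar angle `α` and azimuth `θ`. -/
def spherePoint (α θ : ℝ) : Metric.sphere (0 : EuclideanSpace ℝ (Fin 3)) 1 :=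
  ⟨!₂[Real.sin α * Real.cos θ, Real.sin α * Real.sin θ, Real.cos α], by
    rw [mem_sphere_zero_iff_norm, EuclideanSpace.norm_eq, Real.sqrt_eq_one]
    simp only [Fin.sum_univ_three, Real.norm_eq_abs, sq_abs]
    simp
    nlinarith [Real.sin_sq_add_cos_sq α, Real.sin_sq_add_cos_sq θ]⟩

/-- The coordinates `(r, θ, ξ)`, with `r ∈ [0, 2]`, on `S² × S¹`. -/
def polarMap (x : Fin 3 → ℝ) : M :=
  (spherePoint (Real.pi / 2 * x 0) (x 1), Circle.exp (x 2))

/-- The region `0 < r < 2` in coordinate space. -/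
def polarDom : Set (Fin 3 → ℝ) := {x | 0 < x 0 ∧ x 0 < 2}

/-- The regular part `{0 < r < 2} × S¹ × S¹` of `S² × S¹`. -/
def regularPart : Set M := polarMap '' polarDom

/-- `φ⁻² (dr² + u² dθ²) + φ² dξ²` in the coordinates `(r, θ, ξ)`. -/
def polarMetric (φ u : ℝ → ℝ) (x : Fin 3 → ℝ) : Matrix (Fin 3) (Fin 3) ℝ :=
  Matrix.diagonal ![(φ (x 0) ^ 2)⁻¹, (φ (x 0) ^ 2)⁻¹ * u (x 0) ^ 2, φ (x 0) ^ 2]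

/-- The chart `(r, θ, ξ)` of the regular part. -/
def polarChart (φ u : ℝ → ℝ) : Chart M := ⟨polarDom, polarMap, polarMetric φ u⟩

/-- The distance `√(x² + y²)` to the pole in Cartesian coordinates `(x, y, ξ)` around it. -/
def capRadius (x : Fin 3 → ℝ) : ℝ := √(x 0 ^ 2 + x 1 ^ 2)

/-- `φ⁻² (ds² + u² dθ²) + φ² dξ²` in the Cartesian coordinates `x = s cos θ`, `y = s sin θ` around
the pole `s = 0`, with `φ` and `u` functions of `s`:
`ds² + u² dθ² = dx² + dy² + (u² - s²) dθ²` and `dθ = (x dy - y dx) / s²`. At the pole the Lean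
convention `0 / 0 = 0` gives `dx² + dy²`, as it should when `u = s` near `s = 0`. -/
def capMetric (φ u : ℝ → ℝ) (x : Fin 3 → ℝ) : Matrix (Fin 3) (Fin 3) ℝ :=
  let s := capRadius x
  let k := (u s ^ 2 - s ^ 2) / s ^ 4
  !![(φ s ^ 2)⁻¹ * (1 + k * x 1 ^ 2), -((φ s ^ 2)⁻¹ * (k * (x 0 * x 1))), 0;
     -((φ s ^ 2)⁻¹ * (k * (x 0 * x 1))), (φ s ^ 2)⁻¹ * (1 + k * x 0 ^ 2), 0;
     0, 0, φ s ^ 2]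

/-- Cartesian chart of `{r < a}` around the circle `r = 0`. -/
def northChart (φ u : ℝ → ℝ) (a : ℝ) : Chart M where
  dom := {x | x 0 ^ 2 + x 1 ^ 2 < a ^ 2}
  map x := polarMap ![capRadius x, Complex.arg ⟨x 0, x 1⟩, x 2]
  metric := capMetric φ u

/-- Cartesian chart of `{2 - r < b}` around the circle `r = 2`. -/
def southChart (φ u : ℝ → ℝ) (b : ℝ) : Chart M where
  dom := {x | x 0 ^ 2 + x 1 ^ 2 < b ^ 2}
  map x := polarMap ![2 - capRadius x, Complex.arg ⟨x 0, x 1⟩, x 2]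
  metric := capMetric (fun s => φ (2 - s)) (fun s => u (2 - s))

/-- The metric `φ⁻² (dr² + u² dθ²) + φ² dξ²` on `S² × S¹`, given in an atlas consisting of the
polar chart and Cartesian charts around `r = 0` and `r = 2`. -/
def warpedAtlas (φ u : ℝ → ℝ) (a b : ℝ) : Set (Chart M) :=
  {polarChart φ u, northChart φ u a, southChart φ u b}

/-- The volume of `S² × S¹` (the two circles `r = 0`, `r = 2` are null sets). -/
def warpedVolume (φ u : ℝ → ℝ) : ENNReal :=
  ∫⁻ x in {x : Fin 3 → ℝ | x 0 ∈ Ioo 0 2 ∧ x 1 ∈ Ioo 0 (2 * Real.pi) ∧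
      x 2 ∈ Ioo 0 (2 * Real.pi)},
    ENNReal.ofReal (√(polarMetric φ u x).det)

/-! ### The drawstring-type example -/

/-- A smooth cutoff with values in `[0, 1]`, equal to `0` for `t ≤ 0` and to `1` for `t ≥ 1`. -/
structure IsCutoff (η : ℝ → ℝ) : Prop where
  smooth : ContDiff ℝ ∞ η
  mem_Icc : ∀ t, η t ∈ Icc (0 : ℝ) 1
  eq_zero : ∀ t ≤ 0, η t = 0
  eq_one : ∀ t, 1 ≤ t → η t = 1

/-- `ρ = e^{-A³} / 10`. -/
def rho (A : ℝ) : ℝ := 1 / 10 * Real.exp (-A ^ 3)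

def psi (η : ℝ → ℝ) (A r : ℝ) : ℝ :=
  η (Real.log (r / rho A) / Real.log 2) * η (Real.log (1 / (10 * r)) / Real.log 2)

def lam (η : ℝ → ℝ) (A : ℝ) : ℝ := A / ∫ s in (0 : ℝ)..(1 / 10), psi η A s / s

def fFun (η : ℝ → ℝ) (A r : ℝ) : ℝ := -A + lam η A * ∫ s in (0 : ℝ)..r, psi η A s / s

/-- The fibre warping function `φ = e^f`. -/
def phiFun (η : ℝ → ℝ) (A r : ℝ) : ℝ := Real.exp (fFun η A r)

/-- The conditions on the base warping function `u` belonging to the parameter `A`. -/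
structure IsBaseWarping (η : ℝ → ℝ) (A : ℝ) (u : ℝ → ℝ) : Prop where
  smooth : ContDiffOn ℝ ∞ u (Icc 0 2)
  concave : ConcaveOn ℝ (Icc 0 2) u
  zero_left : u 0 = 0
  zero_right : u 2 = 0
  sup_ge : 1 / 10 ≤ sSup (u '' Icc 0 2)
  deriv_left : derivWithin u (Icc 0 2) 0 = 1
  deriv_right : derivWithin u (Icc 0 2) 2 = -1
  pos : ∀ r ∈ Ioo (0 : ℝ) 2, 0 < u r
  deriv_pos : ∀ r ∈ Ioo (0 : ℝ) (1 / 5), 0 < deriv u r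
  eq_left : ∀ r ∈ Ico 0 (rho A), u r = r
  eq_right : ∀ r ∈ Ioc (9 / 5 : ℝ) 2, u r = 2 - r
  ineq : ∀ r ∈ Ioo (0 : ℝ) 2, (deriv (fFun η A) r) ^ 2 ≤ -(deriv (deriv u) r) / u r

/-- The Riemannian metric `φ⁻² (dr² + u² dθ²) + φ² dξ²` of the example on `S² × S¹`. -/
def exampleMetric (η : ℝ → ℝ) (A : ℝ) (u : ℝ → ℝ) : Set (Chart M) :=
  warpedAtlas (phiFun η A) u (rho A) (1 / 5)

/-- The intrinsic length distance on the regular part of the metric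
`φ⁻² (dr² + u² dθ²) + φ² dξ²`. -/
def regularDist (φ u : ℝ → ℝ) : M → M → ℝ := riemDist {polarChart φ u}

/-- `dstar` is a metric on the set `S`. -/
def IsMetricOn {X : Type*} (dstar : X → X → ℝ) (S : Set X) : Prop :=
  (∀ p ∈ S, ∀ q ∈ S, 0 ≤ dstar p q ∧ (dstar p q = 0 ↔ p = q) ∧ dstar p q = dstar q p) ∧
    ∀ p ∈ S, ∀ q ∈ S, ∀ s ∈ S, dstar p s ≤ dstar p q + dstar q s

/-- Along the subsequence `σ`, the warping functions `φ i`, `u i` converge (locally) uniformly to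
`φlim`, `ulim`, and the distances `d i` converge to the metric `dstar` on the regular part,
uniformly on `K × K` for all compact subsets `K`. -/
structure IsLimitAlong (φ u : ℕ → ℝ → ℝ) (d : ℕ → M → M → ℝ) (σ : ℕ → ℕ)
    (φlim ulim : ℝ → ℝ) (dstar : M → M → ℝ) : Prop where
  strictMono : StrictMono σ
  tendsto_u : TendstoUniformlyOn (fun i => u (σ i)) ulim atTop (Icc 0 2)
  tendsto_phi : TendstoLocallyUniformlyOn (fun i => φ (σ i)) φlim atTop (Ioo 0 2)
  isMetricOn : IsMetricOn dstar regularPart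
  tendsto_dist : ∀ K ⊆ regularPart, IsCompact K →
    TendstoUniformlyOn (fun i (z : M × M) => d (σ i) z.1 z.2) (fun z => dstar z.1 z.2) atTop
      (K ×ˢ K)

end Drawstring

end

noncomputable section

namespace Drawstring

/-! ### The logarithmic profile `f` and the fibre factor `φ = e^f`. -/

variable {η : ℝ → ℝ} {A : ℝ}

/-! Existence and curvature. The function `f` climbs from `-A` to `0` with slope `λψ/r`. The climb
occupies a range of `log r` of length about `A³`, so `λ ≤ 2/A²` (`lam_le`), and the total mass of
`f'² r` is at most `λA ≤ 2/A`. Very little concavity is therefore needed for `-u'' ≥ f'² u`, and a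
base function arises by integrating twice a density of mass 2 and first moment 2 (`exists_density`,
`exists_isBaseWarping`). In the scalar curvature the second derivatives of `φ` cancel, leaving
`2φ²(-u''/u - f'²)` (`scalarCurvature_polarMetric`). Since `φ ≥ (10r)^λ` for small `r`
(`rpow_le_phiFun`), the volume density `u/φ` stays bounded.

Minimal surfaces. The area density of the torus `r = const` is `u`, so the sign of `u'` is the sign
of its mean curvature. By the maximum principle (`deriv_sign_of_hessian`), `r` restricted to a
minimal surface has no local maximum where `u' > 0` and no local minimum where `u' < 0`; hence a
closed minimal surface meets `1/5 ≤ r ≤ 9/5` (`exists_rad_mem_middle`). Around such a point there is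
a box of fixed size in which `φ = 1` and the metric is `dr² + u² dθ² + dξ²`, with `1/100 ≤ u ≤ 1` at
the centre and `|u'| ≤ 1`, independently of `A`. The first variation formula, applied to a field
close to `(x - x₀)/|x - x₀|²` and cut off at a fixed scale, bounds the area from below
(`planeDiv_testField_ge`, `mass_ge`, `area_ge`). The surface enters only as a measure on pairs
(point, tangent projection), glued from finitely many parametrizations
(`atlasVarifold_restrict_cyl`, `integral_atlasVarifold`).

Distances. Because `λ → 0`, `φ → 1` locally uniformly on `0 < r < 2`. The distances are then
equi-Lipschitz in coordinates (`riemDist_polarMap_le`), and Arzelà–Ascoli gives a limit. It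
separates points because `horiz`, `height` and `cutFibre` satisfy Lipschitz bounds with a constant
independent of the index. In the limit metric `φ = 1`, so crossing half a fibre costs `π`
(`regularDist_opposite`). In the approximating metrics one can instead run radially to `r = ρ`, at a
cost tending to `r`, cross there at cost `π e^{-A}`, and run back (`riemDist_opposite_le`). The
collapsing circle is lost in the limit of the warping functions but not in the limit of the
distances. -/

lemma rho_pos (A : ℝ) : 0 < rho A := by unfold rho; positivity

lemma log_tenth_div_rho (A : ℝ) : Real.log (1 / 10 / rho A) = A ^ 3 := by
  unfold rho
  rw [div_mul_eq_div_div, div_self (by norm_num), one_div, ← Real.exp_neg, Real.log_exp]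
  ring

/-- A crude bound from `e^x ≥ 1 + x`; it makes the plateau `[2ρ, 1/20]` of `psi` nonempty. -/
lemma rho_lt {A : ℝ} (hA : 10 ≤ A) : 4 * rho A < 1 / 40 := by
  have h1 : Real.exp (-A ^ 3) ≤ 1 / 1000 := by
    have h3 : (1000 : ℝ) ≤ A ^ 3 := by
      have := pow_le_pow_left₀ (by norm_num : (0 : ℝ) ≤ 10) hA 3
      linarith
    have h2 := Real.add_one_le_exp (A ^ 3)
    rw [Real.exp_neg, ← one_div]
    exact one_div_le_one_div_of_le (by norm_num) (by linarith)
  unfold rho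
  linarith

lemma psi_mem (hη : IsCutoff η) (A r : ℝ) : psi η A r ∈ Icc (0 : ℝ) 1 := by
  obtain ⟨a, b⟩ := hη.mem_Icc (Real.log (r / rho A) / Real.log 2)
  obtain ⟨c, d⟩ := hη.mem_Icc (Real.log (1 / (10 * r)) / Real.log 2)
  exact ⟨mul_nonneg a c, mul_le_one₀ b c d⟩

lemma psi_eq_zero_left (hη : IsCutoff η) {r : ℝ} (h0 : 0 ≤ r) (hr : r ≤ rho A) :
    psi η A r = 0 := by
  have h2 : 0 < Real.log 2 := Real.log_pos (by norm_num)
  unfold psi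
  rw [hη.eq_zero, zero_mul]
  apply div_nonpos_of_nonpos_of_nonneg _ h2.le
  exact Real.log_nonpos (div_nonneg h0 (rho_pos A).le) ((div_le_one (rho_pos A)).2 hr)

lemma psi_eq_zero_right (hη : IsCutoff η) {r : ℝ} (hr : 1 / 10 ≤ r) : psi η A r = 0 := by
  have h2 : 0 < Real.log 2 := Real.log_pos (by norm_num)
  unfold psi
  rw [hη.eq_zero (Real.log (1 / (10 * r)) / Real.log 2), mul_zero]
  apply div_nonpos_of_nonpos_of_nonneg _ h2.le
  have : 0 < 10 * r := by linarith
  exact Real.log_nonpos (by positivity) ((div_le_one this).2 (by linarith))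

lemma psi_eq_one (hη : IsCutoff η) {r : ℝ} (h0 : 2 * rho A ≤ r) (hr : r ≤ 1 / 20) :
    psi η A r = 1 := by
  have h2 : 0 < Real.log 2 := Real.log_pos (by norm_num)
  have hρ := rho_pos A
  have hr0 : 0 < r := by linarith
  unfold psi
  rw [hη.eq_one, hη.eq_one, one_mul]
  · rw [le_div_iff₀ h2, one_mul]
    apply Real.log_le_log (by norm_num)
    rw [le_div_iff₀ (by positivity)]
    linarith
  · rw [le_div_iff₀ h2, one_mul]
    apply Real.log_le_log (by norm_num)
    rw [le_div_iff₀ hρ]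
    linarith

lemma psi_contDiffOn (hη : IsCutoff η) : ContDiffOn ℝ ∞ (psi η A) (Ioi 0) := by
  have hρ := rho_pos A
  unfold psi
  apply ContDiffOn.mul
  · apply hη.smooth.comp_contDiffOn
    apply ContDiffOn.div_const
    apply ContDiffOn.log (contDiffOn_id.div_const _)
    intro x hx
    exact (div_pos hx hρ).ne'
  · apply hη.smooth.comp_contDiffOn
    apply ContDiffOn.div_const
    apply ContDiffOn.log
    · apply ContDiffOn.div contDiffOn_const (contDiffOn_const.mul contDiffOn_id)
      intro x hx
      have : (0 : ℝ) < x := hx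
      simpa using this.ne'
    · intro x hx
      have : (0 : ℝ) < x := hx
      positivity

lemma psi_div_contDiffOn (hη : IsCutoff η) : ContDiffOn ℝ ∞ (fun s => psi η A s / s) (Ioi 0) :=
  (psi_contDiffOn hη).div contDiffOn_id fun _ hx => ne_of_gt hx

lemma psi_div_continuousOn (hη : IsCutoff η) : ContinuousOn (fun s => psi η A s / s) (Ici 0) := by
  intro x hx
  rcases eq_or_lt_of_le (show (0 : ℝ) ≤ x from hx) with rfl | hx
  · have : (fun s => psi η A s / s) =ᶠ[𝓝[Ici 0] 0] fun _ => 0 := by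
      filter_upwards [self_mem_nhdsWithin, mem_nhdsWithin_of_mem_nhds (Iio_mem_nhds (rho_pos A))]
        with s hs hs'
      rw [psi_eq_zero_left hη hs (le_of_lt hs'), zero_div]
    exact continuousWithinAt_const.congr_of_eventuallyEq this (by simp)
  · exact ((psi_div_contDiffOn hη).continuousOn.continuousAt (Ioi_mem_nhds hx)).continuousWithinAt

lemma psi_div_intervalIntegrable (hη : IsCutoff η) {a b : ℝ} (ha : 0 ≤ a) (hb : 0 ≤ b) :
    IntervalIntegrable (fun s => psi η A s / s) volume a b :=
  ((psi_div_continuousOn hη).mono fun x hx => by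
    rw [mem_uIcc] at hx
    rcases hx with h | h
    · exact ha.trans h.1
    · exact hb.trans h.1).intervalIntegrable

lemma integral_psi_div_le (hη : IsCutoff η) {a b : ℝ} (ha : 0 < a) (hb : a ≤ b) :
    ∫ s in a..b, psi η A s / s ≤ Real.log (b / a) := by
  have hb0 := ha.trans_le hb
  rw [← integral_one_div_of_pos ha hb0]
  apply intervalIntegral.integral_mono_on hb (psi_div_intervalIntegrable hη ha.le hb0.le)
  · apply ContinuousOn.intervalIntegrable
    apply ContinuousOn.div continuousOn_const continuousOn_id
    intro x hx
    rw [uIcc_of_le hb] at hx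
    exact (ha.trans_le hx.1).ne'
  · intro x hx
    have : 0 < x := ha.trans_le hx.1
    gcongr
    exact (psi_mem hη A x).2

lemma integral_psi_div_nonneg (hη : IsCutoff η) {a b : ℝ} (ha : 0 ≤ a) (hb : a ≤ b) :
    0 ≤ ∫ s in a..b, psi η A s / s :=
  intervalIntegral.integral_nonneg hb fun x hx =>
    div_nonneg (psi_mem hη A x).1 (ha.trans hx.1)

lemma integral_psi_div_left (hη : IsCutoff η) {r : ℝ} (h0 : 0 ≤ r) (hr : r ≤ rho A) :
    ∫ s in (0 : ℝ)..r, psi η A s / s = 0 := by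
  rw [intervalIntegral.integral_congr (g := fun _ => (0 : ℝ))]
  · simp
  · intro x hx
    rw [uIcc_of_le h0] at hx
    simp [psi_eq_zero_left hη hx.1 (hx.2.trans hr)]

lemma integral_psi_div_right (hη : IsCutoff η) {r : ℝ} (hr : 1 / 10 ≤ r) :
    ∫ s in (1 / 10 : ℝ)..r, psi η A s / s = 0 := by
  rw [intervalIntegral.integral_congr (g := fun _ => (0 : ℝ))]
  · simp
  · intro x hx
    rw [uIcc_of_le hr] at hx
    simp [psi_eq_zero_right hη hx.1]

lemma integral_psi_add (hη : IsCutoff η) {a b c : ℝ} (ha : 0 ≤ a) (hb : 0 ≤ b) (hc : 0 ≤ c) :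
    (∫ s in a..b, psi η A s / s) + ∫ s in b..c, psi η A s / s = ∫ s in a..c, psi η A s / s :=
  intervalIntegral.integral_add_adjacent_intervals (psi_div_intervalIntegrable hη ha hb)
    (psi_div_intervalIntegrable hη hb hc)

/-- On `[2ρ, 1/20]` the cutoffs equal one, and there `ds/s` integrates to `A³ - 2 log 2`. This is
where the cube in the definition of `rho` is used: it makes `λ` of order `A⁻²`, so that even `λA`
tends to zero. -/
lemma integral_psi_lower (hη : IsCutoff η) (hA : 10 ≤ A) :
    A ^ 3 / 2 ≤ ∫ s in (0 : ℝ)..(1 / 10), psi η A s / s := by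
  have h1 := rho_lt hA
  have h2 := rho_pos A
  rw [← integral_psi_add hη le_rfl (by linarith : 0 ≤ 2 * rho A) (by norm_num),
    ← integral_psi_add hη (by linarith : 0 ≤ 2 * rho A) (by norm_num : (0 : ℝ) ≤ 1 / 20)
      (by norm_num)]
  have h3 := integral_psi_div_nonneg (A := A) hη le_rfl (by linarith : 0 ≤ 2 * rho A)
  have h4 := integral_psi_div_nonneg (A := A) hη (by norm_num : (0 : ℝ) ≤ 1 / 20)
    (by norm_num : (1 : ℝ) / 20 ≤ 1 / 10)
  have h5 : ∫ s in (2 * rho A)..(1 / 20), psi η A s / s = A ^ 3 - 2 * Real.log 2 := by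
    rw [intervalIntegral.integral_congr (g := fun s => 1 / s),
      integral_one_div_of_pos (by linarith) (by norm_num), ← log_tenth_div_rho]
    · have : (1 : ℝ) / 20 / (2 * rho A) = 1 / 10 / rho A / 2 / 2 := by
        field_simp; norm_num
      rw [this, Real.log_div (by positivity) (by norm_num), Real.log_div (by positivity)
        (by norm_num)]
      ring
    · intro x hx
      rw [uIcc_of_le (by linarith)] at hx
      simp [psi_eq_one hη hx.1 hx.2]
  have h6 : (1000 : ℝ) ≤ A ^ 3 := by
    have := pow_le_pow_left₀ (by norm_num : (0 : ℝ) ≤ 10) hA 3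
    linarith
  have := Real.log_two_lt_d9
  linarith

lemma lam_pos (hη : IsCutoff η) (hA : 10 ≤ A) : 0 < lam η A := by
  have h1 := integral_psi_lower hη hA
  have : 0 < A := by linarith
  exact div_pos this (by linarith [pow_pos this 3])

lemma lam_le (hη : IsCutoff η) (hA : 10 ≤ A) : lam η A ≤ 2 / A ^ 2 := by
  have h1 := integral_psi_lower hη hA
  have h0 : 0 < A := by linarith
  have h3 := pow_pos h0 3
  unfold lam
  rw [div_le_div_iff₀ (by linarith) (by positivity)]
  nlinarith

lemma lam_le_half (hη : IsCutoff η) (hA : 10 ≤ A) : lam η A ≤ 1 / 50 := by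
  refine (lam_le hη hA).trans ?_
  rw [div_le_div_iff₀ (by positivity) (by norm_num)]
  nlinarith

lemma lam_mul (hη : IsCutoff η) (hA : 10 ≤ A) :
    lam η A * ∫ s in (0 : ℝ)..(1 / 10), psi η A s / s = A := by
  have h1 := integral_psi_lower hη hA
  have h0 : 0 < A := by linarith
  have h3 := pow_pos h0 3
  exact div_mul_cancel₀ _ (by linarith)

lemma fFun_left (hη : IsCutoff η) {r : ℝ} (h0 : 0 ≤ r) (hr : r ≤ rho A) : fFun η A r = -A := by
  unfold fFun
  rw [integral_psi_div_left hη h0 hr]; ring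

lemma fFun_right (hη : IsCutoff η) (hA : 10 ≤ A) {r : ℝ} (hr : 1 / 10 ≤ r) :
    fFun η A r = 0 := by
  unfold fFun
  rw [← integral_psi_add hη le_rfl (by norm_num : (0 : ℝ) ≤ 1 / 10) (by linarith),
    integral_psi_div_right hη hr, add_zero, lam_mul hη hA]
  ring

/-- The normalization of `lam` allows `f` to be measured inward from its final value `0` at `r =
1/10`; its sign and its lower bound are visible in this form. -/
lemma fFun_eq (hη : IsCutoff η) (hA : 10 ≤ A) {r : ℝ} (hr : 0 ≤ r) :
    fFun η A r = - (lam η A * ∫ s in r..(1 / 10), psi η A s / s) := by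
  have h := lam_mul hη hA
  rw [← integral_psi_add hη le_rfl hr (by norm_num : (0 : ℝ) ≤ 1 / 10)] at h
  unfold fFun
  linarith

lemma fFun_nonpos (hη : IsCutoff η) (hA : 10 ≤ A) {r : ℝ} (h0 : 0 ≤ r) : fFun η A r ≤ 0 := by
  rcases le_total r (1 / 10) with h | h
  · rw [fFun_eq hη hA h0]
    have := mul_nonneg (lam_pos hη hA).le (integral_psi_div_nonneg (A := A) hη h0 h)
    linarith
  · rw [fFun_right hη hA h]

/-- Since `psi ≤ 1`, the climb left to do between `r` and `1/10` is at most `λ log (1/(10r))`.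
Exponentiated, this is the power bound on `φ` behind all estimates near the axis. -/
lemma fFun_ge (hη : IsCutoff η) (hA : 10 ≤ A) {r : ℝ} (h0 : 0 < r) (hr : r ≤ 1 / 10) :
    lam η A * Real.log (10 * r) ≤ fFun η A r := by
  rw [fFun_eq hη hA h0.le]
  have h1 := mul_le_mul_of_nonneg_left (integral_psi_div_le (A := A) hη h0 hr) (lam_pos hη hA).le
  have : Real.log (1 / 10 / r) = - Real.log (10 * r) := by
    rw [← Real.log_inv]; congr 1; field_simp
  rw [this] at h1
  linarith

lemma hasDerivAt_fFun (hη : IsCutoff η) {r : ℝ} (hr : 0 < r) :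
    HasDerivAt (fFun η A) (lam η A * (psi η A r / r)) r := by
  unfold fFun
  apply HasDerivAt.const_add
  apply HasDerivAt.const_mul
  have hc : ContinuousAt (fun s => psi η A s / s) r :=
    (psi_div_contDiffOn hη).continuousOn.continuousAt (Ioi_mem_nhds hr)
  apply intervalIntegral.integral_hasDerivAt_right (psi_div_intervalIntegrable hη le_rfl hr.le)
    _ hc
  exact (psi_div_contDiffOn hη).continuousOn.stronglyMeasurableAtFilter isOpen_Ioi r hr

lemma fFun_contDiffOn (hη : IsCutoff η) : ContDiffOn ℝ ∞ (fFun η A) (Ioi 0) := by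
  rw [contDiffOn_infty_iff_deriv_of_isOpen isOpen_Ioi]
  refine ⟨fun r hr => (hasDerivAt_fFun hη hr).differentiableAt.differentiableWithinAt, ?_⟩
  exact (contDiffOn_const.mul (psi_div_contDiffOn hη)).congr
    fun r hr => (hasDerivAt_fFun hη hr).deriv

lemma phiFun_pos (η : ℝ → ℝ) (A r : ℝ) : 0 < phiFun η A r := Real.exp_pos _

lemma phiFun_contDiffOn (hη : IsCutoff η) : ContDiffOn ℝ ∞ (phiFun η A) (Ioi 0) :=
  (fFun_contDiffOn hη).exp

lemma hasDerivAt_phiFun (hη : IsCutoff η) {r : ℝ} (hr : 0 < r) :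
    HasDerivAt (phiFun η A) (phiFun η A r * deriv (fFun η A) r) r := by
  have := hasDerivAt_fFun (A := A) hη hr
  rw [this.deriv]
  exact this.exp

lemma phiFun_left (hη : IsCutoff η) {r : ℝ} (h0 : 0 ≤ r) (hr : r ≤ rho A) :
    phiFun η A r = Real.exp (-A) := by
  unfold phiFun
  rw [fFun_left hη h0 hr]

lemma phiFun_right (hη : IsCutoff η) (hA : 10 ≤ A) {r : ℝ} (hr : 1 / 10 ≤ r) :
    phiFun η A r = 1 := by
  unfold phiFun
  rw [fFun_right hη hA hr, Real.exp_zero]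

lemma phiFun_le_one (hη : IsCutoff η) (hA : 10 ≤ A) {r : ℝ} (h0 : 0 ≤ r) : phiFun η A r ≤ 1 :=
  Real.exp_le_one_iff.2 (fFun_nonpos hη hA h0)

lemma rpow_le_phiFun (hη : IsCutoff η) (hA : 10 ≤ A) {r : ℝ} (h0 : 0 < r) (hr : r ≤ 1 / 10) :
    (10 * r) ^ lam η A ≤ phiFun η A r := by
  unfold phiFun
  rw [Real.rpow_def_of_pos (by linarith), mul_comm]
  exact Real.exp_le_exp.2 (fFun_ge hη hA h0 hr)

lemma inv_phiFun_le (hη : IsCutoff η) (hA : 10 ≤ A) {r : ℝ} (h0 : 0 < r) (hr : r ≤ 1 / 10) :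
    (phiFun η A r)⁻¹ ≤ (10 * r) ^ (-lam η A) := by
  rw [Real.rpow_neg (by linarith)]
  exact inv_anti₀ (Real.rpow_pos_of_pos (by linarith) _) (rpow_le_phiFun hη hA h0 hr)

/-! ### Existence of admissible base functions. -/

variable {η : ℝ → ℝ} {A : ℝ}

/-- A smooth density of total mass and first moment `2` on `[0, 2]` dominating `|f'|² r`. -/
lemma exists_density (hη : IsCutoff η) (hA : 10 ≤ A) :
    ∃ h : ℝ → ℝ, ContDiff ℝ ∞ h ∧ (∀ r, 0 ≤ h r) ∧ (∀ r ≤ rho A, h r = 0) ∧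
      (∀ r, 9 / 5 ≤ r → h r = 0) ∧
      (∀ r, 0 < r → deriv (fFun η A) r ^ 2 * r ≤ h r) ∧ ∫ s in (0 : ℝ)..2, h s = 2 ∧
      ∫ s in (0 : ℝ)..2, s * h s = 2 ∧ ∫ s in (0 : ℝ)..(1 / 5), h s ≤ 1 / 5 := by
  have hρ := rho_pos A
  have hl := lam_pos hη hA
  -- The part of the density that is forced: it equals `f'² r` for `r > 0`. Setting it to zero for
  -- `r ≤ 0` keeps it smooth on the whole line, since `psi` vanishes up to `rho A`.
  set h₀ : ℝ → ℝ := fun r => if r ≤ 0 then 0 else lam η A ^ 2 * (psi η A r ^ 2 / r) with h₀_def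
  have h₀_left : ∀ r ≤ rho A, h₀ r = 0 := by
    intro r hr
    by_cases h : r ≤ 0
    · simp [h₀_def, h]
    · simp [h₀_def, h, psi_eq_zero_left hη (not_le.1 h).le hr]
  have h₀_right : ∀ r, 1 / 10 ≤ r → h₀ r = 0 := by
    intro r hr
    simp only [h₀_def, psi_eq_zero_right hη hr]
    simp
  have h₀_nonneg : ∀ r, 0 ≤ h₀ r := by
    intro r
    by_cases h : r ≤ 0
    · simp [h₀_def, h]
    · simp only [h₀_def, h, if_false]
      have : 0 < r := not_le.1 h
      positivity
  have h₀_smooth : ContDiff ℝ ∞ h₀ := by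
    rw [contDiff_iff_contDiffAt]
    intro x
    by_cases hx : x ≤ 0
    · have : h₀ =ᶠ[𝓝 x] fun _ => 0 := by
        filter_upwards [Iio_mem_nhds (hx.trans_lt hρ)] with y hy
        exact h₀_left y (le_of_lt hy)
      exact contDiffAt_const.congr_of_eventuallyEq this
    · have hx := not_le.1 hx
      have : h₀ =ᶠ[𝓝 x] fun r => lam η A ^ 2 * (psi η A r ^ 2 / r) := by
        filter_upwards [Ioi_mem_nhds hx] with y hy
        simp [h₀_def, not_le.2 (show (0 : ℝ) < y from hy)]
      refine ContDiffAt.congr_of_eventuallyEq ?_ this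
      have hc : ContDiffOn ℝ ∞ (fun r => lam η A ^ 2 * (psi η A r ^ 2 / r)) (Ioi 0) :=
        contDiffOn_const.mul (((psi_contDiffOn hη).pow 2).div contDiffOn_id
          fun y hy => ne_of_gt hy)
      exact hc.contDiffAt (Ioi_mem_nhds hx)
  have hi₀ : ∀ a b, IntervalIntegrable h₀ volume a b :=
    fun a b => h₀_smooth.continuous.intervalIntegrable _ _
  have hj₀ : ∀ a b, IntervalIntegrable (fun s => s * h₀ s) volume a b :=
    fun a b => (continuous_id.mul h₀_smooth.continuous).intervalIntegrable _ _
  have hz₀ : ∀ b, 1 / 10 ≤ b → ∫ s in (1 / 10 : ℝ)..b, h₀ s = 0 := by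
    intro b hb
    rw [intervalIntegral.integral_congr (g := fun _ => (0 : ℝ))]
    · simp
    · intro x hx
      rw [uIcc_of_le hb] at hx
      exact h₀_right x hx.1
  set m := ∫ s in (0 : ℝ)..2, h₀ s with hm
  set n := ∫ s in (0 : ℝ)..2, s * h₀ s with hn
  have hm_eq : ∀ b, 1 / 10 ≤ b → ∫ s in (0 : ℝ)..b, h₀ s = ∫ s in (0 : ℝ)..(1 / 10), h₀ s := by
    intro b hb
    rw [← intervalIntegral.integral_add_adjacent_intervals (hi₀ 0 (1 / 10)) (hi₀ _ b), hz₀ b hb,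
      add_zero]
  have hm0 : 0 ≤ m := intervalIntegral.integral_nonneg (by norm_num) fun x _ => h₀_nonneg x
  have hn0 : 0 ≤ n := intervalIntegral.integral_nonneg (by norm_num)
    fun x hx => mul_nonneg hx.1 (h₀_nonneg x)
  have hnm : n ≤ m := by
    apply intervalIntegral.integral_mono_on (by norm_num) (hj₀ _ _) (hi₀ _ _)
    intro x hx
    rcases le_total x (1 / 10) with h | h
    · nlinarith [h₀_nonneg x]
    · simp [h₀_right x h]
  -- From `psi² ≤ psi` and the normalization of `lam`, the forced mass is at most `λ · A ≤ 2/A`.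
  have hm1 : m ≤ 1 / 5 := by
    rw [hm, hm_eq 2 (by norm_num)]
    have h1 : ∫ s in (0 : ℝ)..(1 / 10), h₀ s
        ≤ ∫ s in (0 : ℝ)..(1 / 10), lam η A ^ 2 * (psi η A s / s) := by
      apply intervalIntegral.integral_mono_on (by norm_num) (hi₀ _ _)
        ((psi_div_intervalIntegrable hη le_rfl (by norm_num)).const_mul _)
      intro x hx
      by_cases h : x ≤ 0
      · simp only [h₀_def, h, if_true]
        have := (psi_mem hη A x).1
        have h' := hx.1
        positivity
      · simp only [h₀_def, h, if_false]
        have : 0 < x := not_le.1 h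
        have h2 := psi_mem hη A x
        gcongr
        nlinarith [h2.1, h2.2]
    rw [intervalIntegral.integral_const_mul, pow_two, mul_assoc, lam_mul hη hA] at h1
    have h2 := lam_le hη hA
    have h3 : lam η A * A ≤ 2 / A ^ 2 * A := by
      apply mul_le_mul_of_nonneg_right h2; linarith
    have h4 : 2 / A ^ 2 * A = 2 / A := by field_simp
    have h5 : 2 / A ≤ 1 / 5 := by
      rw [div_le_div_iff₀ (by linarith) (by norm_num)]; linarith
    linarith
  have hm2 : 0 < 2 - m := by linarith
  -- The missing mass `2 - m` goes into one bump, centred so that the first moment also becomes 2.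
  -- As `1 ≤ c ≤ 6/5` and the bump has radius `1/2`, it lives inside `(1/5, 9/5)`.
  set c := (2 - n) / (2 - m) with hc
  have hc1 : 1 ≤ c := by rw [hc, le_div_iff₀ hm2]; linarith
  have hc2 : c ≤ 6 / 5 := by rw [hc, div_le_iff₀ hm2]; linarith
  let β : ContDiffBump c := ⟨1 / 4, 1 / 2, by norm_num, by norm_num⟩
  set b := β.normed volume with hb
  have hb_smooth : ContDiff ℝ ∞ b := β.contDiff_normed
  have hb_zero : ∀ x, x ≤ 1 / 5 ∨ 9 / 5 ≤ x → b x = 0 := by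
    intro x hx
    have : x ∉ Function.support b := by
      rw [hb, β.support_normed_eq, Metric.mem_ball, Real.dist_eq, not_lt]
      show 1 / 2 ≤ |x - c|
      rcases hx with hx | hx
      · rw [abs_sub_comm]; exact le_trans (by linarith) (le_abs_self _)
      · exact le_trans (by linarith) (le_abs_self _)
    simpa using this
  have hb_supp : Function.support b ⊆ Ioc 0 2 := by
    intro x hx
    by_contra hx'
    apply hx
    apply hb_zero
    rw [mem_Ioc, not_and_or, not_lt, not_le] at hx'
    rcases hx' with h | h
    · left; linarith
    · right; linarith
  have hb_int : ∫ s in (0 : ℝ)..2, b s = 1 := by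
    rw [intervalIntegral.integral_eq_integral_of_support_subset hb_supp]
    exact β.integral_normed
  have hb_mom : ∫ s in (0 : ℝ)..2, s * b s = c := by
    have hs : Function.support (fun s => s * b s) ⊆ Ioc 0 2 :=
      (Function.support_mul_subset_right _ _).trans hb_supp
    rw [intervalIntegral.integral_eq_integral_of_support_subset hs]
    have h1 : ∫ s, s * b s = ∫ s, (s + c) * b (s + c) := by
      rw [integral_add_right_eq_self (fun s => s * b s) c]
    have hsym : ∀ s, b (-s + c) = b (s + c) := by
      intro s
      have := β.normed_sub (μ := volume) s
      rw [hb, show -s + c = c - s by ring, show s + c = c + s by ring]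
      exact this
    have hbi : Integrable fun s => b (s + c) :=
      (hb_smooth.continuous.integrable_of_hasCompactSupport
        β.hasCompactSupport_normed).comp_add_right c
    have hcs : HasCompactSupport fun s => b (s + c) :=
      β.hasCompactSupport_normed.comp_homeomorph (Homeomorph.addRight c)
    have hsi : Integrable fun s => s * b (s + c) := by
      apply Continuous.integrable_of_hasCompactSupport
      · exact continuous_id.mul (hb_smooth.continuous.comp (continuous_id.add continuous_const))
      · exact hcs.mul_left
    -- The bump is even about its centre, so its centred first moment changes sign under reflection.
    have hodd : ∫ s, s * b (s + c) = 0 := by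
      have h2 := integral_neg_eq_self (fun s => s * b (s + c)) (volume : Measure ℝ)
      simp only [hsym, neg_mul, integral_neg] at h2
      linarith
    rw [h1]
    simp only [add_mul]
    rw [integral_add hsi (hbi.const_mul c), hodd, zero_add, integral_const_mul,
      integral_add_right_eq_self b c]
    rw [show ∫ s, b s = 1 from β.integral_normed, mul_one]
  have hbi : ∀ x y, IntervalIntegrable (fun s => (2 - m) * b s) volume x y :=
    fun x y => (continuous_const.mul hb_smooth.continuous).intervalIntegrable _ _
  refine ⟨fun r => h₀ r + (2 - m) * b r, h₀_smooth.add (contDiff_const.mul hb_smooth), ?_, ?_, ?_,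
    ?_, ?_, ?_, ?_⟩
  · intro r
    exact add_nonneg (h₀_nonneg r) (mul_nonneg hm2.le (β.nonneg_normed r))
  · intro r hr
    have := rho_lt hA
    simp only [h₀_left r hr, hb_zero r (Or.inl (by linarith)), mul_zero, add_zero]
  · intro r hr
    simp only [h₀_right r (by linarith), hb_zero r (Or.inr hr), mul_zero, add_zero]
  · intro r hr
    have h1 : deriv (fFun η A) r ^ 2 * r = h₀ r := by
      rw [(hasDerivAt_fFun hη hr).deriv]
      simp only [h₀_def, not_le.2 hr, if_false]
      field_simp
    rw [h1]
    exact le_add_of_nonneg_right (mul_nonneg hm2.le (β.nonneg_normed r))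
  · rw [intervalIntegral.integral_add (hi₀ _ _) (hbi _ _), intervalIntegral.integral_const_mul,
      hb_int]
    ring
  · simp only [mul_add, mul_left_comm _ (2 - m)]
    rw [intervalIntegral.integral_add (hj₀ _ _), intervalIntegral.integral_const_mul, hb_mom, hc,
      mul_div_cancel₀ _ hm2.ne']
    · ring
    · exact (continuous_const.mul (continuous_id.mul hb_smooth.continuous)).intervalIntegrable _ _
  · have hb5 : ∫ s in (0 : ℝ)..(1 / 5), (2 - m) * b s = 0 := by
      rw [intervalIntegral.integral_congr (g := fun _ => (0 : ℝ)), intervalIntegral.integral_zero]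
      intro x hx
      rw [uIcc_of_le (by norm_num)] at hx
      simp [hb_zero x (Or.inl hx.2)]
    rw [intervalIntegral.integral_add (hi₀ _ _) (hbi _ _), hm_eq _ (by norm_num),
      ← hm_eq 2 (by norm_num), hb5, add_zero]
    exact hm1

/-- Solve `u'' = -h`, `u(0) = 0`, `u'(0) = 1`. Mass 2 of `h` gives `u'(2) = -1`, and first moment 2
gives `u(2) = 0`; vanishing of `h` near the ends makes `u` linear there. The differential inequality
follows from `h ≥ f'² r` and `u ≤ r`. -/
theorem exists_isBaseWarping (hη : IsCutoff η) (hA : 10 ≤ A) : ∃ u, IsBaseWarping η A u := by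
  obtain ⟨h, hs, h0, hl, hr, hf, hm, hn, hq⟩ := exists_density hη hA
  have hρ := rho_pos A
  have hρ' := rho_lt hA
  set H : ℝ → ℝ := fun r => ∫ s in (0 : ℝ)..r, h s with hH
  set K : ℝ → ℝ := fun r => ∫ s in (0 : ℝ)..r, s * h s with hK
  have hi : ∀ a b, IntervalIntegrable h volume a b :=
    fun a b => hs.continuous.intervalIntegrable _ _
  have hj : ∀ a b, IntervalIntegrable (fun s => s * h s) volume a b :=
    fun a b => (continuous_id.mul hs.continuous).intervalIntegrable _ _
  have hdH : ∀ r, HasDerivAt H (h r) r := fun r => hs.continuous.integral_hasStrictDerivAt 0 r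
    |>.hasDerivAt
  have hdK : ∀ r, HasDerivAt K (r * h r) r := fun r =>
    (continuous_id.mul hs.continuous).integral_hasStrictDerivAt 0 r |>.hasDerivAt
  set u : ℝ → ℝ := fun r => r * (1 - H r) + K r with hu
  have hdu : ∀ r, HasDerivAt u (1 - H r) r := by
    intro r
    have := ((hasDerivAt_id r).mul ((hdH r).const_sub 1)).add (hdK r)
    refine this.congr_deriv ?_
    simp only [id]; ring
  have hdu_eq : deriv u = fun r => 1 - H r := funext fun r => (hdu r).deriv
  have hddu : ∀ r, deriv (deriv u) r = - h r := by
    intro r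
    rw [hdu_eq]
    exact ((hdH r).const_sub 1).deriv
  have hH_smooth : ContDiff ℝ ∞ H := by
    rw [contDiff_infty_iff_deriv]
    exact ⟨fun r => (hdH r).differentiableAt, by
      rwa [show deriv H = h from funext fun r => (hdH r).deriv]⟩
  have hu_smooth : ContDiff ℝ ∞ u := by
    rw [contDiff_infty_iff_deriv]
    exact ⟨fun r => (hdu r).differentiableAt, by rw [hdu_eq]; exact contDiff_const.sub hH_smooth⟩
  have hHmono : Monotone H := monotone_of_deriv_nonneg (fun r => (hdH r).differentiableAt)
    fun r => by rw [(hdH r).deriv]; exact h0 r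
  have hH0 : H 0 = 0 := by simp [hH]
  have hK0 : K 0 = 0 := by simp [hK]
  have hH2 : H 2 = 2 := hm
  have hK2 : K 2 = 2 := hn
  have hHl : ∀ r ∈ Icc 0 (rho A), H r = 0 := by
    intro r hr
    simp only [hH]
    rw [intervalIntegral.integral_congr (g := fun _ => (0 : ℝ))]
    · simp
    · intro x hx
      rw [uIcc_of_le hr.1] at hx
      exact hl x (hx.2.trans hr.2)
  have hKl : ∀ r ∈ Icc 0 (rho A), K r = 0 := by
    intro r hr
    simp only [hK]
    rw [intervalIntegral.integral_congr (g := fun _ => (0 : ℝ))]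
    · simp
    · intro x hx
      rw [uIcc_of_le hr.1] at hx
      simp [hl x (hx.2.trans hr.2)]
  have hHr : ∀ r, 9 / 5 ≤ r → H r = 2 := by
    intro r hr'
    rw [← hH2]
    have : H 2 + ∫ s in (2 : ℝ)..r, h s = H r :=
      intervalIntegral.integral_add_adjacent_intervals (hi _ _) (hi _ _)
    rw [← this, intervalIntegral.integral_congr (g := fun _ => (0 : ℝ))]
    · simp
    · intro x hx
      rw [mem_uIcc] at hx
      apply hr
      rcases hx with hx | hx <;> linarith
  have hKr : ∀ r, 9 / 5 ≤ r → K r = 2 := by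
    intro r hr'
    rw [← hK2]
    have : K 2 + ∫ s in (2 : ℝ)..r, s * h s = K r :=
      intervalIntegral.integral_add_adjacent_intervals (hj _ _) (hj _ _)
    rw [← this, intervalIntegral.integral_congr (g := fun _ => (0 : ℝ))]
    · simp
    · intro x hx
      rw [mem_uIcc] at hx
      have : h x = 0 := hr x (by rcases hx with hx | hx <;> linarith)
      simp [this]
  have hKnn : ∀ r, 0 ≤ r → 0 ≤ K r := fun r hr =>
    intervalIntegral.integral_nonneg hr fun x hx => mul_nonneg hx.1 (h0 x)
  have hKle : ∀ r, 0 ≤ r → K r ≤ r * H r := by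
    intro r hr
    simp only [hK, hH]
    rw [← intervalIntegral.integral_const_mul]
    apply intervalIntegral.integral_mono_on hr (hj _ _) ((hi _ _).const_mul r)
    intro x hx
    exact mul_le_mul_of_nonneg_right hx.2 (h0 x)
  have hu0 : u 0 = 0 := by simp [hu, hK0]
  have hu2 : u 2 = 0 := by simp only [hu, hH2, hK2]; norm_num
  have hule : ∀ r, 0 ≤ r → u r ≤ r := by
    intro r hr
    have := hKle r hr
    simp only [hu]; linarith
  -- Only the forced mass, at most `1/5`, lies in `[0, 1/5]`, so the slope is still at least `4/5`
  -- there.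
  have hu5 : ∀ r ∈ Icc (0 : ℝ) (1 / 5), r * (4 / 5) ≤ u r := by
    intro r hr
    have h1 := hHmono hr.2
    have h2 := hKnn r hr.1
    have h3 : H (1 / 5) ≤ 1 / 5 := hq
    simp only [hu]
    nlinarith [hr.1]
  have hconc : ConcaveOn ℝ (Icc 0 2) u := by
    apply AntitoneOn.concaveOn_of_deriv (convex_Icc 0 2) hu_smooth.continuous.continuousOn
      (fun r _ => (hdu r).differentiableAt.differentiableWithinAt)
    rw [hdu_eq]
    intro x _ y _ hxy
    have := hHmono hxy
    simp only; linarith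
  have hpos : ∀ r ∈ Ioo (0 : ℝ) 2, 0 < u r := by
    intro r hr
    rcases le_total r (1 / 5) with h' | h'
    · have := hu5 r ⟨hr.1.le, h'⟩
      linarith [hr.1]
    -- Beyond `1/5`, concavity keeps `u` above the chord from `(1/5, u(1/5))` to `(2, 0)`.
    · have h1 := hu5 (1 / 5) (by norm_num)
      have h2 := hconc.2 (show (1 / 5 : ℝ) ∈ Icc (0 : ℝ) 2 by norm_num)
        (show (2 : ℝ) ∈ Icc (0 : ℝ) 2 by norm_num)
        (show 0 ≤ (2 - r) / (9 / 5) from div_nonneg (by linarith [hr.2]) (by norm_num))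
        (show 0 ≤ (r - 1 / 5) / (9 / 5) from div_nonneg (by linarith) (by norm_num))
        (by ring)
      rw [hu2] at h2
      have h3 : ((2 - r) / (9 / 5)) • (1 / 5 : ℝ) + ((r - 1 / 5) / (9 / 5)) • (2 : ℝ) = r := by
        simp only [smul_eq_mul]; ring
      rw [h3] at h2
      simp only [smul_eq_mul, mul_zero, add_zero] at h2
      have h4 : 0 < (2 - r) / (9 / 5) * u (1 / 5) := by
        have : 0 < 2 - r := by linarith [hr.2]
        have : 0 < u (1 / 5) := by linarith
        positivity
      linarith
  refine ⟨u, hu_smooth.contDiffOn, hconc, hu0, hu2, ?_, ?_, ?_, hpos, ?_, ?_, ?_, ?_⟩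
  · have h1 := hu5 (1 / 5) (by norm_num)
    have h2 : u (1 / 5) ≤ sSup (u '' Icc 0 2) :=
      le_csSup (isCompact_Icc.image hu_smooth.continuous).bddAbove ⟨1 / 5, by norm_num, rfl⟩
    linarith
  · rw [(hdu 0).hasDerivWithinAt.derivWithin (uniqueDiffOn_Icc (by norm_num) 0 (by norm_num)),
      hH0]
    norm_num
  · rw [(hdu 2).hasDerivWithinAt.derivWithin (uniqueDiffOn_Icc (by norm_num) 2 (by norm_num)),
      hH2]
    norm_num
  · intro r hr
    have h1 := hHmono hr.2.le
    have h3 : H (1 / 5) ≤ 1 / 5 := hq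
    rw [(hdu r).deriv]
    linarith
  · intro r hr
    simp only [hu, hHl r ⟨hr.1, hr.2.le⟩, hKl r ⟨hr.1, hr.2.le⟩]
    ring
  · intro r hr
    simp only [hu, hHr r hr.1.le, hKr r hr.1.le]
    ring
  · intro r hr
    rw [hddu, neg_neg, le_div_iff₀ (hpos r hr)]
    refine le_trans ?_ (hf r hr.1)
    exact mul_le_mul_of_nonneg_left (hule r hr.1.le) (sq_nonneg _)

/-! ### Base warping functions -/

section BaseWarping

variable {η : ℝ → ℝ} {A : ℝ} {u : ℝ → ℝ}

lemma IsBaseWarping.contDiffOn_Ioo (hu : IsBaseWarping η A u) : ContDiffOn ℝ ∞ u (Ioo 0 2) :=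
  hu.smooth.mono Ioo_subset_Icc_self

lemma IsBaseWarping.continuousOn (hu : IsBaseWarping η A u) : ContinuousOn u (Icc 0 2) :=
  hu.smooth.continuousOn

lemma IsBaseWarping.hasDerivAt (hu : IsBaseWarping η A u) {r : ℝ} (hr : r ∈ Ioo (0 : ℝ) 2) :
    HasDerivAt u (deriv u r) r :=
  ((hu.contDiffOn_Ioo.contDiffAt (isOpen_Ioo.mem_nhds hr)).differentiableAt (by simp)).hasDerivAt

lemma IsBaseWarping.hasDerivAt_deriv (hu : IsBaseWarping η A u) {r : ℝ}
    (hr : r ∈ Ioo (0 : ℝ) 2) : HasDerivAt (deriv u) (deriv (deriv u) r) r := by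
  have h := ((contDiffOn_infty_iff_deriv_of_isOpen isOpen_Ioo).1 hu.contDiffOn_Ioo).2
  exact ((h.contDiffAt (isOpen_Ioo.mem_nhds hr)).differentiableAt (by simp)).hasDerivAt

lemma IsBaseWarping.deriv_near_zero (hu : IsBaseWarping η A u) {r : ℝ}
    (hr : r ∈ Ioo 0 (rho A)) : deriv u r = 1 := by
  have : u =ᶠ[𝓝 r] id := by
    filter_upwards [isOpen_Ioo.mem_nhds hr] with y hy
    exact hu.eq_left y ⟨hy.1.le, hy.2⟩
  rw [this.deriv_eq, deriv_id]

lemma IsBaseWarping.deriv_near_two (hu : IsBaseWarping η A u) {r : ℝ}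
    (hr : r ∈ Ioo (9 / 5 : ℝ) 2) : deriv u r = -1 := by
  have : u =ᶠ[𝓝 r] fun x => 2 - x := by
    filter_upwards [isOpen_Ioo.mem_nhds hr] with y hy
    exact hu.eq_right y ⟨hy.1, hy.2.le⟩
  rw [this.deriv_eq, deriv_const_sub, deriv_id'']

/-- By concavity `u'` decreases from `1` near the left end to `-1` near the right end. -/
lemma IsBaseWarping.abs_deriv_le (hu : IsBaseWarping η A u) {r : ℝ}
    (hr : r ∈ Ioo (0 : ℝ) 2) : |deriv u r| ≤ 1 := by
  have ha : AntitoneOn (deriv u) (Ioo 0 2) :=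
    (hu.concave.subset Ioo_subset_Icc_self (convex_Ioo 0 2)).antitoneOn_deriv
      fun x hx => (hu.hasDerivAt hx).differentiableAt
  have hρ := rho_pos A
  rw [abs_le]
  constructor
  · obtain ⟨y, hy, hy'⟩ := exists_between (max_lt hr.2 (by norm_num : (9 / 5 : ℝ) < 2))
    rw [max_lt_iff] at hy
    rw [← hu.deriv_near_two ⟨hy.2, hy'⟩]
    exact ha hr ⟨by linarith, hy'⟩ hy.1.le
  · obtain ⟨y, hy, hy'⟩ := exists_between (lt_min hr.1 hρ)
    rw [lt_min_iff] at hy'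
    rw [← hu.deriv_near_zero ⟨hy, hy'.2⟩]
    exact ha ⟨hy, hy'.1.trans hr.2⟩ hr hy'.1.le

lemma IsBaseWarping.abs_sub_le (hu : IsBaseWarping η A u) {x y : ℝ} (hx : x ∈ Icc (0 : ℝ) 2)
    (hy : y ∈ Icc (0 : ℝ) 2) : |u x - u y| ≤ |x - y| := by
  wlog hxy : y < x generalizing x y
  · rcases eq_or_lt_of_le (not_lt.1 hxy) with h | h
    · simp [h]
    · rw [abs_sub_comm, abs_sub_comm x]
      exact this hy hx h
  have hsub : Ioo y x ⊆ Ioo 0 2 := Ioo_subset_Ioo hy.1 hx.2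
  obtain ⟨c, hc, hc'⟩ := exists_deriv_eq_slope u hxy
    (hu.continuousOn.mono (Icc_subset_Icc hy.1 hx.2))
    (fun z hz => (hu.hasDerivAt (hsub hz)).differentiableAt.differentiableWithinAt)
  have h1 := hu.abs_deriv_le (hsub hc)
  have h2 : u x - u y = deriv u c * (x - y) := by
    rw [hc', div_mul_cancel₀]; linarith
  rw [h2, abs_mul]
  exact mul_le_of_le_one_left (abs_nonneg _) h1

lemma IsBaseWarping.nonneg (hu : IsBaseWarping η A u) {r : ℝ} (hr : r ∈ Icc (0 : ℝ) 2) :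
    0 ≤ u r := by
  rcases eq_or_lt_of_le hr.1 with rfl | h0
  · exact hu.zero_left.ge
  rcases eq_or_lt_of_le hr.2 with rfl | h2
  · exact hu.zero_right.ge
  exact (hu.pos r ⟨h0, h2⟩).le

lemma IsBaseWarping.le_self (hu : IsBaseWarping η A u) {r : ℝ} (hr : r ∈ Icc (0 : ℝ) 2) :
    u r ≤ r := by
  have := hu.abs_sub_le hr (show (0 : ℝ) ∈ Icc (0 : ℝ) 2 by norm_num)
  rw [hu.zero_left, sub_zero, sub_zero, abs_of_nonneg hr.1] at this
  exact (le_abs_self _).trans this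

lemma IsBaseWarping.le_two_sub (hu : IsBaseWarping η A u) {r : ℝ} (hr : r ∈ Icc (0 : ℝ) 2) :
    u r ≤ 2 - r := by
  have := hu.abs_sub_le hr (show (2 : ℝ) ∈ Icc (0 : ℝ) 2 by norm_num)
  rw [hu.zero_right, sub_zero, abs_sub_comm, abs_of_nonneg (by linarith [hr.2] : 0 ≤ 2 - r)] at this
  exact (le_abs_self _).trans this

/-- Concavity puts `u` above the chords joining a maximum point, of height at least `1/10`, to the
two zeros; each chord has horizontal extent at most 2. The bound does not depend on `A`, which is
what makes both the Lipschitz estimates and the area bound uniform. -/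
lemma IsBaseWarping.min_le (hu : IsBaseWarping η A u) {r : ℝ} (hr : r ∈ Icc (0 : ℝ) 2) :
    min r (2 - r) / 20 ≤ u r := by
  obtain ⟨m, hm, hmax⟩ := isCompact_Icc.exists_sSup_image_eq
    (nonempty_Icc.2 (by norm_num : (0 : ℝ) ≤ 2)) hu.continuousOn
  have hm1 : 1 / 10 ≤ u m := hmax ▸ hu.sup_ge
  have hm0 := (hu.le_self hm)
  have hm2 := (hu.le_two_sub hm)
  have h0m : 0 < m := by linarith
  have h2m : 0 < 2 - m := by linarith
  rcases le_total r m with h | h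
  · have h3 := hu.concave.2 (show (0 : ℝ) ∈ Icc (0 : ℝ) 2 by norm_num) hm
      (show 0 ≤ 1 - r / m by rw [sub_nonneg, div_le_one h0m]; exact h)
      (show 0 ≤ r / m from div_nonneg hr.1 h0m.le) (by ring)
    simp only [smul_eq_mul, hu.zero_left, mul_zero, zero_add, div_mul_cancel₀ _ h0m.ne'] at h3
    refine le_trans ?_ h3
    have h4 : r / 2 ≤ r / m := div_le_div_of_nonneg_left hr.1 h0m hm.2
    have h5 : min r (2 - r) ≤ r := min_le_left _ _
    nlinarith [hr.1]
  · have h3 := hu.concave.2 hm (show (2 : ℝ) ∈ Icc (0 : ℝ) 2 by norm_num)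
      (show 0 ≤ (2 - r) / (2 - m) from div_nonneg (by linarith [hr.2]) h2m.le)
      (show 0 ≤ (r - m) / (2 - m) from div_nonneg (by linarith) h2m.le)
      (by rw [← add_div, div_eq_one_iff_eq h2m.ne']; ring)
    have h6 : (2 - r) / (2 - m) * m + (r - m) / (2 - m) * 2 = r := by
      field_simp; ring
    simp only [smul_eq_mul, hu.zero_right, mul_zero, add_zero, h6] at h3
    refine le_trans ?_ h3
    have h4 : (2 - r) / 2 ≤ (2 - r) / (2 - m) :=
      div_le_div_of_nonneg_left (by linarith [hr.2]) h2m (by linarith)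
    have h5 : min r (2 - r) ≤ 2 - r := min_le_right _ _
    nlinarith [hr.2]

end BaseWarping

/-! ### Partial derivatives -/

lemma pd_congr {n : ℕ} {i : Fin n} {F G : (Fin n → ℝ) → ℝ} {x : Fin n → ℝ} (h : F =ᶠ[𝓝 x] G) :
    pd i F x = pd i G x := by
  unfold pd
  apply Filter.EventuallyEq.deriv_eq
  have hc : Tendsto (fun t => Function.update x i t) (𝓝 (x i)) (𝓝 x) := by
    have : Continuous fun t => Function.update x i t :=
      continuous_const.update i continuous_id
    simpa using this.tendsto (x i)
  exact hc.eventually h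

lemma pd_const {n : ℕ} (i : Fin n) (c : ℝ) (x : Fin n → ℝ) : pd i (fun _ => c) x = 0 := by
  simp [pd]

lemma pd_eval {n : ℕ} (i j : Fin n) (g : ℝ → ℝ) (x : Fin n → ℝ) :
    pd i (fun y => g (y j)) x = if i = j then deriv g (x j) else 0 := by
  unfold pd
  split_ifs with h
  · subst h; simp
  · simp [Function.update_of_ne (Ne.symm h)]

lemma isOpen_polarDom : IsOpen polarDom :=
  (isOpen_lt continuous_const (continuous_apply 0)).inter
    (isOpen_lt (continuous_apply 0) continuous_const)

/-! ### Curvature of constant and of warped metrics -/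

lemma christoffel_eq_zero {G : (Fin 3 → ℝ) → Matrix (Fin 3) (Fin 3) ℝ} {D : Set (Fin 3 → ℝ)}
    (hD : IsOpen D) {C : Matrix (Fin 3) (Fin 3) ℝ} (hG : ∀ x ∈ D, G x = C) (k i j : Fin 3)
    {x : Fin 3 → ℝ} (hx : x ∈ D) : christoffel G k i j x = 0 := by
  have h : ∀ a b l : Fin 3, pd l (fun y => G y a b) x = 0 := by
    intro a b l
    rw [← pd_const l (C a b) x]
    apply pd_congr
    filter_upwards [hD.mem_nhds hx] with y hy
    rw [hG y hy]
  simp [christoffel, h]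

lemma scalarCurvature_eq_zero {G : (Fin 3 → ℝ) → Matrix (Fin 3) (Fin 3) ℝ}
    {D : Set (Fin 3 → ℝ)} (hD : IsOpen D) {C : Matrix (Fin 3) (Fin 3) ℝ}
    (hG : ∀ x ∈ D, G x = C) {x : Fin 3 → ℝ} (hx : x ∈ D) : scalarCurvature G x = 0 := by
  have h : ∀ a b l m : Fin 3, pd l (christoffel G m a b) x = 0 := by
    intro a b l m
    rw [← pd_const l 0 x]
    apply pd_congr
    filter_upwards [hD.mem_nhds hx] with y hy
    exact christoffel_eq_zero hD hG _ _ _ hy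
  simp [scalarCurvature, ricci, h, christoffel_eq_zero hD hG _ _ _ hx]

section Warped

variable {φ u p q : ℝ → ℝ}

/-- The Christoffel symbols of `φ⁻² (dr² + u² dθ²) + φ² dξ²`, where `φ' = φ q` and `u' = p`. -/
def polarGamma (φ u p q : ℝ → ℝ) (r : ℝ) : Fin 3 → Fin 3 → Fin 3 → ℝ :=
  ![![![-q r, 0, 0], ![0, q r * u r ^ 2 - u r * p r, 0], ![0, 0, -(q r * φ r ^ 4)]],
    ![![0, p r / u r - q r, 0], ![p r / u r - q r, 0, 0], ![0, 0, 0]],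
    ![![0, 0, q r], ![0, 0, 0], ![q r, 0, 0]]]

lemma polarMetric_inv {x : Fin 3 → ℝ} (hφ : 0 < φ (x 0)) (hu : 0 < u (x 0)) :
    (polarMetric φ u x)⁻¹ =
      Matrix.diagonal ![φ (x 0) ^ 2, φ (x 0) ^ 2 / u (x 0) ^ 2, (φ (x 0) ^ 2)⁻¹] := by
  apply Matrix.inv_eq_right_inv
  rw [polarMetric, Matrix.diagonal_mul_diagonal, ← Matrix.diagonal_one]
  congr 1
  ext i
  fin_cases i <;> simp <;> field_simp

lemma christoffel_polarMetric (hφ : ∀ r ∈ Ioo (0 : ℝ) 2, 0 < φ r)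
    (hu : ∀ r ∈ Ioo (0 : ℝ) 2, 0 < u r)
    (hφ' : ∀ r ∈ Ioo (0 : ℝ) 2, HasDerivAt φ (φ r * q r) r)
    (hu' : ∀ r ∈ Ioo (0 : ℝ) 2, HasDerivAt u (p r) r) {x : Fin 3 → ℝ} (hx : x ∈ polarDom)
    (k i j : Fin 3) :
    christoffel (polarMetric φ u) k i j x = polarGamma φ u p q (x 0) k i j := by
  have hφ0 := hφ _ hx
  have hu0 := hu _ hx
  have hφ1 := hφ' _ hx
  have hu1 := hu' _ hx
  have d0 : HasDerivAt (fun r => (φ r ^ 2)⁻¹) (-(2 * q (x 0)) / φ (x 0) ^ 2) (x 0) := by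
    have := (hφ1.pow 2).inv (pow_pos hφ0 2).ne'
    refine this.congr_deriv ?_
    simp; field_simp
  have d1 : HasDerivAt (fun r => (φ r ^ 2)⁻¹ * u r ^ 2)
      ((2 * u (x 0) * p (x 0) - 2 * q (x 0) * u (x 0) ^ 2) / φ (x 0) ^ 2) (x 0) := by
    have := d0.mul (hu1.pow 2)
    refine this.congr_deriv ?_
    simp; field_simp; ring
  have d2 : HasDerivAt (fun r => φ r ^ 2) (2 * q (x 0) * φ (x 0) ^ 2) (x 0) := by
    refine (hφ1.pow 2).congr_deriv ?_
    simp; ring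
  have hm : ∀ l a b : Fin 3, pd l (fun y => polarMetric φ u y a b) x =
      if l = 0 then Matrix.diagonal ![-(2 * q (x 0)) / φ (x 0) ^ 2,
        (2 * u (x 0) * p (x 0) - 2 * q (x 0) * u (x 0) ^ 2) / φ (x 0) ^ 2,
        2 * q (x 0) * φ (x 0) ^ 2] a b else 0 := by
    intro l a b
    have h00 := pd_eval l 0 (fun r => (φ r ^ 2)⁻¹) x
    have h11 := pd_eval l 0 (fun r => (φ r ^ 2)⁻¹ * u r ^ 2) x
    have h22 := pd_eval l 0 (fun r => φ r ^ 2) x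
    rw [d0.deriv] at h00
    rw [d1.deriv] at h11
    rw [d2.deriv] at h22
    fin_cases a <;> fin_cases b <;>
      simp [polarMetric, Matrix.diagonal, pd_const, h00, h11, h22]
  unfold christoffel
  simp only [hm, polarMetric_inv hφ0 hu0, Fin.sum_univ_three]
  fin_cases k <;> fin_cases i <;> fin_cases j <;>
    simp [Matrix.diagonal, polarGamma] <;> field_simp <;> ring

/-- The factor `φ⁻²` on the base and `φ²` on the fibre are matched so that `q'` cancels; only the
Gauss curvature `-u''/u` of the base and the square of `q = (log φ)'` survive. -/
lemma scalarCurvature_polarMetric (hφ : ∀ r ∈ Ioo (0 : ℝ) 2, 0 < φ r)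
    (hu : ∀ r ∈ Ioo (0 : ℝ) 2, 0 < u r)
    (hφ' : ∀ r ∈ Ioo (0 : ℝ) 2, HasDerivAt φ (φ r * q r) r)
    (hu' : ∀ r ∈ Ioo (0 : ℝ) 2, HasDerivAt u (p r) r) {x : Fin 3 → ℝ} (hx : x ∈ polarDom)
    {p' q' : ℝ} (hp : HasDerivAt p p' (x 0)) (hq : HasDerivAt q q' (x 0)) :
    scalarCurvature (polarMetric φ u) x
      = 2 * φ (x 0) ^ 2 * (-p' / u (x 0) - q (x 0) ^ 2) := by
  have hφ0 := hφ _ hx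
  have hu0 := hu _ hx
  have hφ1 := hφ' _ hx
  have hu1 := hu' _ hx
  have d11 : HasDerivAt (fun r => q r * u r ^ 2 - u r * p r)
      (q' * u (x 0) ^ 2 + q (x 0) * (2 * u (x 0) * p (x 0)) -
        (p (x 0) * p (x 0) + u (x 0) * p')) (x 0) := by
    refine ((hq.mul (hu1.pow 2)).sub (hu1.mul hp)).congr_deriv ?_
    simp
  have d22 : HasDerivAt (fun r => -(q r * φ r ^ 4))
      (-(q' * φ (x 0) ^ 4 + q (x 0) * (4 * φ (x 0) ^ 3 * (φ (x 0) * q (x 0))))) (x 0) := by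
    refine ((hq.mul (hφ1.pow 4)).neg).congr_deriv ?_
    simp
  have d01 : HasDerivAt (fun r => p r / u r - q r)
      ((p' * u (x 0) - p (x 0) * p (x 0)) / u (x 0) ^ 2 - q') (x 0) :=
    (hp.div hu1 hu0.ne').sub hq
  have hm : ∀ l k i j : Fin 3, pd l (christoffel (polarMetric φ u) k i j) x =
      if l = 0 then deriv (fun r => polarGamma φ u p q r k i j) (x 0) else 0 := by
    intro l k i j
    rw [← pd_eval l 0 (fun r => polarGamma φ u p q r k i j) x]
    apply pd_congr
    filter_upwards [isOpen_polarDom.mem_nhds hx] with y hy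
    exact christoffel_polarMetric hφ hu hφ' hu' hy k i j
  unfold scalarCurvature ricci
  simp only [hm, christoffel_polarMetric hφ hu hφ' hu' hx, polarMetric_inv hφ0 hu0,
    Fin.sum_univ_three]
  have e11 := d11.deriv
  have e22 := d22.deriv
  have e01 := d01.deriv
  have eq := hq.deriv
  simp [Matrix.diagonal, polarGamma, e11, e22, e01, eq]
  field_simp
  ring

end Warped

/-! ### The metric of the example is smooth, with nonnegative scalar curvature -/

section

variable {η : ℝ → ℝ} {A : ℝ} {φ u : ℝ → ℝ}

lemma posDef_diagonal {d : Fin 3 → ℝ} (h : ∀ i, 0 < d i) : (Matrix.diagonal d).PosDef :=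
  Matrix.PosDef.diagonal h

lemma polarMetric_smooth (hφ : ContDiffOn ℝ ∞ φ (Ioo 0 2)) (hφ0 : ∀ r ∈ Ioo (0 : ℝ) 2, 0 < φ r)
    (hu : ContDiffOn ℝ ∞ u (Ioo 0 2)) (i j : Fin 3) :
    ContDiffOn ℝ ∞ (fun x => polarMetric φ u x i j) polarDom := by
  have h0 : ContDiffOn ℝ ∞ (fun x : Fin 3 → ℝ => x 0) polarDom := (contDiff_apply ℝ ℝ 0).contDiffOn
  have hm : MapsTo (fun x : Fin 3 → ℝ => x 0) polarDom (Ioo 0 2) := fun x hx => hx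
  have h1 : ContDiffOn ℝ ∞ (fun x : Fin 3 → ℝ => φ (x 0)) polarDom := hφ.comp h0 hm
  have h2 : ContDiffOn ℝ ∞ (fun x : Fin 3 → ℝ => u (x 0)) polarDom := hu.comp h0 hm
  have h3 : ContDiffOn ℝ ∞ (fun x : Fin 3 → ℝ => (φ (x 0) ^ 2)⁻¹) polarDom :=
    (h1.pow 2).inv fun x hx => (pow_pos (hφ0 _ hx) 2).ne'
  have h4 : ContDiffOn ℝ ∞ (fun x : Fin 3 → ℝ => (φ (x 0) ^ 2)⁻¹ * u (x 0) ^ 2) polarDom :=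
    h3.mul (h2.pow 2)
  fin_cases i <;> fin_cases j <;>
    simp [polarMetric, Matrix.diagonal, contDiffOn_const, h3, h4, h1.pow 2]

lemma polarMetric_posDef (hφ0 : ∀ r ∈ Ioo (0 : ℝ) 2, 0 < φ r)
    (hu0 : ∀ r ∈ Ioo (0 : ℝ) 2, 0 < u r) {x : Fin 3 → ℝ} (hx : x ∈ polarDom) :
    (polarMetric φ u x).PosDef := by
  have h1 := hφ0 _ hx
  have h2 := hu0 _ hx
  apply posDef_diagonal
  intro i
  fin_cases i <;> simp <;> positivity

/-- With `u(s) = s` the correction `k` to the flat base vanishes identically. Near both poles the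
metric is thus constant, so smoothness across the poles and zero curvature come for free. -/
lemma capMetric_eq {a c : ℝ} (hφ : ∀ s ∈ Ico 0 a, φ s = c) (hu : ∀ s ∈ Ico 0 a, u s = s)
    (ha : 0 < a) {x : Fin 3 → ℝ} (hx : x 0 ^ 2 + x 1 ^ 2 < a ^ 2) :
    capMetric φ u x = Matrix.diagonal ![(c ^ 2)⁻¹, (c ^ 2)⁻¹, c ^ 2] := by
  have hs : capRadius x ∈ Ico 0 a := by
    refine ⟨Real.sqrt_nonneg _, ?_⟩
    rw [capRadius, Real.sqrt_lt' ha]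
    exact hx
  unfold capMetric
  simp only [hφ _ hs, hu _ hs]
  ext i j
  fin_cases i <;> fin_cases j <;> simp [Matrix.diagonal]

lemma isOpen_capDom (a : ℝ) : IsOpen {x : Fin 3 → ℝ | x 0 ^ 2 + x 1 ^ 2 < a ^ 2} :=
  isOpen_lt (by fun_prop) continuous_const

variable (hη : IsCutoff η) (hA : 10 ≤ A) (hu : IsBaseWarping η A u)

include hη hu in
lemma northChart_metric {x : Fin 3 → ℝ} (hx : x ∈ (northChart (phiFun η A) u (rho A)).dom) :
    (northChart (phiFun η A) u (rho A)).metric x =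
      Matrix.diagonal ![(Real.exp (-A) ^ 2)⁻¹, (Real.exp (-A) ^ 2)⁻¹, Real.exp (-A) ^ 2] :=
  capMetric_eq (fun _ hs => phiFun_left hη hs.1 hs.2.le) (fun s hs => hu.eq_left s hs)
    (rho_pos A) hx

include hη hA hu in
lemma southChart_metric {x : Fin 3 → ℝ} (hx : x ∈ (southChart (phiFun η A) u (1 / 5)).dom) :
    (southChart (phiFun η A) u (1 / 5)).metric x = 1 := by
  have h := capMetric_eq (φ := fun s => phiFun η A (2 - s)) (u := fun s => u (2 - s)) (c := 1)
    (a := 1 / 5) (x := x)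
    (fun s hs => phiFun_right hη hA (by linarith [hs.2]))
    (fun s hs => by
      show u (2 - s) = s
      rw [hu.eq_right (2 - s) ⟨by linarith [hs.2], by linarith [hs.1]⟩]; ring) (by norm_num) hx
  refine h.trans ?_
  ext i j
  fin_cases i <;> fin_cases j <;> simp

include hη hA hu

theorem isSmoothMetric_example : IsSmoothMetric (exampleMetric η A u) := by
  intro c hc
  rcases hc with rfl | rfl | rfl
  · exact ⟨polarMetric_smooth ((phiFun_contDiffOn hη).mono Ioo_subset_Ioi_self)
      (fun r _ => phiFun_pos η A r) hu.contDiffOn_Ioo,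
      fun x hx => polarMetric_posDef (fun r _ => phiFun_pos η A r) hu.pos hx⟩
  · constructor
    · intro i j
      exact contDiffOn_const.congr fun x hx => by rw [northChart_metric hη hu hx]
    · intro x hx
      rw [northChart_metric hη hu hx]
      apply posDef_diagonal
      intro i
      fin_cases i <;> simp <;> positivity
  · constructor
    · intro i j
      exact contDiffOn_const.congr fun x hx => by rw [southChart_metric hη hA hu hx]
    · intro x hx
      rw [southChart_metric hη hA hu hx]
      exact Matrix.PosDef.one

theorem nonnegScalar_example : NonnegScalar (exampleMetric η A u) := by
  intro c hc
  rcases hc with rfl | rfl | rfl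
  · intro x hx
    have hq : HasDerivAt (deriv (fFun η A)) (deriv (deriv (fFun η A)) (x 0)) (x 0) := by
      have h := ((contDiffOn_infty_iff_deriv_of_isOpen isOpen_Ioi).1
        (fFun_contDiffOn (A := A) hη)).2
      exact ((h.contDiffAt (Ioi_mem_nhds hx.1)).differentiableAt (by simp)).hasDerivAt
    have h := scalarCurvature_polarMetric (fun r _ => phiFun_pos η A r) hu.pos
      (fun r hr => hasDerivAt_phiFun (A := A) hη hr.1) (fun r hr => hu.hasDerivAt hr) hx
      (hu.hasDerivAt_deriv hx) hq
    refine le_of_le_of_eq ?_ h.symm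
    have h1 := hu.ineq _ hx
    have h2 := phiFun_pos η A (x 0)
    apply mul_nonneg (by positivity)
    linarith
  · intro x hx
    exact (scalarCurvature_eq_zero (isOpen_capDom _)
      (fun y hy => northChart_metric hη hu hy) hx).ge
  · intro x hx
    exact (scalarCurvature_eq_zero (isOpen_capDom _)
      (fun y hy => southChart_metric hη hA hu hy) hx).ge

/-! ### Volume -/

/-- For `r ≤ 1/10` the exponent satisfies `λ ≤ 1`, hence `φ⁻¹ ≤ (10r)⁻¹`, and the factor `u ≤ r`
absorbs this singularity. The product is the volume density. -/
lemma self_mul_inv_phiFun_le {r : ℝ} (hr : r ∈ Ioo (0 : ℝ) 2) :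
    u r * (phiFun η A r)⁻¹ ≤ 2 := by
  have hle := hu.le_self ⟨hr.1.le, hr.2.le⟩
  have hφ := phiFun_pos η A r
  rcases le_total r (1 / 10) with h | h
  · have h1 := inv_phiFun_le hη hA hr.1 h
    have h2 : (10 * r) ^ (-lam η A) ≤ (10 * r) ^ (-1 : ℝ) :=
      Real.rpow_le_rpow_of_exponent_ge (by linarith [hr.1]) (by linarith)
        (by linarith [lam_le_half hη hA])
    rw [Real.rpow_neg_one] at h2
    calc u r * (phiFun η A r)⁻¹ ≤ r * (10 * r)⁻¹ :=
          mul_le_mul hle (h1.trans h2) (by positivity) hr.1.le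
      _ = 1 / 10 := by have := hr.1; field_simp
      _ ≤ 2 := by norm_num
  · rw [phiFun_right hη hA h]
    linarith [hr.2]

theorem warpedVolume_le :
    warpedVolume (phiFun η A) u ≤ ENNReal.ofReal (2 * (2 * (2 * Real.pi) * (2 * Real.pi))) := by
  unfold warpedVolume
  set D : Set (Fin 3 → ℝ) := {x | x 0 ∈ Ioo 0 2 ∧ x 1 ∈ Ioo 0 (2 * Real.pi) ∧
      x 2 ∈ Ioo 0 (2 * Real.pi)} with hD
  have hDpi : D = Set.pi univ ![Ioo 0 2, Ioo 0 (2 * Real.pi), Ioo 0 (2 * Real.pi)] := by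
    ext x
    simp [hD, Set.mem_pi, Fin.forall_fin_succ]
  have hDm : MeasurableSet D := by
    rw [hDpi]
    refine MeasurableSet.univ_pi fun i => ?_
    fin_cases i <;> exact measurableSet_Ioo
  have hvol : volume D = ENNReal.ofReal (2 * (2 * Real.pi) * (2 * Real.pi)) := by
    rw [hDpi, volume_pi_pi, Fin.prod_univ_three]
    have := Real.pi_pos
    rw [ENNReal.ofReal_mul (by positivity), ENNReal.ofReal_mul (by positivity)]
    simp
  calc ∫⁻ x in D, ENNReal.ofReal (√(polarMetric (phiFun η A) u x).det)
      ≤ ∫⁻ _ in D, ENNReal.ofReal 2 := by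
        apply setLIntegral_mono measurable_const
        intro x hx
        apply ENNReal.ofReal_le_ofReal
        have hφ := phiFun_pos η A (x 0)
        have hu0 := hu.pos _ hx.1
        refine le_trans (le_of_eq ?_) (self_mul_inv_phiFun_le hη hA hu hx.1)
        rw [polarMetric, Matrix.det_diagonal, Fin.prod_univ_three,
          Real.sqrt_eq_iff_mul_self_eq_of_pos (by positivity)]
        simp
        field_simp
    _ = ENNReal.ofReal (2 * (2 * (2 * Real.pi) * (2 * Real.pi))) := by
        rw [setLIntegral_const, hvol, ← ENNReal.ofReal_mul (by norm_num)]

end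

/-! ### Lengths of curves and the length distance -/

section Length

variable {X : Type*} {𝒜 : Set (Chart X)} {p q s : X} {ℓ : ℝ}

lemma HasCurve.nonneg (h : HasCurve 𝒜 p q ℓ) : 0 ≤ ℓ := by
  induction h with
  | piece c hc γ hγ hdom =>
    exact intervalIntegral.integral_nonneg (by norm_num) fun t _ => Real.sqrt_nonneg _
  | trans _ _ h1 h2 => exact add_nonneg h1 h2

lemma HasCurve.symm (h : HasCurve 𝒜 p q ℓ) : HasCurve 𝒜 q p ℓ := by
  induction h with
  | piece c hc γ hγ hdom =>
    have h := HasCurve.piece (𝒜 := 𝒜) c hc (fun t => γ (1 - t))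
      (hγ.comp (contDiff_const.sub contDiff_id)) fun t ht => hdom _ ⟨by linarith [ht.2],
        by linarith [ht.1]⟩
    have hd : ∀ t, deriv (fun t => γ (1 - t)) t = - deriv γ (1 - t) := fun t =>
      deriv_comp_const_sub γ 1 t
    simp only [hd, sub_self, sub_zero, Matrix.mulVec_neg, neg_dotProduct_neg] at h
    rwa [intervalIntegral.integral_comp_sub_left
      (fun t => √(deriv γ t ⬝ᵥ (c.metric (γ t) *ᵥ deriv γ t))) 1, sub_zero, sub_self] at h
  | trans _ _ h1 h2 => rw [add_comm]; exact h2.trans h1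

lemma HasCurve.refl_of_chart {c : Chart X} (hc : c ∈ 𝒜) {x : Fin 3 → ℝ} (hx : x ∈ c.dom) :
    HasCurve 𝒜 (c.map x) (c.map x) 0 := by
  simpa using HasCurve.piece (𝒜 := 𝒜) c hc (fun _ => x) contDiff_const fun _ _ => hx

lemma bddBelow_lengths (𝒜 : Set (Chart X)) (p q : X) : BddBelow {ℓ | HasCurve 𝒜 p q ℓ} :=
  ⟨0, fun _ h => HasCurve.nonneg h⟩

lemma riemDist_le (h : HasCurve 𝒜 p q ℓ) : riemDist 𝒜 p q ≤ ℓ :=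
  csInf_le (bddBelow_lengths 𝒜 p q) h

lemma riemDist_nonneg (𝒜 : Set (Chart X)) (p q : X) : 0 ≤ riemDist 𝒜 p q :=
  Real.sInf_nonneg fun _ h => HasCurve.nonneg h

lemma riemDist_comm (𝒜 : Set (Chart X)) (p q : X) : riemDist 𝒜 p q = riemDist 𝒜 q p := by
  unfold riemDist
  congr 1
  ext ℓ
  exact ⟨HasCurve.symm, HasCurve.symm⟩

/-- The connecting curves have to be supplied: with `sInf ∅ = 0`, unconnected points would be at
distance zero and the inequality could fail. -/
lemma riemDist_triangle (h : ∃ ℓ, HasCurve 𝒜 p q ℓ) (h' : ∃ ℓ, HasCurve 𝒜 q s ℓ) :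
    riemDist 𝒜 p s ≤ riemDist 𝒜 p q + riemDist 𝒜 q s := by
  apply le_of_forall_pos_le_add
  intro ε hε
  obtain ⟨a, ha, ha'⟩ := exists_lt_of_csInf_lt (s := {ℓ | HasCurve 𝒜 p q ℓ}) h
    (lt_add_of_pos_right (riemDist 𝒜 p q) (half_pos hε))
  obtain ⟨b, hb, hb'⟩ := exists_lt_of_csInf_lt (s := {ℓ | HasCurve 𝒜 q s ℓ}) h'
    (lt_add_of_pos_right (riemDist 𝒜 q s) (half_pos hε))
  have := riemDist_le (HasCurve.trans ha hb)
  linarith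

/-- A function that is `C`-Lipschitz along the curves in each chart is `C`-Lipschitz for the length
distance. -/
lemma HasCurve.norm_sub_le {E : Type*} [SeminormedAddCommGroup E] {h : X → E} {C : ℝ}
    (hC : ∀ c ∈ 𝒜, ∀ γ : ℝ → Fin 3 → ℝ, ContDiff ℝ 1 γ → (∀ t ∈ Icc (0 : ℝ) 1, γ t ∈ c.dom) →
      ‖h (c.map (γ 1)) - h (c.map (γ 0))‖ ≤
        C * ∫ t in (0 : ℝ)..1, √(deriv γ t ⬝ᵥ (c.metric (γ t) *ᵥ deriv γ t)))
    (hpq : HasCurve 𝒜 p q ℓ) : ‖h q - h p‖ ≤ C * ℓ := by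
  induction hpq with
  | piece c hc γ hγ hdom => exact hC c hc γ hγ hdom
  | @trans p q s _ _ _ _ h1 h2 =>
    rw [mul_add, ← sub_add_sub_cancel (h s) (h q) (h p), add_comm (C * _)]
    exact (norm_add_le _ _).trans (add_le_add h2 h1)

lemma norm_sub_le_of_lengths {E : Type*} [SeminormedAddCommGroup E] {h : X → E} {C : ℝ}
    (hC0 : 0 < C) (hC : ∀ ℓ, HasCurve 𝒜 p q ℓ → ‖h q - h p‖ ≤ C * ℓ)
    (hne : ∃ ℓ, HasCurve 𝒜 p q ℓ) : ‖h q - h p‖ ≤ C * riemDist 𝒜 p q := by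
  rw [← div_le_iff₀' hC0]
  apply le_csInf hne
  intro ℓ hℓ
  rw [div_le_iff₀' hC0]
  exact hC ℓ hℓ

lemma norm_sub_le_integral {E : Type*} [NormedAddCommGroup E] [NormedSpace ℝ E]
    {w w' : ℝ → E} {b : ℝ → ℝ} {C : ℝ} (hw : ∀ t ∈ Icc (0 : ℝ) 1, HasDerivAt w (w' t) t)
    (hb : ContinuousOn b (Icc 0 1)) (hwb : ∀ t ∈ Icc (0 : ℝ) 1, ‖w' t‖ ≤ C * b t) :
    ‖w 1 - w 0‖ ≤ C * ∫ t in (0 : ℝ)..1, b t := by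
  rw [← intervalIntegral.integral_const_mul]
  have hbi : IntervalIntegrable (fun t => C * b t) volume 0 1 := by
    apply ContinuousOn.intervalIntegrable
    rw [uIcc_of_le zero_le_one]
    exact continuousOn_const.mul hb
  exact norm_sub_le_integral_of_norm_deriv_le_of_le zero_le_one
    (fun t ht => (hw t ht).continuousAt.continuousWithinAt)
    (fun t ht => (hw t (Ioo_subset_Icc_self ht)).differentiableAt.differentiableWithinAt)
    (Eventually.of_forall fun t ht => by
      rw [(hw t (Ioo_subset_Icc_self ht)).deriv]
      exact hwb t (Ioo_subset_Icc_self ht)) hbi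

end Length

/-! ### Coordinate functions on `S² × S¹` -/

/-- The horizontal coordinates of the `S²`-component, as a complex number. -/
def horiz (p : M) : ℂ := ⟨p.1.1 0, p.1.1 1⟩

/-- The vertical coordinate of the `S²`-component. -/
def height (p : M) : ℝ := p.1.1 2

/-- The distance `r ∈ [0, 2]` to the pole, as a function on `S² × S¹`. -/
def rad (p : M) : ℝ := 2 / Real.pi * Real.arccos (height p)

lemma height_polarMap (x : Fin 3 → ℝ) :
    height (polarMap x) = Real.cos (Real.pi / 2 * x 0) := by
  simp [height, polarMap, spherePoint]

lemma horiz_polarMap (x : Fin 3 → ℝ) : horiz (polarMap x)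
    = (Real.sin (Real.pi / 2 * x 0) : ℂ) * Complex.exp (x 1 * Complex.I) := by
  apply Complex.ext
  · simp [horiz, polarMap, spherePoint, Complex.exp_ofReal_mul_I_re, Complex.exp_ofReal_mul_I_im,
      -Complex.ofReal_sin]
  · simp [horiz, polarMap, spherePoint, Complex.exp_ofReal_mul_I_re, Complex.exp_ofReal_mul_I_im,
      -Complex.ofReal_sin]

lemma rad_polarMap {x : Fin 3 → ℝ} (hx : x 0 ∈ Icc (0 : ℝ) 2) : rad (polarMap x) = x 0 := by
  have hπ := Real.pi_pos
  rw [rad, height_polarMap, Real.arccos_cos (by have := hx.1; positivity) (by nlinarith [hx.2])]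
  field_simp

lemma snd_polarMap (x : Fin 3 → ℝ) :
    ((polarMap x).2 : ℂ) = Complex.exp (x 2 * Complex.I) := by
  simp [polarMap]

lemma M_ext {p q : M} (h1 : horiz p = horiz q) (h2 : height p = height q) (h3 : p.2 = q.2) :
    p = q := by
  have h4 := congrArg Complex.re h1
  have h5 := congrArg Complex.im h1
  refine Prod.ext (Subtype.ext ?_) h3
  ext i
  fin_cases i
  · exact h4
  · exact h5
  · exact h2

lemma continuous_height : Continuous height := by
  unfold height
  fun_prop

lemma continuous_rad : Continuous rad :=
  continuous_const.mul (Real.continuous_arccos.comp continuous_height)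

lemma height_mem (p : M) : height p ∈ Icc (-1 : ℝ) 1 := by
  have h : ‖p.1.1‖ = 1 := by simp
  rw [mem_Icc, ← abs_le, ← Real.norm_eq_abs, ← h]
  exact PiLp.norm_apply_le p.1.1 2

lemma rad_mem (p : M) : rad p ∈ Icc (0 : ℝ) 2 := by
  have hπ := Real.pi_pos
  constructor
  · exact mul_nonneg (by positivity) (Real.arccos_nonneg _)
  · have := Real.arccos_le_pi (height p)
    calc rad p ≤ 2 / Real.pi * Real.pi := by unfold rad; gcongr
      _ = 2 := by field_simp

lemma exists_polarMap (p : M) : ∃ x : Fin 3 → ℝ, x 0 = rad p ∧ x 1 ∈ Ioc (-Real.pi) Real.pi ∧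
    x 2 ∈ Ioc (-Real.pi) Real.pi ∧ polarMap x = p := by
  have hπ := Real.pi_pos
  have hcos : Real.cos (Real.pi / 2 * rad p) = height p := by
    have : Real.pi / 2 * rad p = Real.arccos (height p) := by unfold rad; field_simp
    rw [this, Real.cos_arccos (height_mem p).1 (height_mem p).2]
  have hsin0 : 0 ≤ Real.sin (Real.pi / 2 * rad p) := by
    apply Real.sin_nonneg_of_nonneg_of_le_pi
    · have := (rad_mem p).1; positivity
    · nlinarith [(rad_mem p).2]
  have hnorm : ‖horiz p‖ = Real.sin (Real.pi / 2 * rad p) := by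
    have h : ‖p.1.1‖ = 1 := by simp
    rw [EuclideanSpace.norm_eq, Real.sqrt_eq_one, Fin.sum_univ_three] at h
    simp only [Real.norm_eq_abs, sq_abs] at h
    rw [Complex.norm_eq_sqrt_sq_add_sq, Real.sqrt_eq_iff_eq_sq (by positivity) hsin0,
      Real.sin_sq, hcos]
    simp only [horiz, height]
    linarith
  refine ⟨![rad p, Complex.arg (horiz p), Complex.arg (p.2 : ℂ)], rfl,
    Complex.arg_mem_Ioc _, Complex.arg_mem_Ioc _, M_ext ?_ ?_ ?_⟩
  · rw [horiz_polarMap]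
    simp only [Matrix.cons_val_zero, Matrix.cons_val_one]
    rw [← hnorm, Complex.norm_mul_exp_arg_mul_I]
  · rw [height_polarMap]
    exact hcos
  · show Circle.exp (Complex.arg (p.2 : ℂ)) = p.2
    exact Circle.exp_arg p.2

lemma mem_regularPart_iff (p : M) : p ∈ regularPart ↔ rad p ∈ Ioo (0 : ℝ) 2 := by
  constructor
  · rintro ⟨x, hx, rfl⟩
    rw [rad_polarMap ⟨hx.1.le, hx.2.le⟩]
    exact hx
  · intro h
    obtain ⟨x, hx, -, -, rfl⟩ := exists_polarMap p
    exact ⟨x, ⟨hx ▸ h.1, hx ▸ h.2⟩, rfl⟩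

/-! ### Lower bounds for lengths -/

lemma dotProduct_diagonal (d v : Fin 3 → ℝ) :
    v ⬝ᵥ (Matrix.diagonal d *ᵥ v) = d 0 * v 0 ^ 2 + d 1 * v 1 ^ 2 + d 2 * v 2 ^ 2 := by
  simp only [dotProduct, Matrix.mulVec_diagonal, Fin.sum_univ_three]
  ring

lemma sqrt_mul_abs_le_sqrt_dotProduct {d : Fin 3 → ℝ} (hd : ∀ i, 0 ≤ d i) (v : Fin 3 → ℝ)
    (i : Fin 3) : √(d i) * |v i| ≤ √(v ⬝ᵥ (Matrix.diagonal d *ᵥ v)) := by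
  rw [← Real.sqrt_sq_eq_abs, ← Real.sqrt_mul (hd i)]
  apply Real.sqrt_le_sqrt
  rw [dotProduct_diagonal]
  have h : ∀ j, 0 ≤ d j * v j ^ 2 := fun j => mul_nonneg (hd j) (sq_nonneg _)
  have h0 := h 0
  have h1 := h 1
  have h2 := h 2
  fin_cases i <;> simp <;> linarith

lemma sqrt_dotProduct_le {d : Fin 3 → ℝ} (hd : ∀ i, 0 ≤ d i) (v : Fin 3 → ℝ) :
    √(v ⬝ᵥ (Matrix.diagonal d *ᵥ v)) ≤ √(d 0) * |v 0| + √(d 1) * |v 1| + √(d 2) * |v 2| := by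
  rw [dotProduct_diagonal]
  have h : ∀ i, d i * v i ^ 2 = (√(d i) * |v i|) ^ 2 := fun i => by
    rw [mul_pow, Real.sq_sqrt (hd i), sq_abs]
  have hn : ∀ i, 0 ≤ √(d i) * |v i| := fun i => by positivity
  rw [h 0, h 1, h 2]
  have h0 := hn 0
  have h1 := hn 1
  have h2 := hn 2
  refine Real.sqrt_le_iff.2 ⟨by positivity, ?_⟩
  nlinarith [mul_nonneg h0 h1, mul_nonneg h0 h2, mul_nonneg h1 h2]

section PolarLength

variable {φ u : ℝ → ℝ} {γ : ℝ → Fin 3 → ℝ}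

lemma hasDerivAt_coord (hγ : ContDiff ℝ 1 γ) (t : ℝ) (i : Fin 3) :
    HasDerivAt (fun t => γ t i) (deriv γ t i) t :=
  hasDerivAt_pi.1 ((hγ.differentiable (by simp)) t).hasDerivAt i

lemma continuous_deriv_coord (hγ : ContDiff ℝ 1 γ) (i : Fin 3) :
    Continuous fun t => deriv γ t i :=
  (continuous_apply i).comp (hγ.continuous_deriv le_rfl)

lemma polar_speed_continuousOn (hφ : ContinuousOn φ (Ioo 0 2))
    (hφ0 : ∀ r ∈ Ioo (0 : ℝ) 2, 0 < φ r) (hu : ContinuousOn u (Ioo 0 2)) (hγ : ContDiff ℝ 1 γ)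
    (hdom : ∀ t ∈ Icc (0 : ℝ) 1, γ t ∈ polarDom) :
    ContinuousOn (fun t => √(deriv γ t ⬝ᵥ (polarMetric φ u (γ t) *ᵥ deriv γ t))) (Icc 0 1) := by
  have h0 : ContinuousOn (fun t => γ t 0) (Icc 0 1) :=
    ((continuous_apply 0).comp hγ.continuous).continuousOn
  have h1 : ContinuousOn (fun t => φ (γ t 0)) (Icc 0 1) := hφ.comp h0 fun t ht => hdom t ht
  have h2 : ContinuousOn (fun t => u (γ t 0)) (Icc 0 1) := hu.comp h0 fun t ht => hdom t ht
  have h3 : ContinuousOn (fun t => (φ (γ t 0) ^ 2)⁻¹) (Icc 0 1) :=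
    (h1.pow 2).inv₀ fun t ht => (pow_pos (hφ0 _ (hdom t ht)) 2).ne'
  have hd := fun i => (continuous_deriv_coord hγ i).continuousOn (s := Icc 0 1)
  simp only [polarMetric, dotProduct_diagonal]
  apply ContinuousOn.sqrt
  simp only [Matrix.cons_val_zero, Matrix.cons_val_one, Matrix.cons_val]
  exact ((h3.mul ((hd 0).pow 2)).add ((h3.mul (h2.pow 2)).mul ((hd 1).pow 2))).add
    ((h1.pow 2).mul ((hd 2).pow 2))

lemma polar_speed_ge {x : Fin 3 → ℝ} (hφ0 : 0 < φ (x 0)) (hu0 : 0 ≤ u (x 0)) (v : Fin 3 → ℝ) :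
    (φ (x 0))⁻¹ * |v 0| ≤ √(v ⬝ᵥ (polarMetric φ u x *ᵥ v)) ∧
    (φ (x 0))⁻¹ * u (x 0) * |v 1| ≤ √(v ⬝ᵥ (polarMetric φ u x *ᵥ v)) ∧
    φ (x 0) * |v 2| ≤ √(v ⬝ᵥ (polarMetric φ u x *ᵥ v)) := by
  have hd : ∀ i, 0 ≤ ![(φ (x 0) ^ 2)⁻¹, (φ (x 0) ^ 2)⁻¹ * u (x 0) ^ 2, φ (x 0) ^ 2] i := by
    intro i
    fin_cases i <;> simp <;> positivity
  have h := sqrt_mul_abs_le_sqrt_dotProduct hd v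
  have h0 := h 0
  have h1 := h 1
  have h2 := h 2
  simp only [Matrix.cons_val_zero, Matrix.cons_val_one, Matrix.cons_val] at h0 h1 h2
  have e0 : √(φ (x 0) ^ 2)⁻¹ = (φ (x 0))⁻¹ := by
    rw [← inv_pow, Real.sqrt_sq (by positivity)]
  have e1 : √((φ (x 0) ^ 2)⁻¹ * u (x 0) ^ 2) = (φ (x 0))⁻¹ * u (x 0) := by
    rw [← inv_pow, ← mul_pow, Real.sqrt_sq (by positivity)]
  rw [e0] at h0
  rw [e1] at h1
  rw [Real.sqrt_sq hφ0.le] at h2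
  exact ⟨h0, h1, h2⟩

lemma polar_speed_le {x : Fin 3 → ℝ} (hφ0 : 0 < φ (x 0)) (hu0 : 0 ≤ u (x 0)) (v : Fin 3 → ℝ) :
    √(v ⬝ᵥ (polarMetric φ u x *ᵥ v)) ≤
      (φ (x 0))⁻¹ * |v 0| + (φ (x 0))⁻¹ * u (x 0) * |v 1| + φ (x 0) * |v 2| := by
  have hd : ∀ i, 0 ≤ ![(φ (x 0) ^ 2)⁻¹, (φ (x 0) ^ 2)⁻¹ * u (x 0) ^ 2, φ (x 0) ^ 2] i := by
    intro i
    fin_cases i <;> simp <;> positivity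
  refine (sqrt_dotProduct_le hd v).trans (le_of_eq ?_)
  simp only [Matrix.cons_val_zero, Matrix.cons_val_one, Matrix.cons_val]
  rw [← inv_pow, ← mul_pow, Real.sqrt_sq (by positivity), Real.sqrt_sq (by positivity),
    Real.sqrt_sq hφ0.le]

end PolarLength

/-- The law of cosines. It compares two points through their moduli and arguments without
differentiating `arg`, which jumps across the cut, or polar coordinates at the pole. -/
lemma norm_ofReal_mul_exp_sub (S T a b : ℝ) :
    ‖(S : ℂ) * Complex.exp (a * Complex.I) - T * Complex.exp (b * Complex.I)‖ ^ 2
      = (S - T) ^ 2 + 2 * (S * T) * (1 - Real.cos (a - b)) := by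
  rw [← Complex.normSq_eq_norm_sq, Complex.normSq_apply]
  simp only [Complex.sub_re, Complex.sub_im, Complex.re_ofReal_mul, Complex.im_ofReal_mul,
    Complex.exp_ofReal_mul_I_re, Complex.exp_ofReal_mul_I_im, Real.cos_sub]
  linear_combination S ^ 2 * Real.sin_sq_add_cos_sq a + T ^ 2 * Real.sin_sq_add_cos_sq b

/-- The map `z ↦ sin (π |z| / 2) z / |z|` is Lipschitz. -/
lemma norm_sin_mul_exp_arg_sub_le (z w : ℂ) :
    ‖(Real.sin (Real.pi / 2 * ‖z‖) : ℂ) * Complex.exp (z.arg * Complex.I)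
      - Real.sin (Real.pi / 2 * ‖w‖) * Complex.exp (w.arg * Complex.I)‖ ≤ 2 * ‖z - w‖ := by
  have hπ := Real.pi_pos
  have hπ' := Real.pi_le_four
  apply le_of_sq_le_sq _ (by positivity)
  have h2 : ‖z - w‖ ^ 2 = (‖z‖ - ‖w‖) ^ 2 + 2 * (‖z‖ * ‖w‖) * (1 - Real.cos (z.arg - w.arg)) := by
    rw [← norm_ofReal_mul_exp_sub, Complex.norm_mul_exp_arg_mul_I, Complex.norm_mul_exp_arg_mul_I]
  rw [norm_ofReal_mul_exp_sub, mul_pow, h2]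
  have h3 : (Real.sin (Real.pi / 2 * ‖z‖) - Real.sin (Real.pi / 2 * ‖w‖)) ^ 2
      ≤ 2 ^ 2 * (‖z‖ - ‖w‖) ^ 2 := by
    rw [← mul_pow]
    apply sq_le_sq.2
    refine (Real.abs_sin_sub_sin_le _ _).trans ?_
    rw [← mul_sub, abs_mul, abs_mul, abs_of_pos (by positivity : (0 : ℝ) < Real.pi / 2),
      abs_of_pos (by norm_num : (0 : ℝ) < 2)]
    gcongr
    linarith
  have h4 : Real.sin (Real.pi / 2 * ‖z‖) * Real.sin (Real.pi / 2 * ‖w‖)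
      ≤ 4 * (‖z‖ * ‖w‖) := by
    have hb : ∀ s : ℝ, 0 ≤ s → |Real.sin (Real.pi / 2 * s)| ≤ 2 * s := by
      intro s hs
      refine Real.abs_sin_le_abs.trans ?_
      rw [abs_of_nonneg (by positivity)]
      gcongr
      linarith
    calc _ ≤ |Real.sin (Real.pi / 2 * ‖z‖)| * |Real.sin (Real.pi / 2 * ‖w‖)| := by
          rw [← abs_mul]; exact le_abs_self _
      _ ≤ (2 * ‖z‖) * (2 * ‖w‖) :=
          mul_le_mul (hb _ (norm_nonneg _)) (hb _ (norm_nonneg _)) (abs_nonneg _) (by positivity)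
      _ = _ := by ring
  have h5 : 0 ≤ 1 - Real.cos (z.arg - w.arg) := by linarith [Real.cos_le_one (z.arg - w.arg)]
  nlinarith

/-! ### Length estimates in the Cartesian charts, where the metric is constant. -/

section CapLength

variable {γ : ℝ → Fin 3 → ℝ} {G : (Fin 3 → ℝ) → Matrix (Fin 3) (Fin 3) ℝ} {d e : ℝ}

lemma cap_speed_continuousOn (hγ : ContDiff ℝ 1 γ)
    (hG : ∀ t ∈ Icc (0 : ℝ) 1, G (γ t) = Matrix.diagonal ![d, d, e]) :
    ContinuousOn (fun t => √(deriv γ t ⬝ᵥ (G (γ t) *ᵥ deriv γ t))) (Icc 0 1) := by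
  have hd := fun i => continuous_deriv_coord hγ i
  have : Continuous fun t => √(d * deriv γ t 0 ^ 2 + d * deriv γ t 1 ^ 2 + e * deriv γ t 2 ^ 2) :=
    (((continuous_const.mul ((hd 0).pow 2)).add (continuous_const.mul ((hd 1).pow 2))).add
      (continuous_const.mul ((hd 2).pow 2))).sqrt
  refine this.continuousOn.congr fun t ht => ?_
  simp only [hG t ht, dotProduct_diagonal]
  simp

lemma cap_norm_sub_le (hγ : ContDiff ℝ 1 γ)
    (hG : ∀ t ∈ Icc (0 : ℝ) 1, G (γ t) = Matrix.diagonal ![d, d, e]) (hd : 1 ≤ d) (he : 0 ≤ e) :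
    ‖(⟨γ 1 0, γ 1 1⟩ : ℂ) - ⟨γ 0 0, γ 0 1⟩‖ ≤
      1 * ∫ t in (0 : ℝ)..1, √(deriv γ t ⬝ᵥ (G (γ t) *ᵥ deriv γ t)) := by
  refine norm_sub_le_integral (w := fun t => (⟨γ t 0, γ t 1⟩ : ℂ))
    (w' := fun t => (⟨deriv γ t 0, deriv γ t 1⟩ : ℂ)) ?_ (cap_speed_continuousOn hγ hG) ?_
  · intro t _
    simp only [Complex.mk_eq_add_mul_I]
    exact (hasDerivAt_coord hγ t 0).ofReal_comp.add
      ((hasDerivAt_coord hγ t 1).ofReal_comp.mul_const _)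
  · intro t ht
    rw [one_mul, Complex.norm_eq_sqrt_sq_add_sq, hG t ht, dotProduct_diagonal]
    apply Real.sqrt_le_sqrt
    simp only [Matrix.cons_val_zero, Matrix.cons_val_one, Matrix.cons_val]
    nlinarith [mul_nonneg he (sq_nonneg (deriv γ t 2)), sq_nonneg (deriv γ t 0),
      sq_nonneg (deriv γ t 1)]

/-- The hypothesis `1 ≤ e` holds around `r = 2` but not around `r = 0`, where the fibre coefficient
is `e^{-2A}`; there the fibre coordinate is not controlled by length. -/
lemma cap_abs_sub_le (hγ : ContDiff ℝ 1 γ)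
    (hG : ∀ t ∈ Icc (0 : ℝ) 1, G (γ t) = Matrix.diagonal ![d, d, e]) (hd : 0 ≤ d) (he : 1 ≤ e) :
    ‖γ 1 2 - γ 0 2‖ ≤ 1 * ∫ t in (0 : ℝ)..1, √(deriv γ t ⬝ᵥ (G (γ t) *ᵥ deriv γ t)) := by
  refine norm_sub_le_integral (w := fun t => γ t 2)
    (w' := fun t => deriv γ t 2) (fun t _ => hasDerivAt_coord hγ t 2)
    (cap_speed_continuousOn hγ hG) ?_
  intro t ht
  rw [one_mul, Real.norm_eq_abs, ← Real.sqrt_sq_eq_abs, hG t ht, dotProduct_diagonal]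
  apply Real.sqrt_le_sqrt
  simp only [Matrix.cons_val_zero, Matrix.cons_val_one, Matrix.cons_val]
  nlinarith [mul_nonneg hd (sq_nonneg (deriv γ t 0)), mul_nonneg hd (sq_nonneg (deriv γ t 1)),
    sq_nonneg (deriv γ t 2)]

end CapLength

/-- The squared positive part serves as a `C¹` cutoff, here for the fibre coordinate and later for
the radial profile of the monotonicity field. -/
lemma hasDerivAt_max_sq (x : ℝ) : HasDerivAt (fun y => max y 0 ^ 2) (2 * max x 0) x := by
  rcases lt_trichotomy x 0 with h | rfl | h
  · have : (fun y : ℝ => max y 0 ^ 2) =ᶠ[𝓝 x] fun _ => 0 := by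
      filter_upwards [Iio_mem_nhds h] with y hy
      simp [max_eq_right (le_of_lt (show y < 0 from hy))]
    rw [max_eq_right h.le, mul_zero]
    exact (hasDerivAt_const x 0).congr_of_eventuallyEq this
  · have h : (fun y : ℝ => max y 0 ^ 2) =O[𝓝 0] fun y => ‖y - 0‖ ^ 2 := by
      apply Asymptotics.isBigO_of_le
      intro y
      rw [sub_zero, norm_pow, norm_pow, norm_norm]
      gcongr
      rw [Real.norm_eq_abs, Real.norm_eq_abs, abs_of_nonneg (le_max_right y 0)]
      exact max_le (le_abs_self y) (abs_nonneg y)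
    have := h.hasFDerivAt (𝕜 := ℝ) (by norm_num)
    simpa using this.hasDerivAt
  · have : (fun y : ℝ => max y 0 ^ 2) =ᶠ[𝓝 x] fun y => y ^ 2 := by
      filter_upwards [Ioi_mem_nhds h] with y hy
      rw [max_eq_left (le_of_lt (show 0 < y from hy))]
    rw [max_eq_left h.le]
    simpa using (hasDerivAt_pow 2 x).congr_of_eventuallyEq this

/-- The fibre coordinate of a point, multiplied by a cutoff vanishing for `r ≤ a`. -/
def cutFibre (a : ℝ) (p : M) : ℂ := ((max (rad p - a) 0 ^ 2 : ℝ) : ℂ) * (p.2 : ℂ)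

lemma cutFibre_polarMap (a : ℝ) {x : Fin 3 → ℝ} (hx : x 0 ∈ Icc (0 : ℝ) 2) :
    cutFibre a (polarMap x)
      = ((max (x 0 - a) 0 ^ 2 : ℝ) : ℂ) * Complex.exp (x 2 * Complex.I) := by
  rw [cutFibre, rad_polarMap hx, snd_polarMap]

/-! ### Functions with a Lipschitz bound uniform over all the metrics. -/

section Tests

variable {η : ℝ → ℝ} {A : ℝ} {u : ℝ → ℝ} (hη : IsCutoff η) (hA : 10 ≤ A)
  (hu : IsBaseWarping η A u)

lemma capRadius_eq (x : Fin 3 → ℝ) : capRadius x = ‖(⟨x 0, x 1⟩ : ℂ)‖ := by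
  rw [capRadius, Complex.norm_eq_sqrt_sq_add_sq]

lemma capRadius_lt {a : ℝ} (ha : 0 < a) {x : Fin 3 → ℝ} (hx : x 0 ^ 2 + x 1 ^ 2 < a ^ 2) :
    capRadius x < a := by
  rwa [capRadius, Real.sqrt_lt' ha]

include hη hu in
lemma polar_speed_continuousOn_example {γ : ℝ → Fin 3 → ℝ} (hγ : ContDiff ℝ 1 γ)
    (hdom : ∀ t ∈ Icc (0 : ℝ) 1, γ t ∈ polarDom) :
    ContinuousOn (fun t => √(deriv γ t ⬝ᵥ (polarMetric (phiFun η A) u (γ t) *ᵥ deriv γ t)))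
      (Icc 0 1) :=
  polar_speed_continuousOn ((phiFun_contDiffOn hη).continuousOn.mono Ioo_subset_Ioi_self)
    (fun r _ => phiFun_pos η A r) hu.contDiffOn_Ioo.continuousOn hγ hdom

include hη hA hu in
-- As `φ ≤ 1`, the factor `φ⁻¹` in the base directions may be dropped; in the fibre direction `φ`
-- has to stay.
lemma polar_speed_ge_example {x : Fin 3 → ℝ} (hx : x ∈ polarDom) (v : Fin 3 → ℝ) :
    |v 0| ≤ √(v ⬝ᵥ (polarMetric (phiFun η A) u x *ᵥ v)) ∧
    u (x 0) * |v 1| ≤ √(v ⬝ᵥ (polarMetric (phiFun η A) u x *ᵥ v)) ∧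
    phiFun η A (x 0) * |v 2| ≤ √(v ⬝ᵥ (polarMetric (phiFun η A) u x *ᵥ v)) := by
  have hφ := phiFun_pos η A (x 0)
  have hφ1 := phiFun_le_one hη hA hx.1.le
  have hu0 := hu.pos _ hx
  obtain ⟨h0, h1, h2⟩ := polar_speed_ge hφ hu0.le v
  have hinv : 1 ≤ (phiFun η A (x 0))⁻¹ := (one_le_inv₀ hφ).2 hφ1
  refine ⟨le_trans ?_ h0, le_trans ?_ h1, h2⟩
  · exact le_mul_of_one_le_left (abs_nonneg _) hinv
  · rw [mul_assoc]
    exact le_mul_of_one_le_left (by positivity) hinv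

include hη hu in
lemma north_metric_eq {γ : ℝ → Fin 3 → ℝ}
    (hdom : ∀ t ∈ Icc (0 : ℝ) 1, γ t ∈ (northChart (phiFun η A) u (rho A)).dom) :
    ∀ t ∈ Icc (0 : ℝ) 1, (northChart (phiFun η A) u (rho A)).metric (γ t) =
      Matrix.diagonal ![(Real.exp (-A) ^ 2)⁻¹, (Real.exp (-A) ^ 2)⁻¹, Real.exp (-A) ^ 2] :=
  fun t ht => northChart_metric hη hu (hdom t ht)

include hη hA hu in
lemma south_metric_eq {γ : ℝ → Fin 3 → ℝ}
    (hdom : ∀ t ∈ Icc (0 : ℝ) 1, γ t ∈ (southChart (phiFun η A) u (1 / 5)).dom) :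
    ∀ t ∈ Icc (0 : ℝ) 1, (southChart (phiFun η A) u (1 / 5)).metric (γ t) =
      Matrix.diagonal ![1, 1, 1] := by
  intro t ht
  rw [southChart_metric hη hA hu (hdom t ht)]
  ext i j
  fin_cases i <;> fin_cases j <;> simp

include hA in
lemma one_le_inv_exp_sq : 1 ≤ (Real.exp (-A) ^ 2)⁻¹ := by
  rw [one_le_inv₀ (by positivity)]
  apply pow_le_one₀ (by positivity)
  rw [Real.exp_le_one_iff]; linarith

lemma sin_half_pi_mul_le {r : ℝ} (hr : r ∈ Ioo (0 : ℝ) 2) :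
    |Real.sin (Real.pi / 2 * r)| ≤ 2 * min r (2 - r) := by
  have hπ := Real.pi_pos
  have hπ4 := Real.pi_le_four
  obtain ⟨h0, h2⟩ := hr
  have h3 : 0 < 2 - r := by linarith
  rw [mul_min_of_nonneg _ _ (by norm_num : (0 : ℝ) ≤ 2)]
  apply le_min
  · refine Real.abs_sin_le_abs.trans ?_
    rw [abs_of_nonneg (by positivity)]
    gcongr; linarith
  · rw [show Real.pi / 2 * r = Real.pi - Real.pi / 2 * (2 - r) by ring, Real.sin_pi_sub]
    refine Real.abs_sin_le_abs.trans ?_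
    rw [abs_of_nonneg (by positivity)]
    gcongr; linarith

lemma abs_cos_half_pi_sub_le (s t : ℝ) :
    |Real.cos (Real.pi / 2 * s) - Real.cos (Real.pi / 2 * t)| ≤ 2 * |s - t| := by
  have hπ := Real.pi_pos
  have hπ4 := Real.pi_le_four
  refine (Real.abs_cos_sub_cos_le _ _).trans ?_
  rw [← mul_sub, abs_mul, abs_of_pos (by positivity)]
  gcongr; linarith

include hη hA hu

/-- In the polar chart the radial derivative contributes at most 2, since `π/2 ≤ 2`, and the angular
one at most 40, since `|sin (πr/2)| ≤ 2 min(r, 2 - r) ≤ 40 u`. In the caps the metric dominates the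
Euclidean one and the map is 2-Lipschitz. -/
theorem horiz_sub_le {p q : M} {ℓ : ℝ} (h : HasCurve (exampleMetric η A u) p q ℓ) :
    ‖horiz q - horiz p‖ ≤ 42 * ℓ := by
  have hπ := Real.pi_pos
  have hπ4 := Real.pi_le_four
  refine h.norm_sub_le ?_
  intro c hc γ hγ hdom
  rcases hc with rfl | rfl | rfl
  · refine norm_sub_le_integral (w := fun t => horiz (polarMap (γ t)))
      (w' := fun t => ((Real.cos (Real.pi / 2 * γ t 0) * (Real.pi / 2 * deriv γ t 0) : ℝ) : ℂ)
        * Complex.exp (γ t 1 * Complex.I) + (Real.sin (Real.pi / 2 * γ t 0) : ℂ) *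
        (Complex.exp (γ t 1 * Complex.I) * (((deriv γ t 1 : ℝ) : ℂ) * Complex.I)))
      ?_ (polar_speed_continuousOn_example hη hu hγ hdom) ?_
    · intro t ht
      simp only [horiz_polarMap]
      exact ((((hasDerivAt_coord hγ t 0).const_mul (Real.pi / 2)).sin).ofReal_comp).mul
        (((hasDerivAt_coord hγ t 1).ofReal_comp.mul_const Complex.I).cexp)
    · intro t ht
      obtain ⟨h0, h1, -⟩ := polar_speed_ge_example hη hA hu (hdom t ht) (deriv γ t)
      have hmin := hu.min_le ⟨(hdom t ht).1.le, (hdom t ht).2.le⟩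
      have hsin := sin_half_pi_mul_le (hdom t ht)
      refine (norm_add_le _ _).trans ?_
      rw [norm_mul, norm_mul, norm_mul, norm_mul, Complex.norm_exp_ofReal_mul_I, Complex.norm_I,
        Complex.norm_real, Complex.norm_real, Complex.norm_real, Real.norm_eq_abs,
        Real.norm_eq_abs, Real.norm_eq_abs, mul_one, mul_one, one_mul, abs_mul, abs_mul,
        abs_of_pos (by positivity : 0 < Real.pi / 2)]
      have h2 : |Real.cos (Real.pi / 2 * γ t 0)| * (Real.pi / 2 * |deriv γ t 0|)
          ≤ 1 * (2 * |deriv γ t 0|) := by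
        gcongr
        · exact Real.abs_cos_le_one _
        · linarith
      have h3 : |Real.sin (Real.pi / 2 * γ t 0)| * |deriv γ t 1|
          ≤ (40 * u (γ t 0)) * |deriv γ t 1| := by
        gcongr
        linarith
      show _ ≤ 42 * √(deriv γ t ⬝ᵥ (polarMetric (phiFun η A) u (γ t) *ᵥ deriv γ t))
      linarith
  · have h1 := cap_norm_sub_le hγ (north_metric_eq hη hu hdom) (one_le_inv_exp_sq hA)
      (by positivity)
    have h2 := norm_sin_mul_exp_arg_sub_le ⟨γ 1 0, γ 1 1⟩ ⟨γ 0 0, γ 0 1⟩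
    have h3 : ∀ x, horiz ((northChart (phiFun η A) u (rho A)).map x) =
        (Real.sin (Real.pi / 2 * ‖(⟨x 0, x 1⟩ : ℂ)‖) : ℂ) *
          Complex.exp (Complex.arg ⟨x 0, x 1⟩ * Complex.I) := by
      intro x
      show horiz (polarMap _) = _
      rw [horiz_polarMap, capRadius_eq]
      rfl
    rw [h3, h3]
    linarith [norm_nonneg ((⟨γ 1 0, γ 1 1⟩ : ℂ) - ⟨γ 0 0, γ 0 1⟩)]
  · have h1 := cap_norm_sub_le hγ (south_metric_eq hη hA hu hdom) le_rfl
      (by norm_num)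
    have h2 := norm_sin_mul_exp_arg_sub_le ⟨γ 1 0, γ 1 1⟩ ⟨γ 0 0, γ 0 1⟩
    have h3 : ∀ x, horiz ((southChart (phiFun η A) u (1 / 5)).map x) =
        (Real.sin (Real.pi / 2 * ‖(⟨x 0, x 1⟩ : ℂ)‖) : ℂ) *
          Complex.exp (Complex.arg ⟨x 0, x 1⟩ * Complex.I) := by
      intro x
      show horiz (polarMap _) = _
      rw [horiz_polarMap, ← capRadius_eq]
      simp only [Matrix.cons_val_zero, Matrix.cons_val_one]
      rw [show Real.pi / 2 * (2 - capRadius x) = Real.pi - Real.pi / 2 * capRadius x by ring,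
        Real.sin_pi_sub]
    rw [h3, h3]
    linarith [norm_nonneg ((⟨γ 1 0, γ 1 1⟩ : ℂ) - ⟨γ 0 0, γ 0 1⟩)]

theorem height_sub_le {p q : M} {ℓ : ℝ} (h : HasCurve (exampleMetric η A u) p q ℓ) :
    ‖height q - height p‖ ≤ 42 * ℓ := by
  have hπ := Real.pi_pos
  have hπ4 := Real.pi_le_four
  refine h.norm_sub_le ?_
  intro c hc γ hγ hdom
  rcases hc with rfl | rfl | rfl
  · refine norm_sub_le_integral (w := fun t => height (polarMap (γ t)))
      (w' := fun t => -Real.sin (Real.pi / 2 * γ t 0) * (Real.pi / 2 * deriv γ t 0))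
      ?_ (polar_speed_continuousOn_example hη hu hγ hdom) ?_
    · intro t ht
      simp only [height_polarMap]
      exact ((hasDerivAt_coord hγ t 0).const_mul (Real.pi / 2)).cos
    · intro t ht
      obtain ⟨h0, -, -⟩ := polar_speed_ge_example hη hA hu (hdom t ht) (deriv γ t)
      rw [norm_mul, norm_neg, norm_mul, Real.norm_eq_abs, Real.norm_eq_abs, Real.norm_eq_abs,
        abs_of_pos (by positivity : 0 < Real.pi / 2)]
      have h2 : |Real.sin (Real.pi / 2 * γ t 0)| * (Real.pi / 2 * |deriv γ t 0|)
          ≤ 1 * (2 * |deriv γ t 0|) := by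
        gcongr
        · exact Real.abs_sin_le_one _
        · linarith
      show _ ≤ 42 * √(deriv γ t ⬝ᵥ (polarMetric (phiFun η A) u (γ t) *ᵥ deriv γ t))
      linarith [abs_nonneg (deriv γ t 0)]
  · have h1 := cap_norm_sub_le hγ (north_metric_eq hη hu hdom) (one_le_inv_exp_sq hA)
      (by positivity)
    have h2 := abs_norm_sub_norm_le (⟨γ 1 0, γ 1 1⟩ : ℂ) ⟨γ 0 0, γ 0 1⟩
    have h3 : ∀ x, height ((northChart (phiFun η A) u (rho A)).map x) =
        Real.cos (Real.pi / 2 * ‖(⟨x 0, x 1⟩ : ℂ)‖) := by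
      intro x
      show height (polarMap _) = _
      rw [height_polarMap, capRadius_eq]
      rfl
    rw [h3, h3, Real.norm_eq_abs]
    have h4 := abs_cos_half_pi_sub_le ‖(⟨γ 1 0, γ 1 1⟩ : ℂ)‖ ‖(⟨γ 0 0, γ 0 1⟩ : ℂ)‖
    linarith [norm_nonneg ((⟨γ 1 0, γ 1 1⟩ : ℂ) - ⟨γ 0 0, γ 0 1⟩)]
  · have h1 := cap_norm_sub_le hγ (south_metric_eq hη hA hu hdom) le_rfl
      (by norm_num)
    have h2 := abs_norm_sub_norm_le (⟨γ 1 0, γ 1 1⟩ : ℂ) ⟨γ 0 0, γ 0 1⟩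
    have h3 : ∀ x, height ((southChart (phiFun η A) u (1 / 5)).map x) =
        - Real.cos (Real.pi / 2 * ‖(⟨x 0, x 1⟩ : ℂ)‖) := by
      intro x
      show height (polarMap _) = _
      rw [height_polarMap, ← capRadius_eq]
      simp only [Matrix.cons_val_zero]
      rw [show Real.pi / 2 * (2 - capRadius x) = Real.pi - Real.pi / 2 * capRadius x by ring,
        Real.cos_pi_sub]
    rw [h3, h3, neg_sub_neg, Real.norm_eq_abs, abs_sub_comm]
    have h4 := abs_cos_half_pi_sub_le ‖(⟨γ 1 0, γ 1 1⟩ : ℂ)‖ ‖(⟨γ 0 0, γ 0 1⟩ : ℂ)‖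
    linarith [norm_nonneg ((⟨γ 1 0, γ 1 1⟩ : ℂ) - ⟨γ 0 0, γ 0 1⟩)]

/-- The bare fibre coordinate has no uniform Lipschitz bound, as the fibre over the axis collapses.
The cutoff annihilates `r ≤ a`, which contains the whole north cap, and beyond `a` the fibre factor
is at least `1/2`. -/
theorem cutFibre_sub_le {a : ℝ} (ha : rho A ≤ a) (hφa : ∀ r ∈ Ioo a 2, 1 / 2 ≤ phiFun η A r)
    {p q : M} {ℓ : ℝ} (h : HasCurve (exampleMetric η A u) p q ℓ) :
    ‖cutFibre a q - cutFibre a p‖ ≤ 42 * ℓ := by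
  have hρ := rho_pos A
  refine h.norm_sub_le ?_
  intro c hc γ hγ hdom
  rcases hc with rfl | rfl | rfl
  · show ‖cutFibre a (polarMap (γ 1)) - cutFibre a (polarMap (γ 0))‖ ≤ _
    have hmem : ∀ t ∈ Icc (0 : ℝ) 1, γ t 0 ∈ Icc (0 : ℝ) 2 :=
      fun t ht => ⟨(hdom t ht).1.le, (hdom t ht).2.le⟩
    rw [cutFibre_polarMap a (hmem 1 (by norm_num)), cutFibre_polarMap a (hmem 0 (by norm_num))]
    refine norm_sub_le_integral
      (w := fun t => ((max (γ t 0 - a) 0 ^ 2 : ℝ) : ℂ) * Complex.exp (γ t 2 * Complex.I))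
      (w' := fun t => ((2 * max (γ t 0 - a) 0 * deriv γ t 0 : ℝ) : ℂ)
        * Complex.exp (γ t 2 * Complex.I) + ((max (γ t 0 - a) 0 ^ 2 : ℝ) : ℂ) *
        (Complex.exp (γ t 2 * Complex.I) * (((deriv γ t 2 : ℝ) : ℂ) * Complex.I)))
      ?_ (polar_speed_continuousOn_example hη hu hγ hdom) ?_
    · intro t ht
      have h1 := (hasDerivAt_max_sq (γ t 0 - a)).comp t ((hasDerivAt_coord hγ t 0).sub_const a)
      exact h1.ofReal_comp.mul
        (((hasDerivAt_coord hγ t 2).ofReal_comp.mul_const Complex.I).cexp)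
    · intro t ht
      obtain ⟨h0, -, h2⟩ := polar_speed_ge_example hη hA hu (hdom t ht) (deriv γ t)
      refine (norm_add_le _ _).trans ?_
      rw [norm_mul, norm_mul, norm_mul, norm_mul, Complex.norm_exp_ofReal_mul_I, Complex.norm_I,
        Complex.norm_real, Complex.norm_real, Complex.norm_real, Real.norm_eq_abs,
        Real.norm_eq_abs, Real.norm_eq_abs, mul_one, mul_one, one_mul, abs_mul]
      have hm0 : 0 ≤ max (γ t 0 - a) 0 := le_max_right _ _
      have hm2 : max (γ t 0 - a) 0 ≤ 2 := max_le (by linarith [(hdom t ht).2]) (by norm_num)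
      rw [abs_of_nonneg (by positivity : 0 ≤ 2 * max (γ t 0 - a) 0), abs_of_nonneg
        (by positivity : 0 ≤ max (γ t 0 - a) 0 ^ 2)]
      have h3 : 2 * max (γ t 0 - a) 0 * |deriv γ t 0| ≤ 2 * 2 * |deriv γ t 0| := by gcongr
      -- The cutoff is at most `2² = 4`, and `4 ≤ 8φ` where it does not vanish.
      have h4 : max (γ t 0 - a) 0 ^ 2 * |deriv γ t 2|
          ≤ 8 * (phiFun η A (γ t 0) * |deriv γ t 2|) := by
        rcases le_or_gt (γ t 0) a with hle | hgt
        · rw [max_eq_right (by linarith)]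
          have := phiFun_pos η A (γ t 0)
          have : 0 ≤ 8 * (phiFun η A (γ t 0) * |deriv γ t 2|) := by positivity
          simpa using this
        · have h5 := hφa _ ⟨hgt, (hdom t ht).2⟩
          have h6 : max (γ t 0 - a) 0 ^ 2 ≤ 2 ^ 2 := by gcongr
          rw [← mul_assoc]
          gcongr
          linarith
      show _ ≤ 42 * √(deriv γ t ⬝ᵥ (polarMetric (phiFun η A) u (γ t) *ᵥ deriv γ t))
      linarith [abs_nonneg (deriv γ t 0)]
  · have h1 : ∀ x ∈ (northChart (phiFun η A) u (rho A)).dom,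
        cutFibre a ((northChart (phiFun η A) u (rho A)).map x) = 0 := by
      intro x hx
      have hs := capRadius_lt hρ hx
      have hρ' := rho_lt hA
      show cutFibre a (polarMap _) = 0
      rw [cutFibre_polarMap]
      · simp only [Matrix.cons_val_zero]
        rw [max_eq_right (by linarith)]
        simp
      · exact ⟨Real.sqrt_nonneg _, le_of_lt (lt_trans hs (by linarith))⟩
    rw [h1 _ (hdom 1 (by norm_num)), h1 _ (hdom 0 (by norm_num)), sub_zero, norm_zero]
    exact mul_nonneg (by norm_num)
      (intervalIntegral.integral_nonneg (by norm_num) fun t _ => Real.sqrt_nonneg _)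
  · have h1 := cap_norm_sub_le hγ (south_metric_eq hη hA hu hdom) le_rfl (by norm_num)
    have h1' := cap_abs_sub_le hγ (south_metric_eq hη hA hu hdom) (by norm_num) le_rfl
    have h2 := abs_norm_sub_norm_le (⟨γ 1 0, γ 1 1⟩ : ℂ) ⟨γ 0 0, γ 0 1⟩
    rw [← capRadius_eq, ← capRadius_eq] at h2
    have hs : ∀ x ∈ (southChart (phiFun η A) u (1 / 5)).dom, 0 ≤ capRadius x ∧
        capRadius x < 1 / 5 := fun x hx => ⟨Real.sqrt_nonneg _, capRadius_lt (by norm_num) hx⟩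
    have h3 : ∀ x ∈ (southChart (phiFun η A) u (1 / 5)).dom,
        cutFibre a ((southChart (phiFun η A) u (1 / 5)).map x) =
        ((max (2 - capRadius x - a) 0 ^ 2 : ℝ) : ℂ) * Complex.exp (x 2 * Complex.I) := by
      intro x hx
      show cutFibre a (polarMap _) = _
      rw [cutFibre_polarMap]
      · rfl
      · have := hs x hx
        exact ⟨by simp only [Matrix.cons_val_zero]; linarith,
          by simp only [Matrix.cons_val_zero]; linarith⟩
    have hd0 := hdom 0 (by norm_num)
    have hd1 := hdom 1 (by norm_num)
    rw [h3 _ hd1, h3 _ hd0]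
    set m₁ := max (2 - capRadius (γ 1) - a) 0 with hm₁
    set m₀ := max (2 - capRadius (γ 0) - a) 0 with hm₀
    have hm : |m₁ - m₀| ≤ |capRadius (γ 1) - capRadius (γ 0)| := by
      refine (abs_max_sub_max_le_abs _ _ _).trans (le_of_eq ?_)
      rw [abs_sub_comm]
      congr 1; ring
    have hm1 : 0 ≤ m₁ ∧ m₁ ≤ 2 := ⟨le_max_right _ _,
      max_le (by linarith [(hs _ hd1).1]) (by norm_num)⟩
    have hm0 : 0 ≤ m₀ ∧ m₀ ≤ 2 := ⟨le_max_right _ _,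
      max_le (by linarith [(hs _ hd0).1]) (by norm_num)⟩
    have he : ‖Complex.exp (γ 1 2 * Complex.I) - Complex.exp (γ 0 2 * Complex.I)‖
        ≤ ‖γ 1 2 - γ 0 2‖ := by
      have : Complex.exp (γ 1 2 * Complex.I) - Complex.exp (γ 0 2 * Complex.I) =
          Complex.exp (γ 0 2 * Complex.I) *
            (Complex.exp (Complex.I * ((γ 1 2 - γ 0 2 : ℝ) : ℂ)) - 1) := by
        rw [mul_sub, ← Complex.exp_add, mul_one]
        congr 2
        push_cast; ring
      rw [this, norm_mul, Complex.norm_exp_ofReal_mul_I, one_mul]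
      exact Real.norm_exp_I_mul_ofReal_sub_one_le
    have hsplit : ((m₁ ^ 2 : ℝ) : ℂ) * Complex.exp (γ 1 2 * Complex.I)
        - ((m₀ ^ 2 : ℝ) : ℂ) * Complex.exp (γ 0 2 * Complex.I)
        = (((m₁ + m₀) * (m₁ - m₀) : ℝ) : ℂ) * Complex.exp (γ 1 2 * Complex.I)
          + ((m₀ ^ 2 : ℝ) : ℂ) * (Complex.exp (γ 1 2 * Complex.I)
            - Complex.exp (γ 0 2 * Complex.I)) := by
      push_cast; ring
    rw [hsplit]
    refine (norm_add_le _ _).trans ?_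
    rw [norm_mul, norm_mul, Complex.norm_exp_ofReal_mul_I, mul_one, Complex.norm_real,
      Complex.norm_real, Real.norm_eq_abs, Real.norm_eq_abs, abs_mul, abs_of_nonneg
      (by linarith [hm1.1, hm0.1] : 0 ≤ m₁ + m₀), abs_of_nonneg (sq_nonneg m₀)]
    have h5 : (m₁ + m₀) * |m₁ - m₀| ≤ 4 * ‖(⟨γ 1 0, γ 1 1⟩ : ℂ) - ⟨γ 0 0, γ 0 1⟩‖ :=
      mul_le_mul (by linarith [hm1.2, hm0.2]) (hm.trans h2) (abs_nonneg _) (by norm_num)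
    have h6 : m₀ ^ 2 * ‖Complex.exp (γ 1 2 * Complex.I) - Complex.exp (γ 0 2 * Complex.I)‖
        ≤ 2 ^ 2 * ‖γ 1 2 - γ 0 2‖ :=
      mul_le_mul (pow_le_pow_left₀ hm0.1 hm0.2 2) he (norm_nonneg _) (by norm_num)
    linarith [norm_nonneg (γ 1 2 - γ 0 2)]

end Tests

/-- An Arzelà–Ascoli theorem for asymptotically equi-Lipschitz sequences. -/
theorem exists_subseq_tendstoUniformlyOn {X : Type*} [PseudoMetricSpace X] {K : ℕ → Set X}
    (hK : ∀ n, IsCompact (K n)) {F : ℕ → X → ℝ}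
    (hB : ∀ n, ∀ x ∈ K n, ∃ B, ∀ᶠ i in atTop, |F i x| ≤ B)
    (hL : ∀ n, ∃ L, ∀ᶠ i in atTop, ∀ x ∈ K n, ∀ y ∈ K n, |F i x - F i y| ≤ L * dist x y) :
    ∃ (σ : ℕ → ℕ) (G : X → ℝ), StrictMono σ ∧
      ∀ n, TendstoUniformlyOn (fun i => F (σ i)) G atTop (K n) := by
  have hD : ∀ n, ∃ D : Set X, D ⊆ K n ∧ D.Countable ∧ K n ⊆ closure D := fun n =>
    (hK n).isSeparable.exists_countable_dense_subset
  choose D hDK hDc hDd using hD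
  set E : Set X := ⋃ n, D n with hE
  have hEc : E.Countable := countable_iUnion hDc
  have : Countable E := hEc.to_subtype
  have hB' : ∀ x : E, ∃ B, ∀ i, F i x ∈ Icc (-B) B := by
    rintro ⟨x, hx⟩
    obtain ⟨n, hn⟩ := mem_iUnion.1 hx
    obtain ⟨B, hB⟩ := hB n x (hDK n hn)
    obtain ⟨i₀, hi₀⟩ := eventually_atTop.1 hB
    -- The bound is only eventual, so the finitely many early values are added to get one interval
    -- containing the whole sequence.
    refine ⟨|B| + ∑ i ∈ Finset.range i₀, |F i x|, fun i => ?_⟩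
    rw [mem_Icc, ← abs_le]
    have hs : 0 ≤ ∑ i ∈ Finset.range i₀, |F i x| := Finset.sum_nonneg fun _ _ => abs_nonneg _
    rcases lt_or_ge i i₀ with h | h
    · have := Finset.single_le_sum (f := fun i => |F i x|) (fun _ _ => abs_nonneg _)
        (Finset.mem_range.2 h)
      have := abs_nonneg B
      linarith
    · have := hi₀ i h
      have := le_abs_self B
      linarith
  choose B hB using hB'
  -- Sequential compactness of a countable product of intervals takes the place of the diagonal
  -- argument over the dense set.
  obtain ⟨a, -, σ, hσ, ha⟩ := (isCompact_univ_pi fun x : E => isCompact_Icc (a := -B x)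
    (b := B x)).tendsto_subseq (x := fun i (x : E) => F i x) fun i x _ => hB x i
  have ha' : ∀ x ∈ E, ∃ l, Tendsto (fun i => F (σ i) x) atTop (𝓝 l) := fun x hx =>
    ⟨a ⟨x, hx⟩, (tendsto_pi_nhds.1 ha) ⟨x, hx⟩⟩
  have hcauchy : ∀ n, UniformCauchySeqOn (fun i => F (σ i)) atTop (K n) := by
    intro n
    rw [Metric.uniformCauchySeqOn_iff]
    intro ε hε
    obtain ⟨L, hL⟩ := hL n
    have hL' := hσ.tendsto_atTop.eventually hL
    set δ := ε / (4 * (|L| + 1)) with hδ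
    have hδ0 : 0 < δ := by positivity
    have hLδ : |L| * δ ≤ ε / 4 := by
      rw [hδ, ← mul_div_assoc, div_le_div_iff₀ (by positivity) (by norm_num)]
      nlinarith [abs_nonneg L]
    obtain ⟨t, htD, htf, htK⟩ := (hK n).elim_finite_subcover_image (b := D n)
      (c := fun d => Metric.ball d δ) (fun d _ => Metric.isOpen_ball) (by
        intro x hx
        obtain ⟨d, hd, hd'⟩ := Metric.mem_closure_iff.1 (hDd n hx) δ hδ0
        exact mem_iUnion₂.2 ⟨d, hd, hd'⟩)
    have hpt : ∀ᶠ k in atTop, ∀ d ∈ t, ∀ i ≥ k, ∀ j ≥ k, |F (σ i) d - F (σ j) d| < ε / 4 := by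
      rw [eventually_all_finite htf]
      intro d hd
      obtain ⟨l, hl⟩ := ha' d (mem_iUnion.2 ⟨n, htD hd⟩)
      obtain ⟨k, hk⟩ := Metric.cauchySeq_iff.1 hl.cauchySeq (ε / 4) (by positivity)
      filter_upwards [eventually_ge_atTop k] with k' hk' i hi j hj
      exact hk i (hk'.trans hi) j (hk'.trans hj)
    obtain ⟨k, hk1, hk2⟩ := (hpt.and (eventually_atTop.2
      ((eventually_atTop.1 hL').imp fun k hk j hj i (hi : i ≥ j) => hk i (hj.trans hi)))).exists
    refine ⟨k, fun i hi j hj x hx => ?_⟩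
    obtain ⟨d, hd, hxd⟩ := mem_iUnion₂.1 (htK hx)
    have hdK := hDK n (htD hd)
    have h1 := hk1 d hd i hi j hj
    have hLd : L * dist x d ≤ ε / 4 := by
      refine le_trans ?_ hLδ
      exact mul_le_mul (le_abs_self L) (le_of_lt hxd) dist_nonneg (abs_nonneg L)
    have h2 := (hk2 i hi x hx d hdK).trans hLd
    have h3 := (hk2 j hj x hx d hdK).trans hLd
    rw [Real.dist_eq]
    rw [abs_le] at h2 h3
    rw [abs_lt] at h1 ⊢
    constructor <;> linarith
  have hlim : ∀ x, ∃ l, (∃ n, x ∈ K n) → Tendsto (fun i => F (σ i) x) atTop (𝓝 l) := by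
    intro x
    by_cases hx : ∃ n, x ∈ K n
    · obtain ⟨n, hn⟩ := hx
      obtain ⟨l, hl⟩ := cauchySeq_tendsto_of_complete ((hcauchy n).cauchySeq hn)
      exact ⟨l, fun _ => hl⟩
    · exact ⟨0, fun h => absurd h hx⟩
  choose G hG using hlim
  exact ⟨σ, G, hσ, fun n => (hcauchy n).tendstoUniformlyOn_of_tendsto fun x hx => hG x ⟨n, hx⟩⟩

/-! ### Curves in the polar chart -/

lemma convex_polarDom : Convex ℝ polarDom := by
  have : polarDom = (fun x : Fin 3 → ℝ => x 0) ⁻¹' Ioo 0 2 := rfl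
  rw [this]
  exact (convex_Ioo 0 2).is_linear_preimage ⟨fun _ _ => rfl, fun _ _ => rfl⟩

lemma hasCurve_segment {𝒜 : Set (Chart M)} {φ u : ℝ → ℝ} (h𝒜 : polarChart φ u ∈ 𝒜)
    {x y : Fin 3 → ℝ} (hx : x ∈ polarDom) (hy : y ∈ polarDom) :
    HasCurve 𝒜 (polarMap x) (polarMap y) (∫ t in (0 : ℝ)..1,
      √((y - x) ⬝ᵥ (polarMetric φ u (x + t • (y - x)) *ᵥ (y - x)))) := by
  have hγ : ContDiff ℝ 1 fun t : ℝ => x + t • (y - x) := by fun_prop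
  have h := HasCurve.piece (𝒜 := 𝒜) (polarChart φ u) h𝒜 (fun t => x + t • (y - x)) hγ
    fun t ht => convex_polarDom.add_smul_sub_mem hx hy ht
  have hd : ∀ t : ℝ, deriv (fun t : ℝ => x + t • (y - x)) t = y - x := by
    intro t
    have := (((hasDerivAt_id t).smul_const (y - x)).const_add x).deriv
    simpa using this
  simp only [hd] at h
  simpa [polarChart] using h

lemma exists_hasCurve {𝒜 : Set (Chart M)} {φ u : ℝ → ℝ} (h𝒜 : polarChart φ u ∈ 𝒜) {p q : M}
    (hp : p ∈ regularPart) (hq : q ∈ regularPart) : ∃ ℓ, HasCurve 𝒜 p q ℓ := by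
  obtain ⟨x, hx, rfl⟩ := hp
  obtain ⟨y, hy, rfl⟩ := hq
  exact ⟨_, hasCurve_segment h𝒜 hx hy⟩

lemma polarChart_mem_example (η : ℝ → ℝ) (A : ℝ) (u : ℝ → ℝ) :
    polarChart (phiFun η A) u ∈ exampleMetric η A u := Or.inl rfl

/-- Along the coordinate segment `φ⁻¹ ≤ 2`, `u ≤ 2` and `φ ≤ 1`, so the three directions contribute
`2 + 4 + 1 = 7`. -/
lemma riemDist_polarMap_le {η : ℝ → ℝ} {A : ℝ} {u : ℝ → ℝ} (hη : IsCutoff η) (hA : 10 ≤ A)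
    (hu : IsBaseWarping η A u) {b : ℝ} (hb : 0 < b)
    (hφ : ∀ r ∈ Icc b (2 - b), 1 / 2 ≤ phiFun η A r) {x y : Fin 3 → ℝ}
    (hx : x 0 ∈ Icc b (2 - b)) (hy : y 0 ∈ Icc b (2 - b)) :
    riemDist (exampleMetric η A u) (polarMap x) (polarMap y) ≤ 7 * ‖x - y‖ := by
  have hsub : Icc b (2 - b) ⊆ Ioo 0 2 := fun r hr => ⟨by linarith [hr.1], by linarith [hr.2]⟩
  refine (riemDist_le (hasCurve_segment (polarChart_mem_example η A u)
    (show x ∈ polarDom from hsub hx) (show y ∈ polarDom from hsub hy))).trans ?_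
  refine (le_abs_self _).trans ?_
  have := intervalIntegral.norm_integral_le_of_norm_le_const (a := 0) (b := 1)
    (C := 7 * ‖x - y‖)
    (f := fun t : ℝ => √((y - x) ⬝ᵥ (polarMetric (phiFun η A) u (x + t • (y - x)) *ᵥ (y - x)))) ?_
  · simpa using this
  · intro t ht
    rw [uIoc_of_le zero_le_one] at ht
    have hr : (x + t • (y - x)) 0 ∈ Icc b (2 - b) :=
      (convex_Icc b (2 - b)).add_smul_sub_mem hx hy ⟨ht.1.le, ht.2⟩
    set z := x + t • (y - x)
    have h1 := hφ _ hr
    have hz := hsub hr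
    have hu0 := hu.nonneg ⟨hz.1.le, hz.2.le⟩
    have hu2 := (hu.le_self ⟨hz.1.le, hz.2.le⟩).trans hz.2.le
    have hφ0 := phiFun_pos η A (z 0)
    have hφ1 := phiFun_le_one hη hA hz.1.le
    have hinv : (phiFun η A (z 0))⁻¹ ≤ 2 := by
      rw [inv_le_comm₀ hφ0 (by norm_num)]; linarith
    rw [Real.norm_eq_abs, abs_of_nonneg (Real.sqrt_nonneg _)]
    refine (polar_speed_le hφ0 hu0 _).trans ?_
    have hn : ∀ i, |(y - x) i| ≤ ‖x - y‖ := fun i => by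
      rw [norm_sub_rev]; exact norm_le_pi_norm (y - x) i
    calc _ ≤ 2 * ‖x - y‖ + 2 * 2 * ‖x - y‖ + 1 * ‖x - y‖ := by
          gcongr <;> exact hn _
      _ = _ := by ring

/-! ### Asymptotics of the warping functions -/

section Sequence

variable {η : ℝ → ℝ} {A : ℕ → ℝ}

lemma tendsto_rho (hA : Tendsto A atTop atTop) : Tendsto (fun i => rho (A i)) atTop (𝓝 0) := by
  have h3 : Tendsto (fun i => -A i ^ 3) atTop atBot :=
    tendsto_neg_atTop_atBot.comp ((tendsto_pow_atTop (by norm_num)).comp hA)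
  have := (Real.tendsto_exp_atBot.comp h3).const_mul (1 / 10)
  rw [mul_zero] at this
  exact this

lemma tendsto_lam (hη : IsCutoff η) (hA : Tendsto A atTop atTop) :
    Tendsto (fun i => lam η (A i)) atTop (𝓝 0) := by
  have h1 : Tendsto (fun i => 2 / A i ^ 2) atTop (𝓝 0) :=
    ((tendsto_pow_atTop (by norm_num)).comp hA).const_div_atTop 2
  refine squeeze_zero' ?_ ?_ h1
  · filter_upwards [hA.eventually_ge_atTop 10] with i hi using (lam_pos hη hi).le
  · filter_upwards [hA.eventually_ge_atTop 10] with i hi using lam_le hη hi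

/-- For `b ≤ r ≤ 1/10` one has `φ ≥ (10r)^λ ≥ m^λ` with `m > 0` fixed, and `m^λ → 1` as `λ → 0`.
Past `1/10` the value is exactly 1. -/
lemma eventually_phiFun_gt (hη : IsCutoff η) (hA : Tendsto A atTop atTop) {b c : ℝ} (hb : 0 < b)
    (hc : c < 1) : ∀ᶠ i in atTop, ∀ r, b ≤ r → c < phiFun η (A i) r := by
  set m := min (10 * b) 1 with hm
  have hm0 : 0 < m := lt_min (by positivity) one_pos
  have h : Tendsto (fun i => m ^ lam η (A i)) atTop (𝓝 1) := by
    have := (Real.continuousAt_const_rpow hm0.ne' (b := 0)).tendsto.comp (tendsto_lam hη hA)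
    rw [Real.rpow_zero] at this
    exact this
  filter_upwards [h.eventually_const_lt hc, hA.eventually_ge_atTop 10] with i hi hi' r hr
  rcases le_total r (1 / 10) with h' | h'
  · refine lt_of_lt_of_le hi (le_trans ?_ (rpow_le_phiFun hη hi' (hb.trans_le hr) h'))
    apply Real.rpow_le_rpow hm0.le _ (lam_pos hη hi').le
    exact (min_le_left _ _).trans (by linarith)
  · rw [phiFun_right hη hi' h']
    exact hc

lemma tendsto_phiFun (hη : IsCutoff η) (hA : Tendsto A atTop atTop) {r : ℝ} (hr : 0 < r) :
    Tendsto (fun i => phiFun η (A i) r) atTop (𝓝 1) := by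
  rw [tendsto_order]
  refine ⟨fun c hc => ?_, fun c hc => ?_⟩
  · filter_upwards [eventually_phiFun_gt hη hA hr hc] with i hi using hi r le_rfl
  · filter_upwards [hA.eventually_ge_atTop 10] with i hi
    exact (phiFun_le_one hη hi hr.le).trans_lt hc

lemma tendstoLocallyUniformlyOn_phiFun (hη : IsCutoff η) (hA : Tendsto A atTop atTop) :
    TendstoLocallyUniformlyOn (fun i => phiFun η (A i)) (fun _ => 1) atTop (Ioo 0 2) := by
  rw [Metric.tendstoLocallyUniformlyOn_iff]
  intro ε hε x hx
  refine ⟨Ioi (x / 2), mem_nhdsWithin_of_mem_nhds (Ioi_mem_nhds (by linarith [hx.1])), ?_⟩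
  have hx2 : 0 < x / 2 := by linarith [hx.1]
  filter_upwards [eventually_phiFun_gt hη hA hx2 (by linarith : 1 - ε < 1),
    hA.eventually_ge_atTop 10] with i hi hi' y hy
  have hy' : x / 2 < y := hy
  have h1 := hi y hy'.le
  have h2 := phiFun_le_one hη hi' (hx2.trans hy').le
  rw [Real.dist_eq, abs_lt]
  constructor <;> linarith

end Sequence

/-! ### Exhaustion of the regular part by coordinate boxes, and the limit of the distances. -/

/-- The box `1 / (n + 2) ≤ r ≤ 2 - 1 / (n + 2)`, `|θ|, |ξ| ≤ π` in coordinate space. -/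
def coordBox (n : ℕ) : Set (Fin 3 → ℝ) :=
  Icc ![1 / (n + 2), -Real.pi, -Real.pi] ![2 - 1 / (n + 2), Real.pi, Real.pi]

lemma coordBox_fst {n : ℕ} {x : Fin 3 → ℝ} (hx : x ∈ coordBox n) :
    x 0 ∈ Icc (1 / (n + 2 : ℝ)) (2 - 1 / (n + 2)) := ⟨hx.1 0, hx.2 0⟩

lemma coordBox_subset (n : ℕ) : coordBox n ⊆ polarDom := by
  intro x hx
  have := coordBox_fst hx
  have h : (0 : ℝ) < 1 / (n + 2) := by positivity
  exact ⟨by linarith [this.1], by linarith [this.2]⟩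

lemma exists_coordBox {n : ℕ} {p : M} (hp : rad p ∈ Icc (1 / (n + 2 : ℝ)) (2 - 1 / (n + 2))) :
    ∃ x ∈ coordBox n, polarMap x = p := by
  obtain ⟨x, h0, h1, h2, rfl⟩ := exists_polarMap p
  refine ⟨x, ⟨?_, ?_⟩, rfl⟩
  · intro i
    fin_cases i
    · exact h0 ▸ hp.1
    · exact h1.1.le
    · exact h2.1.le
  · intro i
    fin_cases i
    · exact h0 ▸ hp.2
    · exact h1.2
    · exact h2.2

lemma exists_rad_mem {K : Set M} (hK : K ⊆ regularPart) (hKc : IsCompact K) :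
    ∃ n : ℕ, ∀ p ∈ K, rad p ∈ Icc (1 / (n + 2 : ℝ)) (2 - 1 / (n + 2)) := by
  rcases K.eq_empty_or_nonempty with rfl | hne
  · exact ⟨0, by simp⟩
  have hmin : Continuous fun p => min (rad p) (2 - rad p) :=
    continuous_rad.min (continuous_const.sub continuous_rad)
  obtain ⟨p, hp, hpm⟩ := hKc.exists_isMinOn hne hmin.continuousOn
  have h0 : 0 < min (rad p) (2 - rad p) := by
    have := (mem_regularPart_iff p).1 (hK hp)
    exact lt_min this.1 (by linarith [this.2])
  obtain ⟨n, hn⟩ := exists_nat_one_div_lt h0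
  have hn2 : (1 : ℝ) / (n + 2) ≤ 1 / (n + 1) := by
    apply one_div_le_one_div_of_le (by positivity); linarith
  refine ⟨n, fun q hq => ?_⟩
  have h1 : min (rad p) (2 - rad p) ≤ min (rad q) (2 - rad q) := hpm hq
  have h2 := min_le_left (rad q) (2 - rad q)
  have h3 := min_le_right (rad q) (2 - rad q)
  exact ⟨by linarith, by linarith⟩

section Limit

variable {η : ℝ → ℝ} {A : ℕ → ℝ} {u : ℕ → ℝ → ℝ} {N : ℕ}
  (hη : IsCutoff η) (hA : Tendsto A atTop atTop)
  (hu : ∀ i ≥ N, IsBaseWarping η (A i) (u i))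

include hη hA hu

lemma eventually_riemDist_polarMap_le (n : ℕ) : ∀ᶠ i in atTop, ∀ x ∈ coordBox n,
    ∀ y ∈ coordBox n, riemDist (exampleMetric η (A i) (u i)) (polarMap x) (polarMap y)
      ≤ 7 * ‖x - y‖ := by
  have hn : (0 : ℝ) < 1 / (n + 2) := by positivity
  filter_upwards [eventually_phiFun_gt hη hA hn (by norm_num : (1 / 2 : ℝ) < 1),
    hA.eventually_ge_atTop 10, eventually_ge_atTop N] with i h1 h2 h3 x hx y hy
  exact riemDist_polarMap_le hη h2 (hu i h3) hn (fun r hr => (h1 r hr.1).le) (coordBox_fst hx)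
    (coordBox_fst hy)

/-- A limit of the distances separates the points of the regular part. -/
lemma eq_of_tendsto_riemDist_zero {σ : ℕ → ℕ} (hσ : StrictMono σ) {p q : M}
    (hp : p ∈ regularPart) (hq : q ∈ regularPart)
    (h : Tendsto (fun i => riemDist (exampleMetric η (A (σ i)) (u (σ i))) p q) atTop (𝓝 0)) :
    p = q := by
  have hA' := hA.comp hσ.tendsto_atTop
  have h42 := h.const_mul 42
  rw [mul_zero] at h42
  have hev : ∀ᶠ i in atTop, 10 ≤ A (σ i) ∧ N ≤ σ i :=
    (hA'.eventually_ge_atTop 10).and (hσ.tendsto_atTop.eventually_ge_atTop N)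
  have hlen : ∀ i, ∃ ℓ, HasCurve (exampleMetric η (A (σ i)) (u (σ i))) p q ℓ :=
    fun i => exists_hasCurve (polarChart_mem_example _ _ _) hp hq
  have h1 : horiz p = horiz q := by
    have : ‖horiz q - horiz p‖ ≤ 0 := by
      refine ge_of_tendsto h42 ?_
      filter_upwards [hev] with i hi
      exact norm_sub_le_of_lengths (by norm_num)
        (fun ℓ hℓ => horiz_sub_le hη hi.1 (hu _ hi.2) hℓ) (hlen i)
    exact (sub_eq_zero.1 (norm_le_zero_iff.1 this)).symm
  have h2 : height p = height q := by
    have : ‖height q - height p‖ ≤ 0 := by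
      refine ge_of_tendsto h42 ?_
      filter_upwards [hev] with i hi
      exact norm_sub_le_of_lengths (by norm_num)
        (fun ℓ hℓ => height_sub_le hη hi.1 (hu _ hi.2) hℓ) (hlen i)
    exact (sub_eq_zero.1 (norm_le_zero_iff.1 this)).symm
  have hr : rad p = rad q := by rw [rad, rad, h2]
  have hr0 := ((mem_regularPart_iff p).1 hp).1
  -- Cutting off at half the radius keeps the cutoff nonzero at `p`, while eventually `ρ` is smaller
  -- and `φ ≥ 1/2` beyond. The common nonzero factor is then cancelled.
  have h3 : cutFibre (rad p / 2) p = cutFibre (rad p / 2) q := by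
    have : ‖cutFibre (rad p / 2) q - cutFibre (rad p / 2) p‖ ≤ 0 := by
      refine ge_of_tendsto h42 ?_
      filter_upwards [hev, hσ.tendsto_atTop.eventually (eventually_phiFun_gt hη hA
        (half_pos hr0) (by norm_num : (1 / 2 : ℝ) < 1)),
        ((tendsto_rho hA).comp hσ.tendsto_atTop).eventually_le_const (half_pos hr0)]
        with i hi hi' hi''
      exact norm_sub_le_of_lengths (by norm_num)
        (fun ℓ hℓ => cutFibre_sub_le hη hi.1 (hu _ hi.2) hi'' (fun r hr => (hi' r hr.1.le).le) hℓ)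
        (hlen i)
    exact (sub_eq_zero.1 (norm_le_zero_iff.1 this)).symm
  refine M_ext h1 h2 ?_
  rw [cutFibre, cutFibre, ← hr] at h3
  have h4 : ((max (rad p - rad p / 2) 0 ^ 2 : ℝ) : ℂ) ≠ 0 := by
    rw [Complex.ofReal_ne_zero, max_eq_left (by linarith)]
    have : 0 < rad p - rad p / 2 := by linarith
    positivity
  exact Circle.ext (mul_left_cancel₀ h4 h3)

/-- Pulled back to coordinate boxes the distances are eventually Lipschitz with constant `7 + 7 =
14`, so compactness can be applied in Euclidean space, first for `u` and then along that subsequence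
for the distances. Symmetry and the triangle inequality pass to the limit; separation of points is
`eq_of_tendsto_riemDist_zero`. -/
theorem exists_isLimitAlong : ∃ (σ : ℕ → ℕ) (φlim ulim : ℝ → ℝ) (dstar : M → M → ℝ),
    IsLimitAlong (fun i => phiFun η (A i)) u (fun i => riemDist (exampleMetric η (A i) (u i)))
      σ φlim ulim dstar := by
  obtain ⟨σ₁, ulim, hσ₁, hulim⟩ := exists_subseq_tendstoUniformlyOn
    (K := fun _ => Icc (0 : ℝ) 2) (fun _ => isCompact_Icc) (F := u) (by
      intro _ x hx
      refine ⟨2, ?_⟩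
      filter_upwards [eventually_ge_atTop N] with i hi
      rw [abs_of_nonneg ((hu i hi).nonneg hx)]
      exact ((hu i hi).le_self hx).trans hx.2) (by
      intro _
      refine ⟨1, ?_⟩
      filter_upwards [eventually_ge_atTop N] with i hi x hx y hy
      rw [one_mul, Real.dist_eq]
      exact (hu i hi).abs_sub_le hx hy)
  set d : ℕ → M → M → ℝ := fun i => riemDist (exampleMetric η (A i) (u i)) with hd
  have htri : ∀ i, ∀ p ∈ regularPart, ∀ q ∈ regularPart, ∀ s ∈ regularPart,
      d i p s ≤ d i p q + d i q s := fun i p hp q hq s hs =>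
    riemDist_triangle (exists_hasCurve (polarChart_mem_example _ _ _) hp hq)
      (exists_hasCurve (polarChart_mem_example _ _ _) hq hs)
  have hmem : ∀ n, ∀ x ∈ coordBox n, polarMap x ∈ regularPart :=
    fun n x hx => mem_image_of_mem _ (coordBox_subset n hx)
  obtain ⟨σ₂, G, hσ₂, hG⟩ := exists_subseq_tendstoUniformlyOn
    (K := fun n => coordBox n ×ˢ coordBox n) (fun n => isCompact_Icc.prod isCompact_Icc)
    (F := fun i z => d (σ₁ i) (polarMap z.1) (polarMap z.2)) (by
      intro n z hz
      refine ⟨7 * ‖z.1 - z.2‖, ?_⟩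
      filter_upwards [hσ₁.tendsto_atTop.eventually (eventually_riemDist_polarMap_le hη hA hu n)]
        with i hi
      rw [abs_of_nonneg (riemDist_nonneg _ _ _)]
      exact hi _ hz.1 _ hz.2) (by
      intro n
      refine ⟨14, ?_⟩
      filter_upwards [hσ₁.tendsto_atTop.eventually (eventually_riemDist_polarMap_le hη hA hu n)]
        with i hi z hz w hw
      have h1 : d (σ₁ i) _ _ ≤ _ := hi _ hz.1 _ hw.1
      have h2 : d (σ₁ i) _ _ ≤ _ := hi _ hz.2 _ hw.2
      have h3 : ‖z.1 - w.1‖ ≤ dist z w := by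
        rw [dist_eq_norm]; exact norm_fst_le (z - w)
      have h4 : ‖z.2 - w.2‖ ≤ dist z w := by
        rw [dist_eq_norm]; exact norm_snd_le (z - w)
      have t1 := htri (σ₁ i) _ (hmem n _ hz.1) _ (hmem n _ hw.1) _ (hmem n _ hz.2)
      have t2 := htri (σ₁ i) _ (hmem n _ hw.1) _ (hmem n _ hw.2) _ (hmem n _ hz.2)
      have t3 := htri (σ₁ i) _ (hmem n _ hw.1) _ (hmem n _ hz.1) _ (hmem n _ hw.2)
      have t4 := htri (σ₁ i) _ (hmem n _ hz.1) _ (hmem n _ hz.2) _ (hmem n _ hw.2)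
      have c1 : d (σ₁ i) (polarMap w.2) (polarMap z.2) = d (σ₁ i) (polarMap z.2) (polarMap w.2) :=
        riemDist_comm _ _ _
      have c2 : d (σ₁ i) (polarMap w.1) (polarMap z.1) = d (σ₁ i) (polarMap z.1) (polarMap w.1) :=
        riemDist_comm _ _ _
      rw [abs_le]
      constructor <;> linarith)
  set σ := σ₁ ∘ σ₂ with hσ
  have hσm : StrictMono σ := hσ₁.comp hσ₂
  have hlim : ∀ p ∈ regularPart, ∀ q ∈ regularPart,
      ∃ l, Tendsto (fun i => d (σ i) p q) atTop (𝓝 l) := by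
    intro p hp q hq
    obtain ⟨n, hn⟩ := exists_rad_mem (K := {p, q}) (by
      rintro s (rfl | rfl) <;> assumption) (by simp)
    obtain ⟨x, hx, rfl⟩ := exists_coordBox (hn p (by simp))
    obtain ⟨y, hy, rfl⟩ := exists_coordBox (hn q (by simp))
    exact ⟨G (x, y), (hG n).tendsto_at (x := (x, y)) ⟨hx, hy⟩⟩
  -- Defined through points rather than coordinates, so no compatibility of `G` with the periodic
  -- identifications has to be checked.
  set dstar : M → M → ℝ := fun p q => limUnder atTop fun i => d (σ i) p q with hdstar
  have hdt : ∀ p ∈ regularPart, ∀ q ∈ regularPart,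
      Tendsto (fun i => d (σ i) p q) atTop (𝓝 (dstar p q)) :=
    fun p hp q hq => tendsto_nhds_limUnder (hlim p hp q hq)
  refine ⟨σ, fun _ => 1, ulim, dstar, hσm, ?_, ?_, ?_, ?_⟩
  · intro v hv
    exact hσ₂.tendsto_atTop.eventually (hulim 0 v hv)
  · exact tendstoLocallyUniformlyOn_phiFun hη (hA.comp hσm.tendsto_atTop)
  · refine ⟨fun p hp q hq => ⟨?_, ⟨?_, ?_⟩, ?_⟩, ?_⟩
    · exact ge_of_tendsto' (hdt p hp q hq) fun i => riemDist_nonneg _ _ _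
    · intro h0
      have := hdt p hp q hq
      rw [h0] at this
      exact eq_of_tendsto_riemDist_zero hη hA hu hσm hp hq this
    · rintro rfl
      refine tendsto_nhds_unique (hdt p hp p hp) ?_
      refine tendsto_const_nhds.congr fun i => ?_
      obtain ⟨x, hx, rfl⟩ := hp
      exact (le_antisymm (riemDist_le (HasCurve.refl_of_chart
        (polarChart_mem_example η (A (σ i)) (u (σ i))) hx)) (riemDist_nonneg _ _ _)).symm
    · refine tendsto_nhds_unique (hdt p hp q hq) ?_
      exact (hdt q hq p hp).congr fun i => riemDist_comm _ _ _
    · intro p hp q hq s hs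
      exact le_of_tendsto_of_tendsto' (hdt p hp s hs) ((hdt p hp q hq).add (hdt q hq s hs))
        fun i => htri _ p hp q hq s hs
  · intro K hK hKc
    obtain ⟨n, hn⟩ := exists_rad_mem hK hKc
    have hGn := hG n
    rw [Metric.tendstoUniformlyOn_iff] at hGn ⊢
    intro ε hε
    filter_upwards [hGn ε hε] with i hi z hz
    obtain ⟨x, hx, hx'⟩ := exists_coordBox (hn z.1 hz.1)
    obtain ⟨y, hy, hy'⟩ := exists_coordBox (hn z.2 hz.2)
    have h1 : G (x, y) = dstar z.1 z.2 := by
      refine tendsto_nhds_unique ((hG n).tendsto_at (x := (x, y)) ⟨hx, hy⟩) ?_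
      simp only [hx', hy']
      exact hdt _ (hK hz.1) _ (hK hz.2)
    have h2 := hi (x, y) ⟨hx, hy⟩
    rw [h1, hx', hy'] at h2
    exact h2

end Limit

/-! ### The intrinsic distance of the limit metric -/

section Regular

variable {φ u : ℝ → ℝ} (hφ : ∀ r ∈ Ioo (0 : ℝ) 2, φ r = 1) (hu : ContinuousOn u (Ioo 0 2))
  (hu0 : ∀ r ∈ Ioo (0 : ℝ) 2, 0 ≤ u r)

include hφ hu hu0

/-- When `φ = 1` the real-valued fibre coordinate of each piece changes by at most its length. These
increments add under concatenation, which lifts the fibre coordinate along the whole curve. -/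
lemma exists_fibre_angle {p q : M} {ℓ : ℝ} (h : HasCurve {polarChart φ u} p q ℓ) :
    ∃ t, |t| ≤ ℓ ∧ q.2 = Circle.exp t * p.2 := by
  induction h with
  | piece c hc γ hγ hdom =>
    rw [mem_singleton_iff] at hc
    subst hc
    refine ⟨γ 1 2 - γ 0 2, ?_, ?_⟩
    · have hφc : ContinuousOn φ (Ioo 0 2) := continuousOn_const.congr hφ
      have h := norm_sub_le_integral (w := fun t => γ t 2) (w' := fun t => deriv γ t 2) (C := 1)
        (fun t _ => hasDerivAt_coord hγ t 2)
        (polar_speed_continuousOn hφc (fun r hr => by rw [hφ r hr]; norm_num) hu hγ hdom) (by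
          intro t ht
          have h1 := hφ _ (hdom t ht)
          have h2 := (polar_speed_ge (φ := φ) (u := u) (x := γ t) (by rw [h1]; norm_num)
            (hu0 _ (hdom t ht)) (deriv γ t)).2.2
          rw [one_mul]
          rw [h1, one_mul] at h2
          exact h2)
      rw [one_mul] at h
      exact h
    · show Circle.exp (γ 1 2) = Circle.exp (γ 1 2 - γ 0 2) * Circle.exp (γ 0 2)
      rw [← Circle.exp_add, sub_add_cancel]
  | trans _ _ h1 h2 =>
    obtain ⟨t, ht, ht'⟩ := h1
    obtain ⟨s, hs, hs'⟩ := h2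
    refine ⟨s + t, ?_, ?_⟩
    · exact (abs_add_le s t).trans (by linarith)
    · rw [hs', ht', Circle.exp_add, mul_assoc]

lemma regularDist_opposite {r : ℝ} (hr : r ∈ Ioo (0 : ℝ) 2) (θ : ℝ) :
    regularDist φ u (polarMap ![r, θ, 0]) (polarMap ![r, θ, Real.pi]) = Real.pi := by
  have hx : ![r, θ, 0] ∈ polarDom := hr
  have hy : ![r, θ, Real.pi] ∈ polarDom := hr
  have hπ := Real.pi_pos
  have hseg := hasCurve_segment (mem_singleton (polarChart φ u)) hx hy
  apply le_antisymm
  · refine riemDist_le ?_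
    have h : ∀ t : ℝ, √((![r, θ, Real.pi] - ![r, θ, 0]) ⬝ᵥ (polarMetric φ u
        (![r, θ, 0] + t • (![r, θ, Real.pi] - ![r, θ, 0])) *ᵥ
          (![r, θ, Real.pi] - ![r, θ, 0]))) = Real.pi := by
      intro t
      rw [polarMetric, dotProduct_diagonal]
      simp [hφ r hr, hπ.le]
    simp only [h] at hseg
    simpa using hseg
  · refine le_csInf ⟨_, hseg⟩ fun ℓ hℓ => ?_
    obtain ⟨t, ht, ht'⟩ := exists_fibre_angle hφ hu hu0 hℓ
    refine le_trans ?_ ht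
    have h1 : Circle.exp Real.pi = Circle.exp t := by
      have h2 : Circle.exp Real.pi = Circle.exp t * Circle.exp 0 := ht'
      rwa [Circle.exp_zero, mul_one] at h2
    obtain ⟨m, hm⟩ := Circle.exp_eq_exp.1 h1
    -- If `|t| < π`, then `π - t = 2πm` lies strictly between `0` and `2π`, impossible for an
    -- integer `m`.
    by_contra hlt
    rw [not_le, abs_lt] at hlt
    have h3 : (m : ℝ) < 1 := by nlinarith [hlt.1]
    have h4 : (0 : ℝ) < m := by nlinarith [hlt.2]
    have h5 : m < 1 := by exact_mod_cast h3
    have h6 : 0 < m := by exact_mod_cast h4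
    omega

end Regular

/-! ### Short cuts through the shrinking circle -/

section Shortcut

variable {η : ℝ → ℝ} {A : ℝ} {u : ℝ → ℝ} (hη : IsCutoff η) (hA : 10 ≤ A)
  (hu : IsBaseWarping η A u)

include hη hA hu

/-- On the segment from `r` to `ρ` the radius at time `t` is at least `r(1 - t)`, so the speed is at
most `r (10r(1 - t))^{-λ}`. The integral of `(1 - t)^{-λ}` is `1/(1 - λ)`, and the bound tends to
`r` as `λ → 0`. -/
lemma riemDist_radial_le {r : ℝ} (hr : rho A ≤ r) (hr' : r < 1 / 10) (θ ξ : ℝ) :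
    riemDist (exampleMetric η A u) (polarMap ![r, θ, ξ]) (polarMap ![rho A, θ, ξ])
      ≤ r * (10 * r) ^ (-lam η A) * (1 / (1 - lam η A)) := by
  have hρ := rho_pos A
  have hr0 : 0 < r := hρ.trans_le hr
  have hl := lam_pos hη hA
  have hl' := lam_le_half hη hA
  have hx : ![r, θ, ξ] ∈ polarDom := ⟨hr0, by
    show r < 2
    linarith⟩
  have hy : ![rho A, θ, ξ] ∈ polarDom := ⟨hρ, by
    show rho A < 2
    linarith⟩
  have hseg := hasCurve_segment (polarChart_mem_example η A u) hx hy
  refine (riemDist_le hseg).trans ?_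
  have hcont := polar_speed_continuousOn_example hη hu
    (γ := fun t : ℝ => ![r, θ, ξ] + t • (![rho A, θ, ξ] - ![r, θ, ξ])) (by fun_prop)
    fun t ht => convex_polarDom.add_smul_sub_mem hx hy ht
  have hd : ∀ t : ℝ, deriv (fun t : ℝ => ![r, θ, ξ] + t • (![rho A, θ, ξ] - ![r, θ, ξ])) t
      = ![rho A, θ, ξ] - ![r, θ, ξ] := by
    intro t
    have := (((hasDerivAt_id t).smul_const (![rho A, θ, ξ] - ![r, θ, ξ])).const_add
      ![r, θ, ξ]).deriv
    rwa [one_smul] at this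
  simp only [hd] at hcont
  have hint : ∫ t in (0 : ℝ)..1, r * (10 * r) ^ (-lam η A) * (1 - t) ^ (-lam η A)
      = r * (10 * r) ^ (-lam η A) * (1 / (1 - lam η A)) := by
    rw [intervalIntegral.integral_const_mul,
      intervalIntegral.integral_comp_sub_left (fun t => t ^ (-lam η A)) 1,
      integral_rpow (Or.inl (by linarith)), sub_self, sub_zero, Real.one_rpow,
      Real.zero_rpow (by linarith), sub_zero, neg_add_eq_sub]
  rw [← hint]
  apply intervalIntegral.integral_mono_on_of_le_Ioo zero_le_one
  · apply ContinuousOn.intervalIntegrable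
    rwa [uIcc_of_le zero_le_one]
  · apply IntervalIntegrable.const_mul
    have h := (intervalIntegral.intervalIntegrable_rpow' (a := 1) (b := 0)
      (r := -lam η A) (by linarith)).comp_sub_left 1
    simpa using h
  · intro t ht
    have hz := convex_polarDom.add_smul_sub_mem hx hy (Ioo_subset_Icc_self ht)
    set z := ![r, θ, ξ] + t • (![rho A, θ, ξ] - ![r, θ, ξ]) with hz_def
    have hz0 : z 0 = r + t * (rho A - r) := by simp [hz_def]
    have hzr : r * (1 - t) ≤ z 0 := by
      rw [hz0]
      nlinarith [mul_pos ht.1 hρ]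
    have hzr' : z 0 ≤ r := by
      rw [hz0]
      nlinarith [ht.1]
    have h1t : 0 < 1 - t := by linarith [ht.2]
    have hφ0 := phiFun_pos η A (z 0)
    refine (polar_speed_le hφ0 (hu.pos _ hz).le _).trans ?_
    have hv : |(![rho A, θ, ξ] - ![r, θ, ξ]) 0| ≤ r := by
      simp only [Pi.sub_apply, Matrix.cons_val_zero]
      rw [abs_le]
      constructor <;> linarith
    have hinv : (phiFun η A (z 0))⁻¹ ≤ (10 * r) ^ (-lam η A) * (1 - t) ^ (-lam η A) := by
      refine (inv_phiFun_le hη hA hz.1 (by linarith)).trans ?_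
      rw [← Real.mul_rpow (by linarith) h1t.le]
      exact Real.rpow_le_rpow_of_nonpos (by positivity) (by linarith) (by linarith)
    calc _ = (phiFun η A (z 0))⁻¹ * |(![rho A, θ, ξ] - ![r, θ, ξ]) 0| := by simp
      _ ≤ ((10 * r) ^ (-lam η A) * (1 - t) ^ (-lam η A)) * r :=
          mul_le_mul hinv hv (abs_nonneg _) (by positivity)
      _ = _ := by ring

omit hu in
lemma riemDist_axis_le (θ : ℝ) :
    riemDist (exampleMetric η A u) (polarMap ![rho A, θ, 0]) (polarMap ![rho A, θ, Real.pi])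
      ≤ Real.exp (-A) * Real.pi := by
  have hρ := rho_pos A
  have hρ' := rho_lt hA
  have hπ := Real.pi_pos
  have hmem : rho A < 2 := by linarith
  have hx : ![rho A, θ, 0] ∈ polarDom := ⟨hρ, hmem⟩
  have hy : ![rho A, θ, Real.pi] ∈ polarDom := ⟨hρ, hmem⟩
  have hseg := hasCurve_segment (polarChart_mem_example η A u) hx hy
  have h : ∀ t : ℝ, √((![rho A, θ, Real.pi] - ![rho A, θ, 0]) ⬝ᵥ (polarMetric (phiFun η A) u
      (![rho A, θ, 0] + t • (![rho A, θ, Real.pi] - ![rho A, θ, 0])) *ᵥ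
        (![rho A, θ, Real.pi] - ![rho A, θ, 0]))) = Real.exp (-A) * Real.pi := by
    intro t
    rw [polarMetric, dotProduct_diagonal]
    have hz : (![rho A, θ, 0] + t • (![rho A, θ, Real.pi] - ![rho A, θ, 0])) 0 = rho A := by
      simp
    rw [hz, phiFun_left hη hρ.le le_rfl]
    simp only [Pi.sub_apply, Matrix.cons_val_zero, Matrix.cons_val_one, Matrix.cons_val, sub_self,
      sub_zero]
    rw [zero_pow two_ne_zero, mul_zero, mul_zero, zero_add, zero_add, ← mul_pow,
      Real.sqrt_sq (by positivity)]
  simp only [h] at hseg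
  refine riemDist_le ?_
  simpa using hseg

lemma riemDist_opposite_le {r : ℝ} (hr : rho A ≤ r) (hr' : r < 1 / 10) (θ : ℝ) :
    riemDist (exampleMetric η A u) (polarMap ![r, θ, 0]) (polarMap ![r, θ, Real.pi])
      ≤ 2 * (r * (10 * r) ^ (-lam η A) * (1 / (1 - lam η A))) + Real.exp (-A) * Real.pi := by
  have hρ := rho_pos A
  have hreg : ∀ s ξ, rho A ≤ s → s < 1 / 10 → polarMap ![s, θ, ξ] ∈ regularPart :=
    fun s ξ h1 h2 => ⟨_, ⟨hρ.trans_le h1, h2.trans (by norm_num)⟩, rfl⟩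
  have hρ' : rho A < 1 / 10 := hr.trans_lt hr'
  have hc := fun p hp q hq => exists_hasCurve (polarChart_mem_example η A u) (p := p) (q := q) hp hq
  have h1 := riemDist_radial_le hη hA hu hr hr' θ 0
  have h2 := riemDist_radial_le hη hA hu hr hr' θ Real.pi
  have h3 := riemDist_axis_le (u := u) hη hA θ
  have t1 := riemDist_triangle (hc _ (hreg r 0 hr hr') _ (hreg _ 0 le_rfl hρ'))
    (hc _ (hreg _ 0 le_rfl hρ') _ (hreg r Real.pi hr hr'))
  have t2 := riemDist_triangle (hc _ (hreg _ 0 le_rfl hρ') _ (hreg _ Real.pi le_rfl hρ'))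
    (hc _ (hreg _ Real.pi le_rfl hρ') _ (hreg r Real.pi hr hr'))
  rw [riemDist_comm] at h2
  linarith

end Shortcut

/-! ### Comparison of the two distances in the limit. -/

section Limit

variable {η : ℝ → ℝ} {A : ℕ → ℝ} {u : ℕ → ℝ → ℝ} {N : ℕ} {σ : ℕ → ℕ} {φlim ulim : ℝ → ℝ}
  {dstar : M → M → ℝ}

theorem limit_distances (hη : IsCutoff η) (hA : Tendsto A atTop atTop)
    (hu : ∀ i ≥ N, IsBaseWarping η (A i) (u i))
    (h : IsLimitAlong (fun i => phiFun η (A i)) u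
      (fun i => riemDist (exampleMetric η (A i) (u i))) σ φlim ulim dstar)
    {r : ℝ} (hr : 0 < r) (hr' : r < 1 / 40) (θ : ℝ) :
    polarMap ![r, θ, 0] ∈ regularPart ∧ polarMap ![r, θ, Real.pi] ∈ regularPart ∧
      dstar (polarMap ![r, θ, 0]) (polarMap ![r, θ, Real.pi]) ≤ 2 * r ∧ 2 * r < Real.pi ∧
      regularDist φlim ulim (polarMap ![r, θ, 0]) (polarMap ![r, θ, Real.pi]) = Real.pi := by
  have hp : polarMap ![r, θ, 0] ∈ regularPart := ⟨_, ⟨hr, hr'.trans (by norm_num)⟩, rfl⟩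
  have hq : polarMap ![r, θ, Real.pi] ∈ regularPart := ⟨_, ⟨hr, hr'.trans (by norm_num)⟩, rfl⟩
  have hσ := h.strictMono.tendsto_atTop
  have hAσ := hA.comp hσ
  refine ⟨hp, hq, ?_, by linarith [Real.pi_gt_three], ?_⟩
  · have hd : Tendsto (fun i => riemDist (exampleMetric η (A (σ i)) (u (σ i)))
        (polarMap ![r, θ, 0]) (polarMap ![r, θ, Real.pi])) atTop
        (𝓝 (dstar (polarMap ![r, θ, 0]) (polarMap ![r, θ, Real.pi]))) := by
      have := h.tendsto_dist {polarMap ![r, θ, 0], polarMap ![r, θ, Real.pi]}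
        (by rintro s (rfl | rfl) <;> assumption) (by simp)
      exact this.tendsto_at (x := (polarMap ![r, θ, 0], polarMap ![r, θ, Real.pi]))
        ⟨by simp, by simp⟩
    have hl := (tendsto_lam hη hA).comp hσ
    have hlim : Tendsto (fun i => 2 * (r * (10 * r) ^ (-lam η (A (σ i))) *
        (1 / (1 - lam η (A (σ i))))) + Real.exp (-A (σ i)) * Real.pi) atTop
        (𝓝 (2 * (r * (10 * r) ^ (-(0 : ℝ)) * (1 / (1 - 0))) + 0 * Real.pi)) := by
      refine Tendsto.add (Tendsto.const_mul 2 (Tendsto.mul (Tendsto.const_mul r ?_) ?_)) ?_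
      · exact (Real.continuousAt_const_rpow (by positivity)).tendsto.comp hl.neg
      · exact tendsto_const_nhds.div (tendsto_const_nhds.sub hl) (by norm_num)
      · exact (Real.tendsto_exp_neg_atTop_nhds_zero.comp hAσ).mul_const _
    simp only [neg_zero, Real.rpow_zero, sub_zero, div_one, mul_one, zero_mul, add_zero] at hlim
    refine le_of_tendsto_of_tendsto hd hlim ?_
    filter_upwards [hAσ.eventually_ge_atTop 10, hσ.eventually_ge_atTop N,
      ((tendsto_rho hA).comp hσ).eventually_le_const hr] with i h1 h2 h3
    exact riemDist_opposite_le hη h1 (hu _ h2) h3 (by linarith) θ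
  -- Whatever the subsequence, the fibre factor can only converge to 1, so the intrinsic distance of
  -- the limit metric is known exactly.
  · have hφ : ∀ s ∈ Ioo (0 : ℝ) 2, φlim s = 1 := fun s hs =>
      tendsto_nhds_unique (h.tendsto_phi.tendsto_at hs) ((tendsto_phiFun hη hA hs.1).comp hσ)
    have hev := hσ.eventually_ge_atTop N
    have hc : ContinuousOn ulim (Icc 0 2) :=
      h.tendsto_u.continuousOn (hev.mono fun i hi => (hu _ hi).continuousOn).frequently
    refine regularDist_opposite hφ (hc.mono Ioo_subset_Icc_self) (fun s hs => ?_)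
      ⟨hr, hr'.trans (by norm_num)⟩ θ
    refine ge_of_tendsto (h.tendsto_u.tendsto_at (Ioo_subset_Icc_self hs)) ?_
    exact hev.mono fun i hi => (hu _ hi).nonneg (Ioo_subset_Icc_self hs)

end Limit

/-! ### Change of coordinates in patches -/

lemma pd_eq_fderiv {n : ℕ} {F : (Fin n → ℝ) → ℝ} {x : Fin n → ℝ} (hF : DifferentiableAt ℝ F x)
    (i : Fin n) : pd i F x = fderiv ℝ F x (Pi.single i 1) := by
  have h1 : HasFDerivAt F (fderiv ℝ F x) (Function.update x i (x i)) := by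
    rw [Function.update_eq_self]; exact hF.hasFDerivAt
  exact (h1.comp_hasDerivAt (x i) (hasDerivAt_update x i (x i))).deriv

lemma tangentVec_eq_fderiv {ψ : (Fin 2 → ℝ) → Fin 3 → ℝ} {y : Fin 2 → ℝ}
    (hψ : DifferentiableAt ℝ ψ y) (a : Fin 2) :
    tangentVec ψ a y = fderiv ℝ ψ y (Pi.single a 1) := by
  ext k
  have h : DifferentiableAt ℝ (fun z => ψ z k) y := differentiableAt_pi.1 hψ k
  rw [tangentVec, pd_eq_fderiv h, fderiv_apply hψ k]
  rfl

section Patch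

variable {X : Type*} [TopologicalSpace X] {𝒜 : Set (Chart X)} {S : Set X}

lemma Patch.differentiableAt (P : Patch 𝒜 S) {y : Fin 2 → ℝ} (hy : y ∈ P.U) :
    DifferentiableAt ℝ P.ψ y :=
  (P.smooth.contDiffAt (P.isOpen_U.mem_nhds hy)).differentiableAt (by simp)

/-- Change of coordinates in a patch. -/
lemma Patch.exists_comp (P : Patch 𝒜 S) {c : Chart X} (hc : c ∈ 𝒜) {W : Set (Fin 3 → ℝ)}
    (hW : IsOpen W) {τ σ : (Fin 3 → ℝ) → Fin 3 → ℝ} (hτ : ContDiffOn ℝ ∞ τ W)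
    (hσ : Differentiable ℝ σ) (hστ : ∀ x ∈ W, σ (τ x) = x) (hτc : MapsTo τ W c.dom)
    (hmap : ∀ x ∈ W, c.map (τ x) = P.c.map x) :
    ∃ P' : Patch 𝒜 S, P'.c = c ∧ P'.U = P.U ∩ P.ψ ⁻¹' W ∧ P'.ψ = τ ∘ P.ψ := by
  have hU : IsOpen (P.U ∩ P.ψ ⁻¹' W) :=
    P.smooth.continuousOn.isOpen_inter_preimage P.isOpen_U hW
  have hτd : ∀ x ∈ W, DifferentiableAt ℝ τ x := fun x hx =>
    (hτ.contDiffAt (hW.mem_nhds hx)).differentiableAt (by simp)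
  have heq : ∀ y ∈ P.U ∩ P.ψ ⁻¹' W, (c.map ∘ τ ∘ P.ψ) y = (P.c.map ∘ P.ψ) y :=
    fun y hy => hmap _ hy.2
  have hmaps : MapsTo (c.map ∘ τ ∘ P.ψ) (P.U ∩ P.ψ ⁻¹' W) S := by
    intro y hy
    rw [heq y hy]
    exact P.mapsTo hy.1
  refine ⟨⟨c, hc, P.U ∩ P.ψ ⁻¹' W, hU, τ ∘ P.ψ, ?_, ?_, ?_, hmaps, ?_⟩, rfl, rfl, rfl⟩
  · exact hτ.comp (P.smooth.mono inter_subset_left) fun y hy => hy.2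
  · exact fun y hy => hτc hy.2
  · intro y hy
    have hψ := P.differentiableAt hy.1
    have hτ' := hτd _ hy.2
    -- The local left inverse `σ` makes the derivative of `τ` injective, so linear independence of
    -- the tangent vectors survives.
    have hker : LinearMap.ker (fderiv ℝ τ (P.ψ y)).toLinearMap = ⊥ := by
      have h1 : HasFDerivAt (σ ∘ τ) ((fderiv ℝ σ (τ (P.ψ y))).comp (fderiv ℝ τ (P.ψ y))) (P.ψ y) :=
        (hσ _).hasFDerivAt.comp _ hτ'.hasFDerivAt
      have h2 : HasFDerivAt (σ ∘ τ) (ContinuousLinearMap.id ℝ _) (P.ψ y) := by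
        refine (hasFDerivAt_id _).congr_of_eventuallyEq ?_
        filter_upwards [hW.mem_nhds hy.2] with x hx using hστ x hx
      have h3 := h1.unique h2
      rw [LinearMap.ker_eq_bot]
      intro v w hvw
      have hv := congrArg (fun L => L v) h3
      have hw := congrArg (fun L => L w) h3
      simp only [ContinuousLinearMap.comp_apply, ContinuousLinearMap.id_apply] at hv hw
      rw [← hv, ← hw]
      exact congrArg _ hvw
    have h := (P.immersion y hy.1).map' (fderiv ℝ τ (P.ψ y)).toLinearMap hker
    have heq' : (fun a => tangentVec (τ ∘ P.ψ) a y)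
        = (fderiv ℝ τ (P.ψ y)).toLinearMap ∘ fun a => tangentVec P.ψ a y := by
      ext1 a
      rw [tangentVec_eq_fderiv (hτ'.comp y hψ), fderiv_comp y hτ' hψ, Function.comp_apply,
        tangentVec_eq_fderiv hψ]
      rfl
    rw [heq']
    exact h
  · have h1 : IsOpenEmbedding (inclusion (inter_subset_left : P.U ∩ P.ψ ⁻¹' W ⊆ P.U)) :=
      IsOpenEmbedding.inclusion _ (hU.preimage continuous_subtype_val)
    have h2 := P.isOpenEmbedding.comp h1
    convert h2 using 1
    ext y
    exact heq y y.2

/-- Restriction of a patch to a smaller region of coordinate space. -/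
lemma Patch.exists_restrict (P : Patch 𝒜 S) {W : Set (Fin 3 → ℝ)} (hW : IsOpen W) :
    ∃ P' : Patch 𝒜 S, P'.c = P.c ∧ P'.U = P.U ∩ P.ψ ⁻¹' W ∧ P'.ψ = P.ψ := by
  have hU : IsOpen (P.U ∩ P.ψ ⁻¹' W) :=
    P.smooth.continuousOn.isOpen_inter_preimage P.isOpen_U hW
  have hmaps : MapsTo (P.c.map ∘ P.ψ) (P.U ∩ P.ψ ⁻¹' W) S := fun y hy => P.mapsTo hy.1
  refine ⟨⟨P.c, P.mem, _, hU, P.ψ, P.smooth.mono inter_subset_left,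
    fun y hy => P.mapsTo_dom hy.1, fun y hy => P.immersion y hy.1, hmaps, ?_⟩, rfl, rfl, rfl⟩
  exact P.isOpenEmbedding.comp (IsOpenEmbedding.inclusion
    (inter_subset_left : P.U ∩ P.ψ ⁻¹' W ⊆ P.U) (hU.preimage continuous_subtype_val))

end Patch

/-! ### Patches in polar coordinates -/

/-- The polar coordinates `(α + β s, θ, ξ)` of the point with Cartesian coordinates `(x, y, ξ)`, the
angle being chosen near the argument of `w`. -/
def toPolar (α β : ℝ) (w : ℂ) (x : Fin 3 → ℝ) : Fin 3 → ℝ :=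
  ![α + β * capRadius x, Complex.arg (⟨x 0, x 1⟩ * (starRingEnd ℂ) w) + Complex.arg w, x 2]

/-- The inverse of `toPolar`. -/
def ofPolar (α β : ℝ) (x : Fin 3 → ℝ) : Fin 3 → ℝ :=
  ![β * (x 0 - α) * Real.cos (x 1), β * (x 0 - α) * Real.sin (x 1), x 2]

section ToPolar

variable {α β : ℝ} {w : ℂ} {x : Fin 3 → ℝ}

/-- Rotating by the conjugate of `w` moves the branch cut opposite to `w`; adding `arg w` back gives
an argument of `z` that is smooth near `w` itself. -/
lemma norm_mul_exp_toPolar (hw : w ≠ 0) (z : ℂ) :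
    (‖z‖ : ℂ) * Complex.exp ((Complex.arg (z * (starRingEnd ℂ) w) + Complex.arg w : ℝ)
      * Complex.I) = z := by
  have h1 := Complex.norm_mul_exp_arg_mul_I (z * (starRingEnd ℂ) w)
  have h2 := Complex.norm_mul_exp_arg_mul_I w
  have hn : (‖w‖ : ℂ) ≠ 0 := by simpa using hw
  rw [norm_mul, RCLike.norm_conj] at h1
  push_cast at h1 ⊢
  rw [add_mul, Complex.exp_add]
  have h3 : w * (starRingEnd ℂ) w = (‖w‖ : ℂ) ^ 2 := by
    rw [Complex.mul_conj, Complex.normSq_eq_norm_sq]; push_cast; rfl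
  have h4 : (‖w‖ : ℂ) ^ 2 ≠ 0 := pow_ne_zero 2 hn
  apply mul_left_cancel₀ h4
  linear_combination Complex.exp (Complex.arg w * Complex.I) * (‖w‖ : ℂ) * h1
    + z * (starRingEnd ℂ) w * h2 + z * h3

lemma ofPolar_toPolar (hβ : β ^ 2 = 1) (hw : w ≠ 0) : ofPolar α β (toPolar α β w x) = x := by
  have h := norm_mul_exp_toPolar hw ⟨x 0, x 1⟩
  have h1 : β * (α + β * capRadius x - α) = ‖(⟨x 0, x 1⟩ : ℂ)‖ := by
    rw [← capRadius_eq]; linear_combination capRadius x * hβ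
  have hre := congrArg Complex.re h
  have him := congrArg Complex.im h
  rw [Complex.re_ofReal_mul, Complex.exp_ofReal_mul_I_re] at hre
  rw [Complex.im_ofReal_mul, Complex.exp_ofReal_mul_I_im] at him
  ext i
  fin_cases i
  · show β * (α + β * capRadius x - α) * Real.cos _ = x 0
    rw [h1]; exact hre
  · show β * (α + β * capRadius x - α) * Real.sin _ = x 1
    rw [h1]; exact him
  · simp [ofPolar, toPolar]

lemma differentiable_ofPolar : Differentiable ℝ (ofPolar α β) := by
  rw [differentiable_pi]
  intro i
  fin_cases i
  · show Differentiable ℝ fun x : Fin 3 → ℝ => β * (x 0 - α) * Real.cos (x 1)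
    fun_prop
  · show Differentiable ℝ fun x : Fin 3 → ℝ => β * (x 0 - α) * Real.sin (x 1)
    fun_prop
  · show Differentiable ℝ fun x : Fin 3 → ℝ => x 2
    fun_prop

/-- The region where `toPolar` is smooth. -/
def toPolarDom (w : ℂ) : Set (Fin 3 → ℝ) :=
  {x | (⟨x 0, x 1⟩ * (starRingEnd ℂ) w : ℂ) ∈ Complex.slitPlane}

lemma contDiff_mk : ContDiff ℝ ∞ fun x : Fin 3 → ℝ => (⟨x 0, x 1⟩ : ℂ) := by
  simp only [Complex.mk_eq_add_mul_I]
  exact (Complex.ofRealCLM.contDiff.comp (contDiff_apply ℝ ℝ 0)).add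
    ((Complex.ofRealCLM.contDiff.comp (contDiff_apply ℝ ℝ 1)).mul contDiff_const)

lemma isOpen_toPolarDom (w : ℂ) : IsOpen (toPolarDom w) :=
  Complex.isOpen_slitPlane.preimage (contDiff_mk.continuous.mul continuous_const)

lemma ne_zero_of_mem_toPolarDom (hx : x ∈ toPolarDom w) : (⟨x 0, x 1⟩ : ℂ) ≠ 0 := by
  intro h
  apply Complex.slitPlane_ne_zero hx
  rw [h, zero_mul]

lemma contDiffOn_toPolar : ContDiffOn ℝ ∞ (toPolar α β w) (toPolarDom w) := by
  rw [contDiffOn_pi]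
  intro i
  fin_cases i
  · show ContDiffOn ℝ ∞ (fun x : Fin 3 → ℝ => α + β * capRadius x) _
    refine contDiffOn_const.add (contDiffOn_const.mul ?_)
    exact (contDiff_mk.contDiffOn.norm ℝ fun x hx => ne_zero_of_mem_toPolarDom hx).congr
      fun x _ => capRadius_eq x
  · show ContDiffOn ℝ ∞ (fun x : Fin 3 → ℝ =>
      Complex.arg (⟨x 0, x 1⟩ * (starRingEnd ℂ) w) + Complex.arg w) _
    refine ContDiffOn.add ?_ contDiffOn_const
    intro x hx
    have h1 : ContDiffAt ℝ ∞ Complex.log (⟨x 0, x 1⟩ * (starRingEnd ℂ) w) :=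
      (Complex.contDiffAt_log hx).restrict_scalars ℝ
    have h2 : ContDiffAt ℝ ∞ (fun x : Fin 3 → ℝ => (⟨x 0, x 1⟩ * (starRingEnd ℂ) w : ℂ)) x :=
      (contDiff_mk.mul contDiff_const).contDiffAt
    have h3 := (Complex.imCLM.contDiff.contDiffAt.comp x (h1.comp x h2)).contDiffWithinAt
      (s := toPolarDom w)
    exact h3.congr (fun y _ => (Complex.log_im _).symm) (Complex.log_im _).symm
  · exact (contDiff_apply ℝ ℝ 2).contDiffOn

lemma polarMap_toPolar (hw : w ≠ 0) (hx : (⟨x 0, x 1⟩ : ℂ) ≠ 0) :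
    polarMap (toPolar α β w x)
      = polarMap ![α + β * capRadius x, Complex.arg ⟨x 0, x 1⟩, x 2] := by
  refine M_ext ?_ ?_ rfl
  · rw [horiz_polarMap, horiz_polarMap]
    simp only [toPolar, Matrix.cons_val_zero, Matrix.cons_val_one]
    congr 1
    have h1 := norm_mul_exp_toPolar hw ⟨x 0, x 1⟩
    have h2 := Complex.norm_mul_exp_arg_mul_I ⟨x 0, x 1⟩
    have hn : (‖(⟨x 0, x 1⟩ : ℂ)‖ : ℂ) ≠ 0 := by simpa using hx
    exact mul_left_cancel₀ hn (h1.trans h2.symm)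
  · rw [height_polarMap, height_polarMap]
    rfl

end ToPolar

lemma polarMap_eq_iff {x y : Fin 3 → ℝ} (hx : x ∈ polarDom) (hy : y ∈ polarDom)
    (h : polarMap x = polarMap y) :
    ∃ m n : ℤ, x = ![y 0, y 1 + m * (2 * Real.pi), y 2 + n * (2 * Real.pi)] := by
  have h0 : x 0 = y 0 := by
    rw [← rad_polarMap ⟨hx.1.le, hx.2.le⟩, h, rad_polarMap ⟨hy.1.le, hy.2.le⟩]
  have h1 : Complex.exp (x 1 * Complex.I) = Complex.exp (y 1 * Complex.I) := by
    have := congrArg horiz h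
    rw [horiz_polarMap, horiz_polarMap, h0] at this
    refine mul_left_cancel₀ ?_ this
    rw [Complex.ofReal_ne_zero]
    refine (Real.sin_pos_of_pos_of_lt_pi ?_ ?_).ne'
    · have := hy.1; have := Real.pi_pos; positivity
    · nlinarith [hy.2, Real.pi_pos]
  have h2 : Circle.exp (x 2) = Circle.exp (y 2) := congrArg Prod.snd h
  obtain ⟨n, hn⟩ := Circle.exp_eq_exp.1 h2
  have h1' : Circle.exp (x 1) = Circle.exp (y 1) := Circle.ext (by simpa using h1)
  obtain ⟨m, hm⟩ := Circle.exp_eq_exp.1 h1'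
  refine ⟨m, n, ?_⟩
  ext i
  fin_cases i
  · exact h0
  · exact hm
  · exact hn

lemma polarMap_add_two_pi (x : Fin 3 → ℝ) (m n : ℤ) :
    polarMap (x + ![0, m * (2 * Real.pi), n * (2 * Real.pi)]) = polarMap x := by
  refine M_ext ?_ ?_ ?_
  · rw [horiz_polarMap, horiz_polarMap]
    congr 1
    · simp
    · have : Circle.exp (x 1 + m * (2 * Real.pi)) = Circle.exp (x 1) :=
        Circle.exp_eq_exp.2 ⟨m, rfl⟩
      have h := congrArg (fun z : Circle => (z : ℂ)) this
      simp only [Circle.coe_exp] at h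
      exact h
  · rw [height_polarMap, height_polarMap]
    simp
  · exact Circle.exp_eq_exp.2 ⟨n, rfl⟩

lemma mem_warpedAtlas_polar (φ u : ℝ → ℝ) (a b : ℝ) : polarChart φ u ∈ warpedAtlas φ u a b :=
  Or.inl rfl

/-- Around each point of a surface in the regular part there is a patch in polar coordinates, with
prescribed values of the angular coordinates. -/
theorem exists_polar_patch {φ u : ℝ → ℝ} {a b : ℝ} (ha : 0 < a ∧ a ≤ 2) (hb : 0 < b ∧ b ≤ 2)
    {S : Set M} (hS : IsClosedSurface (warpedAtlas φ u a b) S) {x : Fin 3 → ℝ}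
    (hx : x ∈ polarDom) (hxS : polarMap x ∈ S) {W : Set (Fin 3 → ℝ)} (hW : IsOpen W)
    (hxW : x ∈ W) :
    ∃ P : Patch (warpedAtlas φ u a b) S, P.c = polarChart φ u ∧ MapsTo P.ψ P.U W ∧
      ∃ y ∈ P.U, P.ψ y = x := by
  -- it suffices to find a patch in polar coordinates with the right image
  suffices h : ∃ P : Patch (warpedAtlas φ u a b) S, P.c = polarChart φ u ∧
      ∃ y ∈ P.U, polarMap (P.ψ y) = polarMap x by
    obtain ⟨P, hPc, y, hy, hyx⟩ := h
    have hdom : P.ψ y ∈ polarDom := by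
      have := P.mapsTo_dom hy
      rwa [hPc] at this
    obtain ⟨m, n, hmn⟩ := polarMap_eq_iff hx hdom hyx.symm
    set v : Fin 3 → ℝ := ![0, m * (2 * Real.pi), n * (2 * Real.pi)] with hv
    have hxv : x = P.ψ y + v := by
      rw [hmn]; ext i; fin_cases i <;> simp [hv]
    obtain ⟨P', h1, h2, h3⟩ := P.exists_comp (mem_warpedAtlas_polar φ u a b) (W := polarDom)
      isOpen_polarDom (τ := fun x => x + v) (σ := fun x => x - v)
      (contDiff_id.add contDiff_const).contDiffOn (differentiable_id.sub_const v)
      (fun x _ => add_sub_cancel_right x v) (fun x hx => by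
        show (x + v) ∈ polarDom
        have : (x + v) 0 = x 0 := by simp [hv]
        exact ⟨by rw [this]; exact hx.1, by rw [this]; exact hx.2⟩)
      (fun x _ => by rw [hPc]; exact polarMap_add_two_pi x m n)
    obtain ⟨P'', h1', h2', h3'⟩ := P'.exists_restrict hW
    refine ⟨P'', h1'.trans h1, ?_, y, ?_, ?_⟩
    · intro z hz
      rw [h2'] at hz
      rw [h3']
      exact hz.2
    · rw [h2', h2, h3]
      refine ⟨⟨hy, hdom⟩, ?_⟩
      show P.ψ y + v ∈ W
      rwa [← hxv]
    · rw [h3', h3]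
      exact hxv.symm
  obtain ⟨P, y, hy, hyx⟩ := hS.2.2 _ hxS
  have hrad : rad (P.c.map (P.ψ y)) = x 0 := by
    have : P.c.map (P.ψ y) = polarMap x := hyx
    rw [this, rad_polarMap ⟨hx.1.le, hx.2.le⟩]
  have hydom := P.mapsTo_dom hy
  -- Cartesian charts
  have hcap : ∀ α β e : ℝ, β ^ 2 = 1 → P.c.dom = {x | x 0 ^ 2 + x 1 ^ 2 < e ^ 2} → 0 < e →
      (∀ s, 0 ≤ s → s < e → α + β * s ∈ Icc (0 : ℝ) 2) →
      (∀ s, 0 < s → s < e → α + β * s ∈ Ioo (0 : ℝ) 2) → α ∉ Ioo (0 : ℝ) 2 →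
      (∀ x, P.c.map x = polarMap ![α + β * capRadius x, Complex.arg ⟨x 0, x 1⟩, x 2]) →
      ∃ P : Patch (warpedAtlas φ u a b) S, P.c = polarChart φ u ∧
        ∃ y ∈ P.U, polarMap (P.ψ y) = polarMap x := by
    -- Both caps at once: the radius is `α + β · capRadius`, with `(α, β) = (0, 1)` at one pole and
    -- `(2, -1)` at the other.
    intro α β e hβ hdom he hIcc hIoo hα hmap
    set z : Fin 3 → ℝ := P.ψ y with hz
    set w : ℂ := ⟨z 0, z 1⟩ with hw
    have hze : capRadius z < e := capRadius_lt he (by rw [hdom] at hydom; exact hydom)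
    have hw0 : w ≠ 0 := by
      intro h0
      apply hα
      have hs : capRadius z = 0 := by rw [capRadius_eq, ← hw, h0, norm_zero]
      rw [hmap, rad_polarMap (show α + β * capRadius z ∈ _ from
        hIcc _ (Real.sqrt_nonneg _) hze)] at hrad
      simp only [Matrix.cons_val_zero, hs, mul_zero, add_zero] at hrad
      rw [hrad]
      exact hx
    have hpos : ∀ x ∈ toPolarDom w, 0 < capRadius x := fun x hx => by
      rw [capRadius_eq]; exact norm_pos_iff.2 (ne_zero_of_mem_toPolarDom hx)
    obtain ⟨P', h1, h2, h3⟩ := P.exists_comp (mem_warpedAtlas_polar φ u a b)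
      (W := toPolarDom w ∩ P.c.dom)
      ((isOpen_toPolarDom w).inter (by rw [hdom]; exact isOpen_capDom e))
      (τ := toPolar α β w) (σ := ofPolar α β) (contDiffOn_toPolar.mono inter_subset_left)
      differentiable_ofPolar (fun x _ => ofPolar_toPolar hβ hw0)
      (fun x hx => hIoo _ (hpos x hx.1) (capRadius_lt he (by
        have := hx.2; rw [hdom] at this; exact this)))
      (fun x hx => by
        rw [hmap]; exact polarMap_toPolar hw0 (ne_zero_of_mem_toPolarDom hx.1))
    have hmem : z ∈ toPolarDom w := by
      show w * (starRingEnd ℂ) w ∈ Complex.slitPlane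
      rw [Complex.mul_conj, Complex.ofReal_mem_slitPlane]
      exact Complex.normSq_pos.2 hw0
    refine ⟨P', h1, y, ?_, ?_⟩
    · rw [h2]
      exact ⟨hy, hmem, hydom⟩
    · rw [h3]
      show polarMap (toPolar α β w z) = _
      rw [polarMap_toPolar hw0 hw0, ← hmap]
      exact hyx
  rcases P.mem with hc | hc | hc
  · exact ⟨P, hc, y, hy, by rw [← hyx, hc]; rfl⟩
  · refine hcap 0 1 a (by norm_num) (by rw [hc]; rfl) ha.1 ?_ ?_ (by simp) ?_
    · intro s h0 hs
      exact ⟨by linarith, by linarith [ha.2]⟩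
    · intro s h0 hs
      exact ⟨by linarith, by linarith [ha.2]⟩
    · intro x
      rw [hc, zero_add, one_mul]; rfl
  · rw [mem_singleton_iff] at hc
    refine hcap 2 (-1) b (by norm_num) (by rw [hc]; rfl) hb.1 ?_ ?_ (by simp) ?_
    · intro s h0 hs
      exact ⟨by linarith [hb.2], by linarith⟩
    · intro s h0 hs
      exact ⟨by linarith [hb.2], by linarith⟩
    · intro x
      rw [hc, neg_one_mul, ← sub_eq_add_neg]; rfl

/-! ### Second order conditions at extrema -/

/-- If `c > 0`, the second derivative test makes `0` a local minimum as well. Then `k` is locally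
constant and its second derivative is zero, a contradiction. -/
lemma second_deriv_nonpos {k k' : ℝ → ℝ} {c : ℝ} (hk : ∀ᶠ t in 𝓝 (0 : ℝ), HasDerivAt k (k' t) t)
    (hk' : HasDerivAt k' c 0) (hmax : IsLocalMax k 0) : c ≤ 0 := by
  by_contra hc
  have h1 : deriv k =ᶠ[𝓝 0] k' := hk.mono fun t ht => ht.deriv
  have h2 : deriv (deriv k) 0 = c := by rw [h1.deriv_eq, hk'.deriv]
  have hmin : IsLocalMin k 0 := isLocalMin_of_deriv_deriv_pos (by rw [h2]; exact not_le.1 hc)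
    hmax.deriv_eq_zero hk.self_of_nhds.continuousAt
  have h3 : k =ᶠ[𝓝 0] fun _ => k 0 := by
    filter_upwards [hmax, hmin] with t ht ht' using le_antisymm ht ht'
  have h4 : deriv (deriv k) 0 = 0 := by
    rw [h3.deriv.deriv_eq]
    simp
  exact hc (h2 ▸ h4.le)

section Hessian

variable {F : (Fin 2 → ℝ) → ℝ} {U : Set (Fin 2 → ℝ)} {y : Fin 2 → ℝ}

lemma fderiv_eq_pd (hF : DifferentiableAt ℝ F y) (v : Fin 2 → ℝ) :
    fderiv ℝ F y v = v 0 * pd 0 F y + v 1 * pd 1 F y := by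
  have : v = v 0 • Pi.single 0 1 + v 1 • Pi.single 1 1 := by
    ext i; fin_cases i <;> simp
  conv_lhs => rw [this]
  rw [map_add, map_smul, map_smul, pd_eq_fderiv hF, pd_eq_fderiv hF]
  rfl

lemma contDiffOn_pd (hF : ContDiffOn ℝ ∞ F U) (hU : IsOpen U) (b : Fin 2) :
    ContDiffOn ℝ ∞ (pd b F) U := by
  have h1 : ContDiffOn ℝ ∞ (fun z => fderiv ℝ F z (Pi.single b 1)) U :=
    (hF.fderiv_of_isOpen hU (by simp)).clm_apply contDiffOn_const
  exact h1.congr fun z hz => pd_eq_fderiv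
    ((hF.contDiffAt (hU.mem_nhds hz)).differentiableAt (by simp)) b

lemma hessian_nonpos_of_isLocalMax (hF : ContDiffOn ℝ ∞ F U) (hU : IsOpen U) (hy : y ∈ U)
    (hmax : IsLocalMax F y) (v : Fin 2 → ℝ) :
    ∑ a, ∑ b, v a * v b * pd a (pd b F) y ≤ 0 := by
  have hd : ∀ {G : (Fin 2 → ℝ) → ℝ}, ContDiffOn ℝ ∞ G U → ∀ z ∈ U, DifferentiableAt ℝ G z :=
    fun hG z hz => (hG.contDiffAt (hU.mem_nhds hz)).differentiableAt (by simp)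
  have hl : ∀ t : ℝ, HasDerivAt (fun t : ℝ => y + t • v) v t := by
    intro t
    have := ((hasDerivAt_id t).smul_const v).const_add y
    rwa [one_smul] at this
  have hline : ∀ {G : (Fin 2 → ℝ) → ℝ}, ContDiffOn ℝ ∞ G U → ∀ t : ℝ, y + t • v ∈ U →
      HasDerivAt (fun t : ℝ => G (y + t • v))
        (v 0 * pd 0 G (y + t • v) + v 1 * pd 1 G (y + t • v)) t := by
    intro G hG t ht
    rw [← fderiv_eq_pd (hd hG _ ht)]
    exact (hd hG _ ht).hasFDerivAt.comp_hasDerivAt t (hl t)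
  have hy0 : y + (0 : ℝ) • v = y := by simp
  have hc : Tendsto (fun t : ℝ => y + t • v) (𝓝 0) (𝓝 y) := by
    have := (hl 0).continuousAt.tendsto
    rwa [hy0] at this
  have hb := fun b => contDiffOn_pd hF hU b
  have h2 : HasDerivAt (fun t : ℝ => v 0 * pd 0 F (y + t • v) + v 1 * pd 1 F (y + t • v))
      (∑ a, ∑ b, v a * v b * pd a (pd b F) y) 0 := by
    have h0 := hline (hb 0) 0 (by rwa [hy0])
    have h1 := hline (hb 1) 0 (by rwa [hy0])
    refine ((h0.const_mul (v 0)).add (h1.const_mul (v 1))).congr_deriv ?_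
    rw [hy0]
    simp only [Fin.sum_univ_two]
    ring
  refine second_deriv_nonpos (k := fun t : ℝ => F (y + t • v)) ?_ h2 ?_
  · filter_upwards [hc.eventually (hU.mem_nhds hy)] with t ht using hline hF t ht
  · have := hc.eventually hmax
    simpa [IsLocalMax, IsMaxFilter] using this

end Hessian

lemma inv_fin_two (m : Matrix (Fin 2) (Fin 2) ℝ) :
    m⁻¹ = !![m 1 1 / m.det, -m 0 1 / m.det; -m 1 0 / m.det, m 0 0 / m.det] := by
  rw [Matrix.inv_def, Matrix.adjugate_fin_two, Ring.inverse_eq_inv']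
  ext i j
  fin_cases i <;> fin_cases j <;> simp <;> ring

/-! ### The maximum principle for `r` on minimal surfaces. -/

section MaximumPrinciple

lemma linearIndependent_minor {e : Fin 2 → Fin 3 → ℝ} (h : LinearIndependent ℝ e)
    (h0 : ∀ a, e a 0 = 0) : e 0 1 * e 1 2 - e 0 2 * e 1 1 ≠ 0 := by
  intro hD
  rw [linearIndependent_fin2] at h
  obtain ⟨h1, h2⟩ := h
  by_cases h11 : e 1 1 = 0
  · have h12 : e 1 2 ≠ 0 := by
      intro h12
      apply h1
      ext i; fin_cases i
      · exact h0 1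
      · exact h11
      · exact h12
    apply h2 (e 0 2 / e 1 2)
    ext i; fin_cases i
    · simp [h0]
    · have : e 0 1 = 0 := by
        rw [h11, mul_zero, sub_zero] at hD
        exact (mul_eq_zero.1 hD).resolve_right h12
      simp [h11, this]
    · simp [h12]
  · apply h2 (e 0 1 / e 1 1)
    ext i; fin_cases i
    · simp [h0]
    · simp [h11]
    · simp only [Pi.smul_apply, smul_eq_mul]
      field_simp
      simp
      linarith

/-- At a point of a minimal surface where the tangent plane is `{dr = 0}`, the sign of the Hessian
of `r` determines the sign of `u'`. -/
lemma deriv_sign_of_hessian {φ u p q : ℝ → ℝ} (hφ : ∀ r ∈ Ioo (0 : ℝ) 2, 0 < φ r)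
    (hu : ∀ r ∈ Ioo (0 : ℝ) 2, 0 < u r)
    (hφ' : ∀ r ∈ Ioo (0 : ℝ) 2, HasDerivAt φ (φ r * q r) r)
    (hu' : ∀ r ∈ Ioo (0 : ℝ) 2, HasDerivAt u (p r) r) {ψ : (Fin 2 → ℝ) → Fin 3 → ℝ}
    {y : Fin 2 → ℝ} (hx : ψ y ∈ polarDom)
    (hind : LinearIndependent ℝ fun a => tangentVec ψ a y)
    (hmin : MeanCurvatureZeroAt (polarMetric φ u) ψ y) (h0 : ∀ a, tangentVec ψ a y 0 = 0) {s : ℝ}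
    (hH : ∀ v : Fin 2 → ℝ,
      s * ∑ a, ∑ b, v a * v b * pd a (fun z => tangentVec ψ b z 0) y ≤ 0) :
    s * p (ψ y 0) ≤ 0 := by
  have hφ0 := hφ _ hx
  have hu0 := hu _ hx
  have hD := linearIndependent_minor hind h0
  -- The tangent plane is `{dr = 0}`, so the coordinate vector of `r` is normal and may be used as a
  -- test vector.
  have hm := hmin (Pi.single 0 1) (fun a => by
    simp [polarMetric, Matrix.mulVec_diagonal, h0 a])
  set e := fun a => tangentVec ψ a y with he
  set h : Fin 2 → Fin 2 → ℝ := fun a b => pd a (fun z => tangentVec ψ b z 0) y with hh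
  set r := ψ y 0 with hr
  set B := (φ r ^ 2)⁻¹ * u r ^ 2 with hB
  set C := φ r ^ 2 with hC
  have hB0 : 0 < B := by positivity
  have hC0 : 0 < C := by positivity
  set D := e 0 1 * e 1 2 - e 0 2 * e 1 1 with hDdef
  have hg : firstForm (polarMetric φ u) ψ y =
      Matrix.of fun a b => B * (e a 1 * e b 1) + C * (e a 2 * e b 2) := by
    ext a b
    simp only [firstForm, Matrix.of_apply, polarMetric, dotProduct, Matrix.mulVec_diagonal,
      Fin.sum_univ_three, h0, Matrix.cons_val_zero, Matrix.cons_val_one, Matrix.cons_val]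
    simp only [he, hB, hC, hr]
    ring
  have hcov : ∀ a b, covDeriv (polarMetric φ u) ψ a b y 0 =
      h a b + (q r * u r ^ 2 - u r * p r) * (e a 1 * e b 1) - q r * φ r ^ 4 * (e a 2 * e b 2) := by
    intro a b
    simp only [covDeriv, christoffel_polarMetric hφ hu hφ' hu' hx, Fin.sum_univ_three]
    simp only [polarGamma, Matrix.cons_val_zero, Matrix.cons_val_one, Matrix.cons_val, h0, he, hh,
      hr]
    ring
  have hdot : ∀ a b, (Pi.single 0 1 : Fin 3 → ℝ) ⬝ᵥ (polarMetric φ u (ψ y) *ᵥ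
      covDeriv (polarMetric φ u) ψ a b y) = C⁻¹ * covDeriv (polarMetric φ u) ψ a b y 0 := by
    intro a b
    simp [polarMetric, Matrix.mulVec_diagonal, hC, hr]
  have hdet : (firstForm (polarMetric φ u) ψ y).det = B * C * D ^ 2 := by
    rw [hg, Matrix.det_fin_two]
    simp only [Matrix.of_apply, hDdef]
    ring
  simp only [hdot, hcov, inv_fin_two, hdet] at hm
  simp only [hg, Fin.sum_univ_two, Matrix.of_apply, Matrix.cons_val_zero, Matrix.cons_val_one,
    Matrix.cons_val', Matrix.cons_val_fin_one] at hm
  -- The adjugate of the first fundamental form is `B v vᵀ + C v' v'ᵀ` for these two vectors `v`,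
  -- `v'`. The trace of the Hessian of `r` thus becomes a nonnegative combination of two Hessian
  -- values.
  have h1 := hH ![e 1 1, -e 0 1]
  have h2 := hH ![e 1 2, -e 0 2]
  simp only [Fin.sum_univ_two, Matrix.cons_val_zero, Matrix.cons_val_one,
    Matrix.cons_val_fin_one] at h1 h2
  -- The minimal surface equation with denominators cleared. The two `q` terms of the Christoffel
  -- symbols cancel in the trace, because the area density of the torus `r = const` is `u` and does
  -- not involve `φ`; only `p = u'` remains.
  have key : u r * (B * (e 1 1 * e 1 1 * h 0 0 + e 1 1 * -e 0 1 * h 0 1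
        + (-e 0 1 * e 1 1 * h 1 0 + -e 0 1 * -e 0 1 * h 1 1))
      + C * (e 1 2 * e 1 2 * h 0 0 + e 1 2 * -e 0 2 * h 0 1
        + (-e 0 2 * e 1 2 * h 1 0 + -e 0 2 * -e 0 2 * h 1 1)))
      = p r * C * (B * C * D ^ 2) := by
    have hBC : u r ^ 2 = B * C := by
      rw [hB, hC]; field_simp
    have hC2 : φ r ^ 4 = C ^ 2 := by rw [hC]; ring
    rw [hBC, hC2] at hm
    clear_value B C D
    field_simp at hm
    rw [hDdef] at hm ⊢
    linear_combination u r * hm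
      + p r * C * (e 0 1 * e 1 2 - e 0 2 * e 1 1) ^ 2 * hBC
  have h3 : s * (p r * C * (B * C * D ^ 2)) ≤ 0 := by
    rw [← key]
    nlinarith [mul_nonneg hu0.le hB0.le, mul_nonneg hu0.le hC0.le]
  have h4 : 0 < C * (B * C * D ^ 2) := by positivity
  by_contra hcon
  rw [not_le] at hcon
  nlinarith [mul_pos hcon h4]

variable {φ u p q : ℝ → ℝ} (hφ : ∀ r ∈ Ioo (0 : ℝ) 2, 0 < φ r)
    (hu : ∀ r ∈ Ioo (0 : ℝ) 2, 0 < u r)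
    (hφ' : ∀ r ∈ Ioo (0 : ℝ) 2, HasDerivAt φ (φ r * q r) r)
    (hu' : ∀ r ∈ Ioo (0 : ℝ) 2, HasDerivAt u (p r) r) {ψ : (Fin 2 → ℝ) → Fin 3 → ℝ}
    {U : Set (Fin 2 → ℝ)} (hU : IsOpen U) (hψ : ContDiffOn ℝ ∞ ψ U) {y : Fin 2 → ℝ} (hy : y ∈ U)
    (hx : ψ y ∈ polarDom) (hind : LinearIndependent ℝ fun a => tangentVec ψ a y)
    (hmin : MeanCurvatureZeroAt (polarMetric φ u) ψ y)

include hφ hu hφ' hu' hU hψ hy hx hind hmin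

lemma deriv_nonpos_of_isLocalMax (hmax : IsLocalMax (fun z => ψ z 0) y) : p (ψ y 0) ≤ 0 := by
  have hc : ContDiffOn ℝ ∞ (fun z => ψ z 0) U := contDiffOn_pi.1 hψ 0
  have hd : DifferentiableAt ℝ (fun z => ψ z 0) y :=
    (hc.contDiffAt (hU.mem_nhds hy)).differentiableAt (by simp)
  have := deriv_sign_of_hessian hφ hu hφ' hu' hx hind hmin (fun a => by
    rw [tangentVec, pd_eq_fderiv hd, hmax.fderiv_eq_zero]; rfl) (s := 1) (fun v => by
    rw [one_mul]; exact hessian_nonpos_of_isLocalMax hc hU hy hmax v)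
  linarith

lemma deriv_nonneg_of_isLocalMin (hmin' : IsLocalMin (fun z => ψ z 0) y) : 0 ≤ p (ψ y 0) := by
  have hc : ContDiffOn ℝ ∞ (fun z => ψ z 0) U := contDiffOn_pi.1 hψ 0
  have hd : ∀ z ∈ U, DifferentiableAt ℝ (fun z => ψ z 0) z := fun z hz =>
    (hc.contDiffAt (hU.mem_nhds hz)).differentiableAt (by simp)
  have hneg : ∀ (G : (Fin 2 → ℝ) → ℝ) (a : Fin 2) (z : Fin 2 → ℝ),
      pd a (fun z => -G z) z = - pd a G z := fun G a z => by simp [pd, deriv.fun_neg]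
  have := deriv_sign_of_hessian hφ hu hφ' hu' hx hind hmin (fun a => by
    rw [tangentVec, pd_eq_fderiv (hd y hy), hmin'.fderiv_eq_zero]; rfl) (s := -1) (fun v => by
    have h := hessian_nonpos_of_isLocalMax hc.neg hU hy hmin'.neg v
    have h2 : ∀ b, pd b (fun z => -ψ z 0) = fun z => - pd b (fun z => ψ z 0) z := fun b =>
      funext fun z => hneg _ b z
    simp only [h2, hneg, mul_neg, Finset.sum_neg_distrib] at h
    rw [neg_one_mul]
    exact h)
  linarith

end MaximumPrinciple

/-! ### Minimal surfaces reach the middle region -/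

section Reach

variable {η : ℝ → ℝ} {A : ℝ} {u : ℝ → ℝ} {S : Set M}

lemma Patch.continuousOn_map {X : Type*} [TopologicalSpace X] {𝒜 : Set (Chart X)} {S : Set X}
    (P : Patch 𝒜 S) : ContinuousOn (P.c.map ∘ P.ψ) P.U := by
  rw [continuousOn_iff_continuous_domRestrict]
  exact continuous_subtype_val.comp P.isOpenEmbedding.continuous

/-- The image of a patch in a Cartesian chart is not contained in the axis. -/
lemma Patch.not_eventually_axis {X : Type*} [TopologicalSpace X] {𝒜 : Set (Chart X)} {S : Set X}
    (P : Patch 𝒜 S) {y : Fin 2 → ℝ} (hy : y ∈ P.U) :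
    ¬ ∀ᶠ z in 𝓝 y, P.ψ z 0 = 0 ∧ P.ψ z 1 = 0 := by
  intro h
  have hz : ∀ a, tangentVec P.ψ a y 0 = 0 ∧ tangentVec P.ψ a y 1 = 0 := by
    intro a
    constructor
    · rw [tangentVec, pd_congr (h.mono fun z hz => hz.1 : (fun z => P.ψ z 0) =ᶠ[𝓝 y] fun _ => 0),
        pd_const]
    · rw [tangentVec, pd_congr (h.mono fun z hz => hz.2 : (fun z => P.ψ z 1) =ᶠ[𝓝 y] fun _ => 0),
        pd_const]
  apply linearIndependent_minor (P.immersion y hy) (fun a => (hz a).1)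
  rw [(hz 0).2, (hz 1).2, zero_mul, mul_zero, sub_zero]

variable (hη : IsCutoff η) (hA : 10 ≤ A) (hu : IsBaseWarping η A u)
  (hS : IsClosedMinimalSurface (exampleMetric η A u) S)

include hη hA hu hS

omit hη hu in
lemma exists_polar_patch_example {x : Fin 3 → ℝ}
    (hx : x ∈ polarDom) (hxS : polarMap x ∈ S) {W : Set (Fin 3 → ℝ)} (hW : IsOpen W)
    (hxW : x ∈ W) :
    ∃ P : Patch (exampleMetric η A u) S, P.c = polarChart (phiFun η A) u ∧ MapsTo P.ψ P.U W ∧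
      (∀ y ∈ P.U, P.ψ y ∈ polarDom ∧ MeanCurvatureZeroAt (polarMetric (phiFun η A) u) P.ψ y) ∧
      ∃ y ∈ P.U, P.ψ y = x := by
  have hρ := rho_pos A
  have hρ' := rho_lt hA
  obtain ⟨P, hc, hm, hy⟩ := exists_polar_patch (a := rho A) (b := 1 / 5) ⟨hρ, by linarith⟩
    (by norm_num) hS.1 hx hxS hW hxW
  refine ⟨P, hc, hm, fun y hy => ⟨?_, ?_⟩, hy⟩
  · have := P.mapsTo_dom hy
    rwa [hc] at this
  · have := hS.2 P y hy
    rwa [hc] at this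

/-- A local maximum of `r` on a minimal surface does not occur where `u' > 0`. -/
lemma deriv_nonpos_of_rad_max {x : M} (hxS : x ∈ S) (hx : rad x ∈ Ioo (0 : ℝ) 2)
    (hmax : ∀ᶠ z in 𝓝 x, z ∈ S → rad z ≤ rad x) : deriv u (rad x) ≤ 0 := by
  obtain ⟨z, hz, rfl⟩ := (mem_regularPart_iff x).2 hx
  rw [rad_polarMap ⟨hz.1.le, hz.2.le⟩] at hmax ⊢
  obtain ⟨P, hc, -, hP, y, hy, rfl⟩ := exists_polar_patch_example hA hS hz hxS isOpen_univ
    (mem_univ z)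
  refine deriv_nonpos_of_isLocalMax (fun r _ => phiFun_pos η A r) hu.pos
    (fun r hr => hasDerivAt_phiFun (A := A) hη hr.1) (fun r hr => hu.hasDerivAt hr) P.isOpen_U
    P.smooth hy hz (P.immersion y hy) (hP y hy).2 ?_
  have h1 := P.continuousOn_map
  rw [hc] at h1
  have h2 := (h1.continuousAt (P.isOpen_U.mem_nhds hy)).eventually hmax
  filter_upwards [h2, P.isOpen_U.mem_nhds hy] with w hw hwU
  have hwS := P.mapsTo hwU
  rw [hc] at hwS
  have h3 := hw hwS
  have h4 := (hP w hwU).1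
  have h5 : rad (polarMap (P.ψ w)) = P.ψ w 0 := rad_polarMap ⟨h4.1.le, h4.2.le⟩
  exact h5 ▸ h3

/-- A local minimum of `r` on a minimal surface does not occur where `u' < 0`. -/
lemma deriv_nonneg_of_rad_min {x : M} (hxS : x ∈ S) (hx : rad x ∈ Ioo (0 : ℝ) 2)
    (hmin : ∀ᶠ z in 𝓝 x, z ∈ S → rad x ≤ rad z) : 0 ≤ deriv u (rad x) := by
  obtain ⟨z, hz, rfl⟩ := (mem_regularPart_iff x).2 hx
  rw [rad_polarMap ⟨hz.1.le, hz.2.le⟩] at hmin ⊢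
  obtain ⟨P, hc, -, hP, y, hy, rfl⟩ := exists_polar_patch_example hA hS hz hxS isOpen_univ
    (mem_univ z)
  refine deriv_nonneg_of_isLocalMin (fun r _ => phiFun_pos η A r) hu.pos
    (fun r hr => hasDerivAt_phiFun (A := A) hη hr.1) (fun r hr => hu.hasDerivAt hr) P.isOpen_U
    P.smooth hy hz (P.immersion y hy) (hP y hy).2 ?_
  have h1 := P.continuousOn_map
  rw [hc] at h1
  have h2 := (h1.continuousAt (P.isOpen_U.mem_nhds hy)).eventually hmin
  filter_upwards [h2, P.isOpen_U.mem_nhds hy] with w hw hwU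
  have hwS := P.mapsTo hwU
  rw [hc] at hwS
  have h3 := hw hwS
  have h4 := (hP w hwU).1
  have h5 : rad (polarMap (P.ψ w)) = P.ψ w 0 := rad_polarMap ⟨h4.1.le, h4.2.le⟩
  exact h5 ▸ h3

omit hη hu in
/-- The surface is not contained in a pole circle near any of its points. -/
lemma not_eventually_pole {x : M} (hxS : x ∈ S) :
    ¬ ∀ᶠ z in 𝓝 x, z ∈ S → rad z = 0 ∨ rad z = 2 := by
  intro h
  have hρ := rho_pos A
  have hρ' := rho_lt hA
  obtain ⟨P, y, hy, rfl⟩ := hS.1.2.2 x hxS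
  have h1 := P.continuousOn_map
  have h2 := (h1.continuousAt (P.isOpen_U.mem_nhds hy)).eventually h
  have h3 : ∀ᶠ z in 𝓝 y, z ∈ P.U ∧ (rad (P.c.map (P.ψ z)) = 0 ∨ rad (P.c.map (P.ψ z)) = 2) := by
    filter_upwards [h2, P.isOpen_U.mem_nhds hy] with z hz hzU using ⟨hzU, hz (P.mapsTo hzU)⟩
  have hcap : ∀ z, capRadius (P.ψ z) = 0 → P.ψ z 0 = 0 ∧ P.ψ z 1 = 0 := by
    intro z hz
    rw [capRadius_eq, norm_eq_zero] at hz
    exact ⟨congrArg Complex.re hz, congrArg Complex.im hz⟩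
  rcases P.mem with hc | hc | hc
  · obtain ⟨hyU, hy2⟩ := h3.self_of_nhds
    have hd := P.mapsTo_dom hyU
    rw [hc] at hd hy2
    have h5 : rad ((polarChart (phiFun η A) u).map (P.ψ y)) = P.ψ y 0 :=
      rad_polarMap ⟨hd.1.le, hd.2.le⟩
    rw [h5] at hy2
    rcases hy2 with h | h
    · exact hd.1.ne' h
    · exact hd.2.ne h
  · apply P.not_eventually_axis hy
    filter_upwards [h3] with z hz
    apply hcap
    have hd := P.mapsTo_dom hz.1
    have hz2 := hz.2
    rw [hc] at hd hz2
    have hs := capRadius_lt hρ hd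
    have hs0 : 0 ≤ capRadius (P.ψ z) := Real.sqrt_nonneg _
    have h5 : rad ((northChart (phiFun η A) u (rho A)).map (P.ψ z)) = capRadius (P.ψ z) :=
      rad_polarMap ⟨hs0, by
        show capRadius (P.ψ z) ≤ 2
        linarith⟩
    rw [h5] at hz2
    rcases hz2 with h | h <;> linarith
  · rw [mem_singleton_iff] at hc
    apply P.not_eventually_axis hy
    filter_upwards [h3] with z hz
    apply hcap
    have hd := P.mapsTo_dom hz.1
    have hz2 := hz.2
    rw [hc] at hd hz2
    have hs := capRadius_lt (by norm_num) hd
    have hs0 : 0 ≤ capRadius (P.ψ z) := Real.sqrt_nonneg _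
    have h5 : rad ((southChart (phiFun η A) u (1 / 5)).map (P.ψ z)) = 2 - capRadius (P.ψ z) :=
      rad_polarMap ⟨by
        show 0 ≤ 2 - capRadius (P.ψ z)
        linarith, by
        show 2 - capRadius (P.ψ z) ≤ 2
        linarith⟩
    rw [h5] at hz2
    rcases hz2 with h | h <;> linarith

/-- A closed minimal surface reaches the region `1/5 ≤ r ≤ 9/5`. -/
theorem exists_rad_mem_middle : ∃ x ∈ S, rad x ∈ Icc (1 / 5 : ℝ) (9 / 5) := by
  by_contra! hcon
  have hdich : ∀ x ∈ S, rad x < 1 / 5 ∨ 9 / 5 < rad x := by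
    intro x hx
    by_contra! h
    exact hcon x hx h
  obtain ⟨x₀, hx₀⟩ := hS.1.1
  rcases hdich x₀ hx₀ with h0 | h0
  -- If `S` avoids the middle region, a point maximizing `r` over this compact part has `r < 1/5`
  -- strictly, so it is a local maximum of `r` on all of `S`.
  · have hK : IsCompact (S ∩ rad ⁻¹' Iic (1 / 5)) :=
      hS.1.2.1.inter_right (isClosed_Iic.preimage continuous_rad)
    obtain ⟨x, hx, hmax⟩ := hK.exists_isMaxOn ⟨x₀, hx₀, h0.le⟩ continuous_rad.continuousOn
    have hx5 : rad x < 1 / 5 := by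
      rcases hdich x hx.1 with h | h
      · exact h
      · have : rad x ≤ 1 / 5 := hx.2
        linarith
    have hev : ∀ᶠ z in 𝓝 x, z ∈ S → rad z ≤ rad x := by
      filter_upwards [continuous_rad.continuousAt.eventually_lt_const hx5] with z hz hzS
      exact hmax ⟨hzS, le_of_lt hz⟩
    -- A maximal value `0` would put `S` into the axis near the point, which an immersed surface
    -- cannot do; otherwise the maximum principle contradicts `u' > 0`.
    rcases eq_or_lt_of_le (rad_mem x).1 with hr | hr
    · apply not_eventually_pole hA hS hx.1
      filter_upwards [hev] with z hz hzS
      left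
      exact le_antisymm ((hz hzS).trans hr.symm.le) (rad_mem z).1
    · have h1 := deriv_nonpos_of_rad_max hη hA hu hS hx.1 ⟨hr, by linarith⟩ hev
      have h2 := hu.deriv_pos _ ⟨hr, hx5⟩
      linarith
  · have hK : IsCompact (S ∩ rad ⁻¹' Ici (9 / 5)) :=
      hS.1.2.1.inter_right (isClosed_Ici.preimage continuous_rad)
    obtain ⟨x, hx, hmin⟩ := hK.exists_isMinOn ⟨x₀, hx₀, h0.le⟩ continuous_rad.continuousOn
    have hx5 : 9 / 5 < rad x := by
      rcases hdich x hx.1 with h | h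
      · have : 9 / 5 ≤ rad x := hx.2
        linarith
      · exact h
    have hev : ∀ᶠ z in 𝓝 x, z ∈ S → rad x ≤ rad z := by
      filter_upwards [continuous_rad.continuousAt.eventually_const_lt hx5] with z hz hzS
      exact hmin ⟨hzS, le_of_lt hz⟩
    rcases eq_or_lt_of_le (rad_mem x).2 with hr | hr
    · apply not_eventually_pole hA hS hx.1
      filter_upwards [hev] with z hz hzS
      right
      exact le_antisymm (rad_mem z).2 (hr.symm.le.trans (hz hzS))
    · have h1 := deriv_nonneg_of_rad_min hη hA hu hS hx.1 ⟨by linarith, hr⟩ hev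
      have h2 := hu.deriv_near_two ⟨hx5, hr⟩
      linarith

end Reach

/-! ### Local parametrizations of surfaces in coordinate space -/

/-- A regular local parametrization of the subset `Z` of coordinate space. -/
structure LocalParam (Z : Set (Fin 3 → ℝ)) where
  U : Set (Fin 2 → ℝ)
  isOpen_U : IsOpen U
  ψ : (Fin 2 → ℝ) → Fin 3 → ℝ
  smooth : ContDiffOn ℝ ∞ ψ U
  immersion : ∀ y ∈ U, LinearIndependent ℝ (fun a => tangentVec ψ a y)
  injOn : InjOn ψ U
  exists_open : ∀ V ⊆ U, IsOpen V → ∃ O, IsOpen O ∧ ψ '' V = Z ∩ O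

/-- The Jacobian matrix of `ψ`. -/
def jacobian (ψ : (Fin 2 → ℝ) → Fin 3 → ℝ) (y : Fin 2 → ℝ) : Matrix (Fin 3) (Fin 2) ℝ :=
  Matrix.of fun i a => tangentVec ψ a y i

/-- The (contravariant) orthogonal projection onto the tangent plane. -/
def tangentProj (G : (Fin 3 → ℝ) → Matrix (Fin 3) (Fin 3) ℝ) (ψ : (Fin 2 → ℝ) → Fin 3 → ℝ)
    (y : Fin 2 → ℝ) : Matrix (Fin 3) (Fin 3) ℝ :=
  jacobian ψ y * (firstForm G ψ y)⁻¹ * (jacobian ψ y)ᵀ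

/-! ### Linear algebra of tangent planes, and its behaviour under reparametrization. -/

section Pointwise

variable {G : (Fin 3 → ℝ) → Matrix (Fin 3) (Fin 3) ℝ} {ψ : (Fin 2 → ℝ) → Fin 3 → ℝ}
  {y : Fin 2 → ℝ}

lemma firstForm_eq : firstForm G ψ y = (jacobian ψ y)ᵀ * G (ψ y) * jacobian ψ y := by
  ext a b
  rw [Matrix.mul_assoc]
  simp only [firstForm, Matrix.of_apply, Matrix.mul_apply, jacobian, Matrix.transpose_apply,
    dotProduct, Matrix.mulVec]

lemma jacobian_mulVec (hψ : DifferentiableAt ℝ ψ y) (v : Fin 2 → ℝ) :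
    jacobian ψ y *ᵥ v = fderiv ℝ ψ y v := by
  have hv : v = ∑ a, v a • Pi.single a (1 : ℝ) := by
    ext i
    fin_cases i <;> simp [Fin.sum_univ_two]
  conv_rhs => rw [hv, map_sum]
  simp only [map_smul, ← tangentVec_eq_fderiv hψ]
  ext i
  simp only [Matrix.mulVec, dotProduct, jacobian, Matrix.of_apply, Finset.sum_apply, Pi.smul_apply,
    smul_eq_mul]
  exact Finset.sum_congr rfl fun a _ => mul_comm _ _

lemma jacobian_injective (h : LinearIndependent ℝ fun a => tangentVec ψ a y) :
    Function.Injective (jacobian ψ y).mulVec :=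
  Matrix.mulVec_injective_iff.2 h

lemma firstForm_posDef (h : LinearIndependent ℝ fun a => tangentVec ψ a y)
    (hG : (G (ψ y)).PosDef) : (firstForm G ψ y).PosDef := by
  rw [firstForm_eq]
  have := hG.conjTranspose_mul_mul_same (jacobian_injective h)
  rwa [Matrix.conjTranspose_eq_transpose_of_trivial] at this

lemma tangentProj_mul (hd : (firstForm G ψ y).det ≠ 0) :
    tangentProj G ψ y * G (ψ y) * tangentProj G ψ y = tangentProj G ψ y := by
  have h : IsUnit (firstForm G ψ y).det := isUnit_iff_ne_zero.2 hd
  unfold tangentProj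
  calc _ = jacobian ψ y * (firstForm G ψ y)⁻¹ * ((jacobian ψ y)ᵀ * G (ψ y) * jacobian ψ y)
        * (firstForm G ψ y)⁻¹ * (jacobian ψ y)ᵀ := by simp only [Matrix.mul_assoc]
    _ = _ := by rw [← firstForm_eq, Matrix.nonsing_inv_mul_cancel_right _ _ h]

lemma trace_tangentProj_mul (hd : (firstForm G ψ y).det ≠ 0) :
    (tangentProj G ψ y * G (ψ y)).trace = 2 := by
  have h : IsUnit (firstForm G ψ y).det := isUnit_iff_ne_zero.2 hd
  unfold tangentProj
  rw [Matrix.mul_assoc, Matrix.mul_assoc, Matrix.trace_mul_comm, Matrix.mul_assoc, ← firstForm_eq,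
    Matrix.nonsing_inv_mul _ h]
  simp

lemma tangentProj_transpose (hG : (G (ψ y)).IsHermitian) :
    (tangentProj G ψ y)ᵀ = tangentProj G ψ y := by
  have hG' : (G (ψ y))ᵀ = G (ψ y) := by
    rw [← Matrix.conjTranspose_eq_transpose_of_trivial]; exact hG
  have : (firstForm G ψ y)ᵀ = firstForm G ψ y := by
    rw [firstForm_eq]
    simp only [Matrix.transpose_mul, Matrix.transpose_transpose, hG', Matrix.mul_assoc]
  unfold tangentProj
  rw [Matrix.transpose_mul, Matrix.transpose_mul, Matrix.transpose_transpose,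
    Matrix.transpose_nonsing_inv, this, Matrix.mul_assoc]

/-- `0 ≤ ⟨v, Q v⟩ ≤ ⟨v, G⁻¹ v⟩`. -/
lemma tangentProj_nonneg_le (h : LinearIndependent ℝ fun a => tangentVec ψ a y)
    (hG : (G (ψ y)).PosDef) (v w : Fin 3 → ℝ) (hw : G (ψ y) *ᵥ w = v) :
    0 ≤ v ⬝ᵥ (tangentProj G ψ y *ᵥ v) ∧ v ⬝ᵥ (tangentProj G ψ y *ᵥ v) ≤ w ⬝ᵥ v := by
  have hd := (firstForm_posDef h hG).det_pos.ne'
  have hT := tangentProj_transpose (ψ := ψ) hG.isHermitian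
  have hm := tangentProj_mul hd
  set Q := tangentProj G ψ y
  have hpos : ∀ z : Fin 3 → ℝ, 0 ≤ z ⬝ᵥ (G (ψ y) *ᵥ z) := fun z => by
    have := hG.posSemidef.dotProduct_mulVec_nonneg z
    rwa [star_trivial] at this
  have hQ : ∀ a b : Fin 3 → ℝ, (Q *ᵥ a) ⬝ᵥ b = a ⬝ᵥ (Q *ᵥ b) := fun a b => by
    rw [Matrix.dotProduct_mulVec, ← Matrix.mulVec_transpose, hT]
  have h1 : (Q *ᵥ v) ⬝ᵥ (G (ψ y) *ᵥ (Q *ᵥ v)) = v ⬝ᵥ (Q *ᵥ v) := by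
    rw [hQ, Matrix.mulVec_mulVec, Matrix.mulVec_mulVec, hm]
  refine ⟨h1 ▸ hpos _, ?_⟩
  -- The upper bound is the nonnegativity of the squared length of the normal part of `w`, expanded.
  have h2 := hpos (w - Q *ᵥ v)
  have h3 : w ⬝ᵥ (G (ψ y) *ᵥ (Q *ᵥ v)) = v ⬝ᵥ (Q *ᵥ v) := by
    have hG' : (G (ψ y))ᵀ = G (ψ y) := by
      rw [← Matrix.conjTranspose_eq_transpose_of_trivial]; exact hG.isHermitian
    rw [Matrix.dotProduct_mulVec, ← Matrix.mulVec_transpose, hG', hw]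
  rw [Matrix.mulVec_sub, hw, sub_dotProduct, dotProduct_sub, dotProduct_sub, h1, h3, hQ] at h2
  linarith

lemma jacobian_comp {ψ' : (Fin 2 → ℝ) → Fin 3 → ℝ} {τ : (Fin 2 → ℝ) → Fin 2 → ℝ}
    {J : (Fin 2 → ℝ) →L[ℝ] (Fin 2 → ℝ)} (hτ : HasFDerivAt τ J y)
    (hψ' : DifferentiableAt ℝ ψ' (τ y)) (h : ψ' ∘ τ =ᶠ[𝓝 y] ψ) :
    jacobian ψ y = jacobian ψ' (τ y) * LinearMap.toMatrix' (J : (Fin 2 → ℝ) →ₗ[ℝ] (Fin 2 → ℝ)) := by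
  have h1 : HasFDerivAt ψ ((fderiv ℝ ψ' (τ y)).comp J) y :=
    (hψ'.hasFDerivAt.comp y hτ).congr_of_eventuallyEq h.symm
  apply Matrix.toLin'.injective
  ext1 v
  simp only [Matrix.toLin'_mul, Matrix.toLin'_toMatrix']
  ext1
  simp only [Matrix.toLin'_apply, LinearMap.coe_comp, Function.comp_apply, LinearMap.coe_single,
    jacobian_mulVec h1.differentiableAt, h1.fderiv, jacobian_mulVec hψ']
  rfl

variable {ψ' : (Fin 2 → ℝ) → Fin 3 → ℝ} {y' : Fin 2 → ℝ} {J : Matrix (Fin 2) (Fin 2) ℝ}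

lemma sqrt_det_firstForm_of_eq (hy : ψ' y' = ψ y) (hJ : jacobian ψ y = jacobian ψ' y' * J) :
    √(firstForm G ψ y).det = |J.det| * √(firstForm G ψ' y').det := by
  have : firstForm G ψ y = Jᵀ * firstForm G ψ' y' * J := by
    rw [firstForm_eq, firstForm_eq, hJ, hy, Matrix.transpose_mul]
    simp only [Matrix.mul_assoc]
  rw [this, Matrix.det_mul, Matrix.det_mul, Matrix.det_transpose,
    show J.det * (firstForm G ψ' y').det * J.det = J.det ^ 2 * (firstForm G ψ' y').det by ring,
    Real.sqrt_mul (sq_nonneg _), Real.sqrt_sq_eq_abs]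

/-- The tangent projection does not see the parametrization, while the area density picks up `|det
J|`; together these make the varifold parametrization independent. -/
lemma tangentProj_of_eq (hy : ψ' y' = ψ y) (hJ : jacobian ψ y = jacobian ψ' y' * J)
    (hd : J.det ≠ 0) : tangentProj G ψ y = tangentProj G ψ' y' := by
  have h : firstForm G ψ y = Jᵀ * firstForm G ψ' y' * J := by
    rw [firstForm_eq, firstForm_eq, hJ, hy, Matrix.transpose_mul]
    simp only [Matrix.mul_assoc]
  have hu : IsUnit J.det := isUnit_iff_ne_zero.2 hd
  have hu' : IsUnit Jᵀ.det := by rwa [Matrix.det_transpose]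
  unfold tangentProj
  rw [h, hJ, Matrix.mul_inv_rev, Matrix.mul_inv_rev, Matrix.transpose_mul]
  calc _ = jacobian ψ' y' * (J * J⁻¹) * (firstForm G ψ' y')⁻¹ * (Jᵀ⁻¹ * Jᵀ) * (jacobian ψ' y')ᵀ := by
        simp only [Matrix.mul_assoc]
    _ = _ := by
      rw [Matrix.mul_nonsing_inv _ hu, Matrix.nonsing_inv_mul _ hu', Matrix.mul_one, Matrix.mul_one]

end Pointwise

/-! ### Transition maps -/

namespace LocalParam

variable {Z : Set (Fin 3 → ℝ)} (P P' : LocalParam Z)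

lemma differentiableAt {y : Fin 2 → ℝ} (hy : y ∈ P.U) : DifferentiableAt ℝ P.ψ y :=
  (P.smooth.contDiffAt (P.isOpen_U.mem_nhds hy)).differentiableAt (by simp)

/-- An open set which meets `Z` in the image of the parametrization. -/
def O : Set (Fin 3 → ℝ) := (P.exists_open P.U Subset.rfl P.isOpen_U).choose

lemma isOpen_O : IsOpen P.O := (P.exists_open P.U Subset.rfl P.isOpen_U).choose_spec.1

lemma image_U : P.ψ '' P.U = Z ∩ P.O := (P.exists_open P.U Subset.rfl P.isOpen_U).choose_spec.2

lemma mem_of_mem {y : Fin 2 → ℝ} (hy : y ∈ P.U) : P.ψ y ∈ Z ∩ P.O :=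
  P.image_U ▸ mem_image_of_mem _ hy

/-- The inverse of the parametrization. -/
def inv : (Fin 3 → ℝ) → Fin 2 → ℝ := Function.invFunOn P.ψ P.U

lemma inv_mem {x : Fin 3 → ℝ} (hx : x ∈ Z ∩ P.O) : P.inv x ∈ P.U :=
  Function.invFunOn_mem (by rwa [← P.image_U] at hx)

lemma apply_inv {x : Fin 3 → ℝ} (hx : x ∈ Z ∩ P.O) : P.ψ (P.inv x) = x :=
  Function.invFunOn_eq (by rwa [← P.image_U] at hx)

lemma inv_apply {y : Fin 2 → ℝ} (hy : y ∈ P.U) : P.inv (P.ψ y) = y :=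
  P.injOn (P.inv_mem (P.mem_of_mem hy)) hy (P.apply_inv (P.mem_of_mem hy))

lemma continuousOn_inv : ContinuousOn P.inv (Z ∩ P.O) := by
  rw [continuousOn_iff']
  intro V hV
  obtain ⟨O', hO', h⟩ := P.exists_open (P.U ∩ V) inter_subset_left (P.isOpen_U.inter hV)
  refine ⟨O', hO', ?_⟩
  ext x
  constructor
  · rintro ⟨hx, hxZ⟩
    refine ⟨?_, hxZ⟩
    have : x ∈ Z ∩ O' := by
      rw [← h]
      exact ⟨P.inv x, ⟨P.inv_mem hxZ, hx⟩, P.apply_inv hxZ⟩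
    exact this.2
  · rintro ⟨hx, hxZ⟩
    refine ⟨?_, hxZ⟩
    obtain ⟨y, hy, rfl⟩ : x ∈ P.ψ '' (P.U ∩ V) := h ▸ ⟨hxZ.1, hx⟩
    show P.inv (P.ψ y) ∈ V
    rw [P.inv_apply hy.1]
    exact hy.2

/-- The domain of the transition map. -/
def overlap : Set (Fin 2 → ℝ) := P.U ∩ P.ψ ⁻¹' P'.O

lemma isOpen_overlap : IsOpen (P.overlap P') :=
  P.smooth.continuousOn.isOpen_inter_preimage P.isOpen_U P'.isOpen_O

variable {P P'} {y : Fin 2 → ℝ}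

lemma apply_mem_of_mem_overlap (hy : y ∈ P.overlap P') : P.ψ y ∈ Z ∩ P'.O :=
  ⟨(P.mem_of_mem hy.1).1, hy.2⟩

lemma transition_mem (hy : y ∈ P.overlap P') : P'.inv (P.ψ y) ∈ P'.overlap P := by
  refine ⟨P'.inv_mem (apply_mem_of_mem_overlap hy), ?_⟩
  show P'.ψ _ ∈ P.O
  rw [P'.apply_inv (apply_mem_of_mem_overlap hy)]
  exact (P.mem_of_mem hy.1).2

/-- The transition map `τ` is continuous with `ψ' ∘ τ = ψ`, and the derivative of `ψ'` has a linear
left inverse; this already forces differentiability of `τ`, and no inverse function theorem is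
needed. Invertibility follows from the injectivity of the Jacobian of `ψ`. -/
lemma exists_hasFDerivAt_transition (hy : y ∈ P.overlap P') :
    ∃ J : (Fin 2 → ℝ) →L[ℝ] (Fin 2 → ℝ), HasFDerivAt (P'.inv ∘ P.ψ) J y ∧
      jacobian P.ψ y = jacobian P'.ψ (P'.inv (P.ψ y)) *
        LinearMap.toMatrix' (J : (Fin 2 → ℝ) →ₗ[ℝ] (Fin 2 → ℝ)) ∧
      (LinearMap.toMatrix' (J : (Fin 2 → ℝ) →ₗ[ℝ] (Fin 2 → ℝ))).det ≠ 0 := by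
  have hO : P.overlap P' ∈ 𝓝 y := (P.isOpen_overlap P').mem_nhds hy
  have hy' := transition_mem hy
  have hcont : ContinuousAt (P'.inv ∘ P.ψ) y :=
    ((P'.continuousOn_inv.comp (P.smooth.continuousOn.mono inter_subset_left)
      fun z hz => apply_mem_of_mem_overlap hz).continuousAt hO)
  have hcomp : P'.ψ ∘ (P'.inv ∘ P.ψ) =ᶠ[𝓝 y] P.ψ := by
    filter_upwards [hO] with z hz using P'.apply_inv (apply_mem_of_mem_overlap hz)
  have hd' := P'.differentiableAt hy'.1
  have hinj : LinearMap.ker (fderiv ℝ P'.ψ (P'.inv (P.ψ y))).toLinearMap = ⊥ := by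
    rw [LinearMap.ker_eq_bot]
    intro v w hvw
    apply jacobian_injective (P'.immersion _ hy'.1)
    show jacobian _ _ *ᵥ v = jacobian _ _ *ᵥ w
    rw [jacobian_mulVec hd', jacobian_mulVec hd']
    exact hvw
  obtain ⟨g, hg⟩ := LinearMap.exists_leftInverse_of_injective _ hinj
  have hτ := HasFDerivAt.of_comp_of_leftInverse (f'symm := LinearMap.toContinuousLinearMap g)
    hcont hd'.hasFDerivAt (P.differentiableAt hy.1).hasFDerivAt hcomp
    (fun v => LinearMap.congr_fun hg v)
  have hJ := jacobian_comp hτ hd' hcomp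
  refine ⟨_, hτ, hJ, ?_⟩
  intro h0
  obtain ⟨v, hv, hv0⟩ := Matrix.exists_mulVec_eq_zero_iff.2 h0
  apply hv
  apply jacobian_injective (P.immersion y hy.1)
  rw [hJ]
  show (_ * _) *ᵥ v = _ *ᵥ 0
  rw [← Matrix.mulVec_mulVec, hv0, Matrix.mulVec_zero, Matrix.mulVec_zero]

end LocalParam

/-! ### The varifold of a surface -/

/-- Points of coordinate space together with a (candidate for a) projection onto a plane. -/
abbrev PlaneBundle : Type := (Fin 3 → ℝ) × (Fin 3 → Fin 3 → ℝ)

namespace LocalParam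

variable {Z : Set (Fin 3 → ℝ)} (G : (Fin 3 → ℝ) → Matrix (Fin 3) (Fin 3) ℝ) (P P' : LocalParam Z)

/-- The lift of a parametrization: the point together with the tangent plane there. -/
def lift (y : Fin 2 → ℝ) : PlaneBundle := (P.ψ y, tangentProj G P.ψ y)

/-- The area density. -/
def dens (y : Fin 2 → ℝ) : ℝ := √(firstForm G P.ψ y).det

/-- The varifold of the parametrized surface. -/
def varifold : Measure PlaneBundle :=
  ((volume.restrict P.U).withDensity fun y => ENNReal.ofReal (P.dens G y)).map (P.lift G)

/-- Planes at points in the open set `P.O`. -/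
def cyl : Set PlaneBundle := Prod.fst ⁻¹' P.O

lemma measurableSet_cyl : MeasurableSet P.cyl := P.isOpen_O.measurableSet.preimage measurable_fst

variable {G}

lemma lift_mem_cyl {y : Fin 2 → ℝ} (hy : y ∈ P.U) : P.lift G y ∈ P.cyl := (P.mem_of_mem hy).2

lemma continuousOn_tangentVec (a : Fin 2) (i : Fin 3) :
    ContinuousOn (fun y => tangentVec P.ψ a y i) P.U :=
  (contDiffOn_pd (contDiffOn_pi.1 P.smooth i) P.isOpen_U a).continuousOn

variable (hGc : ∀ i j, ContinuousOn (fun x => G x i j) Z) (hGp : ∀ x ∈ Z, (G x).PosDef)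

include hGp in
lemma det_pos {y : Fin 2 → ℝ} (hy : y ∈ P.U) : 0 < (firstForm G P.ψ y).det :=
  (firstForm_posDef (P.immersion y hy) (hGp _ (P.mem_of_mem hy).1)).det_pos

include hGc in
lemma continuousOn_firstForm (a b : Fin 2) :
    ContinuousOn (fun y => firstForm G P.ψ y a b) P.U := by
  simp only [firstForm, Matrix.of_apply, dotProduct, Matrix.mulVec]
  refine continuousOn_finsetSum _ fun i _ => (P.continuousOn_tangentVec a i).mul ?_
  refine continuousOn_finsetSum _ fun j _ => ContinuousOn.mul ?_ (P.continuousOn_tangentVec b j)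
  exact (hGc i j).comp P.smooth.continuousOn fun y hy => (P.mem_of_mem hy).1

include hGc in
lemma continuousOn_det : ContinuousOn (fun y => (firstForm G P.ψ y).det) P.U := by
  simp only [Matrix.det_fin_two]
  have h := P.continuousOn_firstForm hGc
  exact ((h 0 0).mul (h 1 1)).sub ((h 0 1).mul (h 1 0))

include hGc in
lemma continuousOn_dens : ContinuousOn (P.dens G) P.U := (P.continuousOn_det hGc).sqrt

include hGc hGp in
lemma continuousOn_inv_firstForm (a b : Fin 2) :
    ContinuousOn (fun y => (firstForm G P.ψ y)⁻¹ a b) P.U := by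
  have h := P.continuousOn_firstForm hGc
  have hd := P.continuousOn_det hGc
  have h0 : ∀ y ∈ P.U, (firstForm G P.ψ y).det ≠ 0 := fun y hy => (P.det_pos hGp hy).ne'
  simp only [inv_fin_two]
  fin_cases a <;> fin_cases b
  · exact (h 1 1).div hd h0
  · exact (h 0 1).neg.div hd h0
  · exact (h 1 0).neg.div hd h0
  · exact (h 0 0).div hd h0

include hGc hGp in
lemma continuousOn_lift : ContinuousOn (P.lift G) P.U := by
  refine P.smooth.continuousOn.prodMk ?_
  refine continuousOn_pi.2 fun i => continuousOn_pi.2 fun j => ?_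
  simp only [tangentProj, Matrix.mul_apply, jacobian, Matrix.of_apply, Matrix.transpose_apply]
  refine continuousOn_finsetSum _ fun b _ => ContinuousOn.mul ?_ (P.continuousOn_tangentVec b j)
  exact continuousOn_finsetSum _ fun a _ =>
    (P.continuousOn_tangentVec a i).mul (P.continuousOn_inv_firstForm hGc hGp a b)

include hGc in
lemma aemeasurable_dens :
    AEMeasurable (fun y => ENNReal.ofReal (P.dens G y)) (volume.restrict P.U) :=
  ((P.continuousOn_dens hGc).aemeasurable P.isOpen_U.measurableSet).ennreal_ofReal

include hGc hGp in
lemma aemeasurable_lift : AEMeasurable (P.lift G)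
    ((volume.restrict P.U).withDensity fun y => ENNReal.ofReal (P.dens G y)) :=
  ((P.continuousOn_lift hGc hGp).aemeasurable P.isOpen_U.measurableSet).mono_ac
    (withDensity_absolutelyContinuous _ _)

include hGc hGp in
lemma measurableSet_inter_lift {A : Set PlaneBundle} (hA : MeasurableSet A) :
    MeasurableSet (P.U ∩ P.lift G ⁻¹' A) := by
  have h := (P.continuousOn_lift hGc hGp).domRestrict.measurable hA
  have h2 := P.isOpen_U.measurableSet.subtype_image h
  convert h2 using 1
  ext y
  simp [Set.domRestrict, and_comm]

include hGc hGp in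
lemma varifold_apply {A : Set PlaneBundle} (hA : MeasurableSet A) :
    P.varifold G A = ∫⁻ y in P.U ∩ P.lift G ⁻¹' A, ENNReal.ofReal (P.dens G y) := by
  rw [varifold, Measure.map_apply_of_aemeasurable (P.aemeasurable_lift hGc hGp) hA,
    withDensity_apply', Measure.restrict_restrict' P.isOpen_U.measurableSet, inter_comm]

include hGc hGp in
lemma varifold_inter_cyl {A : Set PlaneBundle} (hA : MeasurableSet A) :
    P.varifold G (A ∩ P.cyl) = P.varifold G A := by
  rw [P.varifold_apply hGc hGp hA, P.varifold_apply hGc hGp (hA.inter P.measurableSet_cyl)]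
  congr 2
  ext y
  exact ⟨fun h => ⟨h.1, h.2.1⟩, fun h => ⟨h.1, h.2, P.lift_mem_cyl h.1⟩⟩

/-- Two parametrizations define the same varifold where both are defined. -/
lemma varifold_inter_cyl_eq (hGc : ∀ i j, ContinuousOn (fun x => G x i j) Z)
    (hGp : ∀ x ∈ Z, (G x).PosDef) {A : Set PlaneBundle} (hA : MeasurableSet A) :
    P.varifold G (A ∩ P'.cyl) = P'.varifold G (A ∩ P.cyl) := by
  rw [P.varifold_apply hGc hGp (hA.inter P'.measurableSet_cyl),
    P'.varifold_apply hGc hGp (hA.inter P.measurableSet_cyl)]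
  have hs := P.measurableSet_inter_lift hGc hGp (hA.inter P'.measurableSet_cyl)
  set s := P.U ∩ P.lift G ⁻¹' (A ∩ P'.cyl)
  have hsub : s ⊆ P.overlap P' := fun y hy => ⟨hy.1, hy.2.2⟩
  choose! J hJ1 hJ2 hJ3 using fun y (hy : y ∈ P.overlap P') => exists_hasFDerivAt_transition hy
  have hlift : ∀ y ∈ P.overlap P', P'.lift G (P'.inv (P.ψ y)) = P.lift G y := fun y hy =>
    Prod.ext (P'.apply_inv (apply_mem_of_mem_overlap hy)) (tangentProj_of_eq
      (P'.apply_inv (apply_mem_of_mem_overlap hy)) (hJ2 y hy) (hJ3 y hy)).symm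
  have himg : (P'.inv ∘ P.ψ) '' s = P'.U ∩ P'.lift G ⁻¹' (A ∩ P.cyl) := by
    ext z
    constructor
    · rintro ⟨y, hy, rfl⟩
      refine ⟨(transition_mem (hsub hy)).1, ?_, (transition_mem (hsub hy)).2⟩
      show P'.lift G (P'.inv (P.ψ y)) ∈ A
      rw [hlift y (hsub hy)]
      exact hy.2.1
    · intro hz
      have hz' : z ∈ P'.overlap P := ⟨hz.1, hz.2.2⟩
      have hy := transition_mem hz'
      have hzy : P'.inv (P.ψ (P.inv (P'.ψ z))) = z := by
        rw [P.apply_inv (apply_mem_of_mem_overlap hz'), P'.inv_apply hz.1]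
      refine ⟨P.inv (P'.ψ z), ⟨hy.1, ?_, hy.2⟩, hzy⟩
      show P.lift G _ ∈ A
      rw [← hlift _ hy, hzy]
      exact hz.2.1
  rw [← himg, lintegral_image_eq_lintegral_abs_det_fderiv_mul volume hs
    (fun y hy => (hJ1 y (hsub hy)).hasFDerivWithinAt)]
  · refine setLIntegral_congr_fun hs fun y hy => ?_
    rw [← ENNReal.ofReal_mul (abs_nonneg _)]
    congr 1
    have := sqrt_det_firstForm_of_eq (G := G)
      (P'.apply_inv (apply_mem_of_mem_overlap (hsub hy))) (hJ2 y (hsub hy))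
    rw [LinearMap.det_toMatrix'] at this
    exact this
  · intro y hy z hz h
    have h1 := congrArg P'.ψ h
    simp only [Function.comp_apply] at h1
    rw [P'.apply_inv (apply_mem_of_mem_overlap (hsub hy)),
      P'.apply_inv (apply_mem_of_mem_overlap (hsub hz))] at h1
    exact P.injOn hy.1 hz.1 h1

end LocalParam

/-! ### Gluing the varifolds of finitely many parametrizations. -/

section Atlas

variable {Z : Set (Fin 3 → ℝ)} (G : (Fin 3 → ℝ) → Matrix (Fin 3) (Fin 3) ℝ) {n : ℕ}
  (P : Fin n → LocalParam Z)

/-- Pairwise disjoint sets of planes whose union is the union of the sets `(P k).cyl`. -/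
def pieces (k : Fin n) : Set PlaneBundle := disjointed (fun k => (P k).cyl) k

/-- The varifold of the union of finitely many parametrized pieces of surface. -/
def atlasVarifold : Measure PlaneBundle := ∑ k, ((P k).varifold G).restrict (pieces P k)

lemma measurableSet_pieces (k : Fin n) : MeasurableSet (pieces P k) := by
  unfold pieces
  rw [disjointed_apply]
  refine (P k).measurableSet_cyl.diff ?_
  rw [Finset.sup_set_eq_biUnion]
  exact Finset.measurableSet_biUnion _ fun j _ => (P j).measurableSet_cyl

variable {G} (hGc : ∀ i j, ContinuousOn (fun x => G x i j) Z) (hGp : ∀ x ∈ Z, (G x).PosDef)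

include hGc hGp

lemma atlasVarifold_univ : atlasVarifold G P univ =
    ∑ k, ∫⁻ y in (P k).U ∩ (P k).lift G ⁻¹' pieces P k, ENNReal.ofReal ((P k).dens G y) := by
  simp only [atlasVarifold, Measure.finsetSum_apply, Measure.restrict_apply_univ]
  exact Finset.sum_congr rfl fun k _ => (P k).varifold_apply hGc hGp (measurableSet_pieces P k)

/-- Inside the cylinder of the `k`-th parametrization each disjoint piece may be measured with the
`k`-th varifold instead of its own, and the pieces cover that cylinder. The glued measure is thus
independent of the order used to make the pieces disjoint. -/
lemma atlasVarifold_restrict_cyl (k : Fin n) :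
    (atlasVarifold G P).restrict (P k).cyl = (P k).varifold G := by
  ext A hA
  rw [Measure.restrict_apply hA, atlasVarifold, Measure.finsetSum_apply]
  have h1 : ∀ j, ((P j).varifold G).restrict (pieces P j) (A ∩ (P k).cyl)
      = (P k).varifold G (A ∩ pieces P j) := by
    intro j
    have hsub : pieces P j ⊆ (P j).cyl := disjointed_subset _ j
    rw [Measure.restrict_apply (hA.inter (P k).measurableSet_cyl), inter_right_comm,
      (P j).varifold_inter_cyl_eq (P k) hGc hGp (hA.inter (measurableSet_pieces P j)), inter_assoc,
      inter_eq_left.2 hsub]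
  simp only [h1]
  rw [← tsum_fintype (L := .unconditional _), ← measure_iUnion]
  · rw [← inter_iUnion]
    have h2 : ⋃ j, pieces P j = ⋃ j, (P j).cyl := iUnion_disjointed
    rw [h2, ← (P k).varifold_inter_cyl hGc hGp, inter_assoc,
      inter_eq_right.2 (subset_iUnion (fun j => (P j).cyl) k), (P k).varifold_inter_cyl hGc hGp hA]
    exact hA.inter (MeasurableSet.iUnion fun j => (P j).measurableSet_cyl)
  · intro i j hij
    exact (disjoint_disjointed (fun k => (P k).cyl) hij).mono inter_subset_right inter_subset_right
  · exact fun j => hA.inter (measurableSet_pieces P j)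

lemma ae_atlasVarifold {p : PlaneBundle → Prop} (hp : MeasurableSet {z | p z})
    (h : ∀ k, ∀ y ∈ (P k).U, p ((P k).lift G y)) : ∀ᵐ z ∂atlasVarifold G P, p z := by
  rw [ae_iff, atlasVarifold, Measure.finsetSum_apply]
  refine Finset.sum_eq_zero fun k _ => ?_
  refine le_antisymm ((Measure.restrict_apply_le _ _).trans ?_) zero_le
  rw [← Set.compl_ofPred, (P k).varifold_apply hGc hGp hp.compl]
  have : (P k).U ∩ (P k).lift G ⁻¹' {z | p z}ᶜ = ∅ :=
    eq_empty_of_forall_notMem fun y hy => hy.2 (h k y hy.1)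
  rw [this, Measure.restrict_empty, lintegral_zero_measure]

end Atlas

/-! ### The divergence of the tangential part of a vector field -/

lemma hasDerivAt_pd {n : ℕ} {F : (Fin n → ℝ) → ℝ} {y : Fin n → ℝ} (hF : DifferentiableAt ℝ F y)
    (a : Fin n) : HasDerivAt (fun t => F (Function.update y a t)) (pd a F y) (y a) := by
  have h1 : HasFDerivAt F (fderiv ℝ F y) (Function.update y a (y a)) := by
    rw [Function.update_eq_self]; exact hF.hasFDerivAt
  exact (h1.comp_hasDerivAt (y a) (hasDerivAt_update y a (y a))).differentiableAt.hasDerivAt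

lemma pd_comm {F : (Fin 2 → ℝ) → ℝ} {U : Set (Fin 2 → ℝ)} (hU : IsOpen U)
    (hF : ContDiffOn ℝ ∞ F U) {y : Fin 2 → ℝ} (hy : y ∈ U) (a b : Fin 2) :
    pd a (pd b F) y = pd b (pd a F) y := by
  have hFy := hF.contDiffAt (hU.mem_nhds hy)
  have hd : ∀ c, pd c F =ᶠ[𝓝 y] fun z => fderiv ℝ F z (Pi.single c 1) := by
    intro c
    filter_upwards [hU.mem_nhds hy] with z hz
    exact pd_eq_fderiv ((hF.contDiffAt (hU.mem_nhds hz)).differentiableAt (by simp)) c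
  have h2 : DifferentiableAt ℝ (fderiv ℝ F) y :=
    (hFy.fderiv_right (m := 1) (WithTop.coe_le_coe.2 le_top)).differentiableAt (by simp)
  have h3 : ∀ a b, pd a (pd b F) y = fderiv ℝ (fderiv ℝ F) y (Pi.single a 1) (Pi.single b 1) := by
    intro a b
    rw [pd_congr (hd b), pd_eq_fderiv (h2.clm_apply (differentiableAt_const _)),
      fderiv_clm_apply h2 (differentiableAt_const _)]
    simp
  rw [h3, h3]
  refine ContDiffAt.isSymmSndFDerivAt hFy ?_ _ _
  rw [minSmoothness_of_isRCLikeNormedField]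
  exact WithTop.coe_le_coe.2 le_top

/-- The flux density `√g g^{ab} ⟨∂_b ψ, X⟩`. -/
def flux (G : (Fin 3 → ℝ) → Matrix (Fin 3) (Fin 3) ℝ) (ψ : (Fin 2 → ℝ) → Fin 3 → ℝ)
    (X : (Fin 3 → ℝ) → Fin 3 → ℝ) (a : Fin 2) (y : Fin 2 → ℝ) : ℝ :=
  √(firstForm G ψ y).det * ∑ b, (firstForm G ψ y)⁻¹ a b *
    (tangentVec ψ b y ⬝ᵥ (G (ψ y) *ᵥ X (ψ y)))

/-- The divergence of `X` along a plane for the metric `dr² + w² dθ² + dξ²` with `w' = p`. -/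
def planeDiv (w p : ℝ → ℝ) (X : (Fin 3 → ℝ) → Fin 3 → ℝ) (z : PlaneBundle) : ℝ :=
  (∑ i, ∑ j, z.2 i j * ![1, w (z.1 0) ^ 2, 1] j * pd i (fun x => X x j) z.1)
    + z.2 1 1 * (w (z.1 0) * p (z.1 0)) * X z.1 0

/-- The algebra behind the divergence formula on a minimal surface. Here `m` is the first
fundamental form, `k a b c = ⟨∇_a e_b, e_c⟩`, `c a b = ⟨∇_a e_b, X⟩`, `n a b = ⟨e_b, ∇_a X⟩`,
`v b = ⟨e_b, X⟩`. -/
lemma hasDerivAt_flux_algebra {m00 m01 m11 v0 v1 m00' m01' m11' v0' v1' : ℝ → ℝ} {s t : ℝ}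
    {M00 M01 M11 V0 V1 : ℝ} {k : Fin 2 → Fin 2 → Fin 2 → ℝ} {c n : Fin 2 → Fin 2 → ℝ}
    (hk : ∀ d, k 0 1 d = k 1 0 d) (hc : c 0 1 = c 1 0)
    (e00 : m00 s = M00) (e01 : m01 s = M01) (e11 : m11 s = M11) (e0 : v0 s = V0) (e1 : v1 s = V1)
    (e00' : m00' t = M00) (e01' : m01' t = M01) (e11' : m11' t = M11) (e0' : v0' t = V0)
    (e1' : v1' t = V1)
    (h00 : HasDerivAt m00 (k 0 0 0 + k 0 0 0) s) (h01 : HasDerivAt m01 (k 0 0 1 + k 0 1 0) s)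
    (h11 : HasDerivAt m11 (k 0 1 1 + k 0 1 1) s)
    (h0 : HasDerivAt v0 (c 0 0 + n 0 0) s) (h1 : HasDerivAt v1 (c 0 1 + n 0 1) s)
    (h00' : HasDerivAt m00' (k 1 0 0 + k 1 0 0) t) (h01' : HasDerivAt m01' (k 1 0 1 + k 1 1 0) t)
    (h11' : HasDerivAt m11' (k 1 1 1 + k 1 1 1) t)
    (h0' : HasDerivAt v0' (c 1 0 + n 1 0) t) (h1' : HasDerivAt v1' (c 1 1 + n 1 1) t)
    (hD : 0 < M00 * M11 - M01 * M01)
    (hmin : ∀ f : Fin 2 → Fin 2 → ℝ, (∀ a b, f a b = (M00 * M11 - M01 * M01) * c a b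
      - (M11 * V0 - M01 * V1) * k a b 0 - (M00 * V1 - M01 * V0) * k a b 1) →
      M11 * f 0 0 - M01 * f 0 1 - M01 * f 1 0 + M00 * f 1 1 = 0) :
    ∃ d d', HasDerivAt (fun x => (m11 x * v0 x - m01 x * v1 x)
        / √(m00 x * m11 x - m01 x * m01 x)) d s ∧
      HasDerivAt (fun x => (m00' x * v1' x - m01' x * v0' x)
        / √(m00' x * m11' x - m01' x * m01' x)) d' t ∧
      d + d' = (M11 * n 0 0 - M01 * n 0 1 - M01 * n 1 0 + M00 * n 1 1)
        / √(M00 * M11 - M01 * M01) := by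
  have hs0 : 0 < √(M00 * M11 - M01 * M01) := Real.sqrt_pos.2 hD
  have hsq := Real.sq_sqrt hD.le
  refine ⟨_, _, ((h11.mul h0).sub (h01.mul h1)).div
    (((h00.mul h11).sub (h01.mul h01)).sqrt (by
      simp only [Pi.sub_apply, Pi.mul_apply, e00, e01, e11]; exact hD.ne')) (by
      simp only [e00, e01, e11]; exact hs0.ne'),
    ((h00'.mul h1').sub (h01'.mul h0')).div
    (((h00'.mul h11').sub (h01'.mul h01')).sqrt (by
      simp only [Pi.sub_apply, Pi.mul_apply, e00', e01', e11']; exact hD.ne')) (by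
      simp only [e00', e01', e11']; exact hs0.ne'), ?_⟩
  simp only [Pi.sub_apply, Pi.mul_apply, e00, e01, e11, e0, e1, e00', e01', e11', e0', e1']
  have hm := hmin _ fun a b => rfl
  set S := √(M00 * M11 - M01 * M01) with hS
  field_simp
  simp only [hsq, hk, hc] at hm ⊢
  linear_combination 2 * hm

section Divergence

variable {φ u p q : ℝ → ℝ} {ψ : (Fin 2 → ℝ) → Fin 3 → ℝ} {y : Fin 2 → ℝ}

lemma polarMetric_dot (hφ1 : φ (ψ y 0) = 1) (a b : Fin 3 → ℝ) :
    a ⬝ᵥ (polarMetric φ u (ψ y) *ᵥ b)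
      = a 0 * b 0 + u (ψ y 0) ^ 2 * (a 1 * b 1) + a 2 * b 2 := by
  simp only [polarMetric, dotProduct, Matrix.mulVec_diagonal, Fin.sum_univ_three,
    Matrix.cons_val_zero, Matrix.cons_val_one, Matrix.cons_val, hφ1]
  ring

lemma pd_comp {X : (Fin 3 → ℝ) → ℝ} (hψ : DifferentiableAt ℝ ψ y)
    (hX : DifferentiableAt ℝ X (ψ y)) (a : Fin 2) :
    pd a (fun z => X (ψ z)) y = ∑ i, tangentVec ψ a y i * pd i X (ψ y) := by
  have h1 : pd a (X ∘ ψ) y = _ := pd_eq_fderiv (hX.comp y hψ) a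
  rw [fderiv_comp y hX hψ, ContinuousLinearMap.comp_apply, ← tangentVec_eq_fderiv hψ] at h1
  have hv : tangentVec ψ a y = ∑ i, tangentVec ψ a y i • Pi.single i (1 : ℝ) := by
    ext i
    fin_cases i <;> simp [Fin.sum_univ_three]
  rw [hv, map_sum] at h1
  simp only [map_smul, smul_eq_mul, ← pd_eq_fderiv hX] at h1
  exact h1

variable (hφ : ∀ r ∈ Ioo (0 : ℝ) 2, 0 < φ r)
    (hu : ∀ r ∈ Ioo (0 : ℝ) 2, 0 < u r)
    (hφ' : ∀ r ∈ Ioo (0 : ℝ) 2, HasDerivAt φ (φ r * q r) r)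
    (hu' : ∀ r ∈ Ioo (0 : ℝ) 2, HasDerivAt u (p r) r) {U : Set (Fin 2 → ℝ)} (hU : IsOpen U)
    (hψ : ContDiffOn ℝ ∞ ψ U) (hdom : ∀ z ∈ U, ψ z ∈ polarDom ∧ φ (ψ z 0) = 1 ∧ q (ψ z 0) = 0)
    (hy : y ∈ U) (hind : LinearIndependent ℝ fun a => tangentVec ψ a y)
    (hmin : MeanCurvatureZeroAt (polarMetric φ u) ψ y) {X : (Fin 3 → ℝ) → Fin 3 → ℝ}
    (hX : DifferentiableAt ℝ X (ψ y))

include hφ hu hφ' hu' hU hψ hdom hy hind hmin hX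

/-- The intrinsic divergence of the tangential part of a field is its divergence along the tangent
plane plus a mean curvature term, which vanishes here. On the region considered `φ = 1` and `q = 0`,
so the only Christoffel contribution comes from `u`. -/
theorem pd_flux_add_pd_flux :
    pd 0 (flux (polarMetric φ u) ψ X 0) y + pd 1 (flux (polarMetric φ u) ψ X 1) y
      = √(firstForm (polarMetric φ u) ψ y).det *
        planeDiv u p X (ψ y, tangentProj (polarMetric φ u) ψ y) := by
  have hψd : DifferentiableAt ℝ ψ y :=
    (hψ.contDiffAt (hU.mem_nhds hy)).differentiableAt (by simp)
  have hed : ∀ b i, DifferentiableAt ℝ (fun z => tangentVec ψ b z i) y := fun b i =>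
    ((contDiffOn_pd (contDiffOn_pi.1 hψ i) hU b).contDiffAt (hU.mem_nhds hy)).differentiableAt
      (by simp)
  have hXd : ∀ i, DifferentiableAt ℝ (fun x => X x i) (ψ y) := differentiableAt_pi.1 hX
  obtain ⟨hx, hφ1, hq0⟩ := hdom y hy
  set g : (Fin 2 → ℝ) → ℝ := fun z => u (ψ z 0) with hg
  set e : Fin 2 → Fin 3 → ℝ := fun b i => tangentVec ψ b y i with he
  set T : Fin 2 → Fin 2 → Fin 3 → ℝ := fun a b i => pd a (fun z => tangentVec ψ b z i) y with hT
  set Y : Fin 3 → ℝ := X (ψ y) with hY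
  set DX : Fin 3 → Fin 3 → ℝ := fun i j => pd i (fun x => X x j) (ψ y) with hDX
  set w := u (ψ y 0) with hw
  set w' := p (ψ y 0) with hw'
  have hTsymm : ∀ i, T 0 1 i = T 1 0 i := fun i => pd_comm hU (contDiffOn_pi.1 hψ i) hy 0 1
  -- the coefficients
  set m : Fin 2 → Fin 2 → (Fin 2 → ℝ) → ℝ := fun b c z =>
    tangentVec ψ b z 0 * tangentVec ψ c z 0
      + g z ^ 2 * (tangentVec ψ b z 1 * tangentVec ψ c z 1)
      + tangentVec ψ b z 2 * tangentVec ψ c z 2 with hm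
  set v : Fin 2 → (Fin 2 → ℝ) → ℝ := fun b z =>
    tangentVec ψ b z 0 * X (ψ z) 0 + g z ^ 2 * (tangentVec ψ b z 1 * X (ψ z) 1)
      + tangentVec ψ b z 2 * X (ψ z) 2 with hv
  have hff : ∀ z ∈ U, ∀ b c, firstForm (polarMetric φ u) ψ z b c = m b c z := fun z hz b c =>
    polarMetric_dot (hdom z hz).2.1 _ _
  have hvv : ∀ z ∈ U, ∀ b, tangentVec ψ b z ⬝ᵥ (polarMetric φ u (ψ z) *ᵥ X (ψ z)) = v b z :=
    fun z hz b => polarMetric_dot (hdom z hz).2.1 _ _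
  have hmsymm : ∀ z, m 1 0 z = m 0 1 z := fun z => by simp only [hm]; ring
  have hdet : ∀ z ∈ U, (firstForm (polarMetric φ u) ψ z).det
      = m 0 0 z * m 1 1 z - m 0 1 z * m 0 1 z := fun z hz => by
    rw [Matrix.det_fin_two, hff z hz, hff z hz, hff z hz, hff z hz, hmsymm]
  have hsqrt : ∀ D N : ℝ, √D * (N / D) = N / √D := fun D N => by
    rw [mul_div_assoc', mul_comm, mul_div_assoc, Real.sqrt_div_self', mul_one_div]
  have hflux0 : ∀ z ∈ U, flux (polarMetric φ u) ψ X 0 z = (m 1 1 z * v 0 z - m 0 1 z * v 1 z)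
      / √(m 0 0 z * m 1 1 z - m 0 1 z * m 0 1 z) := fun z hz => by
    rw [flux, hdet z hz, ← hsqrt, inv_fin_two, hdet z hz]
    simp only [Fin.sum_univ_two, hff z hz, hvv z hz, Matrix.of_apply, Matrix.cons_val_zero,
      Matrix.cons_val_one, Matrix.cons_val', Matrix.cons_val_fin_one]
    ring
  have hflux1 : ∀ z ∈ U, flux (polarMetric φ u) ψ X 1 z = (m 0 0 z * v 1 z - m 0 1 z * v 0 z)
      / √(m 0 0 z * m 1 1 z - m 0 1 z * m 0 1 z) := fun z hz => by
    rw [flux, hdet z hz, ← hsqrt, inv_fin_two, hdet z hz]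
    simp only [Fin.sum_univ_two, hff z hz, hvv z hz, Matrix.of_apply, Matrix.cons_val_zero,
      Matrix.cons_val_one, Matrix.cons_val', Matrix.cons_val_fin_one, hmsymm]
    ring
  -- derivatives along coordinate lines
  have hup : ∀ a, Function.update y a (y a) = y := fun a => Function.update_eq_self a y
  have de : ∀ a b i, HasDerivAt (fun t => tangentVec ψ b (Function.update y a t) i) (T a b i) (y a) :=
    fun a b i => hasDerivAt_pd (hed b i) a
  have dX : ∀ a i, HasDerivAt (fun t => X (ψ (Function.update y a t)) i)
      (∑ j, e a j * DX j i) (y a) := fun a i => by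
    rw [← pd_comp hψd (hXd i) a]
    exact hasDerivAt_pd (F := fun z => X (ψ z) i) ((hXd i).comp y hψd) a
  have dg : ∀ a, HasDerivAt (fun t => g (Function.update y a t)) (w' * e a 0) (y a) := fun a => by
    have h0 := hasDerivAt_pd (F := fun z => ψ z 0) (differentiableAt_pi.1 hψd 0) a
    have h1 := hu' _ hx
    rw [← hup a] at h1
    have := h1.comp (y a) h0
    rwa [hup a] at this
  set k : Fin 2 → Fin 2 → Fin 2 → ℝ := fun a b c =>
    (T a b 0 - w * w' * (e a 1 * e b 1)) * e c 0
      + (w ^ 2 * T a b 1 + w * w' * (e a 0 * e b 1 + e a 1 * e b 0)) * e c 1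
      + T a b 2 * e c 2 with hk
  set cc : Fin 2 → Fin 2 → ℝ := fun a b =>
    (T a b 0 - w * w' * (e a 1 * e b 1)) * Y 0
      + (w ^ 2 * T a b 1 + w * w' * (e a 0 * e b 1 + e a 1 * e b 0)) * Y 1
      + T a b 2 * Y 2 with hcc
  set n : Fin 2 → Fin 2 → ℝ := fun a b =>
    e b 0 * ((∑ j, e a j * DX j 0) - w * w' * (e a 1 * Y 1))
      + e b 1 * (w ^ 2 * (∑ j, e a j * DX j 1) + w * w' * (e a 0 * Y 1 + e a 1 * Y 0))
      + e b 2 * ∑ j, e a j * DX j 2 with hn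
  have dm : ∀ a b c, HasDerivAt (fun t => m b c (Function.update y a t)) (k a b c + k a c b) (y a) :=
    fun a b c => by
    refine ((((de a b 0).mul (de a c 0)).add (((dg a).pow 2).mul ((de a b 1).mul (de a c 1)))).add
      ((de a b 2).mul (de a c 2))).congr_deriv ?_
    simp only [hup, Pi.mul_apply, Pi.pow_apply, hk]
    simp only [he, hg, ← hw]
    push_cast
    ring
  have dv : ∀ a b, HasDerivAt (fun t => v b (Function.update y a t)) (cc a b + n a b) (y a) :=
    fun a b => by
    refine ((((de a b 0).mul (dX a 0)).add (((dg a).pow 2).mul ((de a b 1).mul (dX a 1)))).add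
      ((de a b 2).mul (dX a 2))).congr_deriv ?_
    simp only [hup, Pi.mul_apply, Pi.pow_apply, hcc, hn]
    simp only [he, hg, ← hw, ← hY]
    push_cast
    ring
  have hpos : 0 < (firstForm (polarMetric φ u) ψ y).det :=
    (firstForm_posDef hind (polarMetric_posDef hφ hu hx)).det_pos
  have hD := hpos
  rw [hdet y hy] at hD
  -- minimality
  have hcov : ∀ (ν : Fin 3 → ℝ) a b, ν ⬝ᵥ (polarMetric φ u (ψ y) *ᵥ
      covDeriv (polarMetric φ u) ψ a b y) =
      (T a b 0 - w * w' * (e a 1 * e b 1)) * ν 0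
      + (w ^ 2 * T a b 1 + w * w' * (e a 0 * e b 1 + e a 1 * e b 0)) * ν 1
      + T a b 2 * ν 2 := by
    intro ν a b
    have hw0 : w ≠ 0 := (hu _ hx).ne'
    rw [polarMetric_dot hφ1]
    simp only [covDeriv, christoffel_polarMetric hφ hu hφ' hu' hx, Fin.sum_univ_three]
    simp only [polarGamma, Matrix.cons_val_zero, Matrix.cons_val_one, Matrix.cons_val, hq0, hφ1]
    simp only [he, hT, ← hw, ← hw']
    field_simp
    ring
  have hmin' : ∀ f : Fin 2 → Fin 2 → ℝ, (∀ a b, f a b =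
      (m 0 0 y * m 1 1 y - m 0 1 y * m 0 1 y) * cc a b
      - (m 1 1 y * v 0 y - m 0 1 y * v 1 y) * k a b 0
      - (m 0 0 y * v 1 y - m 0 1 y * v 0 y) * k a b 1) →
      m 1 1 y * f 0 0 - m 0 1 y * f 0 1 - m 0 1 y * f 1 0 + m 0 0 y * f 1 1 = 0 := by
    intro f hf
    -- The test vector is the normal part of `X` multiplied by the determinant of the first
    -- fundamental form, which avoids a division.
    have h := hmin (fun i => (m 0 0 y * m 1 1 y - m 0 1 y * m 0 1 y) * Y i
      - (m 1 1 y * v 0 y - m 0 1 y * v 1 y) * e 0 i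
      - (m 0 0 y * v 1 y - m 0 1 y * v 0 y) * e 1 i) (by
        intro a
        rw [polarMetric_dot hφ1]
        have h1 : m 0 a y = e 0 0 * e a 0 + w ^ 2 * (e 0 1 * e a 1) + e 0 2 * e a 2 := rfl
        have h2 : m 1 a y = e 1 0 * e a 0 + w ^ 2 * (e 1 1 * e a 1) + e 1 2 * e a 2 := rfl
        have h3 : v a y = e a 0 * Y 0 + w ^ 2 * (e a 1 * Y 1) + e a 2 * Y 2 := rfl
        have h4 := hmsymm y
        have h5 : (m 0 0 y * m 1 1 y - m 0 1 y * m 0 1 y) * v a y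
            - (m 1 1 y * v 0 y - m 0 1 y * v 1 y) * m 0 a y
            - (m 0 0 y * v 1 y - m 0 1 y * v 0 y) * m 1 a y = 0 := by
          fin_cases a
          · show _ * v 0 y - _ * m 0 0 y - _ * m 1 0 y = 0
            rw [h4]; ring
          · show _ * v 1 y - _ * m 0 1 y - _ * m 1 1 y = 0
            ring
        rw [h1, h2, h3] at h5
        change _ * e a 0 + w ^ 2 * (_ * e a 1) + _ * e a 2 = 0
        linear_combination h5)
    simp only [hcov, inv_fin_two, hdet y hy, hff y hy] at h
    simp only [Fin.sum_univ_two, Matrix.of_apply, Matrix.cons_val_zero, Matrix.cons_val_one,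
      Matrix.cons_val', Matrix.cons_val_fin_one, hmsymm] at h
    simp only [hf, hcc, hk]
    generalize m 0 0 y * m 1 1 y - m 0 1 y * m 0 1 y = D at h hD ⊢
    field_simp at h
    linear_combination h
  obtain ⟨d, d', hd, hd', hsum⟩ := hasDerivAt_flux_algebra
    (m00 := fun t => m 0 0 (Function.update y 0 t)) (m01 := fun t => m 0 1 (Function.update y 0 t))
    (m11 := fun t => m 1 1 (Function.update y 0 t)) (v0 := fun t => v 0 (Function.update y 0 t))
    (v1 := fun t => v 1 (Function.update y 0 t))
    (m00' := fun t => m 0 0 (Function.update y 1 t)) (m01' := fun t => m 0 1 (Function.update y 1 t))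
    (m11' := fun t => m 1 1 (Function.update y 1 t)) (v0' := fun t => v 0 (Function.update y 1 t))
    (v1' := fun t => v 1 (Function.update y 1 t)) (k := k) (c := cc) (n := n)
    (M00 := m 0 0 y) (M01 := m 0 1 y) (M11 := m 1 1 y) (V0 := v 0 y) (V1 := v 1 y)
    (s := y 0) (t := y 1)
    (fun d => by simp only [hk, hTsymm]; ring) (by simp only [hcc, hTsymm]; ring)
    (by rw [hup]) (by rw [hup]) (by rw [hup]) (by rw [hup]) (by rw [hup])
    (by rw [hup]) (by rw [hup]) (by rw [hup]) (by rw [hup]) (by rw [hup])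
    (dm 0 0 0) (dm 0 0 1) (dm 0 1 1) (dv 0 0) (dv 0 1)
    (dm 1 0 0) (dm 1 0 1) (dm 1 1 1) (dv 1 0) (dv 1 1) hD hmin'
  have hp0 : pd 0 (flux (polarMetric φ u) ψ X 0) y = d := by
    rw [pd_congr (G := fun z => (m 1 1 z * v 0 z - m 0 1 z * v 1 z)
      / √(m 0 0 z * m 1 1 z - m 0 1 z * m 0 1 z))]
    · exact hd.deriv
    · filter_upwards [hU.mem_nhds hy] with z hz using hflux0 z hz
  have hp1 : pd 1 (flux (polarMetric φ u) ψ X 1) y = d' := by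
    rw [pd_congr (G := fun z => (m 0 0 z * v 1 z - m 0 1 z * v 0 z)
      / √(m 0 0 z * m 1 1 z - m 0 1 z * m 0 1 z))]
    · exact hd'.deriv
    · filter_upwards [hU.mem_nhds hy] with z hz using hflux1 z hz
  rw [hp0, hp1, hsum, hdet y hy, ← hsqrt]
  congr 1
  have hQ : ∀ i j, tangentProj (polarMetric φ u) ψ y i j =
      (m 1 1 y * (e 0 i * e 0 j) - m 0 1 y * (e 0 i * e 1 j + e 1 i * e 0 j)
        + m 0 0 y * (e 1 i * e 1 j)) / (m 0 0 y * m 1 1 y - m 0 1 y * m 0 1 y) := by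
    intro i j
    simp only [tangentProj, Matrix.mul_apply, Fin.sum_univ_two, inv_fin_two, hdet y hy, hff y hy,
      hmsymm, jacobian, Matrix.of_apply, Matrix.transpose_apply, Matrix.cons_val_zero,
      Matrix.cons_val_one, Matrix.cons_val', Matrix.cons_val_fin_one]
    simp only [he]
    ring
  simp only [planeDiv, hQ, Fin.sum_univ_three, Matrix.cons_val_zero, Matrix.cons_val_one,
    Matrix.cons_val]
  simp only [← hw, ← hw', ← hY, hn, Fin.sum_univ_three]
  generalize m 0 0 y * m 1 1 y - m 0 1 y * m 0 1 y = D at hD ⊢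
  field_simp
  ring

end Divergence

/-! ### Stationarity -/

lemma contDiff_extend {W : (Fin 2 → ℝ) → ℝ} {U C : Set (Fin 2 → ℝ)} (hU : IsOpen U)
    (hW : ContDiffOn ℝ 1 W U) (hC : IsCompact C) (hCU : C ⊆ U) (h0 : ∀ y ∈ U \ C, W y = 0) :
    ContDiff ℝ 1 (U.indicator W) ∧ HasCompactSupport (U.indicator W) ∧
      ∀ a, pd a (U.indicator W) = U.indicator (pd a W) := by
  have hz : ∀ y, y ∉ C → U.indicator W y = 0 := fun y hy => by
    by_cases hyU : y ∈ U
    · rw [indicator_of_mem hyU]; exact h0 y ⟨hyU, hy⟩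
    · exact indicator_of_notMem hyU W
  have hin : ∀ y ∈ U, U.indicator W =ᶠ[𝓝 y] W := fun y hy => by
    filter_upwards [hU.mem_nhds hy] with z hz using indicator_of_mem hz W
  have hout : ∀ y ∉ U, U.indicator W =ᶠ[𝓝 y] fun _ => 0 := fun y hy => by
    filter_upwards [hC.isClosed.isOpen_compl.mem_nhds fun h => hy (hCU h)] with z hz' using hz z hz'
  refine ⟨contDiff_iff_contDiffAt.2 fun y => ?_, HasCompactSupport.intro hC hz, fun a => ?_⟩
  · by_cases hy : y ∈ U
    · exact (hW.contDiffAt (hU.mem_nhds hy)).congr_of_eventuallyEq (hin y hy)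
    · exact contDiffAt_const.congr_of_eventuallyEq (hout y hy)
  · ext y
    by_cases hy : y ∈ U
    · rw [indicator_of_mem hy, pd_congr (hin y hy)]
    · rw [indicator_of_notMem hy, pd_congr (hout y hy), pd_const]

lemma integral_pd_eq_zero {f : (Fin 2 → ℝ) → ℝ} (hf : ContDiff ℝ 1 f) (hc : HasCompactSupport f)
    (a : Fin 2) : Integrable (pd a f) ∧ ∫ y, pd a f y = 0 := by
  have hd : Differentiable ℝ f := hf.differentiable one_ne_zero
  have hp : pd a f = fun y => fderiv ℝ f y (Pi.single a 1) := funext fun y => pd_eq_fderiv (hd y) a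
  have hcont : Continuous fun y => fderiv ℝ f y (Pi.single a 1) :=
    (hf.continuous_fderiv one_ne_zero).clm_apply continuous_const
  have hint : Integrable fun y => fderiv ℝ f y (Pi.single a 1) := by
    refine hcont.integrable_of_hasCompactSupport ?_
    exact (hc.fderiv (𝕜 := ℝ)).mono fun y hy h => hy (by simp [h])
  rw [hp]
  refine ⟨hint, ?_⟩
  have h := integral_mul_fderiv_eq_neg_fderiv_mul_of_integrable (μ := volume)
    (f := fun _ : Fin 2 → ℝ => (1 : ℝ)) (g := f) (v := Pi.single a 1)
    (by simp) (by simpa using hint) (by simpa using hf.continuous.integrable_of_hasCompactSupport hc)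
    (fun x _ => differentiableAt_const _) (fun x _ => hd x)
  simpa using h

section PlaneDiv

variable {w p : ℝ → ℝ} {X X' : (Fin 3 → ℝ) → Fin 3 → ℝ}

lemma planeDiv_congr {z : PlaneBundle} (h : X =ᶠ[𝓝 z.1] X') :
    planeDiv w p X z = planeDiv w p X' z := by
  unfold planeDiv
  have h1 : ∀ i j, pd i (fun x => X x j) z.1 = pd i (fun x => X' x j) z.1 := fun i j =>
    pd_congr (h.mono fun x hx => congrFun hx j)
  simp only [h1, h.eq_of_nhds]

lemma planeDiv_zero (z : PlaneBundle) : planeDiv w p (fun _ => 0) z = 0 := by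
  simp [planeDiv, pd_const]

lemma planeDiv_sum {n : ℕ} {Y : Fin n → (Fin 3 → ℝ) → Fin 3 → ℝ} (hY : ∀ k, Differentiable ℝ (Y k))
    (z : PlaneBundle) : planeDiv w p (fun x => ∑ k, Y k x) z = ∑ k, planeDiv w p (Y k) z := by
  have h1 : ∀ i j, pd i (fun x => (∑ k, Y k x) j) z.1 = ∑ k, pd i (fun x => Y k x j) z.1 := by
    intro i j
    have hd : ∀ k, DifferentiableAt ℝ (fun x => Y k x j) z.1 := fun k =>
      differentiableAt_pi.1 (hY k z.1) j
    have := HasDerivAt.fun_sum (u := Finset.univ) fun k _ => hasDerivAt_pd (hd k) i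
    rw [← this.deriv]
    simp only [pd, Finset.sum_apply]
  unfold planeDiv
  simp only [h1]
  simp only [Finset.sum_apply, Finset.mul_sum, Finset.sum_add_distrib]
  congr 1
  symm
  rw [Finset.sum_comm]
  refine Finset.sum_congr rfl fun i _ => ?_
  exact Finset.sum_comm

lemma continuous_planeDiv (hw : Continuous w) (hp : Continuous p) (hX : ContDiff ℝ 1 X) :
    Continuous (planeDiv w p X) := by
  have h1 : ∀ i j, Continuous fun z : PlaneBundle => pd i (fun x => X x j) z.1 := by
    intro i j
    have hj : ContDiff ℝ 1 fun x => X x j := contDiff_pi.1 hX j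
    have : pd i (fun x => X x j) = fun x => fderiv ℝ (fun x => X x j) x (Pi.single i 1) :=
      funext fun x => pd_eq_fderiv (hj.differentiable one_ne_zero x) i
    rw [this]
    exact ((hj.continuous_fderiv one_ne_zero).clm_apply continuous_const).comp continuous_fst
  have h2 : ∀ i j, Continuous fun z : PlaneBundle => z.2 i j := fun i j => by fun_prop
  have h3 : Continuous fun z : PlaneBundle => z.1 0 := by fun_prop
  have hX0 : Continuous fun z : PlaneBundle => X z.1 0 :=
    ((continuous_apply 0).comp hX.continuous).comp continuous_fst
  have hw0 := hw.comp h3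
  have hp0 := hp.comp h3
  refine Continuous.add ?_ (((h2 1 1).mul (hw0.mul hp0)).mul hX0)
  refine continuous_finsetSum _ fun i _ => continuous_finsetSum _ fun j _ => ?_
  refine ((h2 i j).mul ?_).mul (h1 i j)
  fin_cases j
  · exact continuous_const
  · exact hw0.pow 2
  · exact continuous_const

end PlaneDiv

/-- A piece of coordinate space in which `polarMetric φ u` is `dr² + w² dθ² + dξ²`. -/
structure FlatFibre (φ u p q w w' : ℝ → ℝ) (Z : Set (Fin 3 → ℝ)) : Prop where
  φ_pos : ∀ r ∈ Ioo (0 : ℝ) 2, 0 < φ r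
  u_pos : ∀ r ∈ Ioo (0 : ℝ) 2, 0 < u r
  hasDerivAt_φ : ∀ r ∈ Ioo (0 : ℝ) 2, HasDerivAt φ (φ r * q r) r
  hasDerivAt_u : ∀ r ∈ Ioo (0 : ℝ) 2, HasDerivAt u (p r) r
  smooth : ∀ i j, ContDiffOn ℝ ∞ (fun x => polarMetric φ u x i j) polarDom
  dom : ∀ x ∈ Z, x ∈ polarDom
  φ_eq : ∀ x ∈ Z, φ (x 0) = 1
  q_eq : ∀ x ∈ Z, q (x 0) = 0
  u_eq : ∀ x ∈ Z, u (x 0) = w (x 0)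
  p_eq : ∀ x ∈ Z, p (x 0) = w' (x 0)
  continuous_w : Continuous w
  continuous_w' : Continuous w'

section Stationary

variable {φ u p q w w' : ℝ → ℝ} {Z : Set (Fin 3 → ℝ)} (hF : FlatFibre φ u p q w w' Z)

include hF

lemma FlatFibre.continuousOn (i j : Fin 3) : ContinuousOn (fun x => polarMetric φ u x i j) Z :=
  (hF.smooth i j).continuousOn.mono hF.dom

lemma FlatFibre.posDef (x : Fin 3 → ℝ) (hx : x ∈ Z) : (polarMetric φ u x).PosDef :=
  polarMetric_posDef hF.φ_pos hF.u_pos (hF.dom x hx)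

lemma LocalParam.contDiffOn_flux (P : LocalParam Z) {X : (Fin 3 → ℝ) → Fin 3 → ℝ}
    (hX : ContDiff ℝ 1 X) (a : Fin 2) : ContDiffOn ℝ 1 (flux (polarMetric φ u) P.ψ X a) P.U := by
  have h1 : ∀ i j, ContDiffOn ℝ 1 (fun y => polarMetric φ u (P.ψ y) i j) P.U := fun i j =>
    ((hF.smooth i j).of_le (by simp)).comp (P.smooth.of_le (by simp))
      fun y hy => hF.dom _ (P.mem_of_mem hy).1
  have he : ∀ b i, ContDiffOn ℝ 1 (fun y => tangentVec P.ψ b y i) P.U := fun b i =>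
    (contDiffOn_pd (contDiffOn_pi.1 P.smooth i) P.isOpen_U b).of_le (by simp)
  have hXψ : ∀ j, ContDiffOn ℝ 1 (fun y => X (P.ψ y) j) P.U := fun j =>
    (contDiff_pi.1 hX j).comp_contDiffOn (P.smooth.of_le (by simp))
  have hff : ∀ b c, ContDiffOn ℝ 1 (fun y => firstForm (polarMetric φ u) P.ψ y b c) P.U := by
    intro b c
    simp only [firstForm, Matrix.of_apply, dotProduct, Matrix.mulVec]
    exact ContDiffOn.sum fun i _ => (he b i).mul (ContDiffOn.sum fun j _ => (h1 i j).mul (he c j))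
  have hdet : ContDiffOn ℝ 1 (fun y => (firstForm (polarMetric φ u) P.ψ y).det) P.U := by
    simp only [Matrix.det_fin_two]
    exact ((hff 0 0).mul (hff 1 1)).sub ((hff 0 1).mul (hff 1 0))
  have hne : ∀ y ∈ P.U, (firstForm (polarMetric φ u) P.ψ y).det ≠ 0 := fun y hy =>
    (P.det_pos hF.posDef hy).ne'
  have hinv : ∀ b c, ContDiffOn ℝ 1 (fun y => (firstForm (polarMetric φ u) P.ψ y)⁻¹ b c) P.U := by
    intro b c
    simp only [inv_fin_two]
    fin_cases b <;> fin_cases c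
    · exact (hff 1 1).div hdet hne
    · exact (hff 0 1).neg.div hdet hne
    · exact (hff 1 0).neg.div hdet hne
    · exact (hff 0 0).div hdet hne
  refine (hdet.sqrt hne).mul (ContDiffOn.sum fun b _ => (hinv a b).mul ?_)
  simp only [dotProduct, Matrix.mulVec]
  exact ContDiffOn.sum fun i _ => (he b i).mul (ContDiffOn.sum fun j _ => (h1 i j).mul (hXψ j))

/-- A minimal parametrized surface is stationary. -/
theorem LocalParam.integral_planeDiv (P : LocalParam Z)
    (hmin : ∀ y ∈ P.U, MeanCurvatureZeroAt (polarMetric φ u) P.ψ y) {X : (Fin 3 → ℝ) → Fin 3 → ℝ}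
    (hX : ContDiff ℝ 1 X) {K : Set (Fin 3 → ℝ)} (hK : IsCompact (Z ∩ K)) (hKO : Z ∩ K ⊆ P.O)
    (hXK : ∀ x ∉ K, X x = 0) :
    Integrable (planeDiv w w' X) (P.varifold (polarMetric φ u)) ∧
      ∫ z, planeDiv w w' X z ∂P.varifold (polarMetric φ u) = 0 := by
  set G := polarMetric φ u with hG
  have hcont := continuous_planeDiv hF.continuous_w hF.continuous_w' hX
  have hKO' : Z ∩ K ⊆ Z ∩ P.O := fun x hx => ⟨hx.1, hKO hx⟩
  have hC : IsCompact (P.inv '' (Z ∩ K)) := hK.image_of_continuousOn (P.continuousOn_inv.mono hKO')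
  have hCU : P.inv '' (Z ∩ K) ⊆ P.U := by
    rintro _ ⟨x, hx, rfl⟩
    exact P.inv_mem (hKO' hx)
  -- The field vanishes off `K`, so the flux is supported in the preimage of `Z ∩ K`, a compact
  -- subset of the parameter domain; no boundary term can appear.
  have h0 : ∀ a, ∀ y ∈ P.U \ P.inv '' (Z ∩ K), flux G P.ψ X a y = 0 := by
    intro a y hy
    have : X (P.ψ y) = 0 := by
      apply hXK
      intro h
      exact hy.2 ⟨P.ψ y, ⟨(P.mem_of_mem hy.1).1, h⟩, P.inv_apply hy.1⟩
    simp [flux, this]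
  have hpd : ∀ a, IntegrableOn (pd a (flux G P.ψ X a)) P.U ∧
      ∫ y in P.U, pd a (flux G P.ψ X a) y = 0 := by
    intro a
    obtain ⟨h1, h2, h3⟩ := contDiff_extend P.isOpen_U (P.contDiffOn_flux hF hX a) hC hCU (h0 a)
    obtain ⟨h4, h5⟩ := integral_pd_eq_zero h1 h2 a
    rw [h3 a] at h4 h5
    rw [integrable_indicator_iff P.isOpen_U.measurableSet] at h4
    rw [integral_indicator P.isOpen_U.measurableSet] at h5
    exact ⟨h4, h5⟩
  have key : ∀ y ∈ P.U, pd 0 (flux G P.ψ X 0) y + pd 1 (flux G P.ψ X 1) y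
      = (ENNReal.ofReal (P.dens G y)).toReal • planeDiv w w' X (P.lift G y) := by
    intro y hy
    have hyZ := (P.mem_of_mem hy).1
    rw [pd_flux_add_pd_flux hF.φ_pos hF.u_pos hF.hasDerivAt_φ hF.hasDerivAt_u P.isOpen_U P.smooth
      (fun z hz => ⟨hF.dom _ (P.mem_of_mem hz).1, hF.φ_eq _ (P.mem_of_mem hz).1,
        hF.q_eq _ (P.mem_of_mem hz).1⟩) hy (P.immersion y hy) (hmin y hy)
      (hX.differentiable one_ne_zero _), show (ENNReal.ofReal (P.dens G y)).toReal = P.dens G y from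
        ENNReal.toReal_ofReal (Real.sqrt_nonneg _), smul_eq_mul]
    simp only [dens, lift, planeDiv, hF.u_eq _ hyZ, hF.p_eq _ hyZ, hG]
  have hint := (hpd 0).1.add (hpd 1).1
  have hint' : IntegrableOn (fun y => (ENNReal.ofReal (P.dens G y)).toReal •
      planeDiv w w' X (P.lift G y)) P.U :=
    hint.congr_fun key P.isOpen_U.measurableSet
  have hlift := P.aemeasurable_lift hF.continuousOn hF.posDef
  have hdens := P.aemeasurable_dens hF.continuousOn
  constructor
  · rw [varifold, integrable_map_measure hcont.aestronglyMeasurable hlift]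
    rw [integrable_withDensity_iff_integrable_smul₀' hdens
      (Eventually.of_forall fun _ => ENNReal.ofReal_lt_top)]
    exact hint'
  · rw [varifold, integral_map hlift hcont.aestronglyMeasurable,
      integral_withDensity_eq_integral_toReal_smul₀ hdens
      (Eventually.of_forall fun _ => ENNReal.ofReal_lt_top),
      ← setIntegral_congr_fun P.isOpen_U.measurableSet key]
    rw [integral_add (hpd 0).1 (hpd 1).1, (hpd 0).2, (hpd 1).2, add_zero]

/-- The varifold of a minimal surface is stationary. -/
theorem integral_atlasVarifold {n : ℕ} (P : Fin n → LocalParam Z)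
    (hmin : ∀ k, ∀ y ∈ (P k).U, MeanCurvatureZeroAt (polarMetric φ u) (P k).ψ y)
    {X : (Fin 3 → ℝ) → Fin 3 → ℝ} (hX : ContDiff ℝ 1 X) {K : Set (Fin 3 → ℝ)} (hKc : IsClosed K)
    (hK : IsCompact (Z ∩ K)) (hKO : Z ∩ K ⊆ ⋃ k, (P k).O) (hXK : ∀ x ∉ K, X x = 0) :
    Integrable (planeDiv w w' X) (atlasVarifold (polarMetric φ u) P) ∧
      ∫ z, planeDiv w w' X z ∂atlasVarifold (polarMetric φ u) P = 0 := by
  -- The partition of unity is made to sum to one on the larger compact set `L`, hence in a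
  -- neighbourhood of `Z ∩ K`, so that first derivatives agree there too. Each summand then lives in
  -- a single parametrization.
  obtain ⟨L, hL, hKL, hLO⟩ := exists_compact_between hK (isOpen_iUnion fun k => (P k).isOpen_O) hKO
  obtain ⟨f, hf⟩ := SmoothPartitionOfUnity.exists_isSubordinate
    (modelWithCornersSelf ℝ (Fin 3 → ℝ)) hL.isClosed (fun k => (P k).O) (fun k => (P k).isOpen_O) hLO
  have hfs : ∀ k, ContDiff ℝ ∞ (f k) := fun k => (f k).contMDiff.contDiff
  set Y : Fin n → (Fin 3 → ℝ) → Fin 3 → ℝ := fun k x => f k x • X x with hY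
  have hYs : ∀ k, ContDiff ℝ 1 (Y k) := fun k => ((hfs k).of_le (by simp)).smul hX
  have hY0 : ∀ k, ∀ x ∉ K ∩ tsupport (f k), Y k x = 0 := by
    intro k x hx
    by_cases hxK : x ∈ K
    · have : x ∉ tsupport (f k) := fun h => hx ⟨hxK, h⟩
      simp [hY, image_eq_zero_of_notMem_tsupport this]
    · simp [hY, hXK x hxK]
  have hcont := fun {X : (Fin 3 → ℝ) → Fin 3 → ℝ} (hX : ContDiff ℝ 1 X) =>
    continuous_planeDiv hF.continuous_w hF.continuous_w' hX
  have hsum : ∀ x ∈ Z, X =ᶠ[𝓝 x] fun x => ∑ k, Y k x := by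
    intro x hx
    by_cases hxK : x ∈ K
    · filter_upwards [isOpen_interior.mem_nhds (hKL ⟨hx, hxK⟩)] with z hz
      have h1 := f.sum_eq_one (interior_subset hz)
      rw [finsum_eq_sum_of_fintype] at h1
      simp only [hY, ← Finset.sum_smul, h1, one_smul]
    · filter_upwards [hKc.isOpen_compl.mem_nhds hxK] with z hz
      simp [hY, hXK z hz]
  have hae : planeDiv w w' X =ᵐ[atlasVarifold (polarMetric φ u) P]
      fun z => ∑ k, planeDiv w w' (Y k) z := by
    refine ae_atlasVarifold P hF.continuousOn hF.posDef (measurableSet_eq_fun (hcont hX).measurable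
      (continuous_finsetSum _ fun k _ => hcont (hYs k)).measurable) fun k y hy => ?_
    rw [planeDiv_congr (hsum _ ((P k).mem_of_mem hy).1),
      planeDiv_sum fun k => (hYs k).differentiable one_ne_zero]
  have hk : ∀ k, Integrable (planeDiv w w' (Y k)) (atlasVarifold (polarMetric φ u) P) ∧
      ∫ z, planeDiv w w' (Y k) z ∂atlasVarifold (polarMetric φ u) P = 0 := by
    intro k
    have h0 : ∀ z, z ∉ (P k).cyl → planeDiv w w' (Y k) z = 0 := by
      intro z hz
      rw [planeDiv_congr (X' := fun _ => 0), planeDiv_zero]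
      have : z.1 ∉ tsupport (f k) := fun h => hz (hf k h)
      filter_upwards [(isClosed_tsupport _).isOpen_compl.mem_nhds this] with x hx
      exact hY0 k x fun h => hx h.2
    have hKk : IsCompact (Z ∩ (K ∩ tsupport (f k))) := by
      rw [← inter_assoc]
      exact hK.inter_right (isClosed_tsupport _)
    obtain ⟨h1, h2⟩ := (P k).integral_planeDiv hF (hmin k) (hYs k) hKk
      (fun x hx => hf k hx.2.2) (hY0 k)
    rw [← atlasVarifold_restrict_cyl P hF.continuousOn hF.posDef k] at h1 h2
    refine ⟨?_, ?_⟩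
    · exact (integrableOn_iff_integrable_of_support_subset fun z hz => by
        by_contra h
        exact hz (h0 z h)).1 h1
    · rwa [setIntegral_eq_integral_of_forall_compl_eq_zero h0] at h2
  refine ⟨(integrable_finsetSum _ fun k _ => (hk k).1).congr hae.symm, ?_⟩
  rw [integral_congr_ae hae, integral_finsetSum _ fun k _ => (hk k).1]
  exact Finset.sum_eq_zero fun k _ => (hk k).2

end Stationary

/-! ### The test field of the monotonicity formula -/

lemma contDiff_max_sq : ContDiff ℝ 1 fun x : ℝ => max x 0 ^ 2 := by
  rw [contDiff_one_iff_deriv]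
  refine ⟨fun x => (hasDerivAt_max_sq x).differentiableAt, ?_⟩
  have : deriv (fun x : ℝ => max x 0 ^ 2) = fun x => 2 * max x 0 :=
    funext fun x => (hasDerivAt_max_sq x).deriv
  rw [this]
  fun_prop

/-- The function `s⁻²`, corrected for the variation of the metric. -/
def kap (C s : ℝ) : ℝ := (s⁻¹ + 4 * C) ^ 2

/-- A `C¹` function which is close to `kap C` for small `s` and vanishes for `2 C s ≥ 1`. -/
def profile (C s : ℝ) : ℝ := max (kap C s - 36 * C ^ 2) 0 ^ 2 / kap C s

/-- The square of the distance to `x₀` in the metric `dr² + b² dθ² + dξ²`. -/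
def sqDist (x₀ : Fin 3 → ℝ) (b : ℝ) (x : Fin 3 → ℝ) : ℝ :=
  (x 0 - x₀ 0) ^ 2 + b ^ 2 * (x 1 - x₀ 1) ^ 2 + (x 2 - x₀ 2) ^ 2

/-- The regularized distance to `x₀`. -/
def regDist (x₀ : Fin 3 → ℝ) (b ε : ℝ) (x : Fin 3 → ℝ) : ℝ := √(sqDist x₀ b x + ε ^ 2)

/-- The test field of the monotonicity formula. -/
def testField (x₀ : Fin 3 → ℝ) (b C ε : ℝ) (x : Fin 3 → ℝ) : Fin 3 → ℝ :=
  fun j => profile C (regDist x₀ b ε x) * (x j - x₀ j)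

section TestField

variable {x₀ : Fin 3 → ℝ} {b C ε s : ℝ}

lemma kap_pos (hC : 0 < C) (hs : 0 < s) : 0 < kap C s := by
  unfold kap; positivity

lemma hasDerivAt_kap (hs : 0 < s) : HasDerivAt (kap C) (-(2 * (s⁻¹ + 4 * C) / s ^ 2)) s := by
  refine (((hasDerivAt_inv hs.ne').add_const (4 * C)).pow 2).congr_deriv ?_
  push_cast
  ring

lemma hasDerivAt_profile (hC : 0 < C) (hs : 0 < s) : HasDerivAt (profile C)
    ((2 * max (kap C s - 36 * C ^ 2) 0 * kap C s - max (kap C s - 36 * C ^ 2) 0 ^ 2)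
      / kap C s ^ 2 * -(2 * (s⁻¹ + 4 * C) / s ^ 2)) s := by
  have h1 := (hasDerivAt_max_sq (kap C s - 36 * C ^ 2)).comp s
    ((hasDerivAt_kap (C := C) hs).sub_const _)
  refine (h1.div (hasDerivAt_kap hs) (kap_pos hC hs).ne').congr_deriv ?_
  simp only [Function.comp_apply]
  ring

lemma contDiffOn_profile (hC : 0 < C) : ContDiffOn ℝ 1 (profile C) (Ioi 0) := by
  have hk : ContDiffOn ℝ 1 (kap C) (Ioi 0) :=
    ((contDiffOn_inv ℝ).mono fun s (hs : 0 < s) => mem_compl_singleton_iff.2 hs.ne').add contDiffOn_const |>.pow 2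
  exact (contDiff_max_sq.comp_contDiffOn (hk.sub contDiffOn_const)).div hk
    fun s hs => (kap_pos hC hs).ne'

/-- For `s⁻¹ ≤ 2C` one gets `kap C s ≤ (2C + 4C)² = 36 C²`, which is the threshold in `profile`. -/
lemma profile_eq_zero (hC : 0 < C) (hs : 1 ≤ 2 * C * s) : profile C s = 0 := by
  have hs0 : 0 < s := by
    by_contra h
    nlinarith
  have h1 : s⁻¹ ≤ 2 * C := by
    rw [inv_le_iff_one_le_mul₀ hs0]; exact hs
  have h2 : 0 < s⁻¹ := inv_pos.2 hs0
  have : kap C s - 36 * C ^ 2 ≤ 0 := by unfold kap; nlinarith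
  rw [profile, max_eq_right this]
  simp

lemma sqDist_nonneg (x : Fin 3 → ℝ) : 0 ≤ sqDist x₀ b x := by unfold sqDist; positivity

lemma regDist_pos (hε : 0 < ε) (x : Fin 3 → ℝ) : 0 < regDist x₀ b ε x :=
  Real.sqrt_pos.2 (by have := sqDist_nonneg (x₀ := x₀) (b := b) x; positivity)

lemma regDist_sq (x : Fin 3 → ℝ) : regDist x₀ b ε x ^ 2 = sqDist x₀ b x + ε ^ 2 :=
  Real.sq_sqrt (by have := sqDist_nonneg (x₀ := x₀) (b := b) x; positivity)

lemma contDiff_sqDist : ContDiff ℝ 1 (sqDist x₀ b) := by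
  have h : ∀ i : Fin 3, ContDiff ℝ 1 fun x : Fin 3 → ℝ => (x i - x₀ i) ^ 2 := fun i =>
    ((contDiff_apply ℝ ℝ i).sub contDiff_const).pow 2
  exact ((h 0).add (contDiff_const.mul (h 1))).add (h 2)

/-- The shift by `ε²` keeps the regularized distance away from zero, where `profile` is singular. -/
lemma contDiff_testField (hC : 0 < C) (hε : 0 < ε) : ContDiff ℝ 1 (testField x₀ b C ε) := by
  have h1 : ContDiff ℝ 1 (regDist x₀ b ε) :=
    (contDiff_sqDist.add contDiff_const).sqrt fun x => by
      have := sqDist_nonneg (x₀ := x₀) (b := b) x; positivity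
  have h2 : ContDiff ℝ 1 fun x => profile C (regDist x₀ b ε x) := by
    rw [← contDiffOn_univ] at h1 ⊢
    exact (contDiffOn_profile hC).comp h1 fun x _ => regDist_pos hε x
  refine contDiff_pi.2 fun j => h2.mul ((contDiff_apply ℝ ℝ j).sub contDiff_const)

lemma testField_eq_zero (hC : 0 < C) {x : Fin 3 → ℝ} (hx : 1 ≤ 2 * C * regDist x₀ b ε x) :
    testField x₀ b C ε x = 0 := by
  ext j
  simp [testField, profile_eq_zero hC hx]

lemma pd_testField (hC : 0 < C) (hε : 0 < ε) (x : Fin 3 → ℝ) (i j : Fin 3) :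
    pd i (fun x => testField x₀ b C ε x j) x =
      deriv (profile C) (regDist x₀ b ε x) / regDist x₀ b ε x *
        (![1, b ^ 2, 1] i * (x i - x₀ i)) * (x j - x₀ j)
      + if i = j then profile C (regDist x₀ b ε x) else 0 := by
  have hs := regDist_pos (x₀ := x₀) (b := b) hε x
  have hup : Function.update x i (x i) = x := Function.update_eq_self i x
  have hc : ∀ k, HasDerivAt (fun t => Function.update x i t k - x₀ k) (if i = k then 1 else 0)
      (x i) := by
    intro k
    have := (hasDerivAt_pi.1 (hasDerivAt_update x i (x i)) k).sub_const (x₀ k)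
    simpa [Pi.single_apply, eq_comm] using this
  have hT : HasDerivAt (fun t => sqDist x₀ b (Function.update x i t) + ε ^ 2)
      (2 * (![1, b ^ 2, 1] i * (x i - x₀ i))) (x i) := by
    refine (((((hc 0).pow 2).add (((hc 1).pow 2).const_mul (b ^ 2))).add
      ((hc 2).pow 2)).add_const (ε ^ 2)).congr_deriv ?_
    rw [hup]
    fin_cases i <;> simp
    ring
  have hpos : 0 < sqDist x₀ b x + ε ^ 2 := by
    have := sqDist_nonneg (x₀ := x₀) (b := b) x; positivity
  have hR : HasDerivAt (fun t => regDist x₀ b ε (Function.update x i t))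
      ((![1, b ^ 2, 1] i * (x i - x₀ i)) / regDist x₀ b ε x) (x i) := by
    refine (hT.sqrt (by rw [hup]; exact hpos.ne')).congr_deriv ?_
    rw [hup]
    unfold regDist
    field_simp
  have hp : HasDerivAt (profile C) (deriv (profile C) (regDist x₀ b ε x))
      (regDist x₀ b ε (Function.update x i (x i))) := by
    rw [hup]
    exact (hasDerivAt_profile hC hs).differentiableAt.hasDerivAt
  refine (((hp.comp (x i) hR).mul (hc j)).congr_deriv ?_).deriv
  simp only [Function.comp_apply, hup]
  split_ifs <;> ring

end TestField

/-- The algebraic properties of the projection onto a tangent plane with respect to the metric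
`dr² + w² dθ² + dξ²`. -/
structure IsTangentPlane (w : ℝ) (Q : Fin 3 → Fin 3 → ℝ) : Prop where
  symm : ∀ i j, Q i j = Q j i
  trace : Q 0 0 + w ^ 2 * Q 1 1 + Q 2 2 = 2
  nonneg : ∀ v : Fin 3 → ℝ, 0 ≤ ∑ i, ∑ j, v i * Q i j * v j
  le : ∀ v : Fin 3 → ℝ, ∑ i, ∑ j, v i * Q i j * v j ≤ v 0 ^ 2 + v 1 ^ 2 / w ^ 2 + v 2 ^ 2

/-- The conditions range over uncountably many `v`, but each one is closed, so the intersection is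
closed. -/
lemma measurableSet_isTangentPlane {w : ℝ → ℝ} (hw : Continuous w) (hw0 : ∀ t, w t ≠ 0) :
    MeasurableSet {z : PlaneBundle | IsTangentPlane (w (z.1 0)) z.2} := by
  have hw1 : Continuous fun z : PlaneBundle => w (z.1 0) := hw.comp (by fun_prop)
  have hQ : ∀ i j, Continuous fun z : PlaneBundle => z.2 i j := fun i j => by fun_prop
  have hq : ∀ v : Fin 3 → ℝ, Continuous fun z : PlaneBundle => ∑ i, ∑ j, v i * z.2 i j * v j :=
    fun v => continuous_finsetSum _ fun i _ => continuous_finsetSum _ fun j _ =>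
      (continuous_const.mul (hQ i j)).mul continuous_const
  have h : {z : PlaneBundle | IsTangentPlane (w (z.1 0)) z.2} =
      ((⋂ i, ⋂ j, {z | z.2 i j = z.2 j i}) ∩
        {z | z.2 0 0 + w (z.1 0) ^ 2 * z.2 1 1 + z.2 2 2 = 2}) ∩
      ((⋂ v : Fin 3 → ℝ, {z | 0 ≤ ∑ i, ∑ j, v i * z.2 i j * v j}) ∩
        ⋂ v : Fin 3 → ℝ, {z | ∑ i, ∑ j, v i * z.2 i j * v j
          ≤ v 0 ^ 2 + v 1 ^ 2 / w (z.1 0) ^ 2 + v 2 ^ 2}) := by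
    ext z
    simp only [mem_inter_iff, mem_iInter, Set.mem_ofPred_eq]
    exact ⟨fun h => ⟨⟨h.symm, h.trace⟩, h.nonneg, h.le⟩, fun h => ⟨h.1.1, h.1.2, h.2.1, h.2.2⟩⟩
  rw [h]
  refine IsClosed.measurableSet ?_
  refine IsClosed.inter (IsClosed.inter ?_ ?_) (IsClosed.inter ?_ ?_)
  · exact isClosed_iInter fun i => isClosed_iInter fun j => isClosed_eq (hQ i j) (hQ j i)
  · exact isClosed_eq (((hQ 0 0).add ((hw1.pow 2).mul (hQ 1 1))).add (hQ 2 2)) continuous_const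
  · exact isClosed_iInter fun v => isClosed_le continuous_const (hq v)
  · exact isClosed_iInter fun v => isClosed_le (hq v) ((continuous_const.add
      (continuous_const.div (hw1.pow 2) fun z => pow_ne_zero 2 (hw0 _))).add continuous_const)

/-- The excess over `2b²` is `(b² - μ²)²/μ²`, quadratic in `b - μ`. One factor `|b - μ| ≤ s` is kept
and the other is bounded by `b/14`, giving an error linear in `s`. -/
lemma ratio_le {b μ s : ℝ} (hb : 0 < b) (hs0 : 0 ≤ s) (hμ : |μ - b| ≤ s) (hs : s ≤ b / 14) :
    b ^ 4 / μ ^ 2 + μ ^ 2 ≤ 2 * b ^ 2 + 14 * (b * s) := by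
  have hμ' := abs_le.1 hμ
  have hμ0 : 13 / 14 * b ≤ μ := by linarith [hμ'.1]
  have hμ1 : 0 < μ := lt_of_lt_of_le (by positivity) hμ0
  have h6 : (b - μ) ^ 2 ≤ s * (b / 14) := by
    have : (b - μ) ^ 2 ≤ s ^ 2 := by
      rw [sq_le_sq, abs_of_nonneg hs0, abs_sub_comm]
      exact hμ
    exact this.trans (by rw [sq]; exact mul_le_mul_of_nonneg_left hs hs0)
  have h7 : (b + μ) ^ 2 ≤ (3 * μ) ^ 2 := by
    apply pow_le_pow_left₀ (by positivity)
    linarith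
  have h5 : (b ^ 2 - μ ^ 2) ^ 2 ≤ 14 * (b * s) * μ ^ 2 := by
    have h8 : (b ^ 2 - μ ^ 2) ^ 2 = (b - μ) ^ 2 * (b + μ) ^ 2 := by ring
    rw [h8]
    calc _ ≤ (s * (b / 14)) * (3 * μ) ^ 2 := by gcongr
      _ = 9 / 14 * (b * s * μ ^ 2) := by ring
      _ ≤ _ := by
        have : 0 ≤ b * s * μ ^ 2 := by positivity
        linarith
  have h9 : b ^ 4 / μ ^ 2 + μ ^ 2 = (b ^ 2 - μ ^ 2) ^ 2 / μ ^ 2 + 2 * b ^ 2 := by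
    field_simp; ring
  have h10 : (b ^ 2 - μ ^ 2) ^ 2 / μ ^ 2 ≤ 14 * (b * s) := by
    rw [div_le_iff₀ (by positivity)]; exact h5
  linarith

/-! ### The pointwise inequality for the divergence of the test field. -/

section Inequality

variable {x₀ : Fin 3 → ℝ} {w w' : ℝ → ℝ} {b C ε : ℝ} {z : PlaneBundle}

/-- The divergence of the test field. -/
lemma planeDiv_testField (hC : 0 < C) (hε : 0 < ε) (hz : IsTangentPlane (w (z.1 0)) z.2) :
    planeDiv w w' (testField x₀ b C ε) z =
      profile C (regDist x₀ b ε z.1) *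
        (2 + z.2 1 1 * (w (z.1 0) * w' (z.1 0)) * (z.1 0 - x₀ 0))
      + deriv (profile C) (regDist x₀ b ε z.1) / regDist x₀ b ε z.1 *
        ∑ i, ∑ j, (![1, b ^ 2, 1] i * (z.1 i - x₀ i)) * z.2 i j *
          (![1, w (z.1 0) ^ 2, 1] j * (z.1 j - x₀ j)) := by
  have ht := hz.trace
  simp only [planeDiv, pd_testField hC hε, Fin.sum_univ_three, Matrix.cons_val_zero,
    Matrix.cons_val_one, Matrix.cons_val]
  simp only [testField]
  simp
  linear_combination profile C (regDist x₀ b ε z.1) * ht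

variable (hb : 0 < b) (hC : C * b = 7) (hε : 0 < ε) (hz : IsTangentPlane (w (z.1 0)) z.2)
  (hw : |w (z.1 0) - b| ≤ |z.1 0 - x₀ 0|) (hw' : |w' (z.1 0)| ≤ 1)
  (hs : 2 * C * regDist x₀ b ε z.1 < 1)

lemma abs_sub_le_regDist : |z.1 0 - x₀ 0| ≤ regDist x₀ b ε z.1 := by
  refine Real.abs_le_sqrt ?_
  unfold sqDist
  nlinarith [sq_nonneg (b * (z.1 1 - x₀ 1)), sq_nonneg (z.1 2 - x₀ 2), sq_nonneg ε]

include hb hC hε hw hs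

omit hε in
-- With `C = 7/b`, the condition `2Cs < 1` reads `s < b/14`, and `w` differs from `b` by at most the
-- distance in `r`.
lemma w_mem : 13 / 14 * b ≤ w (z.1 0) ∧ w (z.1 0) ≤ 15 / 14 * b ∧
    regDist x₀ b ε z.1 ≤ b / 14 := by
  have h1 := abs_sub_le_regDist (b := b) (ε := ε) (x₀ := x₀) (z := z)
  have h2 : regDist x₀ b ε z.1 ≤ b / 14 := by
    have : regDist x₀ b ε z.1 * (2 * C * b) ≤ b := by nlinarith
    nlinarith
  have h3 := abs_le.1 (hw.trans (h1.trans h2))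
  exact ⟨by linarith [h3.1], by linarith [h3.2], h2⟩

include hz hw'

omit hε in
-- The trace of the projection gives the 2. The remaining term is at most `s/w` in absolute value,
-- since the angular entry of the projection is at most `1/w²`, and `s/w ≤ 2Cs`.
lemma divergence_ge : 2 * (1 - C * regDist x₀ b ε z.1) ≤
    2 + z.2 1 1 * (w (z.1 0) * w' (z.1 0)) * (z.1 0 - x₀ 0) := by
  have h1 := abs_sub_le_regDist (b := b) (ε := ε) (x₀ := x₀) (z := z)
  obtain ⟨h2, h3, h4⟩ := w_mem hb hC hw hs
  set s := regDist x₀ b ε z.1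
  set μ := w (z.1 0)
  have hμ : 0 < μ := by linarith [mul_pos (show (0 : ℝ) < 13 / 14 by norm_num) hb]
  have hn := hz.nonneg ![0, 1, 0]
  have hl := hz.le ![0, 1, 0]
  simp only [Fin.sum_univ_three, Matrix.cons_val_zero, Matrix.cons_val_one, Matrix.cons_val] at hn hl
  simp only [zero_mul, mul_zero, zero_add, add_zero, one_mul, mul_one, one_pow, ne_eq,
    OfNat.ofNat_ne_zero, not_false_eq_true, zero_pow] at hn hl
  have h5 : |z.2 1 1 * (μ * w' (z.1 0)) * (z.1 0 - x₀ 0)| ≤ (1 / μ ^ 2 * (μ * 1)) * s := by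
    rw [abs_mul, abs_mul, abs_mul, abs_of_nonneg hn, abs_of_pos hμ]
    gcongr
  have h6 : 1 / μ ^ 2 * (μ * 1) * s ≤ 2 * (C * s) := by
    have hs0 : 0 ≤ s := Real.sqrt_nonneg _
    have : 1 / μ ^ 2 * (μ * 1) ≤ 2 * C := by
      rw [mul_one, one_div, inv_mul_le_iff₀ (by positivity)]
      have hC0 : 0 < C := by
        by_contra h
        nlinarith
      have h7 : (13 : ℝ) / 2 ≤ C * μ := by nlinarith [mul_le_mul_of_nonneg_left h2 hC0.le]
      nlinarith
    nlinarith
  linarith [(abs_le.1 h5).1]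

omit hw' hε in
-- The two covectors are those of the position for the metric frozen at `x₀` and for the actual one.
-- Polarization bounds the mixed value by the mean of their squared lengths, and `ratio_le` compares
-- these with the frozen squared distance.
lemma crossTerm_le : ∑ i, ∑ j, (![1, b ^ 2, 1] i * (z.1 i - x₀ i)) * z.2 i j *
    (![1, w (z.1 0) ^ 2, 1] j * (z.1 j - x₀ j)) ≤
    sqDist x₀ b z.1 * (1 + C * regDist x₀ b ε z.1) := by
  have h1 := abs_sub_le_regDist (b := b) (ε := ε) (x₀ := x₀) (z := z)
  obtain ⟨h2, h3, h4⟩ := w_mem hb hC hw hs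
  have hμ' := hw.trans h1
  set s := regDist x₀ b ε z.1
  set μ := w (z.1 0)
  have hμ : 0 < μ := by linarith [mul_pos (show (0 : ℝ) < 13 / 14 by norm_num) hb]
  have hs0 : 0 ≤ s := Real.sqrt_nonneg _
  set a : Fin 3 → ℝ := fun i => ![1, b ^ 2, 1] i * (z.1 i - x₀ i) with ha
  set c : Fin 3 → ℝ := fun i => ![1, μ ^ 2, 1] i * (z.1 i - x₀ i) with hc
  show ∑ i, ∑ j, a i * z.2 i j * c j ≤ _
  have hn := hz.nonneg (a - c)
  have hA := hz.le a
  have hB := hz.le c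
  have e1 := hz.symm 0 1
  have e2 := hz.symm 0 2
  have e3 := hz.symm 1 2
  have hcs : 2 * ∑ i, ∑ j, a i * z.2 i j * c j ≤
      (a 0 ^ 2 + a 1 ^ 2 / μ ^ 2 + a 2 ^ 2) + (c 0 ^ 2 + c 1 ^ 2 / μ ^ 2 + c 2 ^ 2) := by
    refine le_trans ?_ (add_le_add hA hB)
    simp only [Fin.sum_univ_three, Pi.sub_apply] at hn ⊢
    rw [e1, e2, e3] at hn ⊢
    linarith
  have ha0 : a 0 = z.1 0 - x₀ 0 := by simp [ha]
  have ha1 : a 1 = b ^ 2 * (z.1 1 - x₀ 1) := by simp [ha]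
  have ha2 : a 2 = z.1 2 - x₀ 2 := by simp [ha]
  have hc0 : c 0 = z.1 0 - x₀ 0 := by simp [hc]
  have hc1 : c 1 = μ ^ 2 * (z.1 1 - x₀ 1) := by simp [hc]
  have hc2 : c 2 = z.1 2 - x₀ 2 := by simp [hc]
  rw [ha0, ha1, ha2, hc0, hc1, hc2] at hcs
  have hC0 : 0 < C := by
    by_contra h
    nlinarith
  -- the ratio of the metrics
  have hr : b ^ 4 / μ ^ 2 + μ ^ 2 ≤ 2 * (b ^ 2 * (1 + C * s)) := by
    have hbs : b ^ 2 * (C * s) = 7 * (b * s) := by rw [← hC]; ring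
    have := ratio_le hb hs0 hμ' h4
    linarith
  have hCs : 0 ≤ C * s := by positivity
  have e4 : (b ^ 2 * (z.1 1 - x₀ 1)) ^ 2 / μ ^ 2 + (μ ^ 2 * (z.1 1 - x₀ 1)) ^ 2 / μ ^ 2
      = (b ^ 4 / μ ^ 2 + μ ^ 2) * (z.1 1 - x₀ 1) ^ 2 := by
    field_simp
  have e5 := mul_le_mul_of_nonneg_right hr (sq_nonneg (z.1 1 - x₀ 1))
  unfold sqDist
  linarith [mul_nonneg hCs (sq_nonneg (z.1 0 - x₀ 0)), mul_nonneg hCs (sq_nonneg (z.1 2 - x₀ 2))]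

/-- The pointwise inequality behind the monotonicity formula. -/
lemma planeDiv_testField_ge : -(144 * C ^ 2) + (1 - (36 * C ^ 2) ^ 2
      / kap C (regDist x₀ b ε z.1) ^ 2) * kap C (regDist x₀ b ε z.1) * ε ^ 2
      / regDist x₀ b ε z.1 ^ 2 ≤ planeDiv w w' (testField x₀ b C ε) z ∧
    36 * C ^ 2 < kap C (regDist x₀ b ε z.1) := by
  have hC0 : 0 < C := by
    by_contra h
    nlinarith
  have hd := divergence_ge hb hC hz hw hw' hs
  have hq := crossTerm_le hb hC hz hw hs
  rw [planeDiv_testField hC0 hε hz]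
  have hs0 := regDist_pos (x₀ := x₀) (b := b) hε z.1
  rw [(hasDerivAt_profile hC0 hs0).deriv]
  have hT := regDist_sq (x₀ := x₀) (b := b) (ε := ε) z.1
  have hT0 := sqDist_nonneg (x₀ := x₀) (b := b) z.1
  set s := regDist x₀ b ε z.1
  set T := sqDist x₀ b z.1
  set q := ∑ i, ∑ j, (![1, b ^ 2, 1] i * (z.1 i - x₀ i)) * z.2 i j *
    (![1, w (z.1 0) ^ 2, 1] j * (z.1 j - x₀ j))
  set E := 2 + z.2 1 1 * (w (z.1 0) * w' (z.1 0)) * (z.1 0 - x₀ 0)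
  have hk : 36 * C ^ 2 < kap C s := by
    have : 2 * C < s⁻¹ := by rw [lt_inv_comm₀ (by positivity) hs0, inv_eq_one_div,
      lt_div_iff₀ (by positivity)]; linarith
    unfold kap
    nlinarith
  refine ⟨?_, hk⟩
  have hk0 : 0 < kap C s := kap_pos hC0 hs0
  have hkdef : kap C s = (s⁻¹ + 4 * C) ^ 2 := rfl
  rw [profile, max_eq_left (by linarith)]
  set k := kap C s
  set c := 36 * C ^ 2 with hc
  have hc0 : 0 < c := by positivity
  -- This is the derivative of `(k - c)²/k` with respect to `k`.
  set Ψ := 1 - c ^ 2 / k ^ 2 with hΨ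
  have hΨ0 : 0 ≤ Ψ := by
    rw [hΨ, sub_nonneg, div_le_one (by positivity)]
    exact pow_le_pow_left₀ hc0.le hk.le 2
  have e1 : (2 * (k - c) * k - (k - c) ^ 2) / k ^ 2 = Ψ := by
    rw [hΨ]; field_simp; ring
  have e2 : (k - c) ^ 2 / k = k * Ψ - 2 * c + 2 * (c ^ 2 / k) := by
    rw [hΨ]; field_simp; ring
  rw [e1]
  -- the logarithmic derivative of `k`
  have e3 : 2 * (s⁻¹ + 4 * C) / s ^ 2 / s * (T * (1 + C * s)) ≤ 2 * (1 - C * s) * k * (T / s ^ 2) := by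
    have h1 : (s⁻¹ + 4 * C) / s * (1 + C * s) ≤ (1 - C * s) * k := by
      have h2 : (s⁻¹ + 4 * C) = (1 + 4 * C * s) / s := by field_simp
      rw [hkdef, h2, div_pow, div_div, ← sub_nonneg]
      have h3 : (1 - C * s) * ((1 + 4 * C * s) ^ 2 / s ^ 2) - (1 + 4 * C * s) / (s * s) * (1 + C * s)
          = (1 + 4 * C * s) * (2 * (C * s) * (1 - 2 * C * s)) / s ^ 2 := by
        field_simp; ring
      rw [h3]
      have : 0 ≤ 1 - 2 * C * s := by linarith
      positivity
    have h4 : 2 * (s⁻¹ + 4 * C) / s ^ 2 / s * (T * (1 + C * s))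
        = 2 * ((s⁻¹ + 4 * C) / s * (1 + C * s)) * (T / s ^ 2) := by
      field_simp
    rw [h4]
    have : 0 ≤ T / s ^ 2 := by positivity
    nlinarith
  have e4 : -(Ψ * (2 * (1 - C * s) * k * (T / s ^ 2))) ≤
      Ψ * -(2 * (s⁻¹ + 4 * C) / s ^ 2) / s * q := by
    have h1 : 2 * (s⁻¹ + 4 * C) / s ^ 2 / s * q ≤ 2 * (s⁻¹ + 4 * C) / s ^ 2 / s * (T * (1 + C * s)) := by
      gcongr
    have h2 : Ψ * -(2 * (s⁻¹ + 4 * C) / s ^ 2) / s * q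
        = -(Ψ * (2 * (s⁻¹ + 4 * C) / s ^ 2 / s * q)) := by ring
    rw [h2, neg_le_neg_iff]
    exact mul_le_mul_of_nonneg_left (h1.trans e3) hΨ0
  have e5 : (k - c) ^ 2 / k * (2 * (1 - C * s)) ≤ (k - c) ^ 2 / k * E := by
    have : 0 ≤ (k - c) ^ 2 / k := by positivity
    gcongr
  have e6 : T / s ^ 2 = 1 - ε ^ 2 / s ^ 2 := by
    field_simp
    linarith
  rw [e6] at e4
  -- The leading terms `2(1 - Cs)kΨ` of `e4` and `e5` now cancel. What is left is the `ε²` term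
  -- times `2(1 - Cs) ≥ 1`, a nonnegative multiple of `c²/k`, and `-4c(1 - Cs) ≥ -4c = -144 C²`.
  rw [e2] at e5 ⊢
  have e7 : Ψ * k * ε ^ 2 / s ^ 2 = Ψ * k * (ε ^ 2 / s ^ 2) := by ring
  rw [e7]
  have hx : 0 ≤ Ψ * k * (ε ^ 2 / s ^ 2) := by positivity
  have hy : 0 ≤ c ^ 2 / k := by positivity
  have hCs : 0 < C * s := by positivity
  have hCs' : C * s < 1 / 2 := by linarith
  have e8 : 144 * C ^ 2 = 4 * c := by rw [hc]; ring
  rw [e8]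
  nlinarith [mul_nonneg hx (sub_nonneg.2 hCs'.le), mul_nonneg hy (sub_nonneg.2 hCs'.le),
    mul_pos hc0 hCs]

end Inequality

/-! ### The mass of a stationary varifold -/

section Mass

variable {x₀ : Fin 3 → ℝ} {w w' : ℝ → ℝ} {b C ε : ℝ}

lemma planeDiv_testField_eq_zero (hC : 0 < C) (hε : 0 < ε) {z : PlaneBundle}
    (hz : IsTangentPlane (w (z.1 0)) z.2) (hs : 1 ≤ 2 * C * regDist x₀ b ε z.1) :
    planeDiv w w' (testField x₀ b C ε) z = 0 := by
  have hs0 := regDist_pos (x₀ := x₀) (b := b) hε z.1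
  have h0 := profile_eq_zero hC hs
  have h1 : max (kap C (regDist x₀ b ε z.1) - 36 * C ^ 2) 0 = 0 := by
    rw [profile, div_eq_zero_iff] at h0
    exact pow_eq_zero_iff two_ne_zero |>.1 (h0.resolve_right (kap_pos hC hs0).ne')
  rw [planeDiv_testField hC hε hz, h0, (hasDerivAt_profile hC hs0).deriv, h1]
  simp

/-- Where the squared distance is at most `4ε²`, one has `s² ≤ 5ε²` and `k ≥ 1/(5ε²)`. The condition
on `ε` makes `k ≥ 72 C²`, hence `Ψ ≥ 1/2`, and the `ε²` term is at least `1/(50ε²)`. Outside the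
support of the field the divergence is zero, and the smallness of `ε` keeps that region away from
the small ball. -/
lemma planeDiv_testField_ge_indicator (hb : 0 < b) (hC : C * b = 7) (hε : 0 < ε)
    (hεC : 360 * C ^ 2 * ε ^ 2 ≤ 1) {z : PlaneBundle} (hz : IsTangentPlane (w (z.1 0)) z.2)
    (hw : |w (z.1 0) - b| ≤ |z.1 0 - x₀ 0|) (hw' : |w' (z.1 0)| ≤ 1) :
    -(144 * C ^ 2) + {z : PlaneBundle | sqDist x₀ b z.1 ≤ 4 * ε ^ 2}.indicator
      (fun _ => 1 / (50 * ε ^ 2)) z ≤ planeDiv w w' (testField x₀ b C ε) z := by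
  have hC0 : 0 < C := by
    by_contra h
    nlinarith
  have hs0 := regDist_pos (x₀ := x₀) (b := b) hε z.1
  have hsq := regDist_sq (x₀ := x₀) (b := b) (ε := ε) z.1
  by_cases hs : 2 * C * regDist x₀ b ε z.1 < 1
  · obtain ⟨h1, h2⟩ := planeDiv_testField_ge hb hC hε hz hw hw' hs
    refine le_trans (add_le_add_right ?_ _) h1
    set s := regDist x₀ b ε z.1
    set k := kap C s with hk
    set c := 36 * C ^ 2 with hc
    have hc0 : 0 < c := by positivity
    have hk0 : 0 < k := hc0.trans h2
    by_cases hT : sqDist x₀ b z.1 ≤ 4 * ε ^ 2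
    · rw [indicator_of_mem (show z ∈ {z : PlaneBundle | sqDist x₀ b z.1 ≤ 4 * ε ^ 2} from hT)]
      have hs2 : s ^ 2 ≤ 5 * ε ^ 2 := by rw [hsq]; linarith
      have hks : 1 / s ^ 2 ≤ k := by
        rw [hk, kap, one_div, ← inv_pow]
        apply pow_le_pow_left₀ (by positivity)
        linarith
      have h3 : 1 / (5 * ε ^ 2) ≤ 1 / s ^ 2 := one_div_le_one_div_of_le (by positivity) hs2
      have h4 : 1 / 2 ≤ 1 - c ^ 2 / k ^ 2 := by
        have h5 : 2 * c ≤ k := by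
          refine le_trans ?_ (h3.trans hks)
          rw [le_div_iff₀ (by positivity), hc]
          linarith
        have h6 : c ^ 2 / k ^ 2 ≤ 1 / 2 := by
          rw [div_le_iff₀ (by positivity)]
          nlinarith
        linarith
      calc 1 / (50 * ε ^ 2) = 1 / 2 * (1 / (5 * ε ^ 2)) * ε ^ 2 * (1 / (5 * ε ^ 2)) := by
            field_simp; norm_num
        _ ≤ (1 - c ^ 2 / k ^ 2) * k * ε ^ 2 * (1 / s ^ 2) := by
            have := h3.trans hks
            gcongr
        _ = _ := by rw [mul_one_div]
    · rw [indicator_of_notMem (show z ∉ {z : PlaneBundle | sqDist x₀ b z.1 ≤ 4 * ε ^ 2} from hT)]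
      have : 0 ≤ 1 - c ^ 2 / k ^ 2 := by
        rw [sub_nonneg, div_le_one (by positivity)]
        exact pow_le_pow_left₀ hc0.le h2.le 2
      positivity
  · rw [not_lt] at hs
    rw [planeDiv_testField_eq_zero hC0 hε hz hs]
    have hT : z ∉ {z : PlaneBundle | sqDist x₀ b z.1 ≤ 4 * ε ^ 2} := by
      intro (hT : sqDist x₀ b z.1 ≤ 4 * ε ^ 2)
      have h1 : (1 : ℝ) ≤ (2 * C * regDist x₀ b ε z.1) ^ 2 := one_le_pow₀ hs
      have h2 : (2 * C * regDist x₀ b ε z.1) ^ 2 ≤ 4 * C ^ 2 * (5 * ε ^ 2) := by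
        rw [mul_pow, hsq, mul_pow]
        have : 0 ≤ C ^ 2 := sq_nonneg C
        nlinarith
      nlinarith
    rw [indicator_of_notMem hT]
    nlinarith [sq_nonneg C]

/-- The monotonicity inequality: the mass of a stationary varifold of density one at `x₀` is
bounded from below. -/
theorem mass_ge {V : Measure PlaneBundle} (hb : 0 < b) (hC : C * b = 7) (hε : 0 < ε)
    (hεC : 360 * C ^ 2 * ε ^ 2 ≤ 1) (hz : ∀ᵐ z ∂V, IsTangentPlane (w (z.1 0)) z.2)
    (hw : ∀ r, |w r - b| ≤ |r - x₀ 0|) (hw' : ∀ r, |w' r| ≤ 1)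
    (hint : Integrable (planeDiv w w' (testField x₀ b C ε)) V)
    (hzero : ∫ z, planeDiv w w' (testField x₀ b C ε) z ∂V = 0)
    (hV : ENNReal.ofReal (ε ^ 2 / 2) ≤ V {z | sqDist x₀ b z.1 ≤ 4 * ε ^ 2}) :
    ENNReal.ofReal (1 / (14400 * C ^ 2)) ≤ V univ := by
  by_cases hfin : V univ = ⊤
  · rw [hfin]; exact le_top
  have : IsFiniteMeasure V := ⟨lt_top_iff_ne_top.2 hfin⟩
  have hC0 : 0 < C := by
    by_contra h
    nlinarith
  set D : Set PlaneBundle := {z | sqDist x₀ b z.1 ≤ 4 * ε ^ 2} with hD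
  have hDm : MeasurableSet D :=
    (isClosed_le (contDiff_sqDist.continuous.comp continuous_fst) continuous_const).measurableSet
  have hi : Integrable (D.indicator fun _ => 1 / (50 * ε ^ 2)) V :=
    (integrable_const _).indicator hDm
  have h1 : ∫ z, (-(144 * C ^ 2) + D.indicator (fun _ => 1 / (50 * ε ^ 2)) z) ∂V ≤ 0 := by
    rw [← hzero]
    refine integral_mono_ae ((integrable_const _).add hi) hint ?_
    filter_upwards [hz] with z hz
    exact planeDiv_testField_ge_indicator hb hC hε hεC hz (hw _) (hw' _)
  rw [integral_add (integrable_const _) hi, integral_const, integral_indicator hDm,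
    setIntegral_const, smul_eq_mul, smul_eq_mul] at h1
  have h2 : ε ^ 2 / 2 ≤ V.real D := by
    rw [Measure.real, ← ENNReal.ofReal_le_iff_le_toReal (measure_ne_top V D)]
    exact hV
  rw [ENNReal.ofReal_le_iff_le_toReal hfin]
  change _ ≤ V.real univ
  -- The mass `ε²/2` in the small ball times `1/(50ε²)`. It is balanced by `144 C²` times the total
  -- mass, whence `14400 = 100 · 144`.
  have h3 : 1 / 100 ≤ V.real D * (1 / (50 * ε ^ 2)) := by
    rw [mul_one_div, le_div_iff₀ (by positivity)]
    linarith
  rw [div_le_iff₀ (by positivity)]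
  linarith

end Mass

/-! ### The density of a smooth surface -/

lemma sqDist_le {x₀ : Fin 3 → ℝ} {b : ℝ} (hb : 0 ≤ b) (hb1 : b ≤ 1) (x v : Fin 3 → ℝ) :
    sqDist x₀ b x ≤ 2 * (v 0 ^ 2 + b ^ 2 * v 1 ^ 2 + v 2 ^ 2) + 6 * ‖x - x₀ - v‖ ^ 2 := by
  have h : ∀ i, (x i - x₀ i) ^ 2 ≤ 2 * v i ^ 2 + 2 * ‖x - x₀ - v‖ ^ 2 := by
    intro i
    have h1 : |(x - x₀ - v) i| ≤ ‖x - x₀ - v‖ := by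
      rw [← Real.norm_eq_abs]
      exact norm_le_pi_norm (x - x₀ - v) i
    have h2 := pow_le_pow_left₀ (abs_nonneg _) h1 2
    rw [sq_abs] at h2
    have h3 : x i - x₀ i = v i + (x - x₀ - v) i := by simp
    rw [h3]
    nlinarith [sq_nonneg (v i - (x - x₀ - v) i)]
  have h4 : b ^ 2 ≤ 1 := pow_le_one₀ hb hb1
  have h5 := mul_le_mul_of_nonneg_left (h 1) (sq_nonneg b)
  have h6 : b ^ 2 * ‖x - x₀ - v‖ ^ 2 ≤ ‖x - x₀ - v‖ ^ 2 :=
    mul_le_of_le_one_left (sq_nonneg _) h4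
  unfold sqDist
  linarith [h 0, h 2]

/-- The Cholesky factor: in the coordinates it defines, the first fundamental form at the base point
is Euclidean. -/
lemma exists_eq_transpose_mul_self {g : Matrix (Fin 2) (Fin 2) ℝ} (hg : g.PosDef) :
    ∃ B : Matrix (Fin 2) (Fin 2) ℝ, g = Bᵀ * B := by
  have h0 : 0 < g 0 0 := hg.diag_pos
  have hs : g 1 0 = g 0 1 := by simpa using hg.isHermitian.apply 0 1
  have hd := hg.det_pos
  rw [Matrix.det_fin_two, hs] at hd
  have h1 := Real.mul_self_sqrt h0.le
  have h2 := Real.mul_self_sqrt (div_pos hd h0).le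
  have h3 : √(g 0 0) ≠ 0 := (Real.sqrt_pos.2 h0).ne'
  refine ⟨!![√(g 0 0), g 0 1 / √(g 0 0); 0, √((g 0 0 * g 1 1 - g 0 1 * g 0 1) / g 0 0)], ?_⟩
  ext i j
  fin_cases i <;> fin_cases j <;> simp [Matrix.mul_apply, Fin.sum_univ_two]
  · exact h1.symm
  · field_simp
  · rw [hs]; field_simp
  · rw [h2, div_mul_div_comm, h1]; field_simp; ring

/-- Linearize at `y₀`. The preimage under `B`, where `g = BᵀB`, of the sup-norm ball of radius `ε/2`
has area `ε²/√det g`, and the area density there is at least half of `√det g`. Its image has squared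
distance at most `2 · ε²/2 + 6 · (ε/2)² ≤ 4ε²` from the centre. The sharp density constant is not
needed. -/
theorem LocalParam.density_ge {Z : Set (Fin 3 → ℝ)} {φ u : ℝ → ℝ} (P : LocalParam Z)
    (hGc : ∀ i j, ContinuousOn (fun x => polarMetric φ u x i j) Z)
    (hGp : ∀ x ∈ Z, (polarMetric φ u x).PosDef) {y₀ : Fin 2 → ℝ} (hy₀ : y₀ ∈ P.U)
    (hφ : φ (P.ψ y₀ 0) = 1) {b : ℝ} (hb : 0 ≤ b) (hb1 : b ≤ 1) (hu : u (P.ψ y₀ 0) = b) :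
    ∀ᶠ ε in 𝓝[>] (0 : ℝ), ENNReal.ofReal (ε ^ 2 / 2) ≤
      P.varifold (polarMetric φ u) {z | sqDist (P.ψ y₀) b z.1 ≤ 4 * ε ^ 2} := by
  set G := polarMetric φ u with hG
  have hpos := firstForm_posDef (P.immersion y₀ hy₀) (hGp _ (P.mem_of_mem hy₀).1)
  have hdet := hpos.det_pos
  set g := firstForm G P.ψ y₀ with hg
  obtain ⟨B, hB⟩ := exists_eq_transpose_mul_self hpos
  have hBdet : B.det ^ 2 = g.det := by rw [hB, Matrix.det_mul, Matrix.det_transpose, sq]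
  have hBu' : IsUnit B.det := by
    rw [isUnit_iff_ne_zero]
    intro h
    rw [h] at hBdet
    simp [← hBdet] at hdet
  have hψ := P.differentiableAt hy₀
  set L : (Fin 2 → ℝ) →L[ℝ] (Fin 2 → ℝ) := LinearMap.toContinuousLinearMap (Matrix.toLin' B⁻¹)
  have hL : ∀ v, L (B *ᵥ v) = v := fun v => by
    show B⁻¹ *ᵥ (B *ᵥ v) = v
    rw [Matrix.mulVec_mulVec, Matrix.nonsing_inv_mul _ hBu', Matrix.one_mulVec]
  -- Points of the parallelogram lie within `‖L‖ε/2` of `y₀`, so this relative accuracy makes the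
  -- linearization error at most `ε/2`; the added 1 keeps the denominator positive.
  set c : ℝ := 1 / (1 + ‖L‖) with hc
  have hc0 : 0 < c := by positivity
  -- good points
  have hev : ∀ᶠ y in 𝓝 y₀, y ∈ P.U ∧ √g.det / 2 ≤ P.dens G y ∧
      ‖P.ψ y - P.ψ y₀ - fderiv ℝ P.ψ y₀ (y - y₀)‖ ≤ c * ‖y - y₀‖ := by
    have h1 := hψ.hasFDerivAt.isLittleO.def hc0
    have h2 := (P.continuousOn_dens hGc).continuousAt (P.isOpen_U.mem_nhds hy₀)
    have h3 : √g.det / 2 < P.dens G y₀ := half_lt_self (Real.sqrt_pos.2 hdet)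
    filter_upwards [h1, h2.eventually_const_lt h3, P.isOpen_U.mem_nhds hy₀] with y a1 a2 a3
      using ⟨a3, a2.le, a1⟩
  obtain ⟨δ, hδ, hball⟩ := Metric.eventually_nhds_iff_ball.1 hev
  have hsmall : ∀ᶠ ε in 𝓝[>] (0 : ℝ), 0 < ε ∧ ‖L‖ * (ε / 2) < δ := by
    have h1 : Tendsto (fun ε : ℝ => ‖L‖ * (ε / 2)) (𝓝[>] 0) (𝓝 (‖L‖ * (0 / 2))) :=
      ((continuous_const.mul (continuous_id.div_const 2)).tendsto 0).mono_left nhdsWithin_le_nhds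
    rw [zero_div, mul_zero] at h1
    exact (eventually_mem_nhdsWithin.mono fun x hx => hx).and (h1.eventually_lt_const hδ)
  filter_upwards [hsmall] with ε hε
  obtain ⟨hε0, hεδ⟩ := hε
  -- a parallelogram of good points
  set Q : Set (Fin 2 → ℝ) := Metric.closedBall 0 (ε / 2) with hQ
  set E : Set (Fin 2 → ℝ) := (fun y => y + -y₀) ⁻¹' (Matrix.toLin' B ⁻¹' Q) with hE
  have hEm : MeasurableSet E := by
    refine MeasurableSet.preimage ?_ (by fun_prop)
    exact Metric.isClosed_closedBall.measurableSet.preimage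
      (LinearMap.continuous_of_finiteDimensional _).measurable
  have hEvol : volume E = ENNReal.ofReal (ε ^ 2 / √g.det) := by
    have hdB : LinearMap.det (Matrix.toLin' B) = B.det := LinearMap.det_toLin' B
    rw [hE, measure_preimage_add_right, Measure.addHaar_preimage_linearMap _ (by
      rw [hdB]; exact hBu'.ne_zero), hdB, hQ, Real.volume_pi_closedBall _ (by positivity),
      ← ENNReal.ofReal_mul (abs_nonneg _), ← hBdet, Real.sqrt_sq_eq_abs, abs_inv, Fintype.card_fin]
    congr 1
    ring
  have hgood : ∀ y ∈ E, y ∈ P.U ∧ √g.det / 2 ≤ P.dens G y ∧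
      sqDist (P.ψ y₀) b (P.ψ y) ≤ 4 * ε ^ 2 := by
    intro y hy
    have hBy : ‖B *ᵥ (y - y₀)‖ ≤ ε / 2 := by
      rw [sub_eq_add_neg]
      exact mem_closedBall_zero_iff.1 hy
    have hyy : ‖y - y₀‖ ≤ ‖L‖ * (ε / 2) := by
      have := L.le_opNorm_of_le hBy
      rwa [hL] at this
    obtain ⟨h1, h2, h3⟩ := hball y (by rw [mem_ball_iff_norm]; exact hyy.trans_lt hεδ)
    refine ⟨h1, h2, (sqDist_le hb hb1 _ (fderiv ℝ P.ψ y₀ (y - y₀))).trans ?_⟩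
    have h4 : ‖P.ψ y - P.ψ y₀ - fderiv ℝ P.ψ y₀ (y - y₀)‖ ≤ ε / 2 := by
      refine h3.trans ?_
      have h5 : c * ‖y - y₀‖ ≤ c * ((1 + ‖L‖) * (ε / 2)) := by
        apply mul_le_mul_of_nonneg_left _ hc0.le
        linarith
      refine h5.trans (le_of_eq ?_)
      rw [hc]
      have : (1 + ‖L‖) ≠ 0 := by positivity
      field_simp
    have h6 : (fderiv ℝ P.ψ y₀ (y - y₀)) 0 ^ 2 + b ^ 2 * (fderiv ℝ P.ψ y₀ (y - y₀)) 1 ^ 2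
        + (fderiv ℝ P.ψ y₀ (y - y₀)) 2 ^ 2 = (B *ᵥ (y - y₀)) ⬝ᵥ (B *ᵥ (y - y₀)) := by
      have h7 := polarMetric_dot (u := u) hφ (fderiv ℝ P.ψ y₀ (y - y₀)) (fderiv ℝ P.ψ y₀ (y - y₀))
      rw [hu, ← jacobian_mulVec hψ] at h7
      have h8 : (B *ᵥ (y - y₀)) ⬝ᵥ (B *ᵥ (y - y₀)) = (y - y₀) ⬝ᵥ (g *ᵥ (y - y₀)) := by
        rw [hB, ← Matrix.mulVec_mulVec, Matrix.dotProduct_mulVec (y - y₀), Matrix.vecMul_transpose]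
      have h9 : (jacobian P.ψ y₀ *ᵥ (y - y₀)) ⬝ᵥ (G (P.ψ y₀) *ᵥ (jacobian P.ψ y₀ *ᵥ (y - y₀)))
          = (y - y₀) ⬝ᵥ (g *ᵥ (y - y₀)) := by
        rw [hg, firstForm_eq, ← Matrix.mulVec_mulVec, ← Matrix.mulVec_mulVec,
          Matrix.dotProduct_mulVec (y - y₀), Matrix.vecMul_transpose]
      rw [h8, ← h9, ← jacobian_mulVec hψ, h7]
      ring
    have h10 : (B *ᵥ (y - y₀)) ⬝ᵥ (B *ᵥ (y - y₀)) ≤ ε ^ 2 / 2 := by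
      simp only [dotProduct, Fin.sum_univ_two]
      have h11 : ∀ i, (B *ᵥ (y - y₀)) i * (B *ᵥ (y - y₀)) i ≤ (ε / 2) ^ 2 := fun i => by
        have h12 : |(B *ᵥ (y - y₀)) i| ≤ ε / 2 := (norm_le_pi_norm _ i).trans hBy
        rw [← sq, ← sq_abs]
        exact pow_le_pow_left₀ (abs_nonneg _) h12 2
      linarith [h11 0, h11 1]
    have h13 := pow_le_pow_left₀ (norm_nonneg _) h4 2
    rw [h6]
    nlinarith
  have hm : MeasurableSet {z : PlaneBundle | sqDist (P.ψ y₀) b z.1 ≤ 4 * ε ^ 2} :=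
    (isClosed_le (contDiff_sqDist.continuous.comp continuous_fst) continuous_const).measurableSet
  rw [P.varifold_apply hGc hGp hm]
  calc ENNReal.ofReal (ε ^ 2 / 2) = ENNReal.ofReal (√g.det / 2) * volume E := by
        rw [hEvol, ← ENNReal.ofReal_mul (by positivity)]
        congr 1
        have : √g.det ≠ 0 := (Real.sqrt_pos.2 hdet).ne'
        field_simp
    _ = ∫⁻ _ in E, ENNReal.ofReal (√g.det / 2) := by rw [setLIntegral_const]
    _ ≤ ∫⁻ y in E, ENNReal.ofReal (P.dens G y) := by
        refine setLIntegral_mono' hEm fun y hy => ?_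
        exact ENNReal.ofReal_le_ofReal (hgood y hy).2.1
    _ ≤ _ := by
        refine lintegral_mono_set ?_
        intro y hy
        exact ⟨(hgood y hy).1, (hgood y hy).2.2⟩

/-! ### The lower bound for the area of minimal surfaces -/

lemma FlatFibre.isTangentPlane {φ u p q w w' : ℝ → ℝ} {Z : Set (Fin 3 → ℝ)}
    (hF : FlatFibre φ u p q w w' Z) (P : LocalParam Z) {y : Fin 2 → ℝ} (hy : y ∈ P.U) :
    IsTangentPlane (w ((P.lift (polarMetric φ u) y).1 0)) (P.lift (polarMetric φ u) y).2 := by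
  have hZ := (P.mem_of_mem hy).1
  have hG := hF.posDef _ hZ
  have hd := (P.det_pos hF.posDef hy).ne'
  have hu0 : u (P.ψ y 0) ≠ 0 := (hF.u_pos _ (hF.dom _ hZ)).ne'
  have h1 : w ((P.lift (polarMetric φ u) y).1 0) = u (P.ψ y 0) := (hF.u_eq _ hZ).symm
  have h2 : (P.lift (polarMetric φ u) y).2 = tangentProj (polarMetric φ u) P.ψ y := rfl
  rw [h1, h2]
  have hGd : polarMetric φ u (P.ψ y) = Matrix.diagonal ![1, u (P.ψ y 0) ^ 2, 1] := by
    rw [polarMetric, hF.φ_eq _ hZ]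
    simp
  have hq : ∀ v : Fin 3 → ℝ, ∑ i, ∑ j, v i * tangentProj (polarMetric φ u) P.ψ y i j * v j
      = v ⬝ᵥ (tangentProj (polarMetric φ u) P.ψ y *ᵥ v) := fun v => by
    simp only [dotProduct, Matrix.mulVec, Finset.mul_sum, mul_assoc]
  have hinv : ∀ v : Fin 3 → ℝ,
      polarMetric φ u (P.ψ y) *ᵥ ![v 0, v 1 / u (P.ψ y 0) ^ 2, v 2] = v := fun v => by
    rw [hGd]
    ext i
    rw [Matrix.mulVec_diagonal]
    fin_cases i
    · simp
    · simp; field_simp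
    · simp
  refine ⟨fun i j => ?_, ?_, fun v => ?_, fun v => ?_⟩
  · exact congrFun (congrFun (tangentProj_transpose (ψ := P.ψ) hG.isHermitian) j) i
  · have := trace_tangentProj_mul hd
    rw [hGd] at this
    simp only [Matrix.trace, Matrix.diag_apply, Matrix.mul_diagonal, Fin.sum_univ_three,
      Matrix.cons_val_zero, Matrix.cons_val_one, Matrix.cons_val] at this
    linarith
  · rw [hq]
    exact (tangentProj_nonneg_le (P.immersion y hy) hG v _ (hinv v)).1
  · rw [hq]
    refine (tangentProj_nonneg_le (P.immersion y hy) hG v _ (hinv v)).2.trans (le_of_eq ?_)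
    simp only [dotProduct, Fin.sum_univ_three, Matrix.cons_val_zero, Matrix.cons_val_one,
      Matrix.cons_val]
    ring

lemma continuous_polarMap : Continuous polarMap := by
  unfold polarMap spherePoint
  refine Continuous.prodMk (Continuous.subtype_mk ?_ _) (by fun_prop)
  refine (PiLp.continuous_toLp 2 _).comp (continuous_pi fun i => ?_)
  fin_cases i
  · show Continuous fun x : Fin 3 → ℝ => Real.sin (Real.pi / 2 * x 0) * Real.cos (x 1)
    fun_prop
  · show Continuous fun x : Fin 3 → ℝ => Real.sin (Real.pi / 2 * x 0) * Real.sin (x 1)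
    fun_prop
  · show Continuous fun x : Fin 3 → ℝ => Real.cos (Real.pi / 2 * x 0)
    fun_prop

/-- A coordinate box. -/
def box (x₀ : Fin 3 → ℝ) : Set (Fin 3 → ℝ) := Metric.ball x₀ (1 / 10)

lemma abs_sub_lt_of_mem_box {x₀ x : Fin 3 → ℝ} (hx : x ∈ box x₀) (i : Fin 3) :
    |x i - x₀ i| < 1 / 10 := by
  rw [box, mem_ball_iff_norm, pi_norm_lt_iff (by norm_num)] at hx
  exact hx i

/-- Two points of the box differ by less than `1/5` in each coordinate, too little for a nonzero
multiple of `2π`. -/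
lemma injOn_polarMap_box {x₀ : Fin 3 → ℝ} (hdom : box x₀ ⊆ polarDom) : InjOn polarMap (box x₀) := by
  intro x hx y hy h
  obtain ⟨m, n, hmn⟩ := polarMap_eq_iff (hdom hx) (hdom hy) h
  have hπ := Real.pi_gt_three
  have hint : ∀ (m : ℤ) (i : Fin 3), x i = y i + m * (2 * Real.pi) → m = 0 := by
    intro m i hi
    have h1 := abs_lt.1 (abs_sub_lt_of_mem_box hx i)
    have h2 := abs_lt.1 (abs_sub_lt_of_mem_box hy i)
    have h3 : |(m : ℝ)| < 1 := by
      rw [abs_lt]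
      constructor <;> nlinarith
    have h4 : |m| < 1 := by exact_mod_cast h3
    exact Int.abs_lt_one_iff.1 h4
  have h1 : m = 0 := hint m 1 (by conv_lhs => rw [hmn]; simp)
  have h2 : n = 0 := hint n 2 (by conv_lhs => rw [hmn]; simp)
  rw [hmn, h1, h2]
  ext i
  fin_cases i <;> simp

/-- The part of a surface in a coordinate box. -/
def boxSurface (S : Set M) (x₀ : Fin 3 → ℝ) : Set (Fin 3 → ℝ) := {x ∈ box x₀ | polarMap x ∈ S}

/-- A patch with image in a coordinate box as a local parametrization. -/
def Patch.toLocalParam {𝒜 : Set (Chart M)} {S : Set M} (P : Patch 𝒜 S) {x₀ : Fin 3 → ℝ}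
    (hdom : box x₀ ⊆ polarDom) (hc : P.c.map = polarMap) (hbox : MapsTo P.ψ P.U (box x₀)) :
    LocalParam (boxSurface S x₀) where
  U := P.U
  isOpen_U := P.isOpen_U
  ψ := P.ψ
  smooth := P.smooth
  immersion := P.immersion
  injOn := by
    intro y hy z hz h
    have := P.isOpenEmbedding.injective (a₁ := ⟨y, hy⟩) (a₂ := ⟨z, hz⟩)
      (Subtype.ext (congrArg P.c.map h))
    exact congrArg Subtype.val this
  exists_open := by
    intro V hVU hV
    have h1 := P.isOpenEmbedding.isOpenMap _ (hV.preimage (continuous_subtype_val (p := (· ∈ P.U))))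
    obtain ⟨O', hO', h⟩ := isOpen_induced_iff.1 h1
    refine ⟨polarMap ⁻¹' O', hO'.preimage continuous_polarMap, ?_⟩
    ext x
    constructor
    · rintro ⟨y, hy, rfl⟩
      have hyU := hVU hy
      have hS : polarMap (P.ψ y) ∈ S := by rw [← hc]; exact P.mapsTo hyU
      refine ⟨⟨hbox hyU, hS⟩, ?_⟩
      have : (⟨polarMap (P.ψ y), hS⟩ : S) ∈ Subtype.val ⁻¹' O' := by
        rw [h]
        exact ⟨⟨y, hyU⟩, hy, Subtype.ext (congrFun hc (P.ψ y))⟩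
      exact this
    · rintro ⟨⟨hxB, hxS⟩, hxO⟩
      have : (⟨polarMap x, hxS⟩ : S) ∈ Subtype.val ⁻¹' O' := hxO
      rw [h] at this
      obtain ⟨y, hy, hyx⟩ := this
      have h2 : P.c.map (P.ψ y) = polarMap x := congrArg Subtype.val hyx
      rw [hc] at h2
      exact ⟨y, hy, injOn_polarMap_box hdom (hbox y.2) hxB h2⟩

lemma mem_pieces {Z : Set (Fin 3 → ℝ)} {n : ℕ} {P : Fin n → LocalParam Z} {k : Fin n}
    {z : PlaneBundle} : z ∈ pieces P k ↔ z.1 ∈ (P k).O ∧ ∀ j < k, z.1 ∉ (P j).O := by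
  rw [pieces, disjointed_apply, Finset.sup_set_eq_biUnion]
  show z ∈ (P k).cyl \ _ ↔ _
  rw [Set.mem_sdiff, mem_iUnion₂]
  simp only [Finset.mem_Iio, not_exists]
  exact Iff.rfl

/-- The area is at least the mass of the varifold of the surface in a coordinate box. -/
lemma atlasVarifold_univ_le_area {𝒜 : Set (Chart M)} {S : Set M} {x₀ : Fin 3 → ℝ} {φ u : ℝ → ℝ}
    (hdom : box x₀ ⊆ polarDom)
    (hGc : ∀ i j, ContinuousOn (fun x => polarMetric φ u x i j) (boxSurface S x₀))
    (hGp : ∀ x ∈ boxSurface S x₀, (polarMetric φ u x).PosDef) {n : ℕ} (P : Fin n → Patch 𝒜 S)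
    (hc : ∀ k, (P k).c = polarChart φ u) (hbox : ∀ k, MapsTo (P k).ψ (P k).U (box x₀)) :
    atlasVarifold (polarMetric φ u) (fun k => (P k).toLocalParam hdom (by rw [hc]; rfl) (hbox k)) univ
      ≤ area 𝒜 S := by
  set L : Fin n → LocalParam (boxSurface S x₀) :=
    fun k => (P k).toLocalParam hdom (by rw [hc]; rfl) (hbox k)
  rw [atlasVarifold_univ L hGc hGp]
  -- Restricting each patch to its disjoint piece gives an admissible family in the supremum
  -- defining the area, with total exactly the mass of the glued varifold.
  set B : Fin n → Set (Fin 2 → ℝ) := fun k =>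
    (L k).U ∩ (L k).lift (polarMetric φ u) ⁻¹' pieces L k
  have hB : ∀ k, MeasurableSet (B k) ∧ B k ⊆ (P k).U := fun k =>
    ⟨(L k).measurableSet_inter_lift hGc hGp (measurableSet_pieces L k), inter_subset_left⟩
  have hdisj : Pairwise fun k l => Disjoint (((P k).c.map ∘ (P k).ψ) '' B k)
      (((P l).c.map ∘ (P l).ψ) '' B l) := by
    intro k l hkl
    rw [Set.disjoint_left]
    rintro _ ⟨y, hy, rfl⟩ ⟨y', hy', h⟩
    simp only [Function.comp_apply, hc] at h
    have heq : (P l).ψ y' = (P k).ψ y :=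
      injOn_polarMap_box hdom (hbox l hy'.1) (hbox k hy.1) h
    have h1 := mem_pieces.1 hy.2
    have h2 := mem_pieces.1 hy'.2
    have h3 : ((L k).lift (polarMetric φ u) y).1 = ((L l).lift (polarMetric φ u) y').1 := heq.symm
    rcases lt_or_gt_of_ne hkl with hlt | hlt
    · exact h2.2 k hlt (h3 ▸ h1.1)
    · exact h1.2 l hlt (h3 ▸ h2.1)
  unfold area
  refine le_trans (le_of_eq ?_) (le_iSup_of_le n (le_iSup_of_le P (le_iSup_of_le B
    (le_iSup_of_le hB (le_iSup_of_le hdisj le_rfl)))))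
  refine Finset.sum_congr rfl fun k _ => ?_
  rw [Patch.areaOn, hc]
  rfl

/-! ### The uniform lower bound for the area. -/

section Final

variable {η : ℝ → ℝ} {A : ℝ} {u : ℝ → ℝ} {S : Set M}

/-- Truncation to the interval `[1/10, 19/10]`. -/
def trunc (r : ℝ) : ℝ := projIcc (1 / 10 : ℝ) (19 / 10) (by norm_num) r

lemma trunc_mem (r : ℝ) : trunc r ∈ Icc (1 / 10 : ℝ) (19 / 10) :=
  (projIcc (1 / 10 : ℝ) (19 / 10) (by norm_num) r).2

lemma trunc_eq {r : ℝ} (hr : r ∈ Icc (1 / 10 : ℝ) (19 / 10)) : trunc r = r := by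
  rw [trunc, projIcc_of_mem _ hr]

lemma continuous_trunc : Continuous trunc := continuous_subtype_val.comp continuous_projIcc

lemma trunc_mem_Ioo (r : ℝ) : trunc r ∈ Ioo (0 : ℝ) 2 :=
  ⟨by linarith [(trunc_mem r).1], by linarith [(trunc_mem r).2]⟩

variable (hη : IsCutoff η) (hA : 10 ≤ A) (hu : IsBaseWarping η A u)

lemma mem_of_mem_box {x₀ x : Fin 3 → ℝ} (hx₀ : x₀ 0 ∈ Icc (1 / 5 : ℝ) (9 / 5)) (hx : x ∈ box x₀) :
    x 0 ∈ Ioo (1 / 10 : ℝ) (19 / 10) := by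
  have := abs_lt.1 (abs_sub_lt_of_mem_box hx 0)
  exact ⟨by linarith [hx₀.1], by linarith [hx₀.2]⟩

lemma box_subset_polarDom {x₀ : Fin 3 → ℝ} (hx₀ : x₀ 0 ∈ Icc (1 / 5 : ℝ) (9 / 5)) :
    box x₀ ⊆ polarDom := fun x hx => by
  have := mem_of_mem_box hx₀ hx
  exact ⟨by linarith [this.1], by linarith [this.2]⟩

include hη hA hu

/-- A box of radius `1/10` around the middle region stays in `1/10 < r < 19/10`, where `φ = 1`.
Truncation of `r` supplies globally continuous coefficients without changing anything in the box. -/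
lemma flatFibre_example {x₀ : Fin 3 → ℝ} (hx₀ : x₀ 0 ∈ Icc (1 / 5 : ℝ) (9 / 5)) :
    FlatFibre (phiFun η A) u (deriv u) (deriv (fFun η A)) (fun r => u (trunc r))
      (fun r => deriv u (trunc r)) (boxSurface S x₀) where
  φ_pos r _ := phiFun_pos η A r
  u_pos := hu.pos
  hasDerivAt_φ r hr := hasDerivAt_phiFun (A := A) hη hr.1
  hasDerivAt_u r hr := hu.hasDerivAt hr
  smooth := (isSmoothMetric_example hη hA hu _ (mem_warpedAtlas_polar _ _ _ _)).1
  dom x hx := box_subset_polarDom hx₀ hx.1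
  φ_eq x hx := phiFun_right hη hA (mem_of_mem_box hx₀ hx.1).1.le
  q_eq x hx := by
    have h : fFun η A =ᶠ[𝓝 (x 0)] fun _ => 0 := by
      filter_upwards [Ioi_mem_nhds (mem_of_mem_box hx₀ hx.1).1] with r hr
        using fFun_right hη hA (le_of_lt hr)
    rw [h.deriv_eq, deriv_const]
  u_eq x hx := by rw [trunc_eq (Ioo_subset_Icc_self (mem_of_mem_box hx₀ hx.1))]
  p_eq x hx := by rw [trunc_eq (Ioo_subset_Icc_self (mem_of_mem_box hx₀ hx.1))]
  continuous_w := hu.contDiffOn_Ioo.continuousOn.comp_continuous continuous_trunc trunc_mem_Ioo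
  continuous_w' := (hu.contDiffOn_Ioo.continuousOn_deriv_of_isOpen isOpen_Ioo
    (by simp)).comp_continuous continuous_trunc trunc_mem_Ioo

/-- The area of a closed minimal surface is bounded from below. -/
theorem area_ge (hS : IsClosedMinimalSurface (exampleMetric η A u) S) :
    ENNReal.ofReal (1 / (14400 * 700 ^ 2)) ≤ area (exampleMetric η A u) S := by
  obtain ⟨x, hxS, hx⟩ := exists_rad_mem_middle hη hA hu hS
  obtain ⟨x₀, h0, -, -, rfl⟩ := exists_polarMap x
  rw [← h0] at hx
  set b := u (x₀ 0) with hbdef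
  have hx2 : x₀ 0 ∈ Icc (0 : ℝ) 2 := ⟨by linarith [hx.1], by linarith [hx.2]⟩
  have hb0 : 1 / 100 ≤ b := by
    refine le_trans ?_ (hu.min_le hx2)
    have : 1 / 5 ≤ min (x₀ 0) (2 - x₀ 0) := le_min hx.1 (by linarith [hx.2])
    linarith
  have hb1 : b ≤ 1 := by
    have h1 := hu.le_self hx2
    have h2 := hu.le_two_sub hx2
    linarith
  have hb : 0 < b := by linarith
  -- The field is cut off at scale `1/(2C) = b/14`. As `b ≥ 1/100`, the constant `C` is at most
  -- `700`; as `b ≤ 1`, the support fits into the sup-norm ball of radius `1/14 < 1/10`.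
  set C := 7 / b with hCdef
  have hC : C * b = 7 := div_mul_cancel₀ _ hb.ne'
  have hC0 : 0 < C := by positivity
  have hC1 : C ≤ 700 := by rw [hCdef, div_le_iff₀ hb]; linarith
  have hdom := box_subset_polarDom hx
  have hF := flatFibre_example (S := S) hη hA hu hx
  have hx₀B : x₀ ∈ box x₀ := Metric.mem_ball_self (by norm_num)
  -- the support of the test field
  set K : Set (Fin 3 → ℝ) := {x | sqDist x₀ b x ≤ (b / 14) ^ 2} with hK
  have hKcl : IsClosed K := isClosed_le contDiff_sqDist.continuous continuous_const
  have hKball : K ⊆ Metric.closedBall x₀ (1 / 14) := by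
    intro x (hx : sqDist x₀ b x ≤ (b / 14) ^ 2)
    rw [mem_closedBall_iff_norm, pi_norm_le_iff_of_nonneg (by norm_num)]
    unfold sqDist at hx
    have h1 : (x 0 - x₀ 0) ^ 2 ≤ (1 / 14) ^ 2 ∧ (x 2 - x₀ 2) ^ 2 ≤ (1 / 14) ^ 2 := by
      have hbb : b ^ 2 ≤ 1 := pow_le_one₀ hb.le hb1
      constructor <;>
        nlinarith [sq_nonneg (x 0 - x₀ 0), sq_nonneg (b * (x 1 - x₀ 1)), sq_nonneg (x 2 - x₀ 2)]
    have h2 : (x 1 - x₀ 1) ^ 2 ≤ (1 / 14) ^ 2 := by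
      have : b ^ 2 * (x 1 - x₀ 1) ^ 2 ≤ b ^ 2 * (1 / 14) ^ 2 := by
        nlinarith [sq_nonneg (x 0 - x₀ 0), sq_nonneg (x 2 - x₀ 2)]
      exact le_of_mul_le_mul_left this (by positivity)
    intro i
    rw [Pi.sub_apply, Real.norm_eq_abs]
    refine abs_le_of_sq_le_sq ?_ (by norm_num)
    fin_cases i
    exacts [h1.1, h2, h1.2]
  have hKB : K ⊆ box x₀ := hKball.trans (Metric.closedBall_subset_ball (by norm_num))
  have hKc : IsCompact K := (isCompact_closedBall x₀ (1 / 14)).of_isClosed_subset hKcl hKball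
  -- The box is open, so the part of the surface in it is not compact; but `K` lies inside the box,
  -- and there membership in `S` is a closed condition.
  have hZK : boxSurface S x₀ ∩ K = K ∩ polarMap ⁻¹' S := by
    ext x
    exact ⟨fun h => ⟨h.2, h.1.2⟩, fun h => ⟨⟨hKB h.1, h.2⟩, h.1⟩⟩
  have hZKc : IsCompact (boxSurface S x₀ ∩ K) := by
    rw [hZK]
    exact hKc.inter_right (hS.1.2.1.isClosed.preimage continuous_polarMap)
  -- a finite cover by patches
  have hpatch : ∀ x : ↥(boxSurface S x₀), ∃ P : Patch (exampleMetric η A u) S,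
      P.c = polarChart (phiFun η A) u ∧ MapsTo P.ψ P.U (box x₀) ∧
      (∀ y ∈ P.U, P.ψ y ∈ polarDom ∧ MeanCurvatureZeroAt (polarMetric (phiFun η A) u) P.ψ y) ∧
      ∃ y ∈ P.U, P.ψ y = x := fun x =>
    exists_polar_patch_example hA hS (hdom x.2.1) x.2.2 Metric.isOpen_ball x.2.1
  choose P hPc hPbox hPmin hPx using hpatch
  set L : ↥(boxSurface S x₀) → LocalParam (boxSurface S x₀) :=
    fun x => (P x).toLocalParam hdom (by rw [hPc]; rfl) (hPbox x) with hL
  obtain ⟨t, ht⟩ := hZKc.elim_finite_subcover (fun x => (L x).O) (fun x => (L x).isOpen_O) (by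
    intro x hx
    obtain ⟨y, hy, hyx⟩ := hPx ⟨x, hx.1⟩
    refine mem_iUnion.2 ⟨⟨x, hx.1⟩, ?_⟩
    have := ((L ⟨x, hx.1⟩).mem_of_mem (show y ∈ (L ⟨x, hx.1⟩).U from hy)).2
    have hyx' : (L ⟨x, hx.1⟩).ψ y = x := hyx
    rwa [hyx'] at this)
  set σ : Fin t.card → ↥(boxSurface S x₀) := fun k => (t.equivFin.symm k).1 with hσ
  set V := atlasVarifold (polarMetric (phiFun η A) u) (fun k => L (σ k)) with hV
  have hVarea : V univ ≤ area (exampleMetric η A u) S :=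
    atlasVarifold_univ_le_area hdom hF.continuousOn hF.posDef (fun k => P (σ k)) (fun k => hPc _)
      fun k => hPbox _
  have hcover : boxSurface S x₀ ∩ K ⊆ ⋃ k, (L (σ k)).O := by
    intro x hx
    obtain ⟨z, hz, hxz⟩ := mem_iUnion₂.1 (ht hx)
    refine mem_iUnion.2 ⟨t.equivFin ⟨z, hz⟩, ?_⟩
    simpa [hσ] using hxz
  have hx₀K : x₀ ∈ boxSurface S x₀ ∩ K := by
    refine ⟨⟨hx₀B, hxS⟩, ?_⟩
    show sqDist x₀ b x₀ ≤ _
    simp only [sqDist, sub_self]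
    nlinarith
  -- the density at the center
  have hdens : ∀ᶠ ε in 𝓝[>] (0 : ℝ), ENNReal.ofReal (ε ^ 2 / 2)
      ≤ V {z | sqDist x₀ b z.1 ≤ 4 * ε ^ 2} := by
    obtain ⟨k, hk⟩ := mem_iUnion.1 (hcover hx₀K)
    have hmem : x₀ ∈ boxSurface S x₀ ∩ (L (σ k)).O := ⟨hx₀K.1, hk⟩
    have hψ := (L (σ k)).apply_inv hmem
    have := (L (σ k)).density_ge hF.continuousOn hF.posDef ((L (σ k)).inv_mem hmem)
      (by rw [hψ]; exact hF.φ_eq _ hx₀K.1) hb.le hb1 (by rw [hψ])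
    rw [hψ] at this
    filter_upwards [this] with ε hε
    refine hε.trans ?_
    rw [← atlasVarifold_restrict_cyl (fun k => L (σ k)) hF.continuousOn hF.posDef k]
    exact Measure.restrict_apply_le _ _
  have hsmall : ∀ᶠ ε in 𝓝[>] (0 : ℝ), 0 < ε ∧ 360 * C ^ 2 * ε ^ 2 < 1 := by
    have h1 : Tendsto (fun ε : ℝ => 360 * C ^ 2 * ε ^ 2) (𝓝[>] 0) (𝓝 (360 * C ^ 2 * 0 ^ 2)) :=
      ((continuous_const.mul (continuous_id.pow 2)).tendsto 0).mono_left nhdsWithin_le_nhds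
    rw [zero_pow two_ne_zero, mul_zero] at h1
    exact (eventually_mem_nhdsWithin.mono fun x hx => hx).and (h1.eventually_lt_const one_pos)
  obtain ⟨ε, hεV, hε0, hε1⟩ := (hdens.and hsmall).exists
  have hXK : ∀ x ∉ K, testField x₀ b C ε x = 0 := by
    intro x hx
    have hx' : (b / 14) ^ 2 < sqDist x₀ b x := not_le.1 hx
    apply testField_eq_zero hC0
    have h1 : b / 14 ≤ regDist x₀ b ε x := Real.le_sqrt_of_sq_le (by nlinarith)
    have h2 := mul_le_mul_of_nonneg_left h1 (show 0 ≤ 2 * C by positivity)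
    linarith
  obtain ⟨hint, hzero⟩ := integral_atlasVarifold hF (fun k => L (σ k))
    (fun k y hy => (hPmin (σ k) y hy).2) (contDiff_testField (x₀ := x₀) (b := b) hC0 hε0) hKcl hZKc
    hcover hXK
  have htan : ∀ᵐ z ∂V, IsTangentPlane (u (trunc (z.1 0))) z.2 :=
    ae_atlasVarifold _ hF.continuousOn hF.posDef (measurableSet_isTangentPlane hF.continuous_w
      fun r => (hu.pos _ (trunc_mem_Ioo r)).ne') fun k y hy => hF.isTangentPlane _ hy
  have hlip : ∀ r, |u (trunc r) - b| ≤ |r - x₀ 0| := by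
    intro r
    have h1 : trunc (x₀ 0) = x₀ 0 := trunc_eq ⟨by linarith [hx.1], by linarith [hx.2]⟩
    refine (hu.abs_sub_le (Ioo_subset_Icc_self (trunc_mem_Ioo r)) hx2).trans ?_
    conv_lhs => rw [← h1]
    exact abs_projIcc_sub_projIcc _
  refine le_trans ?_ ((mass_ge (w := fun r => u (trunc r)) (w' := fun r => deriv u (trunc r)) hb hC hε0
    hε1.le htan hlip (fun r => hu.abs_deriv_le (trunc_mem_Ioo r)) hint hzero hεV).trans hVarea)
  apply ENNReal.ofReal_le_ofReal
  apply one_div_le_one_div_of_le (by positivity)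
  gcongr

/-- Closed minimal surfaces in the example have area bounded from below. -/
theorem minA_ge : ENNReal.ofReal (1 / (14400 * 700 ^ 2)) ≤ minA (exampleMetric η A u) :=
  le_iInf₂ fun _ hS => area_ge hη hA hu hS

end Final

end Drawstring

end

theorem mainTheorem8 (A : ℕ → ℝ) (hA : Tendsto A atTop atTop)
    (η : ℝ → ℝ) (hη : Drawstring.IsCutoff η) :
    ∃ N : ℕ,
      (∀ i ≥ N, ∃ u : ℝ → ℝ, Drawstring.IsBaseWarping η (A i) u) ∧
      ∀ u : ℕ → ℝ → ℝ, (∀ i ≥ N, Drawstring.IsBaseWarping η (A i) (u i)) →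
        (∀ i ≥ N, Drawstring.IsSmoothMetric (Drawstring.exampleMetric η (A i) (u i)) ∧
          Drawstring.NonnegScalar (Drawstring.exampleMetric η (A i) (u i))) ∧
        (∃ V₀ : ℝ, ∀ i ≥ N,
          Drawstring.warpedVolume (Drawstring.phiFun η (A i)) (u i) ≤ ENNReal.ofReal V₀) ∧
        (∃ A₀ : ℝ, 0 < A₀ ∧ ∀ i ≥ N,
          ENNReal.ofReal A₀ ≤ Drawstring.minA (Drawstring.exampleMetric η (A i) (u i))) ∧
        (∃ (σ : ℕ → ℕ) (φlim ulim : ℝ → ℝ) (dstar : Drawstring.M → Drawstring.M → ℝ),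
          Drawstring.IsLimitAlong (fun i => Drawstring.phiFun η (A i)) u
            (fun i => Drawstring.riemDist (Drawstring.exampleMetric η (A i) (u i)))
            σ φlim ulim dstar) ∧
        ∀ (σ : ℕ → ℕ) (φlim ulim : ℝ → ℝ) (dstar : Drawstring.M → Drawstring.M → ℝ),
          Drawstring.IsLimitAlong (fun i => Drawstring.phiFun η (A i)) u
            (fun i => Drawstring.riemDist (Drawstring.exampleMetric η (A i) (u i)))
            σ φlim ulim dstar →
          (∀ r θ : ℝ, 0 < r → r < 1 / 40 →
            Drawstring.polarMap ![r, θ, 0] ∈ Drawstring.regularPart ∧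
            Drawstring.polarMap ![r, θ, Real.pi] ∈ Drawstring.regularPart ∧
            dstar (Drawstring.polarMap ![r, θ, 0]) (Drawstring.polarMap ![r, θ, Real.pi])
              ≤ 2 * r ∧
            2 * r < Real.pi ∧
            Drawstring.regularDist φlim ulim
              (Drawstring.polarMap ![r, θ, 0]) (Drawstring.polarMap ![r, θ, Real.pi])
              = Real.pi) ∧
          ∃ p ∈ Drawstring.regularPart, ∃ q ∈ Drawstring.regularPart,
            dstar p q < Drawstring.regularDist φlim ulim p q := by
  -- The only requirement on the index is `A i ≥ 10`; it enters all the explicit constants.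
  obtain ⟨N, hN⟩ := eventually_atTop.1 (hA.eventually_ge_atTop 10)
  refine ⟨N, fun i hi => Drawstring.exists_isBaseWarping hη (hN i hi), fun u hu => ⟨?_, ?_, ?_, ?_, ?_⟩⟩
  · exact fun i hi => ⟨Drawstring.isSmoothMetric_example hη (hN i hi) (hu i hi),
      Drawstring.nonnegScalar_example hη (hN i hi) (hu i hi)⟩
  · exact ⟨_, fun i hi => Drawstring.warpedVolume_le hη (hN i hi) (hu i hi)⟩
  · exact ⟨_, by norm_num, fun i hi => Drawstring.minA_ge hη (hN i hi) (hu i hi)⟩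
  · exact Drawstring.exists_isLimitAlong hη hA hu
  · intro σ φlim ulim dstar h
    have key := fun r θ h0 h1 => Drawstring.limit_distances hη hA hu h (r := r) h0 h1 θ
    refine ⟨key, ?_⟩
    obtain ⟨hp, hq, h1, h2, h3⟩ := key (1 / 80) 0 (by norm_num) (by norm_num)
    exact ⟨_, hp, _, hq, by rw [h3]; exact h1.trans_lt h2⟩
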